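/- Let $n\ge 1$, $b_1>b_2>0$, $f_j(u)=\pm|u|^{b_j}u$ ($j=1,2$, the two signs being arbitrary and independent), and consider for real- or complex-valued $u$ on $[0,\infty)\times\mathbb{R}^n$ the Cauchy problem $$u_t+(-\Delta)^\alpha u=f_1(u)+Df_2(u),\qquad u(0)=\varphi,$$ where either $D=\beta\cdot\nabla$ with $\beta\in\mathbb{R}^n$, $d=1$ and $2\alpha>1$, or $D=\nabla^2=\Delta$, $d=2$ and $\alpha>1$. Put $r_d=\frac{nb_1}{2\alpha-d}$, and assume $r\ge r_d>1$. Let $(q,p,r)$ be an admissible triplet, that is, $\frac1q=\frac n{2\alpha}\big(\frac1r-\frac1p\big)$ with $1<r\le p<\infty$, and $p<\frac{nr}{n-2\alpha}$ if $n>2\alpha$ (so $q=\infty$ if $p=r$). For $I=[0,T)$ let $X(I)=C(I;L^r(\mathbb{R}^n))\cap L^q(I;L^p(\mathbb{R}^n))$. Let $S_\alpha(t)g=K_t*g$ be the semigroup $e^{-t(-\Delta)^\alpha}$, with $K_t(x)=(2\pi)^{-n}\int_{\mathbb{R}^n} e^{ix\cdot\xi}e^{-t|\xi|^{2\alpha}}\,d\xi$.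 A mild solution in $X([0,T))$ is a (jointly measurable) $u\in X([0,T))$ with $u(0)=\varphi$ such that, for every $t\in(0,T)$, each of $f_1(u)$, $f_2(u)$ lies in $L^1((0,t);L^m(\mathbb{R}^n))$ for some $m\in[1,\infty]$ and $$u(t)=S_\alpha(t)\varphi+\int_0^tS_\alpha(t-\tau)f_1(u(\tau))\,d\tau+\int_0^t(DK_{t-\tau})*f_2(u(\tau))\,d\tau$$ almost everywhere in $\mathbb{R}^n$, where for almost every $x$ the integrals over $(0,t)\times\mathbb{R}^n$ converge absolutely. Solutions are identified if at each time they are equal almost everywhere. (i) If $r>r_d$, then for every $M$ there is $T>0$ such that for every $\varphi\in L^r(\mathbb{R}^n)$ with $\|\varphi\|_{L^r}\le M$ there is exactly one mild solution in $X([0,T))$. If $r=r_d$, then for every $\varphi\in L^r(\mathbb{R}^n)$ there is $T=T(\varphi)>0$ such that there is exactly one mild solution in $X([0,T))$. (ii) Let $r>r_d$. For every $\varphi\in L^r(\mathbb{R}^n)$ there is a unique maximal solution $u$ with a unique maximal existence interval $[0,T^*)$, $0<T^*\le\infty$: $u$ is a mild solution in $X([0,T))$ for every finite $T\in(0,T^*)$,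 and $u$ does not extend to a mild solution in $X([0,T))$ for any $T>T^*$. For every $T_0<\infty$ there is a constant $C>0$, independent of $\varphi$, of $u$ and of $T^*$, such that whenever $T^*\le T_0$, $$\|u(s)\|_{L^r}\ge\frac{C}{(T^*-s)^{\frac1{b_1}-\frac d{2b_1\alpha}-\frac n{2r\alpha}}}\qquad\text{for all } s\in[0,T^*).$$ Consequently, if $T^*<\infty$, then $\lim_{t\uparrow T^*}\|u(t)\|_{L^r}=\infty$. -/

import Mathlib

open MeasureTheory Set Filter Topology
open scoped ENNReal FourierTransform

noncomputable section

namespace FracDissip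

/-- The space `ℝⁿ`. -/
abbrev Rn (n : ℕ) := EuclideanSpace ℝ (Fin n)

/-- The kernel `K_t(x) = (2π)⁻ⁿ ∫ e^{i x·ξ} e^{-t |ξ|^{2α}} dξ` of `e^{-t(-Δ)^α}`. (Mathlib's
inverse Fourier transform uses the phase `2π x·ξ`, hence the factor `2π` in the symbol; the symbol
is even, so the integral is real.) -/
def kernel {n : ℕ} (α t : ℝ) (x : Rn n) : ℝ :=
  (𝓕⁻ (fun ξ : Rn n => ((Real.exp (-t * (2 * Real.pi * ‖ξ‖) ^ (2 * α)) : ℝ) : ℂ)) x).re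

/-- Convolution `k * g`. -/
def conv {n : ℕ} {𝕜 : Type*} [RCLike 𝕜] (k : Rn n → ℝ) (g : Rn n → 𝕜) (x : Rn n) : 𝕜 :=
  ∫ y, k (x - y) • g y

/-- The semigroup `S_α(t) g = e^{-t(-Δ)^α} g = K_t * g`. -/
def semigroup {n : ℕ} {𝕜 : Type*} [RCLike 𝕜] (α t : ℝ) (g : Rn n → 𝕜) : Rn n → 𝕜 :=
  conv (kernel α t) g

/-- The differential operator in front of the second nonlinearity: `β · ∇` or `∇² = Δ`. -/
inductive DiffOp (n : ℕ) where
  | convection (β : Rn n) : DiffOp n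
  | laplacian : DiffOp n

/-- The order `d` of the operator. -/
def DiffOp.order {n : ℕ} : DiffOp n → ℝ
  | .convection _ => 1
  | .laplacian => 2

/-- The operator applied to a smooth function. -/
def DiffOp.apply {n : ℕ} : DiffOp n → (Rn n → ℝ) → Rn n → ℝ
  | .convection β, g => fun x => fderiv ℝ g x β
  | .laplacian, g => Laplacian.laplacian g

/-- The power nonlinearity `z ↦ ε |z|^b z`, where the sign `ε` is `1` or `-1`. -/
def power {𝕜 : Type*} [RCLike 𝕜] (ε : ℤˣ) (b : ℝ) (z : 𝕜) : 𝕜 :=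
  (((ε : ℤ) : ℝ) * ‖z‖ ^ b) • z

/-- `(q, p, r)` is an admissible triplet; `q = ∞` exactly when `p = r`. -/
def Admissible (n : ℕ) (α : ℝ) (q : ℝ≥0∞) (p r : ℝ) : Prop :=
  1 < r ∧ r ≤ p ∧ (2 * α < n → p < n * r / (n - 2 * α)) ∧
    q⁻¹ = ENNReal.ofReal (n / (2 * α) * (1 / r - 1 / p))

/-- The norm of `u` in `L^q((0, T); L^p(ℝⁿ))`. -/
def mixedNorm {n : ℕ} {𝕜 : Type*} [RCLike 𝕜] (q p : ℝ≥0∞) (T : ℝ) (u : ℝ → Rn n → 𝕜) : ℝ≥0∞ :=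
  eLpNorm (fun τ => eLpNorm (u τ) p volume) q (volume.restrict (Ioo 0 T))

/-- `u ∈ X([0, T)) = C([0, T); L^r(ℝⁿ)) ∩ L^q([0, T); L^p(ℝⁿ))`, for a jointly measurable
function `u`. -/
structure MemX {n : ℕ} {𝕜 : Type*} [RCLike 𝕜] (q : ℝ≥0∞) (p r T : ℝ) (u : ℝ → Rn n → 𝕜) :
    Prop where
  measurable : AEStronglyMeasurable (fun z : ℝ × Rn n => u z.1 z.2)
    (volume.restrict (Ico 0 T ×ˢ univ))
  memLp : ∀ t ∈ Ico 0 T, MemLp (u t) (ENNReal.ofReal r) volume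
  continuous : ∀ t ∈ Ico 0 T,
    Tendsto (fun s => eLpNorm (u s - u t) (ENNReal.ofReal r) volume) (𝓝[Ico 0 T] t) (𝓝 0)
  mixedNorm_lt : mixedNorm q (ENNReal.ofReal p) T u < ∞

/-- `F` belongs to `L¹((0, t); L^m(ℝⁿ))` for every `t < T`, with some `m ∈ [1, ∞]` (which may
depend on `t`). -/
def SourceIntegrable {n : ℕ} {𝕜 : Type*} [RCLike 𝕜] (T : ℝ) (F : ℝ → Rn n → 𝕜) : Prop :=
  ∀ t ∈ Ioo 0 T, ∃ m : ℝ≥0∞, 1 ≤ m ∧ mixedNorm 1 m t F < ∞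

/-- `u` is a mild solution on `[0, T)` of `u_t + (-Δ)^α u = f₁(u) + D f₂(u)`, `u(0) = φ`, where
`f_j(u) = ε_j |u|^{b_j} u`: both nonlinear terms are locally integrable in time with values in a
Lebesgue space, and for every `t`
`u(t) = S_α(t) φ + ∫₀ᵗ S_α(t-τ) f₁(u(τ)) dτ + ∫₀ᵗ S_α(t-τ) D f₂(u(τ)) dτ`
almost everywhere, the integrals being absolutely convergent. Here `S_α(t-τ) D g` is
`(D K_{t-τ}) * g`. -/
structure IsMild {n : ℕ} {𝕜 : Type*} [RCLike 𝕜] (α : ℝ) (D : DiffOp n) (ε₁ ε₂ : ℤˣ) (b₁ b₂ : ℝ)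
    (φ : Rn n → 𝕜) (T : ℝ) (u : ℝ → Rn n → 𝕜) : Prop where
  source₁ : SourceIntegrable T (fun τ y => power ε₁ b₁ (u τ y))
  source₂ : SourceIntegrable T (fun τ y => power ε₂ b₂ (u τ y))
  integrable₁ : ∀ t ∈ Ioo 0 T, ∀ᵐ x : Rn n,
    IntegrableOn (fun z : ℝ × Rn n => kernel α (t - z.1) (x - z.2) • power ε₁ b₁ (u z.1 z.2))
      (Ioo 0 t ×ˢ univ)
  integrable₂ : ∀ t ∈ Ioo 0 T, ∀ᵐ x : Rn n,
    IntegrableOn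
      (fun z : ℝ × Rn n => D.apply (kernel α (t - z.1)) (x - z.2) • power ε₂ b₂ (u z.1 z.2))
      (Ioo 0 t ×ˢ univ)
  initial : u 0 =ᵐ[volume] φ
  equation : ∀ t ∈ Ioo 0 T, ∀ᵐ x : Rn n,
    u t x = semigroup α t φ x
      + (∫ τ in Ioo 0 t, semigroup α (t - τ) (fun y => power ε₁ b₁ (u τ y)) x)
      + ∫ τ in Ioo 0 t, conv (D.apply (kernel α (t - τ))) (fun y => power ε₂ b₂ (u τ y)) x

/-- `u` is a mild solution in `X([0, T))`. -/
def IsSol {n : ℕ} {𝕜 : Type*} [RCLike 𝕜] (α : ℝ) (D : DiffOp n) (ε₁ ε₂ : ℤˣ) (b₁ b₂ : ℝ)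
    (q : ℝ≥0∞) (p r : ℝ) (φ : Rn n → 𝕜) (T : ℝ) (u : ℝ → Rn n → 𝕜) : Prop :=
  MemX q p r T u ∧ IsMild α D ε₁ ε₂ b₁ b₂ φ T u

/-- `u` is a maximal solution with maximal existence interval `[0, Tₘ)`, `0 < Tₘ ≤ ∞`: it is a
mild solution in `X([0, T))` for each finite `T < Tₘ`, and it does not extend to a mild solution in
`X([0, T))` for any `T > Tₘ`. -/
structure IsMaximal {n : ℕ} {𝕜 : Type*} [RCLike 𝕜] (α : ℝ) (D : DiffOp n) (ε₁ ε₂ : ℤˣ)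
    (b₁ b₂ : ℝ) (q : ℝ≥0∞) (p r : ℝ) (φ : Rn n → 𝕜) (Tₘ : ℝ≥0∞) (u : ℝ → Rn n → 𝕜) : Prop where
  pos : 0 < Tₘ
  isSol : ∀ T : ℝ, 0 < T → ENNReal.ofReal T < Tₘ → IsSol α D ε₁ ε₂ b₁ b₂ q p r φ T u
  not_extends : ∀ T : ℝ, Tₘ < ENNReal.ofReal T →
    ¬ ∃ v : ℝ → Rn n → 𝕜, IsSol α D ε₁ ε₂ b₁ b₂ q p r φ T v ∧
      ∀ t : ℝ, 0 ≤ t → ENNReal.ofReal t < Tₘ → v t =ᵐ[volume] u t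

/-- There is exactly one mild solution in `X([0, T))`, up to equality almost everywhere in space
at each time. -/
def UniqueSol {n : ℕ} {𝕜 : Type*} [RCLike 𝕜] (α : ℝ) (D : DiffOp n) (ε₁ ε₂ : ℤˣ) (b₁ b₂ : ℝ)
    (q : ℝ≥0∞) (p r : ℝ) (φ : Rn n → 𝕜) (T : ℝ) : Prop :=
  (∃ u : ℝ → Rn n → 𝕜, IsSol α D ε₁ ε₂ b₁ b₂ q p r φ T u) ∧
    ∀ u v : ℝ → Rn n → 𝕜, IsSol α D ε₁ ε₂ b₁ b₂ q p r φ T u →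
      IsSol α D ε₁ ε₂ b₁ b₂ q p r φ T v → ∀ t ∈ Ico 0 T, u t =ᵐ[volume] v t

end FracDissip

end

noncomputable section

namespace FracDissip

/-! ### Symbol estimates for exponentials of homogeneous functions. -/

section SymbolEstimates

variable {W : Type} [NormedAddCommGroup W] [NormedSpace ℝ W]

/-! Both nonlinear terms are strictly subcritical in Lʳ, even when r = r_d. Put σ = n/(2αr), θ_j = σ
b_j, and let γ_j be the time singularity of the L¹ norm of the kernel (0 for K, d/(2α) for DK). Then
r ≥ r_d gives σb₁ ≤ 1 - d/(2α), which is less than 1, and b₂ < b₁ gives σb₂ < 1 - d/(2α). So ω_j = 1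
- γ_j - θ_j is positive for both terms, and the existence time depends only on the norm of the
datum. All analysis takes place in an abstract `MildSystem`, which retains only the kernel bounds,
the semigroup identity, the approximation of the identity and ω_j > 0.

Kernel bounds (`kerBound_jet`): by scaling, time one suffices. There the symbol exp(-|2πξ|^{2α}) may
fail to be smooth at the origin, so it is approximated by slices of exp(-(|2πξ|²+s²)^α), whose
exponent is homogeneous in (ξ, s). The derivative estimates of a homogeneous function are then
uniform in s, and 2α > 1 is exactly what allows n+1 integrations by parts (`exists_decay`).

Existence (`MildSystem.exists_bSol`): Picard iteration in the norm sup_t (‖u(t)‖_r + t^σ‖u(t)‖_∞),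
in which the j-th Duhamel term gains T^{ω_j}. These bounded solutions (`BSol`) are unique, can be
restarted and glued, and are continuous in Lʳ. That they lie in L^q L^p follows from interpolation
for the Duhamel terms and, for the linear part, from a real interpolation argument with a truncation
height t^{-σ} that moves in time (`lintegral_lin_lt_top`).

Uniqueness in X is unconditional, and this is the hard point: an arbitrary mild solution carries no
pointwise bound. `Sol.exists_bSol` shows that it has one anyway. Where |u(t,x)| = Y t^{-σ} with Y
large, restart the equation a time κt before t, with κ^σ of order 1/Y. The linear part is then at
most a quarter of |u|. In the Duhamel part over that short window, values of size at most Yτ^{-σ}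
contribute a small fraction, so |u| is controlled by a short-memory integral of the excess
t^{θ₀}|u|^{b₀+1} over the set |u| ≥ A t^{-σ} (`excess_le`). Integrating over space and time, the
total excess J is at most J/2 once A is large. It is finite because the source lies in L¹L^m and the
set of large values has finite measure. Hence J = 0 (`exists_pointwise_bound`).

Maximal solutions are unions of local ones. For the blow-up rate, a datum of size C L^{-e} lives for
a time L; if ‖u(s)‖_r were below the rate, gluing the solution started at u(s) would outlive the
maximal time. -/

theorem uniqueDiffOn_punctured : UniqueDiffOn ℝ ({0}ᶜ : Set W) :=
  isOpen_compl_singleton.uniqueDiffOn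

/-- Iterated derivatives of homogeneous functions satisfy symbol estimates. -/
theorem homogeneous_symbol_bound [FiniteDimensional ℝ W] (i : ℕ) :
    ∀ (F : Type) [NormedAddCommGroup F] [NormedSpace ℝ F] (g : W → F) (ρ : ℝ),
      ContDiffOn ℝ ((⊤ : ℕ∞) : WithTop ℕ∞) g ({0}ᶜ : Set W) →
      (∀ (c : ℝ) (η : W), 0 < c → η ≠ 0 → g (c • η) = c ^ ρ • g η) →
      ∃ C : ℝ, 0 ≤ C ∧ ∀ η : W, η ≠ 0 → ‖iteratedFDeriv ℝ i g η‖ ≤ C * ‖η‖ ^ (ρ - i) := by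
  induction i with
  | zero =>
    intro F _ _ g ρ hg hh
    -- By homogeneity everything is decided on the unit sphere, which is compact in finite
    -- dimension.
    obtain ⟨C, hC⟩ := (isCompact_sphere (0 : W) 1).exists_bound_of_continuousOn
      (hg.continuousOn.mono (by
        intro x hx
        simp only [mem_sphere_iff_norm, sub_zero] at hx
        simp only [mem_compl_iff, mem_singleton_iff]
        rintro rfl
        simp at hx))
    refine ⟨max C 0, le_max_right _ _, fun η hη => ?_⟩
    have hn : 0 < ‖η‖ := norm_pos_iff.2 hη
    have h1 : ‖η‖ • (‖η‖⁻¹ • η) = η := by rw [smul_smul, mul_inv_cancel₀ hn.ne', one_smul]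
    have h2 := hh ‖η‖ (‖η‖⁻¹ • η) hn (by simp [hη])
    rw [h1] at h2
    have h3 := hC (‖η‖⁻¹ • η) (by simp [norm_smul, hn.ne'])
    rw [norm_iteratedFDeriv_zero, h2, norm_smul, Real.norm_of_nonneg (by positivity)]
    simp only [Nat.cast_zero, sub_zero]
    rw [mul_comm]
    gcongr
    exact h3.trans (le_max_left _ _)
  | succ i ih =>
    intro F _ _ g ρ hg hh
    have hd : ContDiffOn ℝ ((⊤ : ℕ∞) : WithTop ℕ∞) (fderiv ℝ g) ({0}ᶜ : Set W) :=
      hg.fderiv_of_isOpen isOpen_compl_singleton (by simp)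
    -- Computing the derivative of η ↦ g(cη) in two ways shows that Dg is homogeneous of degree ρ -
    -- 1. Its values lie in a new space, which is why the induction ranges over all targets F.
    have hh' : ∀ (c : ℝ) (η : W), 0 < c → η ≠ 0 →
        fderiv ℝ g (c • η) = c ^ (ρ - 1) • fderiv ℝ g η := by
      intro c η hc hη
      have hda : ∀ ζ : W, ζ ≠ 0 → DifferentiableAt ℝ g ζ := fun ζ hζ =>
        (hg.differentiableOn (by simp)).differentiableAt (isOpen_compl_singleton.mem_nhds hζ)
      have e1 : HasFDerivAt (fun ζ => g (c • ζ)) ((fderiv ℝ g (c • η)).comp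
          (c • ContinuousLinearMap.id ℝ W)) η := by
        have h1 : HasFDerivAt g (fderiv ℝ g (c • η)) (c • η) :=
          (hda _ (smul_ne_zero hc.ne' hη)).hasFDerivAt
        exact h1.comp η ((c • ContinuousLinearMap.id ℝ W).hasFDerivAt)
      have e2 : HasFDerivAt (fun ζ => g (c • ζ)) (c ^ ρ • fderiv ℝ g η) η := by
        refine ((hda η hη).hasFDerivAt.const_smul (c ^ ρ)).congr_of_eventuallyEq ?_
        filter_upwards [isOpen_compl_singleton.mem_nhds hη] with ζ hζ
        exact hh c ζ hc hζ
      have e3 := e1.unique e2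
      ext v
      have e4 := DFunLike.congr_fun e3 v
      simp only [ContinuousLinearMap.comp_apply, smul_apply,
        ContinuousLinearMap.id_apply, map_smul] at e4
      rw [smul_apply, Real.rpow_sub hc, Real.rpow_one, div_eq_inv_mul, mul_smul,
        ← e4, smul_smul, inv_mul_cancel₀ hc.ne', one_smul]
    obtain ⟨C, hC0, hC⟩ := ih (W →L[ℝ] F) (fderiv ℝ g) (ρ - 1) hd hh'
    refine ⟨C, hC0, fun η hη => ?_⟩
    have := hC η hη
    rw [norm_iteratedFDeriv_fderiv] at this
    refine this.trans_eq ?_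
    push_cast
    ring_nf

/-- Product rule for symbol estimates. -/
theorem symbol_bound_smul {F : Type} [NormedAddCommGroup F] [NormedSpace ℝ F]
    {f : W → ℝ} {g : W → F} (i : ℕ) (ρ ρ' : ℝ)
    (hf : ContDiffOn ℝ ((⊤ : ℕ∞) : WithTop ℕ∞) f ({0}ᶜ : Set W)) (hg : ContDiffOn ℝ ((⊤ : ℕ∞) : WithTop ℕ∞) g ({0}ᶜ : Set W))
    (bf : ∀ j ≤ i, ∃ C : ℝ, 0 ≤ C ∧ ∀ η : W, η ≠ 0 →
      ‖iteratedFDeriv ℝ j f η‖ ≤ C * ‖η‖ ^ (ρ - j))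
    (bg : ∀ j ≤ i, ∃ C : ℝ, 0 ≤ C ∧ ∀ η : W, η ≠ 0 →
      ‖iteratedFDeriv ℝ j g η‖ ≤ C * ‖η‖ ^ (ρ' - j)) :
    ∃ C : ℝ, 0 ≤ C ∧ ∀ η : W, η ≠ 0 →
      ‖iteratedFDeriv ℝ i (fun ζ => f ζ • g ζ) η‖ ≤ C * ‖η‖ ^ (ρ + ρ' - i) := by
  choose! Cf hCf0 hCf using bf
  choose! Cg hCg0 hCg using bg
  refine ⟨∑ j ∈ Finset.range (i + 1), (i.choose j : ℝ) * Cf j * Cg (i - j),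
    Finset.sum_nonneg fun j hj => ?_, fun η hη => ?_⟩
  · have : j ≤ i := by simpa [Nat.lt_succ_iff] using hj
    have := hCf0 j this
    have := hCg0 (i - j) (Nat.sub_le _ _)
    positivity
  -- Leibniz' formula on the open punctured space, where derivatives within the set are the full
  -- ones; nothing is assumed at the origin.
  have h := norm_iteratedFDerivWithin_smul_le (n := i) hf hg uniqueDiffOn_punctured
    (x := η) hη (by exact_mod_cast le_top)
  have hw : ∀ (G : Type) [NormedAddCommGroup G] [NormedSpace ℝ G] (k : ℕ) (φ : W → G),
      iteratedFDerivWithin ℝ k φ ({0}ᶜ : Set W) η = iteratedFDeriv ℝ k φ η := by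
    intro G _ _ k φ
    exact iteratedFDerivWithin_of_isOpen k isOpen_compl_singleton hη
  rw [hw] at h
  refine h.trans ?_
  rw [Finset.sum_mul]
  refine Finset.sum_le_sum fun j hj => ?_
  have hj : j ≤ i := by simpa [Nat.lt_succ_iff] using hj
  rw [hw, hw]
  have h1 := hCf j hj η hη
  have h2 := hCg (i - j) (Nat.sub_le _ _) η hη
  have hn : 0 < ‖η‖ := norm_pos_iff.2 hη
  have h3 : ‖η‖ ^ (ρ + ρ' - i) = ‖η‖ ^ (ρ - j) * ‖η‖ ^ (ρ' - (i - j : ℕ)) := by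
    rw [← Real.rpow_add hn, Nat.cast_sub hj]
    ring_nf
  rw [h3]
  have := hCf0 j hj
  have := hCg0 (i - j) (Nat.sub_le _ _)
  calc (i.choose j : ℝ) * ‖iteratedFDeriv ℝ j f η‖ * ‖iteratedFDeriv ℝ (i - j) g η‖
      ≤ (i.choose j : ℝ) * (Cf j * ‖η‖ ^ (ρ - j)) * (Cg (i - j) * ‖η‖ ^ (ρ' - (i - j : ℕ))) := by
        gcongr
    _ = _ := by ring

/-- `s ^ k * e^{-s}` is bounded. -/
theorem exists_rpow_mul_exp_neg_le (k : ℝ) (hk : 0 ≤ k) :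
    ∃ C : ℝ, 0 ≤ C ∧ ∀ s : ℝ, 0 ≤ s → s ^ k * Real.exp (-s) ≤ C := by
  obtain ⟨m, hm⟩ := exists_nat_ge k
  refine ⟨1 + m.factorial, by positivity, fun s hs => ?_⟩
  have h1 : s ^ k ≤ 1 + s ^ m := by
    rcases le_total s 1 with h | h
    · have := Real.rpow_le_one hs h hk
      have : 0 ≤ s ^ m := by positivity
      linarith
    · have := Real.rpow_le_rpow_of_exponent_le h hm
      rw [Real.rpow_natCast] at this
      linarith
  have h2 : s ^ m ≤ m.factorial * Real.exp s := by
    have := Real.pow_div_factorial_le_exp s hs m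
    rw [div_le_iff₀ (by positivity)] at this
    linarith
  have h3 : (1 : ℝ) ≤ Real.exp s := Real.one_le_exp hs
  rw [Real.exp_neg, ← div_eq_mul_inv, div_le_iff₀ (Real.exp_pos _)]
  nlinarith

variable [FiniteDimensional ℝ W] {f : W → ℝ} {β : ℝ}

/-- Since D(e^{-f}) = -e^{-f} Df and Df is homogeneous of degree β - 1, the product rule trades one
more derivative for the exponent β - 1. At infinity β is a loss, repaired by the arbitrary decay of
e^{-f}; at the origin it is a gain, and limits the singularity to |η|^{β-i}. -/
theorem exp_neg_symbol_bound_succ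
    (hf : ContDiffOn ℝ ((⊤ : ℕ∞) : WithTop ℕ∞) f ({0}ᶜ : Set W))
    (hh : ∀ (c : ℝ) (η : W), 0 < c → η ≠ 0 → f (c • η) = c ^ β • f η) (i : ℕ) (ρ : ℝ)
    (hb : ∀ j ≤ i, ∃ C : ℝ, 0 ≤ C ∧ ∀ η : W, η ≠ 0 →
        ‖iteratedFDeriv ℝ j (fun ζ => Real.exp (-f ζ)) η‖ ≤ C * ‖η‖ ^ (ρ - j)) :
    ∃ C : ℝ, 0 ≤ C ∧ ∀ η : W, η ≠ 0 →
      ‖iteratedFDeriv ℝ (i + 1) (fun ζ => Real.exp (-f ζ)) η‖ ≤ C * ‖η‖ ^ (ρ + β - (i + 1)) := by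
  have hexp : ContDiffOn ℝ ((⊤ : ℕ∞) : WithTop ℕ∞) (fun ζ => Real.exp (-f ζ)) ({0}ᶜ : Set W) :=
    hf.neg.exp
  have hn : ContDiffOn ℝ ((⊤ : ℕ∞) : WithTop ℕ∞) (fun ζ => -f ζ) ({0}ᶜ : Set W) := hf.neg
  have hdf : ContDiffOn ℝ ((⊤ : ℕ∞) : WithTop ℕ∞) (fderiv ℝ (fun ζ => -f ζ)) ({0}ᶜ : Set W) :=
    hn.fderiv_of_isOpen isOpen_compl_singleton (by simp)
  have hdfb : ∀ j ≤ i, ∃ C : ℝ, 0 ≤ C ∧ ∀ η : W, η ≠ 0 →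
      ‖iteratedFDeriv ℝ j (fderiv ℝ (fun ζ => -f ζ)) η‖ ≤ C * ‖η‖ ^ ((β - 1) - j) := by
    intro j _
    obtain ⟨C, hC0, hC⟩ := homogeneous_symbol_bound (j + 1) ℝ (fun ζ => -f ζ) β hn
      (fun c η hc hη => by simp [hh c η hc hη])
    refine ⟨C, hC0, fun η hη => ?_⟩
    rw [norm_iteratedFDeriv_fderiv]
    refine (hC η hη).trans_eq ?_
    push_cast
    ring_nf
  obtain ⟨C, hC0, hC⟩ := symbol_bound_smul i _ _ hexp hdf hb hdfb
  refine ⟨C, hC0, fun η hη => ?_⟩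
  have heq : fderiv ℝ (fun ζ => Real.exp (-f ζ)) =ᶠ[𝓝 η]
      fun ζ => Real.exp (-f ζ) • fderiv ℝ (fun ζ => -f ζ) ζ := by
    filter_upwards [isOpen_compl_singleton.mem_nhds hη] with ζ hζ
    exact (((hn.differentiableOn (by simp)).differentiableAt
      (isOpen_compl_singleton.mem_nhds hζ)).hasFDerivAt.exp).fderiv
  rw [← norm_iteratedFDeriv_fderiv, (heq.iteratedFDeriv ℝ i).eq_of_nhds]
  refine (hC η hη).trans_eq ?_
  congr 2
  ring

/-- Derivatives of `e^{-f}` for a homogeneous `f`: decay at infinity of every order. -/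
theorem exp_neg_symbol_bound (hβ : 0 < β)
    (hf : ContDiffOn ℝ ((⊤ : ℕ∞) : WithTop ℕ∞) f ({0}ᶜ : Set W))
    (hh : ∀ (c : ℝ) (η : W), 0 < c → η ≠ 0 → f (c • η) = c ^ β • f η)
    (hlow : ∀ η, η ≠ 0 → ‖η‖ ^ β ≤ f η) (i : ℕ) :
    ∀ L : ℝ, 0 ≤ L → ∃ C : ℝ, 0 ≤ C ∧ ∀ η : W, η ≠ 0 →
      ‖iteratedFDeriv ℝ i (fun ζ => Real.exp (-f ζ)) η‖ ≤ C * ‖η‖ ^ (-L - i) := by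
  induction i using Nat.strong_induction_on with
  | _ i ih =>
  intro L hL
  rcases i with _ | i
  · obtain ⟨C, hC0, hC⟩ := exists_rpow_mul_exp_neg_le (L / β) (by positivity)
    refine ⟨C, hC0, fun η hη => ?_⟩
    have hn : 0 < ‖η‖ := norm_pos_iff.2 hη
    rw [norm_iteratedFDeriv_zero, Real.norm_of_nonneg (Real.exp_nonneg _)]
    simp only [Nat.cast_zero, sub_zero]
    rw [Real.rpow_neg hn.le, ← div_eq_mul_inv, le_div_iff₀ (by positivity)]
    have := hC (‖η‖ ^ β) (by positivity)
    rw [← Real.rpow_mul hn.le, mul_div_cancel₀ _ hβ.ne'] at this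
    refine le_trans ?_ this
    rw [mul_comm]
    gcongr
    exact hlow η hη
  -- The lower orders are used with L + β in place of L, which pays for the loss of β.
  · obtain ⟨C, hC0, hC⟩ := exp_neg_symbol_bound_succ hf hh i (-(L + β))
      fun j hj => ih j (by omega) (L + β) (by positivity)
    refine ⟨C, hC0, fun η hη => (hC η hη).trans_eq ?_⟩
    push_cast
    ring_nf

/-- Two-sided bound for the derivatives of `e^{-f}`, `f` homogeneous of degree `β`. -/
theorem exp_neg_deriv_bound (hβ : 0 < β)
    (hf : ContDiffOn ℝ ((⊤ : ℕ∞) : WithTop ℕ∞) f ({0}ᶜ : Set W))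
    (hh : ∀ (c : ℝ) (η : W), 0 < c → η ≠ 0 → f (c • η) = c ^ β • f η)
    (hlow : ∀ η, η ≠ 0 → ‖η‖ ^ β ≤ f η) (i : ℕ) (ρ₁ ρ₂ : ℝ) (h0 : 0 ≤ ρ₁) (h1 : i - β ≤ ρ₁)
    (h12 : ρ₁ ≤ ρ₂) :
    ∃ C : ℝ, 0 ≤ C ∧ ∀ η : W, η ≠ 0 →
      ‖iteratedFDeriv ℝ i (fun ζ => Real.exp (-f ζ)) η‖ ≤ C * min (‖η‖ ^ (-ρ₁)) (‖η‖ ^ (-ρ₂)) := by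
  have hlarge := exp_neg_symbol_bound hβ hf hh hlow
  -- Near the origin the function itself is at most 1, and a derivative of order i ≥ 1 is
  -- O(|η|^{β-i}): start the recursion from exponent 0 for the lower orders.
  obtain ⟨A, hA0, hA⟩ : ∃ C : ℝ, 0 ≤ C ∧ ∀ η : W, η ≠ 0 → ‖η‖ ≤ 1 →
      ‖iteratedFDeriv ℝ i (fun ζ => Real.exp (-f ζ)) η‖ ≤ C * ‖η‖ ^ (-ρ₁) := by
    rcases i with _ | i
    · refine ⟨1, zero_le_one, fun η hη h => ?_⟩
      rw [norm_iteratedFDeriv_zero, Real.norm_of_nonneg (Real.exp_nonneg _), one_mul]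
      have hn : 0 < ‖η‖ := norm_pos_iff.2 hη
      have h1 : (1 : ℝ) ≤ ‖η‖ ^ (-ρ₁) := Real.one_le_rpow_of_pos_of_le_one_of_nonpos hn h (by simpa)
      refine le_trans (Real.exp_le_one_iff.2 ?_) h1
      have := hlow η hη
      have : 0 ≤ ‖η‖ ^ β := by positivity
      linarith
    · obtain ⟨C, hC0, hC⟩ := exp_neg_symbol_bound_succ hf hh i 0 fun j _ => by
        simpa using hlarge j 0 le_rfl
      refine ⟨C, hC0, fun η hη h => (hC η hη).trans ?_⟩
      refine mul_le_mul_of_nonneg_left ?_ hC0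
      refine Real.rpow_le_rpow_of_exponent_ge (norm_pos_iff.2 hη) h ?_
      push_cast at h1
      linarith
  obtain ⟨B, hB0, hB⟩ := hlarge i ρ₂ (h0.trans h12)
  refine ⟨A + B, by positivity, fun η hη => ?_⟩
  have hn : 0 < ‖η‖ := norm_pos_iff.2 hη
  rcases le_total ‖η‖ 1 with h | h
  · rw [min_eq_left (Real.rpow_le_rpow_of_exponent_ge hn h (by linarith))]
    refine (hA η hη h).trans ?_
    gcongr
    linarith
  · rw [min_eq_right (Real.rpow_le_rpow_of_exponent_le h (by linarith))]
    refine (hB η hη).trans ?_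
    have := Real.rpow_le_rpow_of_exponent_le h (show -ρ₂ - i ≤ -ρ₂ by simp)
    calc B * ‖η‖ ^ (-ρ₂ - i) ≤ B * ‖η‖ ^ (-ρ₂) := by gcongr
      _ ≤ _ := by gcongr; linarith

end SymbolEstimates
end FracDissip

namespace FracDissip

/-! ### A smooth approximation of the symbol with uniform derivative bounds. -/

section RegularisedSymbol

/-- The derivatives of a slice are bounded by the derivatives of the function. -/
theorem norm_iteratedFDeriv_slice_le {V : Type} [NormedAddCommGroup V] [NormedSpace ℝ V]
    {ε : ℝ} (hε : ε ≠ 0) (i : ℕ) :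
    ∀ (F : Type) [NormedAddCommGroup F] [NormedSpace ℝ F] (h : V × ℝ → F),
      ContDiffOn ℝ ((⊤ : ℕ∞) : WithTop ℕ∞) h ({0}ᶜ : Set (V × ℝ)) → ∀ ξ : V,
      ‖iteratedFDeriv ℝ i (fun ζ : V => h (ζ, ε)) ξ‖ ≤ ‖iteratedFDeriv ℝ i h (ξ, ε)‖ := by
  have hne : ∀ ζ : V, (ζ, ε) ∈ ({0}ᶜ : Set (V × ℝ)) := fun ζ h0 => hε (congrArg Prod.snd h0)
  induction i with
  | zero => intro F _ _ h _ ξ; simp [norm_iteratedFDeriv_zero]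
  | succ i ih =>
    intro F _ _ h hh ξ
    have hd : ContDiffOn ℝ ((⊤ : ℕ∞) : WithTop ℕ∞) (fderiv ℝ h) ({0}ᶜ : Set (V × ℝ)) :=
      hh.fderiv_of_isOpen isOpen_compl_singleton (by simp)
    -- The derivative of the slice is the derivative of h restricted to V × {0}; the restriction map
    -- has norm at most 1, so no constant accumulates in the induction.
    have hfd : fderiv ℝ (fun ζ : V => h (ζ, ε)) =
        ((ContinuousLinearMap.compL ℝ V (V × ℝ) F).flip (ContinuousLinearMap.inl ℝ V ℝ)) ∘
          fun ζ : V => fderiv ℝ h (ζ, ε) := by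
      funext ζ
      have h1 : HasFDerivAt h (fderiv ℝ h (ζ, ε)) (ζ, ε) :=
        ((hh.differentiableOn (by simp)).differentiableAt
          (isOpen_compl_singleton.mem_nhds (hne ζ))).hasFDerivAt
      have h2 : HasFDerivAt (fun ζ : V => ((ζ, ε) : V × ℝ)) (ContinuousLinearMap.inl ℝ V ℝ) ζ := by
        exact (hasFDerivAt_id ζ).prodMk (hasFDerivAt_const ε ζ)
      exact (h1.comp ζ h2).fderiv
    have hcd : ContDiff ℝ ((⊤ : ℕ∞) : WithTop ℕ∞) (fun ζ : V => fderiv ℝ h (ζ, ε)) := by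
      rw [contDiff_iff_contDiffAt]
      intro ζ
      have h1 : ContDiffAt ℝ ((⊤ : ℕ∞) : WithTop ℕ∞) (fderiv ℝ h) (ζ, ε) :=
        hd.contDiffAt (isOpen_compl_singleton.mem_nhds (hne ζ))
      exact h1.comp ζ (contDiffAt_id.prodMk contDiffAt_const)
    rw [← norm_iteratedFDeriv_fderiv, ← norm_iteratedFDeriv_fderiv (f := h), hfd]
    refine (ContinuousLinearMap.norm_iteratedFDeriv_comp_left _ (N := ((⊤ : ℕ∞) : WithTop ℕ∞))
      hcd.contDiffAt (by exact_mod_cast le_top)).trans ?_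
    have hL : ‖(ContinuousLinearMap.compL ℝ V (V × ℝ) F).flip (ContinuousLinearMap.inl ℝ V ℝ)‖
        ≤ 1 := by
      refine ContinuousLinearMap.opNorm_le_bound _ zero_le_one fun A => ?_
      simp only [ContinuousLinearMap.flip_apply, ContinuousLinearMap.compL_apply, one_mul]
      refine (ContinuousLinearMap.opNorm_comp_le _ _).trans ?_
      have := ContinuousLinearMap.norm_inl_le_one ℝ V ℝ
      nlinarith [norm_nonneg A]
    have h3 := ih _ (fderiv ℝ h) hd ξ
    calc _ ≤ 1 * ‖iteratedFDeriv ℝ i (fun ζ : V => fderiv ℝ h (ζ, ε)) ξ‖ := by gcongr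
      _ ≤ _ := by rw [one_mul]; exact h3

/-- A radial integrable majorant. -/
def radialBound (n : ℕ) (ρ : ℝ) (y : ℝ) : ℝ := min (y ^ (-ρ)) (y ^ (-((n : ℝ) + 1)))

theorem radialBound_nonneg {n : ℕ} {ρ : ℝ} {y : ℝ} (hy : 0 ≤ y) : 0 ≤ radialBound n ρ y :=
  le_min (Real.rpow_nonneg hy _) (Real.rpow_nonneg hy _)

/-- Polar coordinates: ρ < n makes the origin harmless, and the exponent n + 1 makes the tail
integrable. -/
theorem integrable_radialBound {n : ℕ} (hn : 1 ≤ n) {ρ : ℝ} (hρ : ρ < n) :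
    Integrable (fun v : Rn n => radialBound n ρ ‖v‖) := by
  have : Nontrivial (Rn n) := by
    have : Nonempty (Fin n) := ⟨⟨0, hn⟩⟩
    infer_instance
  rw [integrable_fun_norm_addHaar volume (f := radialBound n ρ)]
  simp only [finrank_euclideanSpace, Fintype.card_fin, smul_eq_mul]
  have hm : Measurable fun y : ℝ => y ^ (n - 1) * radialBound n ρ y := by
    unfold radialBound; fun_prop
  rw [← Ioc_union_Ioi_eq_Ioi zero_le_one]
  refine IntegrableOn.union ?_ ?_
  · have h1 : IntegrableOn (fun y : ℝ => y ^ ((n : ℝ) - 1 - ρ)) (Ioc 0 1) := by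
      have := (intervalIntegral.intervalIntegrable_rpow' (a := 0) (b := 1)
        (r := (n : ℝ) - 1 - ρ) (by linarith))
      rwa [intervalIntegrable_iff_integrableOn_Ioc_of_le zero_le_one] at this
    refine Integrable.mono' h1 hm.aestronglyMeasurable ?_
    refine (ae_restrict_iff' measurableSet_Ioc).2 (Eventually.of_forall fun y hy => ?_)
    have h0 : 0 < y := hy.1
    rw [Real.norm_of_nonneg (mul_nonneg (by positivity) (radialBound_nonneg h0.le))]
    have : y ^ ((n : ℝ) - 1 - ρ) = y ^ (n - 1) * y ^ (-ρ) := by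
      rw [← Real.rpow_natCast, ← Real.rpow_add h0, Nat.cast_sub hn]; simp [sub_eq_add_neg]
    rw [this]
    gcongr
    exact min_le_left _ _
  · have h1 : IntegrableOn (fun y : ℝ => y ^ (-2 : ℝ)) (Ioi 1) :=
      integrableOn_Ioi_rpow_of_lt (by norm_num) zero_lt_one
    refine Integrable.mono' h1 hm.aestronglyMeasurable ?_
    refine (ae_restrict_iff' measurableSet_Ioi).2 (Eventually.of_forall fun y hy => ?_)
    have h0 : 0 < y := zero_lt_one.trans hy
    rw [Real.norm_of_nonneg (mul_nonneg (by positivity) (radialBound_nonneg h0.le))]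
    have : y ^ (-2 : ℝ) = y ^ (n - 1) * y ^ (-((n : ℝ) + 1)) := by
      rw [← Real.rpow_natCast, ← Real.rpow_add h0, Nat.cast_sub hn, Nat.cast_one]; ring_nf
    rw [this]
    gcongr
    exact min_le_right _ _

/-- `(4π²|ξ|² + s²)^α`. -/
def regSq (n : ℕ) (α : ℝ) (η : Rn n × ℝ) : ℝ := ((2 * Real.pi * ‖η.1‖) ^ 2 + η.2 ^ 2) ^ α

theorem regSq_base_pos {n : ℕ} {η : Rn n × ℝ} (hη : η ≠ 0) :
    0 < (2 * Real.pi * ‖η.1‖) ^ 2 + η.2 ^ 2 := by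
  have hpi := Real.pi_pos
  by_cases h : η.1 = 0
  · have : η.2 ≠ 0 := fun h2 => hη (Prod.ext h h2)
    positivity
  · have : 0 < ‖η.1‖ := norm_pos_iff.2 h
    positivity

theorem contDiffOn_regSq (n : ℕ) (α : ℝ) :
    ContDiffOn ℝ ((⊤ : ℕ∞) : WithTop ℕ∞) (regSq n α) ({0}ᶜ : Set (Rn n × ℝ)) := by
  intro η hη
  apply ContDiffAt.contDiffWithinAt
  unfold regSq
  refine ContDiffAt.rpow_const_of_ne ?_ (regSq_base_pos hη).ne'
  have h1 : ContDiff ℝ ((⊤ : ℕ∞) : WithTop ℕ∞) (fun η : Rn n × ℝ =>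
      (2 * Real.pi) ^ 2 * ‖η.1‖ ^ 2 + η.2 ^ 2) :=
    (contDiff_const.mul (contDiff_fst.norm_sq ℝ)).add (contDiff_snd.pow 2)
  simpa only [mul_pow] using h1.contDiffAt

theorem regSq_smul {n : ℕ} {α : ℝ} (c : ℝ) (η : Rn n × ℝ) (hc : 0 < c) :
    regSq n α (c • η) = c ^ (2 * α) • regSq n α η := by
  have : (2 * Real.pi * ‖(c • η).1‖) ^ 2 + (c • η).2 ^ 2
      = c ^ 2 * ((2 * Real.pi * ‖η.1‖) ^ 2 + η.2 ^ 2) := by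
    simp only [Prod.smul_fst, Prod.smul_snd, norm_smul, Real.norm_of_nonneg hc.le, smul_eq_mul]
    ring
  unfold regSq
  rw [this, Real.mul_rpow (by positivity) (by positivity), ← Real.rpow_natCast c 2,
    ← Real.rpow_mul hc.le]
  norm_num

/-- The product carries the maximum norm, so only the larger of the two components has to be
compared. -/
theorem norm_rpow_le_regSq {n : ℕ} {α : ℝ} (hα : 0 ≤ α) (η : Rn n × ℝ) :
    ‖η‖ ^ (2 * α) ≤ regSq n α η := by
  rw [Real.rpow_mul (norm_nonneg _), Real.rpow_two]
  refine Real.rpow_le_rpow (by positivity) ?_ hα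
  rw [Prod.norm_def]
  have hpi := Real.pi_gt_three
  rcases max_cases ‖η.1‖ ‖η.2‖ with h | h
  · rw [h.1, mul_pow]
    have h2 : 1 ≤ (2 * Real.pi) ^ 2 := by nlinarith
    nlinarith [mul_le_mul_of_nonneg_right h2 (sq_nonneg ‖η.1‖), sq_nonneg η.2]
  · rw [h.1, Real.norm_eq_abs, sq_abs]
    have : 0 ≤ (2 * Real.pi * ‖η.1‖) ^ 2 := by positivity
    linarith

/-- The smooth approximation of the symbol `e^{-|2πξ|^{2α}}`. -/
def regSym (n : ℕ) (α ε : ℝ) (ξ : Rn n) : ℂ := ((Real.exp (-regSq n α (ξ, ε)) : ℝ) : ℂ)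

theorem contDiff_regSq_slice {n : ℕ} {α ε : ℝ} (hε : ε ≠ 0) :
    ContDiff ℝ ((⊤ : ℕ∞) : WithTop ℕ∞) (fun ξ : Rn n => Real.exp (-regSq n α (ξ, ε))) := by
  rw [contDiff_iff_contDiffAt]
  intro ζ
  have h1 : ContDiffAt ℝ ((⊤ : ℕ∞) : WithTop ℕ∞) (regSq n α) (ζ, ε) :=
    (contDiffOn_regSq n α).contDiffAt
      (isOpen_compl_singleton.mem_nhds fun h0 => hε (congrArg Prod.snd h0))
  exact (h1.comp ζ (contDiffAt_id.prodMk contDiffAt_const)).neg.exp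

theorem contDiff_regSym {n : ℕ} {α ε : ℝ} (hε : ε ≠ 0) :
    ContDiff ℝ ((⊤ : ℕ∞) : WithTop ℕ∞) (regSym n α ε) :=
  Complex.ofRealCLM.contDiff.comp (contDiff_regSq_slice hε)

/-- The constant does not depend on ε: the estimate is made for the homogeneous function of (ξ, s),
then sliced, and ‖(v, ε)‖ may be replaced by ‖v‖ because both exponents are nonpositive. An order j
≤ n + 1 costs a singularity of at most |η|^{-(n+1-2α)}, which is integrable precisely because 2α >
1. Decay of order n + 3 leaves n + 1 after multiplication by ‖v‖². -/
theorem norm_iteratedFDeriv_regSym_le {n : ℕ} {α : ℝ} (hα : 1 < 2 * α) :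
    ∃ C : ℝ, 0 ≤ C ∧ ∀ ε : ℝ, ε ≠ 0 → ∀ p ≤ 2, ∀ j ≤ n + 1, ∀ v : Rn n, v ≠ 0 →
      ‖v‖ ^ p * ‖iteratedFDeriv ℝ j (regSym n α ε) v‖
        ≤ C * radialBound n (max 0 (n + 1 - 2 * α)) ‖v‖ := by
  have hβ : 0 < 2 * α := by linarith
  have key : ∀ j ∈ Finset.range (n + 2), ∃ C : ℝ, 0 ≤ C ∧ ∀ η : Rn n × ℝ, η ≠ 0 →
      ‖iteratedFDeriv ℝ j (fun ζ => Real.exp (-regSq n α ζ)) η‖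
        ≤ C * min (‖η‖ ^ (-(max 0 (n + 1 - 2 * α)))) (‖η‖ ^ (-((n : ℝ) + 3))) := by
    intro j hj
    have hj : j ≤ n + 1 := by have := Finset.mem_range.1 hj; omega
    have hj' : (j : ℝ) ≤ n + 1 := by exact_mod_cast hj
    refine exp_neg_deriv_bound hβ (contDiffOn_regSq n α) (fun c η hc _ => regSq_smul c η hc)
      (fun η _ => norm_rpow_le_regSq (by linarith) η) j _ _ (le_max_left _ _) ?_ ?_
    · exact le_trans (by linarith) (le_max_right _ _)
    · refine max_le (by positivity) (by linarith)
  choose! C hC0 hC using key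
  refine ⟨∑ j ∈ Finset.range (n + 2), C j, Finset.sum_nonneg hC0, ?_⟩
  intro ε hε p hp j hj v hv
  have hjm : j ∈ Finset.range (n + 2) := Finset.mem_range.2 (by omega)
  have hne : ((v, ε) : Rn n × ℝ) ≠ 0 := fun h0 => hε (congrArg Prod.snd h0)
  have hv0 : 0 < ‖v‖ := norm_pos_iff.2 hv
  have hvle : ‖v‖ ≤ ‖((v, ε) : Rn n × ℝ)‖ := le_max_left _ _
  have h1 : ‖iteratedFDeriv ℝ j (regSym n α ε) v‖
      ≤ ‖iteratedFDeriv ℝ j (fun ζ => Real.exp (-regSq n α ζ)) (v, ε)‖ := by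
    have e1 : regSym n α ε = Complex.ofRealLI ∘ fun ξ : Rn n => Real.exp (-regSq n α (ξ, ε)) := rfl
    rw [e1, LinearIsometry.norm_iteratedFDeriv_comp_left Complex.ofRealLI
      (contDiff_regSq_slice hε).contDiffAt (i := j) (by exact_mod_cast le_top)]
    exact norm_iteratedFDeriv_slice_le hε j ℝ (fun ζ => Real.exp (-regSq n α ζ))
      (contDiffOn_regSq n α).neg.exp v
  have h2 := hC j hjm (v, ε) hne
  set ρ := max 0 ((n : ℝ) + 1 - 2 * α) with hρ
  have hρ0 : 0 ≤ ρ := le_max_left _ _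
  have hρn : ρ ≤ n := max_le (by positivity) (by linarith)
  have h3 : ‖v‖ ^ p * min (‖((v, ε) : Rn n × ℝ)‖ ^ (-ρ)) (‖((v, ε) : Rn n × ℝ)‖ ^ (-((n : ℝ) + 3)))
      ≤ radialBound n ρ ‖v‖ := by
    have m1 : ‖((v, ε) : Rn n × ℝ)‖ ^ (-ρ) ≤ ‖v‖ ^ (-ρ) :=
      Real.rpow_le_rpow_of_nonpos hv0 hvle (by linarith)
    have m2 : ‖((v, ε) : Rn n × ℝ)‖ ^ (-((n : ℝ) + 3)) ≤ ‖v‖ ^ (-((n : ℝ) + 3)) :=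
      Real.rpow_le_rpow_of_nonpos hv0 hvle (by linarith [(Nat.cast_nonneg n : (0 : ℝ) ≤ n)])
    have hp' : (p : ℝ) ≤ 2 := by exact_mod_cast hp
    have hn0 : (0 : ℝ) ≤ n := Nat.cast_nonneg n
    unfold radialBound
    rcases le_total ‖v‖ 1 with h | h
    · have hp1 : ‖v‖ ^ p ≤ 1 := pow_le_one₀ hv0.le h
      rw [min_eq_left (a := ‖v‖ ^ (-ρ)) (Real.rpow_le_rpow_of_exponent_ge hv0 h (by linarith))]
      calc _ ≤ 1 * ‖v‖ ^ (-ρ) := by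
            gcongr
            exact (min_le_left _ _).trans m1
        _ = _ := one_mul _
    · rw [min_eq_right (a := ‖v‖ ^ (-ρ)) (Real.rpow_le_rpow_of_exponent_le h (by linarith))]
      calc _ ≤ ‖v‖ ^ p * ‖v‖ ^ (-((n : ℝ) + 3)) := by
            gcongr
            exact (min_le_right _ _).trans m2
        _ = ‖v‖ ^ ((p : ℝ) - (n + 3)) := by
            rw [← Real.rpow_natCast, ← Real.rpow_add hv0]; ring_nf
        _ ≤ _ := Real.rpow_le_rpow_of_exponent_le h (by linarith)
  calc ‖v‖ ^ p * ‖iteratedFDeriv ℝ j (regSym n α ε) v‖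
      ≤ ‖v‖ ^ p * (C j * min (‖((v, ε) : Rn n × ℝ)‖ ^ (-ρ))
          (‖((v, ε) : Rn n × ℝ)‖ ^ (-((n : ℝ) + 3)))) := by
        gcongr
        exact h1.trans h2
    _ = C j * (‖v‖ ^ p * min (‖((v, ε) : Rn n × ℝ)‖ ^ (-ρ))
          (‖((v, ε) : Rn n × ℝ)‖ ^ (-((n : ℝ) + 3)))) := by ring
    _ ≤ C j * radialBound n ρ ‖v‖ := mul_le_mul_of_nonneg_left h3 (hC0 j hjm)
    _ ≤ _ := by
        refine mul_le_mul_of_nonneg_right ?_ (radialBound_nonneg hv0.le)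
        exact Finset.single_le_sum hC0 hjm

end RegularisedSymbol

end FracDissip

namespace FracDissip

/-! ### Spatial decay of the kernel and its derivatives at time one. -/

section KernelDecay

variable {n : ℕ}

/-- The symbol `e^{-t|2πξ|^{2α}}`. -/
def sym (α t : ℝ) (ξ : Rn n) : ℂ := ((Real.exp (-t * (2 * Real.pi * ‖ξ‖) ^ (2 * α)) : ℝ) : ℂ)

theorem continuous_sym {α : ℝ} (hα : 0 < α) (t : ℝ) : Continuous (sym (n := n) α t) := by
  unfold sym
  refine Complex.continuous_ofReal.comp (Real.continuous_exp.comp (continuous_const.mul ?_))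
  exact Continuous.rpow_const (by fun_prop) fun x => Or.inr (by positivity)

theorem norm_sym (α t : ℝ) (ξ : Rn n) :
    ‖sym α t ξ‖ = Real.exp (-t * (2 * Real.pi * ‖ξ‖) ^ (2 * α)) := by
  rw [sym, Complex.norm_real, Real.norm_of_nonneg (Real.exp_nonneg _)]

/-- With s = t|2πv|^{2α} and k = (n+3)/(2α), boundedness of sᵏe^{-s} gives decay of order n + 3, two
orders of which absorb the factor ‖v‖^p. -/
theorem pow_mul_norm_sym_le {α t : ℝ} (hα : 0 < α) (ht : 0 < t) :
    ∃ C : ℝ, 0 ≤ C ∧ ∀ p ≤ 2, ∀ v : Rn n, v ≠ 0 →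
      ‖v‖ ^ p * ‖sym α t v‖ ≤ C * radialBound n 0 ‖v‖ := by
  obtain ⟨C, hC0, hC⟩ := exists_rpow_mul_exp_neg_le (((n : ℝ) + 3) / (2 * α)) (by positivity)
  set A := t ^ (-(((n : ℝ) + 3) / (2 * α))) with hA
  have hA0 : 0 ≤ A := Real.rpow_nonneg ht.le _
  refine ⟨1 + C * A, by positivity, fun p hp v hv => ?_⟩
  have hv0 : 0 < ‖v‖ := norm_pos_iff.2 hv
  have hpi := Real.pi_gt_three
  have hp' : (p : ℝ) ≤ 2 := by exact_mod_cast hp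
  rw [norm_sym]
  unfold radialBound
  rcases le_total ‖v‖ 1 with h | h
  · rw [min_eq_left (Real.rpow_le_rpow_of_exponent_ge hv0 h (by linarith [(Nat.cast_nonneg n : (0 : ℝ) ≤ n)]))]
    have hp1 : ‖v‖ ^ p ≤ 1 := pow_le_one₀ hv0.le h
    have h1 : Real.exp (-t * (2 * Real.pi * ‖v‖) ^ (2 * α)) ≤ 1 := by
      rw [Real.exp_le_one_iff, neg_mul, neg_nonpos]; positivity
    simp only [neg_zero, Real.rpow_zero, mul_one]
    have : 0 ≤ C * A := by positivity
    nlinarith [Real.exp_pos (-t * (2 * Real.pi * ‖v‖) ^ (2 * α)), pow_nonneg hv0.le p]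
  · rw [min_eq_right (Real.rpow_le_rpow_of_exponent_le h (by linarith [(Nat.cast_nonneg n : (0 : ℝ) ≤ n)]))]
    have hs : 0 ≤ t * (2 * Real.pi * ‖v‖) ^ (2 * α) := by positivity
    have h1 := hC _ hs
    rw [Real.mul_rpow ht.le (by positivity), ← Real.rpow_mul (by positivity),
      mul_div_cancel₀ _ (by positivity)] at h1
    have h2 : ‖v‖ ^ ((n : ℝ) + 3) ≤ (2 * Real.pi * ‖v‖) ^ ((n : ℝ) + 3) :=
      Real.rpow_le_rpow hv0.le (by nlinarith) (by positivity)
    have h3 : Real.exp (-t * (2 * Real.pi * ‖v‖) ^ (2 * α)) ≤ C * A * ‖v‖ ^ (-((n : ℝ) + 3)) := by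
      rw [Real.rpow_neg hv0.le, ← div_eq_mul_inv, le_div_iff₀ (by positivity), hA,
        Real.rpow_neg ht.le, ← div_eq_mul_inv, le_div_iff₀ (by positivity), neg_mul]
      refine le_trans (le_of_eq ?_) (le_trans (mul_le_mul_of_nonneg_right
        (mul_le_mul_of_nonneg_left h2 (by positivity)) (Real.exp_nonneg _)) h1)
      ring
    calc _ ≤ ‖v‖ ^ p * (C * A * ‖v‖ ^ (-((n : ℝ) + 3))) := by gcongr
      _ = C * A * ‖v‖ ^ ((p : ℝ) - (n + 3)) := by
          rw [show (p : ℝ) - (n + 3) = p + -((n : ℝ) + 3) by ring, Real.rpow_add hv0,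
            Real.rpow_natCast]; ring
      _ ≤ (1 + C * A) * ‖v‖ ^ (-((n : ℝ) + 1)) := by
          refine mul_le_mul (by linarith) (Real.rpow_le_rpow_of_exponent_le h (by linarith))
            (by positivity) (by positivity)

theorem ae_ne_zero (hn : 1 ≤ n) : ∀ᵐ v : Rn n, v ≠ 0 := by
  have : Nontrivial (Rn n) := by
    have : Nonempty (Fin n) := ⟨⟨0, hn⟩⟩
    infer_instance
  exact compl_mem_ae_iff.2 (measure_singleton (0 : Rn n))

theorem integrable_pow_mul_norm_sym (hn : 1 ≤ n) {α t : ℝ} (hα : 0 < α) (ht : 0 < t) {p : ℕ}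
    (hp : p ≤ 2) : Integrable (fun v : Rn n => ‖v‖ ^ p * ‖sym α t v‖) := by
  obtain ⟨C, hC0, hC⟩ := pow_mul_norm_sym_le (n := n) hα ht
  refine Integrable.mono' ((integrable_radialBound hn (ρ := 0) (by positivity)).const_mul C)
    ((continuous_norm.pow p).mul (continuous_sym hα t).norm).aestronglyMeasurable ?_
  filter_upwards [ae_ne_zero hn] with v hv
  rw [Real.norm_of_nonneg (by positivity)]
  exact hC p hp v hv

theorem integrable_sym (hn : 1 ≤ n) {α t : ℝ} (hα : 0 < α) (ht : 0 < t) :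
    Integrable (sym (n := n) α t) := by
  have := integrable_pow_mul_norm_sym hn hα ht (p := 0) (by norm_num)
  simp only [pow_zero, one_mul] at this
  exact (integrable_norm_iff (continuous_sym hα t).aestronglyMeasurable).1 this

theorem sym_neg (α t : ℝ) (v : Rn n) : sym α t (-v) = sym α t v := by simp [sym]

theorem fourierInv_sym (α t : ℝ) : 𝓕⁻ (sym (n := n) α t) = 𝓕 (sym (n := n) α t) := by
  rw [Real.fourierInv_eq_fourier_comp_neg]
  simp only [sym_neg]

theorem kernel_eq (α t : ℝ) (x : Rn n) : kernel α t x = (𝓕 (sym (n := n) α t) x).re := by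
  rw [← fourierInv_sym]; rfl

/-- The Fourier transform of the symbol is real. -/
theorem ofReal_kernel (α t : ℝ) (x : Rn n) : ((kernel α t x : ℝ) : ℂ) = 𝓕 (sym (n := n) α t) x := by
  rw [kernel_eq]
  refine Complex.conj_eq_iff_re.1 ?_
  have h1 : 𝓕 (sym (n := n) α t) x = 𝓕⁻ (sym (n := n) α t) x := by rw [fourierInv_sym]
  conv_rhs => rw [h1]
  rw [Real.fourier_eq', Real.fourierInv_eq', ← integral_conj]
  refine integral_congr_ae (Eventually.of_forall fun v => ?_)
  simp only [smul_eq_mul, map_mul, sym, Complex.conj_ofReal]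
  rw [← Complex.exp_conj]
  congr 2
  simp [Complex.conj_ofReal, map_ofNat]

theorem regSym_integrable (hn : 1 ≤ n) {α ε : ℝ} (hα : 1 < 2 * α) (hε : ε ≠ 0) {p j : ℕ}
    (hp : p ≤ 2) (hj : j ≤ n + 1) :
    Integrable (fun v : Rn n => ‖v‖ ^ p * ‖iteratedFDeriv ℝ j (regSym n α ε) v‖) := by
  obtain ⟨C, hC0, hC⟩ := norm_iteratedFDeriv_regSym_le (n := n) hα
  refine Integrable.mono' ((integrable_radialBound hn
    (ρ := max 0 (n + 1 - 2 * α)) (max_lt (by positivity) (by linarith))).const_mul C)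
    ((continuous_norm.pow p).mul
      ((contDiff_regSym hε).continuous_iteratedFDeriv
        (by exact_mod_cast le_top)).norm).aestronglyMeasurable ?_
  filter_upwards [ae_ne_zero hn] with v hv
  rw [Real.norm_of_nonneg (by positivity)]
  exact hC ε hε p hp j hj v hv

theorem regSym_zero {α : ℝ} (ξ : Rn n) : regSym n α 0 ξ = sym α 1 ξ := by
  simp only [regSym, regSq, sym]
  congr 3
  simp only [ne_eq, OfNat.ofNat_ne_zero, not_false_eq_true, zero_pow, add_zero, neg_mul, one_mul]
  rw [← Real.rpow_natCast, ← Real.rpow_mul (by positivity)]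
  norm_num

theorem tendsto_regSym {α : ℝ} (hα : 0 < α) (ξ : Rn n) :
    Tendsto (fun ε => regSym n α ε ξ) (𝓝[≠] 0) (𝓝 (sym α 1 ξ)) := by
  rw [← regSym_zero]
  have : Continuous fun ε => regSym n α ε ξ := by
    unfold regSym regSq
    refine Complex.continuous_ofReal.comp (Real.continuous_exp.comp (Continuous.neg ?_))
    exact Continuous.rpow_const (by fun_prop) fun x => Or.inr hα.le
  exact (this.tendsto 0).mono_left nhdsWithin_le_nhds

/-- Decay of the derivatives of the kernel at time one. -/
theorem exists_decay (hn : 1 ≤ n) {α : ℝ} (hα : 1 < 2 * α) :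
    ∃ C : ℝ, 0 ≤ C ∧ ∀ k ≤ 2, ∀ N ≤ n + 1, ∀ x : Rn n,
      ‖x‖ ^ N * ‖iteratedFDeriv ℝ k (𝓕 (sym (n := n) α 1)) x‖ ≤ C := by
  have hα0 : 0 < α := by linarith
  obtain ⟨C, hC0, hC⟩ := norm_iteratedFDeriv_regSym_le (n := n) hα
  set ρ := max 0 ((n : ℝ) + 1 - 2 * α) with hρ
  have hint : Integrable (fun v : Rn n => C * radialBound n ρ ‖v‖) :=
    (integrable_radialBound hn (max_lt (by positivity) (by linarith))).const_mul C
  set I := ∫ v : Rn n, C * radialBound n ρ ‖v‖ with hI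
  have hI0 : 0 ≤ I := integral_nonneg fun v => mul_nonneg hC0 (radialBound_nonneg (norm_nonneg _))
  have hpi := Real.pi_gt_three
  -- The factors come from k ≤ 2 and N ≤ n + 1: 2k + 2 ≤ 6, and the sum over orders has (k+1)(N+1) ≤
  -- 3(n+2) terms, each at most I.
  refine ⟨(2 * Real.pi) ^ 2 * 6 ^ (n + 1) * (3 * (n + 2) * I), by positivity, ?_⟩
  intro k hk N hN x
  -- The limit symbol need not have n + 1 derivatives at the origin, so the bound is proved for ε ≠
  -- 0 and passed to the limit. On the Fourier side this needs only dominated convergence of the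
  -- symbols themselves.
  have hlim : Tendsto (fun ε : ℝ => ‖x‖ ^ N * ‖iteratedFDeriv ℝ k (𝓕 (regSym n α ε)) x‖) (𝓝[≠] 0)
      (𝓝 (‖x‖ ^ N * ‖iteratedFDeriv ℝ k (𝓕 (sym (n := n) α 1)) x‖)) := by
    refine (Tendsto.norm ?_).const_mul _
    have e1 : ∀ ε : ℝ, ε ≠ 0 → iteratedFDeriv ℝ k (𝓕 (regSym n α ε)) x =
        𝓕 (fun v => VectorFourier.fourierPowSMulRight (innerSL ℝ) (regSym n α ε) v k) x := by
      intro ε hε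
      rw [Real.iteratedFDeriv_fourier (N := 2) (fun m hm => ?_)
        (contDiff_regSym hε).continuous.aestronglyMeasurable (by exact_mod_cast hk)]
      have := regSym_integrable hn hα hε (p := m) (j := 0) (by exact_mod_cast hm) (by omega)
      simpa only [norm_iteratedFDeriv_zero] using this
    have e2 : iteratedFDeriv ℝ k (𝓕 (sym (n := n) α 1)) x =
        𝓕 (fun v => VectorFourier.fourierPowSMulRight (innerSL ℝ) (sym α 1) v k) x := by
      rw [Real.iteratedFDeriv_fourier (N := 2) (fun m hm => ?_)
        (continuous_sym hα0 1).aestronglyMeasurable (by exact_mod_cast hk)]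
      exact integrable_pow_mul_norm_sym hn hα0 one_pos (by exact_mod_cast hm)
    rw [e2]
    have e3 : (fun ε : ℝ => 𝓕 (fun v =>
        VectorFourier.fourierPowSMulRight (innerSL ℝ) (regSym n α ε) v k) x) =ᶠ[𝓝[≠] 0]
        fun ε => iteratedFDeriv ℝ k (𝓕 (regSym n α ε)) x := by
      filter_upwards [self_mem_nhdsWithin] with ε hε using (e1 ε hε).symm
    refine Tendsto.congr' e3 ?_
    simp only [Real.fourier_eq]
    refine tendsto_integral_filter_of_dominated_convergence
      (fun v => (2 * Real.pi) ^ k * (C * radialBound n ρ ‖v‖)) ?_ ?_ (hint.const_mul _) ?_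
    · filter_upwards [self_mem_nhdsWithin] with ε hε
      refine Continuous.aestronglyMeasurable ?_
      refine Continuous.smul (by fun_prop) ?_
      exact (contDiff_regSym hε).continuous.fourierPowSMulRight _ _
    · filter_upwards [self_mem_nhdsWithin] with ε hε
      filter_upwards [ae_ne_zero hn] with v hv
      rw [Circle.norm_smul]
      refine (VectorFourier.norm_fourierPowSMulRight_le _ _ _ _).trans ?_
      have h1 := hC ε hε k hk 0 (by omega) v hv
      rw [norm_iteratedFDeriv_zero] at h1
      have h2 : ‖innerSL ℝ (E := Rn n)‖ ≤ 1 := norm_innerSL_le ℝ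
      calc _ ≤ (2 * Real.pi * 1) ^ k * ‖v‖ ^ k * ‖regSym n α ε v‖ := by gcongr
        _ = (2 * Real.pi) ^ k * (‖v‖ ^ k * ‖regSym n α ε v‖) := by ring
        _ ≤ _ := by gcongr
    · refine Eventually.of_forall fun v => ?_
      refine Tendsto.const_smul ?_ _
      rw [tendsto_iff_norm_sub_tendsto_zero]
      have h0 : Tendsto (fun ε => (2 * Real.pi * ‖innerSL ℝ (E := Rn n)‖) ^ k * ‖v‖ ^ k *
          ‖regSym n α ε v - sym α 1 v‖) (𝓝[≠] 0) (𝓝 0) := by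
        have := (tendsto_iff_norm_sub_tendsto_zero.1 (tendsto_regSym hα0 v)).const_mul
          ((2 * Real.pi * ‖innerSL ℝ (E := Rn n)‖) ^ k * ‖v‖ ^ k)
        rwa [mul_zero] at this
      refine squeeze_zero (fun _ => norm_nonneg _) (fun ε => ?_) h0
      have : VectorFourier.fourierPowSMulRight (innerSL ℝ) (regSym n α ε) v k
          - VectorFourier.fourierPowSMulRight (innerSL ℝ) (sym α 1) v k
          = VectorFourier.fourierPowSMulRight (innerSL ℝ)
            (fun w => regSym n α ε w - sym α 1 w) v k := by
        ext m
        simp only [sub_apply, VectorFourier.fourierPowSMulRight_apply,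
          smul_sub]
      rw [this]
      exact VectorFourier.norm_fourierPowSMulRight_le _ _ _ _
  refine le_of_tendsto hlim ?_
  filter_upwards [self_mem_nhdsWithin] with ε hε
  -- Integration by parts, legitimate for the smooth symbol; its right-hand side is bounded
  -- independently of ε.
  have hb := Real.pow_mul_norm_iteratedFDeriv_fourier_le (K := 2) (N := (n + 1 : ℕ))
    (f := regSym n α ε) ((contDiff_regSym hε).of_le (by exact_mod_cast le_top))
    (fun p j hp hj => regSym_integrable hn hα hε (by exact_mod_cast hp) (by exact_mod_cast hj))
    (k := k) (n := N) (by exact_mod_cast hk) (by exact_mod_cast hN) x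
  refine hb.trans ?_
  have hk' : (k : ℝ) ≤ 2 := by exact_mod_cast hk
  have hN' : (N : ℝ) ≤ n + 1 := by exact_mod_cast hN
  have hsum : (∑ p ∈ Finset.range (k + 1) ×ˢ Finset.range (N + 1),
      ∫ v : Rn n, ‖v‖ ^ p.1 * ‖iteratedFDeriv ℝ p.2 (regSym n α ε) v‖) ≤ 3 * (n + 2) * I := by
    calc _ ≤ ∑ p ∈ Finset.range (k + 1) ×ˢ Finset.range (N + 1), I := by
          refine Finset.sum_le_sum fun p hp => ?_
          have h1 := Finset.mem_range.1 (Finset.mem_product.1 hp).1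
          have h2 := Finset.mem_range.1 (Finset.mem_product.1 hp).2
          refine integral_mono_ae (regSym_integrable hn hα hε (by omega) (by omega)) hint ?_
          filter_upwards [ae_ne_zero hn] with v hv
          exact hC ε hε p.1 (by omega) p.2 (by omega) v hv
      _ = ((k : ℝ) + 1) * (N + 1) * I := by
          simp [Finset.card_product]
      _ ≤ 3 * (n + 2) * I := by
          refine mul_le_mul_of_nonneg_right ?_ hI0
          exact mul_le_mul (by linarith) (by linarith) (by positivity) (by norm_num)
  have hs0 : 0 ≤ (∑ p ∈ Finset.range (k + 1) ×ˢ Finset.range (N + 1),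
      ∫ v : Rn n, ‖v‖ ^ p.1 * ‖iteratedFDeriv ℝ p.2 (regSym n α ε) v‖) :=
    Finset.sum_nonneg fun p _ => integral_nonneg fun v => by positivity
  calc _ ≤ (2 * Real.pi) ^ 2 * 6 ^ (n + 1) * _ := by
        refine mul_le_mul_of_nonneg_right ?_ hs0
        refine mul_le_mul ?_ ?_ (by positivity) (by positivity)
        · exact pow_le_pow_right₀ (by linarith) hk
        · calc (2 * (k : ℝ) + 2) ^ N ≤ 6 ^ N := by gcongr; linarith
            _ ≤ 6 ^ (n + 1) := pow_le_pow_right₀ (by norm_num) hN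
    _ ≤ _ := by gcongr

end KernelDecay

end FracDissip

/-! ### Scaling, normalisation and semigroup property of the kernels. -/

namespace FracDissip

/-- Bounds of a kernel `k_s` that smooths as `s ^ (-γ)` in `L¹`, with the scaling of
`e^{-s(-Δ)^α}`, `a = 1 / (2α)`. -/
structure KerBound {n : ℕ} (a γ C : ℝ) (k : ℝ → Rn n → ℝ) : Prop where
  meas : Measurable (Function.uncurry k)
  one : ∀ s, 0 < s → ∫⁻ x, ‖k s x‖ₑ ≤ ENNReal.ofReal (C * s ^ (-γ))
  sup : ∀ s, 0 < s → ∀ x, ‖k s x‖ₑ ≤ ENNReal.ofReal (C * s ^ (-(γ + n * a)))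

section KernelProperties

variable {n : ℕ}

/-- The values of a constant coefficient operator of order `k`. -/
def jet {ι : Type} [Fintype ι] (k : ℕ) (m : ι → Fin k → Rn n) (g : Rn n → ℝ) (x : Rn n) : ℝ :=
  ∑ i, iteratedFDeriv ℝ k g x (m i)

/-- Both operators are sums of pure derivatives of one order k ∈ {1, 2}. Together with the trivial
case k = 0, which returns the kernel itself, this lets every kernel estimate be proved once. -/
theorem DiffOp.exists_jet (D : DiffOp n) : ∃ (k : ℕ) (ι : Type) (_ : Fintype ι)
    (m : ι → Fin k → Rn n), 1 ≤ k ∧ k ≤ 2 ∧ (k : ℝ) = D.order ∧ ∀ g x, D.apply g x = jet k m g x := by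
  cases D with
  | convection β =>
    refine ⟨1, Unit, inferInstance, fun _ _ => β, le_rfl, by norm_num, by simp [DiffOp.order], ?_⟩
    intro g x
    simp [DiffOp.apply, jet, iteratedFDeriv_one_apply]
  | laplacian =>
    refine ⟨2, _, inferInstance, fun i => ![stdOrthonormalBasis ℝ (Rn n) i,
      stdOrthonormalBasis ℝ (Rn n) i], by norm_num, le_rfl, by simp [DiffOp.order], ?_⟩
    intro g x
    simp only [DiffOp.apply, jet]
    rw [InnerProductSpace.laplacian_eq_iteratedFDeriv_stdOrthonormalBasis]

theorem contDiff_fourier_sym (hn : 1 ≤ n) {α s : ℝ} (hα : 0 < α) (hs : 0 < s) :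
    ContDiff ℝ 2 (𝓕 (sym (n := n) α s)) := by
  have := Real.contDiff_fourier (N := 2) (f := sym (n := n) α s) fun p hp =>
    integrable_pow_mul_norm_sym hn hα hs (by exact_mod_cast hp)
  exact_mod_cast this

theorem contDiff_kernel (hn : 1 ≤ n) {α s : ℝ} (hα : 0 < α) (hs : 0 < s) :
    ContDiff ℝ 2 (kernel (n := n) α s) := by
  have : kernel (n := n) α s = Complex.reCLM ∘ 𝓕 (sym (n := n) α s) := by
    funext x; exact kernel_eq α s x
  rw [this]
  exact Complex.reCLM.contDiff.comp (contDiff_fourier_sym hn hα hs)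

theorem iteratedFDeriv_fourier_sym (hn : 1 ≤ n) {α s : ℝ} (hα : 0 < α) (hs : 0 < s) {k : ℕ}
    (hk : k ≤ 2) (x : Rn n) (m : Fin k → Rn n) :
    iteratedFDeriv ℝ k (𝓕 (sym (n := n) α s)) x m
      = ((iteratedFDeriv ℝ k (kernel (n := n) α s) x m : ℝ) : ℂ) := by
  have : 𝓕 (sym (n := n) α s) = Complex.ofRealCLM ∘ kernel (n := n) α s := by
    funext x; exact (ofReal_kernel α s x).symm
  rw [this, ContinuousLinearMap.iteratedFDeriv_comp_left _ (contDiff_kernel hn hα hs).contDiffAt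
    (by exact_mod_cast hk)]
  rfl

theorem norm_iteratedFDeriv_kernel_le (hn : 1 ≤ n) {α s : ℝ} (hα : 0 < α) (hs : 0 < s) {k : ℕ}
    (hk : k ≤ 2) (x : Rn n) : ‖iteratedFDeriv ℝ k (kernel (n := n) α s) x‖
      ≤ ‖iteratedFDeriv ℝ k (𝓕 (sym (n := n) α s)) x‖ := by
  refine ContinuousMultilinearMap.opNorm_le_bound (norm_nonneg _) fun m => ?_
  have := (iteratedFDeriv ℝ k (𝓕 (sym (n := n) α s)) x).le_opNorm m
  rwa [iteratedFDeriv_fourier_sym hn hα hs hk, Complex.norm_real] at this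

/-- The symbol of the operator `jet k m`. -/
def jetSymbol {ι : Type} [Fintype ι] (k : ℕ) (m : ι → Fin k → Rn n) (v : Rn n) : ℂ :=
  ∑ i, (-(2 * Real.pi * Complex.I)) ^ k * ((∏ j, inner ℝ v (m i j) : ℝ) : ℂ)

variable {ι : Type} [Fintype ι]

theorem integrable_jetSymbol_mul (hn : 1 ≤ n) {α s : ℝ} (hα : 0 < α) (hs : 0 < s) {k : ℕ}
    (hk : k ≤ 2) (m : ι → Fin k → Rn n) :
    Integrable (fun v => jetSymbol k m v * sym (n := n) α s v) := by
  refine Integrable.mono' ((integrable_pow_mul_norm_sym hn hα hs hk).const_mul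
    (∑ i, (2 * Real.pi) ^ k * ∏ j, ‖m i j‖)) ?_ (Eventually.of_forall fun v => ?_)
  · refine Continuous.aestronglyMeasurable (Continuous.mul ?_ (continuous_sym hα s))
    unfold jetSymbol
    refine continuous_finsetSum _ fun i _ => continuous_const.mul (Complex.continuous_ofReal.comp ?_)
    exact continuous_finsetProd _ fun j _ => by fun_prop
  · rw [norm_mul, ← mul_assoc]
    gcongr
    unfold jetSymbol
    rw [Finset.sum_mul]
    refine norm_sum_le_of_le _ fun i _ => ?_
    have hB : ‖-(2 * (Real.pi : ℂ) * Complex.I)‖ = 2 * Real.pi := by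
      simp [abs_of_nonneg Real.pi_pos.le]
    have hA : ∏ j, ‖inner ℝ v (m i j)‖ ≤ ‖v‖ ^ k * ∏ j, ‖m i j‖ := by
      calc ∏ j, ‖inner ℝ v (m i j)‖ ≤ ∏ j : Fin k, ‖v‖ * ‖m i j‖ :=
            Finset.prod_le_prod (fun _ _ => norm_nonneg _) fun j _ => norm_inner_le_norm _ _
        _ = _ := by rw [Finset.prod_mul_distrib]; simp
    rw [norm_mul, norm_pow, Complex.norm_real, norm_prod, hB]
    calc _ ≤ (2 * Real.pi) ^ k * (‖v‖ ^ k * ∏ j, ‖m i j‖) :=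
          mul_le_mul_of_nonneg_left hA (by positivity)
      _ = _ := by ring

theorem ofReal_jet_kernel (hn : 1 ≤ n) {α s : ℝ} (hα : 0 < α) (hs : 0 < s) {k : ℕ}
    (hk : k ≤ 2) (m : ι → Fin k → Rn n) (x : Rn n) :
    ((jet k m (kernel α s) x : ℝ) : ℂ) = 𝓕 (fun v => jetSymbol k m v * sym (n := n) α s v) x := by
  have hint : Integrable
      (fun v => VectorFourier.fourierPowSMulRight (innerSL ℝ) (sym (n := n) α s) v k) :=
    VectorFourier.integrable_fourierPowSMulRight (innerSL ℝ) (integrable_pow_mul_norm_sym hn hα hs hk)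
      (continuous_sym hα s).aestronglyMeasurable
  rw [jet, Complex.ofReal_sum]
  have e1 : ∀ i, ((iteratedFDeriv ℝ k (kernel (n := n) α s) x (m i) : ℝ) : ℂ) =
      ∫ v, 𝐞 (-inner ℝ v x) • (((-(2 * Real.pi * Complex.I)) ^ k *
        ((∏ j, inner ℝ v (m i j) : ℝ) : ℂ)) * sym (n := n) α s v) := by
    intro i
    rw [← iteratedFDeriv_fourier_sym hn hα hs hk,
      Real.iteratedFDeriv_fourier (N := 2) (fun p hp => integrable_pow_mul_norm_sym hn hα hs
        (by exact_mod_cast hp)) (continuous_sym hα s).aestronglyMeasurable (by exact_mod_cast hk),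
      Real.fourier_continuousMultilinearMap_apply hint, Real.fourier_eq]
    refine integral_congr_ae (Eventually.of_forall fun v => ?_)
    simp only [VectorFourier.fourierPowSMulRight_apply, smul_eq_mul, Complex.real_smul, mul_assoc]
    rfl
  have e2 : ∀ i, Integrable (fun v : Rn n => 𝐞 (-inner ℝ v x) • (((-(2 * Real.pi * Complex.I)) ^ k *
        ((∏ j, inner ℝ v (m i j) : ℝ) : ℂ)) * sym (n := n) α s v)) := by
    intro i
    have := integrable_jetSymbol_mul hn hα hs hk (fun _ : Unit => m i)
    simp only [jetSymbol, Finset.univ_unique, Finset.sum_const, Finset.card_singleton, one_smul]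
      at this
    exact (Real.fourierIntegral_convergent_iff x).2 this
  simp_rw [e1]
  rw [← integral_finsetSum _ fun i _ => e2 i, Real.fourier_eq]
  refine integral_congr_ae (Eventually.of_forall fun v => ?_)
  simp only [jetSymbol, Finset.sum_mul, Finset.smul_sum]

theorem sym_scale {α s : ℝ} (hα : 0 < α) (hs : 0 < s) (v : Rn n) :
    sym α s v = sym α 1 (s ^ (1 / (2 * α)) • v) := by
  unfold sym
  congr 2
  have h1 : 2 * Real.pi * ‖s ^ (1 / (2 * α)) • v‖ = s ^ (1 / (2 * α)) * (2 * Real.pi * ‖v‖) := by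
    rw [norm_smul, Real.norm_of_nonneg (by positivity)]; ring
  rw [h1, Real.mul_rpow (x := s ^ (1 / (2 * α))) (by positivity) (by positivity),
    ← Real.rpow_mul hs.le,
    div_mul_cancel₀ _ (by positivity), Real.rpow_one]
  ring

/-- Substitute w = s^{1/(2α)} v in the Fourier integral. -/
theorem kernel_scale {α s : ℝ} (hα : 0 < α) (hs : 0 < s) (x : Rn n) :
    kernel α s x = s ^ (-(n * (1 / (2 * α)))) * kernel α 1 (s ^ (-(1 / (2 * α))) • x) := by
  set a := 1 / (2 * α) with ha
  have hsa : 0 < s ^ a := by positivity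
  have h := Measure.integral_comp_smul (volume : Measure (Rn n))
    (fun w => 𝐞 (-inner ℝ w (s ^ (-a) • x)) • sym (n := n) α 1 w) (s ^ a)
  have h2 : ∫ v, 𝐞 (-inner ℝ v x) • sym (n := n) α s v =
      ∫ v, 𝐞 (-inner ℝ (s ^ a • v) (s ^ (-a) • x)) • sym (n := n) α 1 (s ^ a • v) := by
    refine integral_congr_ae (Eventually.of_forall fun v => ?_)
    simp only [sym_scale hα hs v, ← ha]
    rw [inner_smul_left, inner_smul_right, ← mul_assoc]
    simp only [conj_trivial]
    rw [← Real.rpow_add hs, add_neg_cancel, Real.rpow_zero, one_mul]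
  have h3 : 𝓕 (sym (n := n) α s) x
      = ((s ^ (-(n * a)) : ℝ) : ℂ) * 𝓕 (sym (n := n) α 1) (s ^ (-a) • x) := by
    rw [Real.fourier_eq, Real.fourier_eq, h2, h, Complex.real_smul]
    congr 2
    rw [finrank_euclideanSpace, Fintype.card_fin, abs_of_pos (by positivity), ← Real.rpow_natCast,
      ← Real.rpow_mul hs.le, ← Real.rpow_neg hs.le, mul_comm a]
  rw [← ofReal_kernel, ← ofReal_kernel, ← Complex.ofReal_mul] at h3
  exact_mod_cast h3

theorem jet_kernel_scale (hn : 1 ≤ n) {α s : ℝ} (hα : 0 < α) (hs : 0 < s) {k : ℕ}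
    (hk : k ≤ 2) (m : ι → Fin k → Rn n) (x : Rn n) :
    jet k m (kernel α s) x = s ^ (-(k * (1 / (2 * α)) + n * (1 / (2 * α)))) *
      jet k m (kernel α 1) (s ^ (-(1 / (2 * α))) • x) := by
  set a := 1 / (2 * α) with ha
  have hc : ContDiff ℝ k (kernel (n := n) α 1) :=
    (contDiff_kernel hn hα one_pos).of_le (by exact_mod_cast hk)
  have h1 : kernel (n := n) α s = s ^ (-(n * a)) • fun x => kernel α 1 (s ^ (-a) • x) := by
    funext x; exact kernel_scale hα hs x
  unfold jet
  rw [Finset.mul_sum]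
  refine Finset.sum_congr rfl fun i _ => ?_
  have hc' : ContDiff ℝ k (fun x => kernel (n := n) α 1 (s ^ (-a) • x)) :=
    hc.comp (contDiff_const_smul _)
  rw [h1, iteratedFDeriv_const_smul_apply hc'.contDiffAt, iteratedFDeriv_comp_const_smul _ hc]
  simp only [smul_apply, smul_eq_mul]
  rw [← mul_assoc, ← Real.rpow_natCast, ← Real.rpow_mul hs.le, ← Real.rpow_add hs]
  ring_nf

/-- For s ≤ 0 the symbol has modulus at least 1, so it is not integrable and the integral takes its
default value 0. Knowing this value makes the kernel jointly measurable on all of ℝ × ℝⁿ, with no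
restriction to positive times. -/
theorem kernel_nonpos (hn : 1 ≤ n) {α s : ℝ} (hs : s ≤ 0) :
    kernel (n := n) α s = 0 := by
  funext x
  rw [kernel_eq, Real.fourier_eq, integral_undef]
  · rfl
  · intro h
    have h1 : Integrable (sym (n := n) α s) := (Real.fourierIntegral_convergent_iff x).1 h
    have h2 : Integrable (fun _ : Rn n => (1 : ℝ)) := by
      refine h1.norm.mono' aestronglyMeasurable_const (Eventually.of_forall fun v => ?_)
      rw [norm_sym, norm_one]
      refine Real.one_le_exp (mul_nonneg (by linarith) (by positivity))
    have : Nontrivial (Rn n) := by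
      have : Nonempty (Fin n) := ⟨⟨0, hn⟩⟩
      infer_instance
    rw [integrable_const_iff] at h2
    have h3 := h2.resolve_left one_ne_zero
    have h4 := measure_lt_top (volume : Measure (Rn n)) univ
    have : NoncompactSpace (Rn n) := NormedSpace.noncompactSpace ℝ (Rn n)
    rw [measure_univ_of_isAddLeftInvariant] at h4
    exact lt_irrefl _ h4

theorem jet_kernel_nonpos (hn : 1 ≤ n) {α s : ℝ} (hs : s ≤ 0) {k : ℕ}
    (m : ι → Fin k → Rn n) (x : Rn n) : jet k m (kernel α s) x = 0 := by
  unfold jet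
  rw [kernel_nonpos hn hs]
  refine Finset.sum_eq_zero fun i _ => ?_
  rw [show (0 : Rn n → ℝ) = fun _ => 0 from rfl, iteratedFDeriv_fun_zero]
  rfl

theorem continuous_jet_kernel (hn : 1 ≤ n) {α s : ℝ} (hα : 0 < α) (hs : 0 < s) {k : ℕ}
    (hk : k ≤ 2) (m : ι → Fin k → Rn n) : Continuous (jet k m (kernel α s)) := by
  unfold jet
  refine continuous_finsetSum _ fun i _ => ?_
  have := (contDiff_kernel hn hα hs).continuous_iteratedFDeriv (m := k) (by exact_mod_cast hk)
  fun_prop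

/-- The decay estimates with N = 0 and N = n + 1, used for |x| ≤ 1 and |x| ≥ 1 respectively. -/
theorem exists_jet_kernel_le (hn : 1 ≤ n) {α : ℝ} (hα : 1 < 2 * α) {k : ℕ}
    (hk : k ≤ 2) (m : ι → Fin k → Rn n) : ∃ C : ℝ, 0 ≤ C ∧ ∀ x : Rn n,
      |jet k m (kernel α 1) x| ≤ C * (1 + ‖x‖) ^ (-((n : ℝ) + 1)) := by
  have hα0 : 0 < α := by linarith
  obtain ⟨C, hC0, hC⟩ := exists_decay hn hα
  have h2 : ∀ x : Rn n, ‖iteratedFDeriv ℝ k (𝓕 (sym (n := n) α 1)) x‖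
      ≤ 2 ^ (n + 1) * C * (1 + ‖x‖) ^ (-((n : ℝ) + 1)) := by
    intro x
    have hx : 0 < 1 + ‖x‖ := by positivity
    rw [Real.rpow_neg hx.le, ← div_eq_mul_inv, le_div_iff₀ (by positivity),
      show (n : ℝ) + 1 = ((n + 1 : ℕ) : ℝ) by push_cast; ring, Real.rpow_natCast]
    have hA := hC k hk 0 (by omega) x
    have hB := hC k hk (n + 1) le_rfl x
    have hN := norm_nonneg (iteratedFDeriv ℝ k (𝓕 (sym (n := n) α 1)) x)
    rcases le_total ‖x‖ 1 with h | h
    · have : (1 + ‖x‖) ^ (n + 1) ≤ 2 ^ (n + 1) := by gcongr; linarith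
      rw [pow_zero, one_mul] at hA
      calc _ ≤ C * 2 ^ (n + 1) := mul_le_mul hA this (by positivity) hC0
        _ = _ := by ring
    · have : (1 + ‖x‖) ^ (n + 1) ≤ (2 * ‖x‖) ^ (n + 1) := by gcongr; linarith
      calc _ ≤ ‖iteratedFDeriv ℝ k (𝓕 (sym (n := n) α 1)) x‖ * (2 * ‖x‖) ^ (n + 1) := by gcongr
        _ = 2 ^ (n + 1) * (‖x‖ ^ (n + 1) * ‖iteratedFDeriv ℝ k (𝓕 (sym (n := n) α 1)) x‖) := by
            rw [mul_pow]; ring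
        _ ≤ _ := by gcongr
  refine ⟨∑ i, 2 ^ (n + 1) * C * ∏ j, ‖m i j‖,
    Finset.sum_nonneg fun i _ => by positivity, fun x => ?_⟩
  unfold jet
  refine (Finset.abs_sum_le_sum_abs _ _).trans ?_
  rw [Finset.sum_mul]
  refine Finset.sum_le_sum fun i _ => ?_
  have h3 := (iteratedFDeriv ℝ k (kernel (n := n) α 1) x).le_opNorm (m i)
  rw [Real.norm_eq_abs] at h3
  calc _ ≤ _ := h3
    _ ≤ (2 ^ (n + 1) * C * (1 + ‖x‖) ^ (-((n : ℝ) + 1))) * ∏ j, ‖m i j‖ := by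
        gcongr
        exact (norm_iteratedFDeriv_kernel_le hn hα0 one_pos hk x).trans (h2 x)
    _ = _ := by ring

theorem integrable_jet_kernel_one (hn : 1 ≤ n) {α : ℝ} (hα : 1 < 2 * α) {k : ℕ}
    (hk : k ≤ 2) (m : ι → Fin k → Rn n) : Integrable (jet k m (kernel (n := n) α 1)) := by
  obtain ⟨C, hC0, hC⟩ := exists_jet_kernel_le hn hα hk m
  refine Integrable.mono' ((integrable_one_add_norm (μ := (volume : Measure (Rn n)))
    (r := (n : ℝ) + 1) (by simp)).const_mul C)
    (continuous_jet_kernel hn (by linarith) one_pos hk m).aestronglyMeasurable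
    (Eventually.of_forall hC)

theorem lintegral_comp_smul_scale (f : Rn n → ℝ≥0∞) {c : ℝ} (hc : 0 < c) :
    ∫⁻ x, f (c • x) = ENNReal.ofReal (c ^ (-(n : ℝ))) * ∫⁻ x, f x := by
  have h := Measure.map_addHaar_smul (volume : Measure (Rn n)) hc.ne'
  have h2 : ∫⁻ x, f (c • x) = ∫⁻ x, f x ∂(Measure.map (c • ·) volume) :=
    ((Homeomorph.smulOfNeZero c hc.ne').measurableEmbedding.lintegral_map f).symm
  rw [h2, h, lintegral_smul_measure, smul_eq_mul]
  congr 2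
  rw [finrank_euclideanSpace, Fintype.card_fin, abs_of_pos (by positivity), Real.rpow_neg hc.le,
    Real.rpow_natCast]

/-- Scaling reduces both bounds to the L¹ norm and the supremum at time one. Every larger constant
is allowed, so that two kernels can later share one. -/
theorem kerBound_jet (hn : 1 ≤ n) {α : ℝ} (hα : 1 < 2 * α) {k : ℕ}
    (hk : k ≤ 2) (m : ι → Fin k → Rn n) : ∃ C : ℝ, ∀ C', C ≤ C' →
      KerBound (1 / (2 * α)) (k * (1 / (2 * α))) C' (fun s => jet k m (kernel (n := n) α s)) := by
  have hα0 : 0 < α := by linarith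
  obtain ⟨C, hC0, hC⟩ := exists_jet_kernel_le hn hα hk m
  have hint := integrable_jet_kernel_one hn hα hk m
  have hfin : ∫⁻ x, ‖jet k m (kernel (n := n) α 1) x‖ₑ ≠ ∞ := hint.2.ne
  set A := (∫⁻ x, ‖jet k m (kernel (n := n) α 1) x‖ₑ).toReal with hA
  refine ⟨max C A, fun C' hC' => ⟨?_, fun s hs => ?_, fun s hs x => ?_⟩⟩
  · have : Function.uncurry (fun s => jet k m (kernel (n := n) α s)) =
        fun z : ℝ × Rn n => if 0 < z.1 then
          z.1 ^ (-(k * (1 / (2 * α)) + n * (1 / (2 * α)))) *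
          jet k m (kernel α 1) (z.1 ^ (-(1 / (2 * α))) • z.2) else 0 := by
      funext ⟨s, x⟩
      simp only [Function.uncurry]
      split_ifs with h
      · exact jet_kernel_scale hn hα0 h hk m x
      · exact jet_kernel_nonpos hn (not_lt.1 h) m x
    rw [this]
    have hc := (continuous_jet_kernel hn hα0 one_pos hk m).measurable
    refine Measurable.ite (measurableSet_lt measurable_const measurable_fst) ?_ measurable_const
    refine Measurable.mul (measurable_fst.pow_const _) (hc.comp ?_)
    exact Measurable.smul (measurable_fst.pow_const _) measurable_snd
  · simp_rw [jet_kernel_scale hn hα0 hs hk m, enorm_mul]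
    rw [lintegral_const_mul' _ _ (by simp),
      lintegral_comp_smul_scale (fun y => ‖jet k m (kernel α 1) y‖ₑ) (Real.rpow_pos_of_pos hs _),
      ← ENNReal.ofReal_toReal hfin, ← hA,
      Real.enorm_of_nonneg (by positivity), ← ENNReal.ofReal_mul (by positivity),
      ← ENNReal.ofReal_mul (by positivity), ← Real.rpow_mul hs.le, ← mul_assoc, ← Real.rpow_add hs]
    refine ENNReal.ofReal_le_ofReal ?_
    rw [mul_comm]
    have : -(↑k * (1 / (2 * α)) + ↑n * (1 / (2 * α))) + -(1 / (2 * α)) * -(n : ℝ)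
      = -(↑k * (1 / (2 * α))) := by ring
    rw [this]
    gcongr
    exact (le_max_right _ _).trans hC'
  · rw [jet_kernel_scale hn hα0 hs hk m, Real.enorm_eq_ofReal_abs, abs_mul,
      abs_of_nonneg (by positivity), mul_comm]
    refine ENNReal.ofReal_le_ofReal ?_
    gcongr
    refine (hC _).trans ?_
    refine le_trans ?_ ((le_max_left C A).trans hC')
    have : (1 + ‖s ^ (-(1 / (2 * α))) • x‖) ^ (-((n : ℝ) + 1)) ≤ 1 :=
      Real.rpow_le_one_of_one_le_of_nonpos (by simp) (by linarith [(Nat.cast_nonneg n : (0 : ℝ) ≤ n)])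
    nlinarith

theorem jet_zero (g : Rn n → ℝ) :
    jet 0 (fun (_ : Unit) (_ : Fin 0) => (0 : Rn n)) g = g := by
  funext x; simp [jet]

theorem integrable_kernel (hn : 1 ≤ n) {α s : ℝ} (hα : 1 < 2 * α) (hs : 0 < s) :
    Integrable (kernel (n := n) α s) := by
  obtain ⟨C, hC⟩ := kerBound_jet (n := n) hn hα (k := 0) (by norm_num)
    (fun (_ : Unit) (_ : Fin 0) => (0 : Rn n))
  refine ⟨(contDiff_kernel hn (by linarith) hs).continuous.aestronglyMeasurable, ?_⟩
  have := (hC C le_rfl).one s hs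
  simp only [jet_zero] at this
  exact this.trans_lt ENNReal.ofReal_lt_top

/-- Fourier inversion, available because the kernel is integrable and the symbol continuous. Its
value at the origin gives total mass one, and it identifies the transform needed for the semigroup
identity. -/
theorem fourierInv_kernel (hn : 1 ≤ n) {α s : ℝ} (hα : 1 < 2 * α) (hs : 0 < s) :
    𝓕⁻ (fun y : Rn n => ((kernel α s y : ℝ) : ℂ)) = sym α s := by
  have hα0 : 0 < α := by linarith
  have h1 : (fun y : Rn n => ((kernel α s y : ℝ) : ℂ)) = 𝓕 (sym (n := n) α s) := by
    funext y; exact ofReal_kernel α s y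
  rw [h1]
  refine (continuous_sym hα0 s).fourierInv_fourier_eq (integrable_sym hn hα0 hs) ?_
  rw [← h1]
  exact (integrable_kernel hn hα hs).ofReal

theorem integral_kernel (hn : 1 ≤ n) {α s : ℝ} (hα : 1 < 2 * α) (hs : 0 < s) :
    ∫ y : Rn n, kernel α s y = 1 := by
  have h := congrFun (fourierInv_kernel (n := n) hn hα hs) 0
  rw [Real.fourierInv_eq] at h
  simp only [inner_zero_right, AddChar.map_zero_eq_one, one_smul] at h
  have h2 : sym (n := n) α s 0 = 1 := by
    simp [sym, Real.zero_rpow (show 2 * α ≠ 0 by linarith)]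
  rw [integral_complex_ofReal, h2] at h
  exact_mod_cast h

theorem sym_mul_sym (α s t : ℝ) (v : Rn n) : sym α t v * sym α s v = sym α (s + t) v := by
  unfold sym
  rw [← Complex.ofReal_mul, ← Real.exp_add]
  congr 2
  ring

/-- `K_s * (D K_t) = D K_{s+t}`. -/
theorem kernel_conv_jet_kernel (hn : 1 ≤ n) {α s t : ℝ} (hα : 1 < 2 * α) (hs : 0 < s) (ht : 0 < t)
    {k : ℕ} (hk : k ≤ 2) (m : ι → Fin k → Rn n) (x : Rn n) :
    ∫ y, kernel α s (x - y) * jet k m (kernel α t) y = jet k m (kernel α (s + t)) x := by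
  have hα0 : 0 < α := by linarith
  have hg : Integrable (fun y : Rn n => ((kernel α s (x - y) : ℝ) : ℂ)) :=
    ((integrable_kernel hn hα hs).comp_sub_left x).ofReal
  -- The multiplication formula ∫ f̂ g = ∫ f ĝ, with f the symbol of D K_t and g(y) = K_s(x - y). It
  -- needs integrability of f and g only.
  have h := VectorFourier.integral_fourierIntegral_smul_eq_flip (μ := (volume : Measure (Rn n)))
    (ν := (volume : Measure (Rn n))) (L := innerₗ (Rn n)) Real.continuous_fourierChar
    (by simpa using continuous_inner)
    (integrable_jetSymbol_mul hn hα0 ht hk m) hg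
  -- The transform of the reflected and translated kernel is the symbol at time s times a phase;
  -- that phase turns the remaining integral into the Fourier transform at x.
  have e1 : ∀ v : Rn n, VectorFourier.fourierIntegral 𝐞 volume (innerₗ (Rn n)).flip
      (fun y : Rn n => ((kernel α s (x - y) : ℝ) : ℂ)) v = 𝐞 (-inner ℝ v x) • sym α s v := by
    intro v
    rw [← fourierInv_kernel hn hα hs, Real.fourierInv_eq]
    simp only [VectorFourier.fourierIntegral, LinearMap.flip_apply, innerₗ_apply_apply]
    rw [← integral_sub_left_eq_self (fun y : Rn n => 𝐞 (inner ℝ y v) • ((kernel α s y : ℝ) : ℂ))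
      volume x, Circle.smul_def, smul_eq_mul, ← integral_const_mul]
    refine integral_congr_ae (Eventually.of_forall fun y => ?_)
    simp only [← smul_eq_mul, ← Circle.smul_def]
    rw [smul_smul, ← AddChar.map_add_eq_mul]
    congr 2
    rw [inner_sub_left, real_inner_comm v x, real_inner_comm v y]
    ring_nf
  have h1 : (((∫ y, kernel α s (x - y) * jet k m (kernel α t) y) : ℝ) : ℂ)
      = ((jet k m (kernel α (s + t)) x : ℝ) : ℂ) := by
    rw [ofReal_jet_kernel hn hα0 (by positivity) hk, Real.fourier_eq, ← integral_complex_ofReal]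
    refine Eq.trans ?_ (h.trans ?_)
    · refine integral_congr_ae (Eventually.of_forall fun y => ?_)
      simp only [Complex.ofReal_mul, ofReal_jet_kernel hn hα0 ht hk m, smul_eq_mul]
      rw [mul_comm]
      rfl
    · refine integral_congr_ae (Eventually.of_forall fun v => ?_)
      simp only [e1]
      rw [smul_comm, smul_eq_mul, mul_assoc, sym_mul_sym]
  exact_mod_cast h1

end KernelProperties

end FracDissip

namespace FracDissip

/-! ### Inequalities of Jensen, Minkowski and Young for extended nonnegative functions. -/

section NonnegativeAnalysis

theorem eLpNorm_ofReal_eq {X E : Type*} [MeasurableSpace X] {μ : Measure X} [TopologicalSpace E]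
    [ContinuousENorm E] {r : ℝ} (hr : 0 < r) (f : X → E) :
    eLpNorm f (ENNReal.ofReal r) μ = (∫⁻ x, ‖f x‖ₑ ^ r ∂μ) ^ (1 / r) := by
  rw [eLpNorm_eq_lintegral_rpow_enorm_toReal (by simpa using hr) ENNReal.ofReal_ne_top,
    ENNReal.toReal_ofReal hr.le]

theorem eLpNorm_ofReal_le_iff {X E : Type*} [MeasurableSpace X] {μ : Measure X}
    [TopologicalSpace E] [ContinuousENorm E] {r : ℝ} (hr : 0 < r) (f : X → E) (c : ℝ≥0∞) :
    eLpNorm f (ENNReal.ofReal r) μ ≤ c ↔ ∫⁻ x, ‖f x‖ₑ ^ r ∂μ ≤ c ^ r := by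
  rw [eLpNorm_ofReal_eq hr, one_div, ENNReal.rpow_inv_le_iff hr]

/-- Jensen's inequality with a weight. -/
theorem lintegral_mul_rpow_le {X : Type*} [MeasurableSpace X] {μ : Measure X} {w g : X → ℝ≥0∞}
    (hw : AEMeasurable w μ) (hg : AEMeasurable g μ) {m : ℝ} (hm : 1 ≤ m) :
    (∫⁻ x, w x * g x ∂μ) ^ m ≤ (∫⁻ x, w x ∂μ) ^ (m - 1) * ∫⁻ x, w x * g x ^ m ∂μ := by
  have hm0 : 0 < m := by linarith
  -- Write wg = w^{1-1/m} (w g^m)^{1/m} and apply Hölder with exponents summing to one.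
  have h1 : ∀ x, w x * g x = w x ^ (1 - 1 / m) * (w x * g x ^ m) ^ (1 / m) := by
    intro x
    have hle : 0 ≤ 1 - 1 / m := by
      rw [sub_nonneg, div_le_one hm0]; exact hm
    rw [ENNReal.mul_rpow_of_nonneg _ _ (by positivity), ← ENNReal.rpow_mul, mul_one_div_cancel hm0.ne',
      ENNReal.rpow_one, ← mul_assoc, ← ENNReal.rpow_add_of_nonneg _ _ hle (by positivity)]
    simp
  have hle : 0 ≤ 1 - 1 / m := by
    rw [sub_nonneg, div_le_one hm0]; exact hm
  have h2 := ENNReal.lintegral_mul_norm_pow_le (μ := μ) hw (hw.mul (hg.pow_const m)) hle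
    (by positivity) (show 1 - 1 / m + 1 / m = 1 by ring)
  calc (∫⁻ x, w x * g x ∂μ) ^ m
      = (∫⁻ x, w x ^ (1 - 1 / m) * (w x * g x ^ m) ^ (1 / m) ∂μ) ^ m := by simp_rw [← h1]
    _ ≤ ((∫⁻ x, w x ∂μ) ^ (1 - 1 / m) * (∫⁻ x, w x * g x ^ m ∂μ) ^ (1 / m)) ^ m := by
        gcongr
        exact h2
    _ = _ := by
        rw [ENNReal.mul_rpow_of_nonneg _ _ hm0.le, ← ENNReal.rpow_mul, ← ENNReal.rpow_mul,
          one_div_mul_cancel hm0.ne', ENNReal.rpow_one]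
        congr 2
        field_simp

/-- Minkowski's integral inequality, with a majorant of the norms of the slices. -/
theorem lintegral_lintegral_rpow_le {T X : Type*} [MeasurableSpace T] [MeasurableSpace X]
    {μ : Measure T} {ν : Measure X} [SFinite μ] [SFinite ν] {g : T → X → ℝ≥0∞} {w : T → ℝ≥0∞}
    (hg : AEMeasurable (Function.uncurry g) (μ.prod ν)) (hw : Measurable w)
    (hw0 : ∀ᵐ τ ∂μ, w τ ≠ 0 ∧ w τ ≠ ∞) {m : ℝ} (hm : 1 ≤ m)
    (hb : ∀ᵐ τ ∂μ, ∫⁻ x, g τ x ^ m ∂ν ≤ w τ ^ m) :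
    ∫⁻ x, (∫⁻ τ, g τ x ∂μ) ^ m ∂ν ≤ (∫⁻ τ, w τ ∂μ) ^ m := by
  have hm0 : 0 < m := by linarith
  have hgs : AEMeasurable (fun z : X × T => g z.2 z.1) (ν.prod μ) := hg.prod_swap
  have hsl : ∀ᵐ x ∂ν, AEMeasurable (fun τ => g τ x) μ := by
    obtain ⟨g', hg', he⟩ := hgs
    filter_upwards [Measure.ae_ae_of_ae_prod he] with x hx
    exact ⟨fun τ => g' (x, τ), hg'.comp measurable_prodMk_left, hx⟩
  -- Jensen with weight w for the quotient g/w. After Tonelli each time slice costs w^{1-m} w^m = w,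
  -- so no duality is needed; this is why w must be finite and nonzero almost everywhere.
  have h1 : ∀ᵐ x ∂ν, (∫⁻ τ, g τ x ∂μ) ^ m ≤
      (∫⁻ τ, w τ ∂μ) ^ (m - 1) * ∫⁻ τ, w τ * (g τ x / w τ) ^ m ∂μ := by
    filter_upwards [hsl] with x hx
    have e : ∫⁻ τ, g τ x ∂μ = ∫⁻ τ, w τ * (g τ x / w τ) ∂μ := by
      refine lintegral_congr_ae ?_
      filter_upwards [hw0] with τ hτ
      rw [ENNReal.mul_div_cancel hτ.1 hτ.2]
    rw [e]
    exact lintegral_mul_rpow_le hw.aemeasurable (hx.div hw.aemeasurable) hm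
  have hmeas : AEMeasurable (Function.uncurry fun x τ => w τ * (g τ x / w τ) ^ m) (ν.prod μ) :=
    (hw.comp measurable_snd).aemeasurable.mul
      ((hgs.div (hw.comp measurable_snd).aemeasurable).pow_const m)
  calc ∫⁻ x, (∫⁻ τ, g τ x ∂μ) ^ m ∂ν
      ≤ ∫⁻ x, (∫⁻ τ, w τ ∂μ) ^ (m - 1) * ∫⁻ τ, w τ * (g τ x / w τ) ^ m ∂μ ∂ν := lintegral_mono_ae h1
    _ = (∫⁻ τ, w τ ∂μ) ^ (m - 1) * ∫⁻ x, ∫⁻ τ, w τ * (g τ x / w τ) ^ m ∂μ ∂ν :=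
        lintegral_const_mul'' _ hmeas.lintegral_prod_right'
    _ = (∫⁻ τ, w τ ∂μ) ^ (m - 1) * ∫⁻ τ, ∫⁻ x, w τ * (g τ x / w τ) ^ m ∂ν ∂μ := by
        rw [lintegral_lintegral_swap hmeas]
    _ ≤ (∫⁻ τ, w τ ∂μ) ^ (m - 1) * ∫⁻ τ, w τ ∂μ := by
        refine mul_le_mul' le_rfl (lintegral_mono_ae ?_)
        filter_upwards [hw0, hb] with τ hτ hbτ
        have e : ∀ x, w τ * (g τ x / w τ) ^ m = (w τ / w τ ^ m) * g τ x ^ m := by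
          intro x
          rw [ENNReal.div_rpow_of_nonneg _ _ hm0.le, div_eq_mul_inv, div_eq_mul_inv]
          ring
        simp_rw [e]
        have hpt : w τ ^ m ≠ ∞ := ENNReal.rpow_ne_top_of_nonneg hm0.le hτ.2
        have hp0 : w τ ^ m ≠ 0 := by simp [hτ.1, hτ.2]
        rw [lintegral_const_mul' _ _ (ENNReal.div_ne_top hτ.2 hp0)]
        calc _ ≤ w τ / w τ ^ m * w τ ^ m := by gcongr
          _ = w τ := ENNReal.div_mul_cancel hp0 hpt
    _ = (∫⁻ τ, w τ ∂μ) ^ m := by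
        conv_lhs => rw [← ENNReal.rpow_one (∫⁻ τ, w τ ∂μ), ← ENNReal.rpow_mul, one_mul]
        rw [← ENNReal.rpow_add_of_nonneg _ _ (by linarith) zero_le_one]
        simp

/-- Convolution of absolute values. -/
def aconv {n : ℕ} (k : Rn n → ℝ) (g : Rn n → ℝ≥0∞) (x : Rn n) : ℝ≥0∞ := ∫⁻ y, ‖k (x - y)‖ₑ * g y

variable {n : ℕ} {k : Rn n → ℝ} {g : Rn n → ℝ≥0∞}

theorem aemeasurable_aconv_integrand (hk : Measurable k) (hg : AEMeasurable g) :
    AEMeasurable (fun z : Rn n × Rn n => ‖k (z.1 - z.2)‖ₑ * g z.2) (volume.prod volume) :=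
  (hk.comp (measurable_fst.sub measurable_snd)).enorm.aemeasurable.mul
    (hg.comp_quasiMeasurePreserving Measure.quasiMeasurePreserving_snd)

theorem aemeasurable_aconv (hk : Measurable k) (hg : AEMeasurable g) : AEMeasurable (aconv k g) :=
  (aemeasurable_aconv_integrand hk hg).lintegral_prod_right'

theorem lintegral_enorm_sub_left (x : Rn n) : ∫⁻ y, ‖k (x - y)‖ₑ = ∫⁻ y, ‖k y‖ₑ :=
  lintegral_sub_left_eq_self (fun y => ‖k y‖ₑ) x

theorem lintegral_aconv (hk : Measurable k) (hg : AEMeasurable g) :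
    ∫⁻ x, aconv k g x = (∫⁻ x, ‖k x‖ₑ) * ∫⁻ y, g y := by
  unfold aconv
  rw [lintegral_lintegral_swap (aemeasurable_aconv_integrand hk hg)]
  have : ∀ y, ∫⁻ x, ‖k (x - y)‖ₑ * g y = (∫⁻ x, ‖k x‖ₑ) * g y := by
    intro y
    rw [lintegral_mul_const _ (by fun_prop), lintegral_sub_right_eq_self (fun y => ‖k y‖ₑ) y]
  simp_rw [this]
  rw [lintegral_const_mul'' _ hg]

theorem aconv_rpow_le (hk : Measurable k) (hg : AEMeasurable g) {m : ℝ} (hm : 1 ≤ m) (x : Rn n) :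
    aconv k g x ^ m ≤ (∫⁻ y, ‖k y‖ₑ) ^ (m - 1) * aconv k (fun y => g y ^ m) x := by
  have := lintegral_mul_rpow_le (μ := volume) (w := fun y => ‖k (x - y)‖ₑ) (g := g)
    (by fun_prop) hg hm
  rwa [lintegral_enorm_sub_left] at this

/-- Young's inequality `L¹ * Lᵐ ⊆ Lᵐ`. -/
theorem lintegral_aconv_rpow_le (hk : Measurable k) (hg : AEMeasurable g) {m : ℝ} (hm : 1 ≤ m) :
    ∫⁻ x, aconv k g x ^ m ≤ (∫⁻ y, ‖k y‖ₑ) ^ m * ∫⁻ y, g y ^ m := by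
  calc ∫⁻ x, aconv k g x ^ m
      ≤ ∫⁻ x, (∫⁻ y, ‖k y‖ₑ) ^ (m - 1) * aconv k (fun y => g y ^ m) x :=
        lintegral_mono fun x => aconv_rpow_le hk hg hm x
    _ = (∫⁻ y, ‖k y‖ₑ) ^ (m - 1) * ((∫⁻ y, ‖k y‖ₑ) * ∫⁻ y, g y ^ m) := by
        rw [lintegral_const_mul'' _ (aemeasurable_aconv hk (hg.pow_const m)),
          lintegral_aconv hk (hg.pow_const m)]
    _ = _ := by
        rw [← mul_assoc]
        congr 1
        conv_lhs => rw [← ENNReal.rpow_one (∫⁻ y, ‖k y‖ₑ), ← ENNReal.rpow_mul, one_mul]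
        rw [← ENNReal.rpow_add_of_nonneg _ _ (by linarith) zero_le_one]
        simp

theorem eLpNorm_aconv_le (hk : Measurable k) (hg : AEMeasurable g) {m : ℝ} (hm : 1 ≤ m) :
    eLpNorm (aconv k g) (ENNReal.ofReal m) volume
      ≤ (∫⁻ y, ‖k y‖ₑ) * eLpNorm g (ENNReal.ofReal m) volume := by
  have hm0 : 0 < m := by linarith
  rw [eLpNorm_ofReal_le_iff hm0, ENNReal.mul_rpow_of_nonneg _ _ hm0.le, eLpNorm_ofReal_eq hm0,
    ← ENNReal.rpow_mul, one_div_mul_cancel hm0.ne', ENNReal.rpow_one]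
  exact lintegral_aconv_rpow_le hk hg hm

theorem aconv_le_of_ae_le {c : ℝ≥0∞} (hc : c ≠ ∞) (h : ∀ᵐ y, g y ≤ c) (x : Rn n) :
    aconv k g x ≤ (∫⁻ y, ‖k y‖ₑ) * c := by
  unfold aconv
  rw [← lintegral_enorm_sub_left x, ← lintegral_mul_const' _ _ hc]
  refine lintegral_mono_ae ?_
  filter_upwards [h] with y hy
  gcongr

/-- The factor in front bounds the norm of the kernel in the dual exponent by interpolation between
L¹ and L^∞, so the two bounds of `KerBound` are all that is ever needed. -/
theorem aconv_le_of_eLpNorm (hk : Measurable k) (hg : AEMeasurable g) {m : ℝ} (hm : 1 ≤ m)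
    {S : ℝ≥0∞} (hS : ∀ x, ‖k x‖ₑ ≤ S) (x : Rn n) :
    aconv k g x ≤ (∫⁻ y, ‖k y‖ₑ) ^ (1 - 1 / m) * S ^ (1 / m)
      * eLpNorm g (ENNReal.ofReal m) volume := by
  have hm0 : 0 < m := by linarith
  have h1 := aconv_rpow_le hk hg hm x
  have h2 : aconv k (fun y => g y ^ m) x ≤ S * ∫⁻ y, g y ^ m := by
    unfold aconv
    rw [← lintegral_const_mul'' _ (hg.pow_const m)]
    gcongr with y
    exact hS _
  have h3 : aconv k g x ^ m ≤ (∫⁻ y, ‖k y‖ₑ) ^ (m - 1) * (S * ∫⁻ y, g y ^ m) :=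
    h1.trans (by gcongr)
  rw [← ENNReal.rpow_le_rpow_iff (z := m) hm0]
  refine h3.trans_eq ?_
  rw [ENNReal.mul_rpow_of_nonneg _ _ hm0.le, ENNReal.mul_rpow_of_nonneg _ _ hm0.le,
    eLpNorm_ofReal_eq hm0, ← ENNReal.rpow_mul, ← ENNReal.rpow_mul, ← ENNReal.rpow_mul,
    one_div_mul_cancel hm0.ne', ENNReal.rpow_one, ENNReal.rpow_one, mul_assoc]
  have : (1 - 1 / m) * m = m - 1 := by field_simp
  rw [this]
  simp

/-- `∫ₛᵗ (τ-s)^{-θ} dτ`. -/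
theorem lintegral_rpow_left {θ s t : ℝ} (hθ : θ < 1) (hst : s ≤ t) :
    ∫⁻ τ in Ioo s t, ENNReal.ofReal ((τ - s) ^ (-θ))
      = ENNReal.ofReal ((t - s) ^ (1 - θ) / (1 - θ)) := by
  have hint : IntervalIntegrable (fun τ : ℝ => (τ - s) ^ (-θ)) volume s t := by
    have := (intervalIntegral.intervalIntegrable_rpow' (a := 0) (b := t - s)
      (r := -θ) (by linarith)).comp_sub_right s
    simpa using this
  rw [setLIntegral_congr Ioo_ae_eq_Ioc, ← ofReal_integral_eq_lintegral_ofReal,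
    ← intervalIntegral.integral_of_le hst,
    intervalIntegral.integral_comp_sub_right (fun y => y ^ (-θ)) s, sub_self,
    integral_rpow (Or.inl (by linarith))]
  · rw [show -θ + 1 = 1 - θ by ring, Real.zero_rpow (by linarith), sub_zero]
  · exact (intervalIntegrable_iff_integrableOn_Ioc_of_le hst).1 hint
  · refine (ae_restrict_iff' measurableSet_Ioc).2 (Eventually.of_forall fun τ hτ => ?_)
    exact Real.rpow_nonneg (by linarith [hτ.1]) _

theorem lintegral_rpow_right {γ s t : ℝ} (hγ : γ < 1) (hst : s ≤ t) :
    ∫⁻ τ in Ioo s t, ENNReal.ofReal ((t - τ) ^ (-γ))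
      = ENNReal.ofReal ((t - s) ^ (1 - γ) / (1 - γ)) := by
  have h := lintegral_rpow_left hγ hst
  rw [← h, ← lintegral_indicator measurableSet_Ioo, ← lintegral_indicator measurableSet_Ioo,
    ← lintegral_sub_left_eq_self _ (s + t)]
  refine lintegral_congr fun τ => ?_
  have : (s + t - τ ∈ Ioo s t) ↔ τ ∈ Ioo s t := by
    simp only [mem_Ioo]; constructor <;> rintro ⟨h1, h2⟩ <;> constructor <;> linarith
  by_cases h : τ ∈ Ioo s t
  · rw [indicator_of_mem h, indicator_of_mem (this.2 h)]
    congr 2; ring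
  · rw [indicator_of_notMem h, indicator_of_notMem (fun h' => h (this.1 h'))]

/-- The constant in the bound of the Beta integral. -/
def betaC (γ θ : ℝ) : ℝ := 2 ^ γ / (1 - θ) + 2 ^ θ / (1 - γ)

theorem betaC_pos {γ θ : ℝ} (hγ : γ < 1) (hθ : θ < 1) : 0 < betaC γ θ := by
  have : 0 < 1 - γ := by linarith
  have : 0 < 1 - θ := by linarith
  unfold betaC; positivity

/-- At every τ one of t - τ and τ - s is at least half of t - s; replace that factor by its value
there and integrate the other one. -/
theorem lintegral_beta_le {γ θ s t : ℝ} (hγ0 : 0 ≤ γ) (hγ : γ < 1) (hθ0 : 0 ≤ θ) (hθ : θ < 1)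
    (hst : s ≤ t) :
    ∫⁻ τ in Ioo s t, ENNReal.ofReal ((t - τ) ^ (-γ) * (τ - s) ^ (-θ))
      ≤ ENNReal.ofReal (betaC γ θ * (t - s) ^ (1 - γ - θ)) := by
  rcases hst.eq_or_lt with rfl | hst'
  · simp
  have hts : 0 < t - s := by linarith
  have hpt : ∀ τ ∈ Ioo s t, ENNReal.ofReal ((t - τ) ^ (-γ) * (τ - s) ^ (-θ)) ≤
      ENNReal.ofReal (((t - s) / 2) ^ (-γ)) * ENNReal.ofReal ((τ - s) ^ (-θ)) +
      ENNReal.ofReal (((t - s) / 2) ^ (-θ)) * ENNReal.ofReal ((t - τ) ^ (-γ)) := by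
    intro τ hτ
    have h1 : 0 < τ - s := by linarith [hτ.1]
    have h2 : 0 < t - τ := by linarith [hτ.2]
    rw [← ENNReal.ofReal_mul (by positivity), ← ENNReal.ofReal_mul (by positivity),
      ← ENNReal.ofReal_add (by positivity) (by positivity)]
    refine ENNReal.ofReal_le_ofReal ?_
    rcases le_total ((t - s) / 2) (t - τ) with h | h
    · have : (t - τ) ^ (-γ) ≤ ((t - s) / 2) ^ (-γ) :=
        Real.rpow_le_rpow_of_nonpos (by positivity) h (by linarith)
      calc _ ≤ ((t - s) / 2) ^ (-γ) * (τ - s) ^ (-θ) := by gcongr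
        _ ≤ _ := le_add_of_nonneg_right (by positivity)
    · have : (τ - s) ^ (-θ) ≤ ((t - s) / 2) ^ (-θ) :=
        Real.rpow_le_rpow_of_nonpos (by positivity) (by linarith) (by linarith)
      calc _ ≤ (t - τ) ^ (-γ) * ((t - s) / 2) ^ (-θ) := by gcongr
        _ = ((t - s) / 2) ^ (-θ) * (t - τ) ^ (-γ) := mul_comm _ _
        _ ≤ _ := le_add_of_nonneg_left (by positivity)
  calc _ ≤ ∫⁻ τ in Ioo s t,
        (ENNReal.ofReal (((t - s) / 2) ^ (-γ)) * ENNReal.ofReal ((τ - s) ^ (-θ)) +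
        ENNReal.ofReal (((t - s) / 2) ^ (-θ)) * ENNReal.ofReal ((t - τ) ^ (-γ))) :=
        setLIntegral_mono' measurableSet_Ioo hpt
    _ = ENNReal.ofReal (((t - s) / 2) ^ (-γ)) * ENNReal.ofReal ((t - s) ^ (1 - θ) / (1 - θ)) +
        ENNReal.ofReal (((t - s) / 2) ^ (-θ)) * ENNReal.ofReal ((t - s) ^ (1 - γ) / (1 - γ)) := by
        rw [lintegral_add_left (by fun_prop), lintegral_const_mul _ (by fun_prop),
          lintegral_const_mul _ (by fun_prop), lintegral_rpow_left hθ hst,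
          lintegral_rpow_right hγ hst]
    _ = _ := by
        have h1 : 0 < 1 - γ := by linarith
        have h2 : 0 < 1 - θ := by linarith
        rw [← ENNReal.ofReal_mul (by positivity), ← ENNReal.ofReal_mul (by positivity),
          ← ENNReal.ofReal_add (by positivity) (by positivity)]
        congr 1
        rw [Real.div_rpow hts.le zero_le_two, Real.div_rpow hts.le zero_le_two,
          Real.rpow_neg zero_le_two, Real.rpow_neg zero_le_two, div_inv_eq_mul, div_inv_eq_mul]
        have e1 : (t - s) ^ (1 - γ - θ) = (t - s) ^ (-γ) * (t - s) ^ (1 - θ) := by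
          rw [← Real.rpow_add hts]; ring_nf
        have e2 : (t - s) ^ (-θ) * (t - s) ^ (1 - γ) = (t - s) ^ (-γ) * (t - s) ^ (1 - θ) := by
          rw [← Real.rpow_add hts, ← Real.rpow_add hts]; ring_nf
        rw [e1, betaC]
        calc _ = (t - s) ^ (-γ) * (t - s) ^ (1 - θ) * (2 ^ γ / (1 - θ)) +
              ((t - s) ^ (-θ) * (t - s) ^ (1 - γ)) * (2 ^ θ / (1 - γ)) := by ring
          _ = _ := by rw [e2]; ring

end NonnegativeAnalysis

/-! ### Bounds of the Duhamel integral of absolute values. -/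

section Duhamel

variable {n : ℕ}

/-- The Duhamel integral of absolute values over `(s, t)`. -/
def aduh (k : ℝ → Rn n → ℝ) (F : ℝ → Rn n → ℝ≥0∞) (s t : ℝ) (x : Rn n) : ℝ≥0∞ :=
  ∫⁻ τ in Ioo s t, aconv (k (t - τ)) (F τ) x

variable {a γ C : ℝ} {k : ℝ → Rn n → ℝ} {F : ℝ → Rn n → ℝ≥0∞}

theorem KerBound.meas_slice (hk : KerBound a γ C k) (s : ℝ) : Measurable (k s) :=
  hk.meas.comp measurable_prodMk_left

/-- Interpolating s^{-γ} and s^{-(γ+na)} with weights 1 - 1/m and 1/m gives the exponent γ + na/m;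
for γ = 0 and m = r this is σ. -/
theorem KerBound.aconv_le_Lm (hk : KerBound a γ C k) (hC : 0 ≤ C) {g : Rn n → ℝ≥0∞}
    (hg : AEMeasurable g) {m : ℝ} (hm : 1 ≤ m) {s : ℝ} (hs : 0 < s) (x : Rn n) :
    aconv (k s) g x ≤ ENNReal.ofReal (C * s ^ (-(γ + n * a / m)))
      * eLpNorm g (ENNReal.ofReal m) volume := by
  have hm0 : 0 < m := by linarith
  refine (aconv_le_of_eLpNorm (hk.meas_slice s) hg hm (hk.sup s hs) x).trans ?_
  gcongr
  have hle : 0 ≤ 1 - 1 / m := by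
    rw [sub_nonneg, div_le_one hm0]; exact hm
  calc _ ≤ ENNReal.ofReal (C * s ^ (-γ)) ^ (1 - 1 / m) *
        ENNReal.ofReal (C * s ^ (-(γ + n * a))) ^ (1 / m) := by
        gcongr
        exact hk.one s hs
    _ = _ := by
        rw [ENNReal.ofReal_rpow_of_nonneg (by positivity) hle,
          ENNReal.ofReal_rpow_of_nonneg (by positivity) (by positivity),
          ← ENNReal.ofReal_mul (by positivity)]
        congr 1
        rw [Real.mul_rpow hC (by positivity), Real.mul_rpow hC (by positivity),
          ← Real.rpow_mul hs.le, ← Real.rpow_mul hs.le]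
        have h1 : C ^ (1 - 1 / m) * C ^ (1 / m) = C := by
          rw [← Real.rpow_add_of_nonneg hC hle (by positivity)]; simp
        have h2 : s ^ (-γ * (1 - 1 / m)) * s ^ (-(γ + n * a) * (1 / m))
            = s ^ (-(γ + n * a / m)) := by
          rw [← Real.rpow_add hs]; congr 1; field_simp; ring
        calc _ = (C ^ (1 - 1 / m) * C ^ (1 / m)) *
              (s ^ (-γ * (1 - 1 / m)) * s ^ (-(γ + n * a) * (1 / m))) := by ring
          _ = _ := by rw [h1, h2]

theorem KerBound.eLpNorm_aconv_le (hk : KerBound a γ C k) {g : Rn n → ℝ≥0∞}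
    (hg : AEMeasurable g) {m : ℝ} (hm : 1 ≤ m) {s : ℝ} (hs : 0 < s) :
    eLpNorm (aconv (k s) g) (ENNReal.ofReal m) volume ≤ ENNReal.ofReal (C * s ^ (-γ))
      * eLpNorm g (ENNReal.ofReal m) volume :=
  (FracDissip.eLpNorm_aconv_le (hk.meas_slice s) hg hm).trans (by gcongr; exact hk.one s hs)

theorem KerBound.aconv_le_sup (hk : KerBound a γ C k) {g : Rn n → ℝ≥0∞}
    {c : ℝ≥0∞} (hc : c ≠ ∞) (h : ∀ᵐ y, g y ≤ c) {s : ℝ} (hs : 0 < s) (x : Rn n) :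
    aconv (k s) g x ≤ ENNReal.ofReal (C * s ^ (-γ)) * c :=
  (aconv_le_of_ae_le hc h x).trans (by gcongr; exact hk.one s hs)

/-- The space-time slab `(s, t) × ℝⁿ`. -/
def slab (n : ℕ) (s t : ℝ) : Measure (ℝ × Rn n) := (volume.restrict (Ioo s t)).prod volume

theorem slab_eq (s t : ℝ) : slab n s t = volume.restrict (Ioo s t ×ˢ univ) := by
  rw [slab, Measure.volume_eq_prod, ← Measure.prod_restrict, Measure.restrict_univ]

instance (s t : ℝ) : SFinite (slab n s t) := by unfold slab; infer_instance

theorem aemeasurable_aduh_integrand (hk : Measurable (Function.uncurry k)) {s t : ℝ}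
    (hF : AEMeasurable (Function.uncurry F) (slab n s t)) (r : ℝ) :
    AEMeasurable (fun w : (ℝ × Rn n) × Rn n => ‖k (r - w.1.1) (w.1.2 - w.2)‖ₑ * F w.1.1 w.2)
      ((slab n s t).prod volume) := by
  refine AEMeasurable.mul ?_ ?_
  · refine Measurable.aemeasurable (Measurable.enorm ?_)
    exact hk.comp ((measurable_const.sub measurable_fst.fst).prodMk
      (measurable_fst.snd.sub measurable_snd))
  -- The map forgets the middle space variable. It does not preserve measure, but preimages of null
  -- sets are null, which suffices for almost everywhere measurability.
  · have h : Measure.QuasiMeasurePreserving (fun w : (ℝ × Rn n) × Rn n => (w.1.1, w.2))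
        ((slab n s t).prod volume) (slab n s t) := by
      refine ⟨by fun_prop, Measure.AbsolutelyContinuous.mk fun N hN h0 => ?_⟩
      rw [Measure.map_apply (by fun_prop) hN, Measure.measure_prod_null (hN.preimage (by fun_prop))]
      rw [slab, Measure.measure_prod_null hN] at h0
      exact Measure.quasiMeasurePreserving_fst.ae h0
    exact hF.comp_quasiMeasurePreserving h

theorem aemeasurable_aconv_uncurry (hk : Measurable (Function.uncurry k)) {s t : ℝ}
    (hF : AEMeasurable (Function.uncurry F) (slab n s t)) (r : ℝ) :
    AEMeasurable (Function.uncurry fun τ x => aconv (k (r - τ)) (F τ) x) (slab n s t) :=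
  (aemeasurable_aduh_integrand hk hF r).lintegral_prod_right'

theorem aemeasurable_aduh (hk : Measurable (Function.uncurry k)) {s t : ℝ}
    (hF : AEMeasurable (Function.uncurry F) (slab n s t)) : AEMeasurable (aduh k F s t) :=
  (aemeasurable_aconv_uncurry hk hF t).lintegral_prod_left'

theorem ae_aemeasurable_slice {s t : ℝ}
    (hF : AEMeasurable (Function.uncurry F) (slab n s t)) :
    ∀ᵐ τ ∂(volume.restrict (Ioo s t)), AEMeasurable (F τ) := by
  obtain ⟨G, hG, he⟩ := hF
  filter_upwards [Measure.ae_ae_of_ae_prod he] with τ hτ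
  exact ⟨fun y => G (τ, y), hG.comp measurable_prodMk_left, hτ⟩

theorem ae_Ioo_mem (s t : ℝ) : ∀ᵐ τ ∂(volume.restrict (Ioo s t)), τ ∈ Ioo s t :=
  ae_restrict_mem measurableSet_Ioo

/-- The `Lʳ` bound of the Duhamel integral. -/
theorem eLpNorm_aduh_le (hk : KerBound a γ C k) (hC : 0 < C) (hγ0 : 0 ≤ γ) (hγ : γ < 1)
    {θ : ℝ} (hθ0 : 0 ≤ θ) (hθ : θ < 1) {r : ℝ} (hr : 1 ≤ r) {s t : ℝ} (hst : s ≤ t)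
    (hF : AEMeasurable (Function.uncurry F) (slab n s t)) {B : ℝ} (hB : 0 < B)
    (hb : ∀ᵐ τ ∂(volume.restrict (Ioo s t)),
      eLpNorm (F τ) (ENNReal.ofReal r) volume ≤ ENNReal.ofReal (B * (τ - s) ^ (-θ))) :
    eLpNorm (aduh k F s t) (ENNReal.ofReal r) volume
      ≤ ENNReal.ofReal (C * betaC γ θ * B * (t - s) ^ (1 - γ - θ)) := by
  have hr0 : 0 < r := by linarith
  set w : ℝ → ℝ≥0∞ := fun τ => ENNReal.ofReal (C * B * ((t - τ) ^ (-γ) * (τ - s) ^ (-θ))) with hw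
  have hwm : Measurable w := by fun_prop
  have hint : ∫⁻ τ in Ioo s t, w τ ≤ ENNReal.ofReal (C * betaC γ θ * B * (t - s) ^ (1 - γ - θ)) := by
    simp only [hw]
    simp_rw [ENNReal.ofReal_mul (mul_pos hC hB).le (q := _)]
    rw [lintegral_const_mul _ (by fun_prop)]
    calc _ ≤ ENNReal.ofReal (C * B) * ENNReal.ofReal (betaC γ θ * (t - s) ^ (1 - γ - θ)) := by
          gcongr
          exact lintegral_beta_le hγ0 hγ hθ0 hθ hst
      _ = _ := by
          rw [← ENNReal.ofReal_mul (by positivity)]; congr 1; ring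
  rw [eLpNorm_ofReal_le_iff hr0]
  simp only [enorm_eq_self]
  refine (lintegral_lintegral_rpow_le (aemeasurable_aconv_uncurry hk.meas hF t) hwm ?_ hr ?_).trans
    (by gcongr)
  · filter_upwards [ae_Ioo_mem s t] with τ hτ
    have h1 : 0 < τ - s := by linarith [hτ.1]
    have h2 : 0 < t - τ := by linarith [hτ.2]
    refine ⟨?_, ENNReal.ofReal_ne_top⟩
    simp only [hw, ne_eq, ENNReal.ofReal_eq_zero, not_le]
    positivity
  · filter_upwards [ae_Ioo_mem s t, ae_aemeasurable_slice hF, hb] with τ hτ hm hbτ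
    have h1 : 0 < τ - s := by linarith [hτ.1]
    have h2 : 0 < t - τ := by linarith [hτ.2]
    have h3 := hk.eLpNorm_aconv_le hm hr h2
    have h4 : eLpNorm (aconv (k (t - τ)) (F τ)) (ENNReal.ofReal r) volume ≤ w τ := by
      refine h3.trans ?_
      calc _ ≤ ENNReal.ofReal (C * (t - τ) ^ (-γ)) * ENNReal.ofReal (B * (τ - s) ^ (-θ)) := by gcongr
        _ = _ := by
          rw [← ENNReal.ofReal_mul (by positivity)]; congr 1; ring
    rw [eLpNorm_ofReal_le_iff hr0] at h4
    simpa only [enorm_eq_self] using h4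

/-- The pointwise bound of the Duhamel integral. -/
theorem aduh_le (hk : KerBound a γ C k) (hC : 0 < C) (ha : 0 ≤ a) (hγ0 : 0 ≤ γ) (hγ : γ < 1)
    {θ : ℝ} (hθ0 : 0 ≤ θ) (hθ : θ < 1) {r : ℝ} (hr : 1 ≤ r) {s t : ℝ} (hst : s < t)
    (hF : AEMeasurable (Function.uncurry F) (slab n s t)) {B : ℝ} (hB : 0 < B)
    (hb : ∀ᵐ τ ∂(volume.restrict (Ioo s t)),
      eLpNorm (F τ) (ENNReal.ofReal r) volume ≤ ENNReal.ofReal (B * (τ - s) ^ (-θ)))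
    (hb' : ∀ᵐ τ ∂(volume.restrict (Ioo s t)),
      ∀ᵐ y, F τ y ≤ ENNReal.ofReal (B * (τ - s) ^ (-(θ + n * a / r)))) (x : Rn n) :
    aduh k F s t x
      ≤ ENNReal.ofReal (C * betaC γ θ * 2 ^ (n * a / r) * B * (t - s) ^ (1 - γ - θ - n * a / r)) := by
  set σ := n * a / r with hσ
  have hσ0 : 0 ≤ σ := by positivity
  have hts : 0 < t - s := by linarith
  have hpt : ∀ᵐ τ ∂(volume.restrict (Ioo s t)), aconv (k (t - τ)) (F τ) x ≤
      ENNReal.ofReal (C * B * ((t - s) / 2) ^ (-σ)) *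
        ENNReal.ofReal ((t - τ) ^ (-γ) * (τ - s) ^ (-θ)) := by
    filter_upwards [ae_Ioo_mem s t, ae_aemeasurable_slice hF, hb, hb'] with τ hτ hm hbτ hbτ'
    have h1 : 0 < τ - s := by linarith [hτ.1]
    have h2 : 0 < t - τ := by linarith [hτ.2]
    rw [← ENNReal.ofReal_mul (by positivity)]
    -- Far from t the kernel smooths from Lʳ to L^∞; close to t the pointwise bound of F is used
    -- instead. Either way the extra factor of exponent σ is frozen at (t-s)/2, so σ itself may
    -- exceed 1.
    rcases le_total ((t - s) / 2) (t - τ) with h | h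
    · refine (hk.aconv_le_Lm hC.le hm hr h2 x).trans ?_
      calc _ ≤ ENNReal.ofReal (C * (t - τ) ^ (-(γ + σ))) * ENNReal.ofReal (B * (τ - s) ^ (-θ)) := by
            gcongr
        _ ≤ _ := by
          rw [← ENNReal.ofReal_mul (by positivity)]
          refine ENNReal.ofReal_le_ofReal ?_
          have e : (t - τ) ^ (-(γ + σ)) = (t - τ) ^ (-γ) * (t - τ) ^ (-σ) := by
            rw [← Real.rpow_add h2]; ring_nf
          have : (t - τ) ^ (-σ) ≤ ((t - s) / 2) ^ (-σ) :=
            Real.rpow_le_rpow_of_nonpos (by positivity) h (by linarith)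
          rw [e]
          calc _ = C * B * (t - τ) ^ (-σ) * ((t - τ) ^ (-γ) * (τ - s) ^ (-θ)) := by ring
            _ ≤ _ := by gcongr
    · refine (hk.aconv_le_sup ENNReal.ofReal_ne_top hbτ' h2 x).trans ?_
      rw [← ENNReal.ofReal_mul (by positivity)]
      refine ENNReal.ofReal_le_ofReal ?_
      have e : (τ - s) ^ (-(θ + σ)) = (τ - s) ^ (-θ) * (τ - s) ^ (-σ) := by
        rw [← Real.rpow_add h1]; ring_nf
      have : (τ - s) ^ (-σ) ≤ ((t - s) / 2) ^ (-σ) :=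
        Real.rpow_le_rpow_of_nonpos (by positivity) (by linarith) (by linarith)
      rw [e]
      calc _ = C * B * (τ - s) ^ (-σ) * ((t - τ) ^ (-γ) * (τ - s) ^ (-θ)) := by ring
        _ ≤ _ := by gcongr
  refine (lintegral_mono_ae hpt).trans ?_
  rw [lintegral_const_mul _ (by fun_prop)]
  calc _ ≤ ENNReal.ofReal (C * B * ((t - s) / 2) ^ (-σ)) *
        ENNReal.ofReal (betaC γ θ * (t - s) ^ (1 - γ - θ)) := by
        gcongr
        exact lintegral_beta_le hγ0 hγ hθ0 hθ hst.le
    _ = _ := by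
        rw [← ENNReal.ofReal_mul (by positivity)]
        congr 1
        rw [Real.div_rpow hts.le zero_le_two, Real.rpow_neg zero_le_two, div_inv_eq_mul,
          Real.rpow_sub hts (1 - γ - θ) σ, Real.rpow_neg hts.le]
        ring

end Duhamel

end FracDissip

namespace FracDissip

/-! ### The Duhamel integral itself: absolute convergence, Fubini, measurability. -/

section DuhamelIntegral

variable {n : ℕ} {𝕜 : Type*} [RCLike 𝕜]

/-- The Duhamel integral over `(s, t)`. -/
def duh (k : ℝ → Rn n → ℝ) (F : ℝ → Rn n → 𝕜) (s t : ℝ) (x : Rn n) : 𝕜 :=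
  ∫ τ in Ioo s t, conv (k (t - τ)) (F τ) x

theorem enorm_conv_le (k : Rn n → ℝ) (g : Rn n → 𝕜) (x : Rn n) :
    ‖conv k g x‖ₑ ≤ aconv k (fun y => ‖g y‖ₑ) x := by
  refine (enorm_integral_le_lintegral_enorm _).trans_eq ?_
  simp only [enorm_smul, aconv]

theorem enorm_duh_le (k : ℝ → Rn n → ℝ) (F : ℝ → Rn n → 𝕜) (s t : ℝ) (x : Rn n) :
    ‖duh k F s t x‖ₑ ≤ aduh k (fun τ y => ‖F τ y‖ₑ) s t x :=
  (enorm_integral_le_lintegral_enorm _).trans (lintegral_mono fun _ => enorm_conv_le _ _ _)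

variable {k : ℝ → Rn n → ℝ} {F G : ℝ → Rn n → 𝕜} {s t : ℝ}

theorem aestronglyMeasurable_duh_integrand (hk : Measurable (Function.uncurry k))
    (hF : AEStronglyMeasurable (Function.uncurry F) (slab n s t)) (r : ℝ) (x : Rn n) :
    AEStronglyMeasurable (fun z : ℝ × Rn n => k (r - z.1) (x - z.2) • F z.1 z.2) (slab n s t) := by
  refine AEStronglyMeasurable.smul ?_ hF
  exact (hk.comp ((measurable_const.sub measurable_fst).prodMk
    (measurable_const.sub measurable_snd))).aestronglyMeasurable

theorem lintegral_duh_integrand (hk : Measurable (Function.uncurry k))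
    (hF : AEStronglyMeasurable (Function.uncurry F) (slab n s t)) (r : ℝ) (x : Rn n) :
    ∫⁻ z, ‖k (r - z.1) (x - z.2) • F z.1 z.2‖ₑ ∂(slab n s t)
      = ∫⁻ τ in Ioo s t, aconv (k (r - τ)) (fun y => ‖F τ y‖ₑ) x := by
  rw [slab, lintegral_prod _ (aestronglyMeasurable_duh_integrand hk hF r x).enorm]
  simp only [enorm_smul, aconv]

theorem integrable_duh_integrand (hk : Measurable (Function.uncurry k))
    (hF : AEStronglyMeasurable (Function.uncurry F) (slab n s t)) {x : Rn n}
    (h : aduh k (fun τ y => ‖F τ y‖ₑ) s t x ≠ ∞) :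
    Integrable (fun z : ℝ × Rn n => k (t - z.1) (x - z.2) • F z.1 z.2) (slab n s t) := by
  refine ⟨aestronglyMeasurable_duh_integrand hk hF t x, ?_⟩
  rw [HasFiniteIntegral, lintegral_duh_integrand hk hF]
  exact h.lt_top

/-- The dictionary between absolute convergence over the slab, as mild solutions require it, and
finiteness of the nonnegative Duhamel integral, in which all estimates are phrased. -/
theorem aduh_ne_top_iff (hk : Measurable (Function.uncurry k))
    (hF : AEStronglyMeasurable (Function.uncurry F) (slab n s t)) {x : Rn n} :
    aduh k (fun τ y => ‖F τ y‖ₑ) s t x ≠ ∞ ↔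
    Integrable (fun z : ℝ × Rn n => k (t - z.1) (x - z.2) • F z.1 z.2) (slab n s t) := by
  refine ⟨integrable_duh_integrand hk hF, fun h => ?_⟩
  have := h.2
  rw [HasFiniteIntegral, lintegral_duh_integrand hk hF] at this
  exact this.ne

theorem duh_eq_integral (hk : Measurable (Function.uncurry k))
    (hF : AEStronglyMeasurable (Function.uncurry F) (slab n s t)) {x : Rn n}
    (h : aduh k (fun τ y => ‖F τ y‖ₑ) s t x ≠ ∞) :
    duh k F s t x = ∫ z, k (t - z.1) (x - z.2) • F z.1 z.2 ∂(slab n s t) := by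
  rw [slab, integral_prod _ (integrable_duh_integrand hk hF h)]
  rfl

theorem enorm_duh_sub_le (hk : Measurable (Function.uncurry k))
    (hF : AEStronglyMeasurable (Function.uncurry F) (slab n s t))
    (hG : AEStronglyMeasurable (Function.uncurry G) (slab n s t)) {x : Rn n}
    (h : aduh k (fun τ y => ‖F τ y‖ₑ) s t x ≠ ∞) (h' : aduh k (fun τ y => ‖G τ y‖ₑ) s t x ≠ ∞) :
    ‖duh k F s t x - duh k G s t x‖ₑ ≤ aduh k (fun τ y => ‖F τ y - G τ y‖ₑ) s t x := by
  rw [duh_eq_integral hk hF h, duh_eq_integral hk hG h',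
    ← integral_sub (integrable_duh_integrand hk hF h) (integrable_duh_integrand hk hG h')]
  refine (enorm_integral_le_lintegral_enorm _).trans_eq ?_
  simp only [← smul_sub]
  exact lintegral_duh_integrand (F := fun τ y => F τ y - G τ y) hk (hF.sub hG) t x

theorem aduh_mono {H H' : ℝ → Rn n → ℝ≥0∞}
    (h : ∀ᵐ τ ∂(volume.restrict (Ioo s t)), ∀ᵐ y, H τ y ≤ H' τ y) (x : Rn n) :
    aduh k H s t x ≤ aduh k H' s t x := by
  refine lintegral_mono_ae ?_
  filter_upwards [h] with τ hτ
  refine lintegral_mono_ae ?_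
  filter_upwards [hτ] with y hy
  gcongr

theorem aduh_congr {H H' : ℝ → Rn n → ℝ≥0∞}
    (h : ∀ᵐ τ ∂(volume.restrict (Ioo s t)), ∀ᵐ y, H τ y = H' τ y) (x : Rn n) :
    aduh k H s t x = aduh k H' s t x :=
  le_antisymm (aduh_mono (h.mono fun _ h => h.mono fun _ h => h.le) x)
    (aduh_mono (h.mono fun _ h => h.mono fun _ h => h.ge) x)

theorem conv_congr {k : Rn n → ℝ} {g g' : Rn n → 𝕜} (h : g =ᵐ[volume] g') (x : Rn n) :
    conv k g x = conv k g' x := by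
  refine integral_congr_ae ?_
  filter_upwards [h] with y hy
  rw [hy]

theorem duh_congr (h : ∀ᵐ τ ∂(volume.restrict (Ioo s t)), F τ =ᵐ[volume] G τ) (x : Rn n) :
    duh k F s t x = duh k G s t x := by
  refine integral_congr_ae ?_
  filter_upwards [h] with τ hτ
  exact conv_congr hτ x

theorem slab_mono {s' t' : ℝ} (h : Ioo s' t' ⊆ Ioo s t) : slab n s' t' ≤ slab n s t :=
  Measure.prod_mono (Measure.restrict_mono h le_rfl) le_rfl

theorem duh_split (hk : Measurable (Function.uncurry k)) {s' : ℝ} (hs : s ≤ s') (hs' : s' ≤ t)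
    (hF : AEStronglyMeasurable (Function.uncurry F) (slab n s t)) {x : Rn n}
    (h : aduh k (fun τ y => ‖F τ y‖ₑ) s t x ≠ ∞) :
    duh k F s t x = (∫ τ in Ioo s s', conv (k (t - τ)) (F τ) x) + duh k F s' t x := by
  have hi : IntegrableOn (fun τ => conv (k (t - τ)) (F τ) x) (Ioo s t) :=
    (integrable_duh_integrand hk hF h).integral_prod_left
  rw [← integrableOn_Ioc_iff_integrableOn_Ioo] at hi
  simp only [duh, ← integral_Ioc_eq_integral_Ioo]
  rw [← setIntegral_union (Set.Ioc_disjoint_Ioc_of_le le_rfl) measurableSet_Ioc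
    (hi.mono_set (Ioc_subset_Ioc_right hs')) (hi.mono_set (Ioc_subset_Ioc_left hs)),
    Ioc_union_Ioc_eq_Ioc hs hs']

theorem lintegral_aconv_comm {K : Rn n → ℝ} (hK : Measurable K)
    (hk : Measurable (Function.uncurry k)) {H : ℝ → Rn n → ℝ≥0∞}
    (hH : AEMeasurable (Function.uncurry H) (slab n s t)) (x : Rn n) :
    aconv K (aduh k H s t) x = ∫⁻ τ in Ioo s t, aconv K (aconv (k (t - τ)) (H τ)) x := by
  have hm : AEMeasurable (fun z : Rn n × ℝ => ‖K (x - z.1)‖ₑ * aconv (k (t - z.2)) (H z.2) z.1)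
      (volume.prod (volume.restrict (Ioo s t))) :=
    (hK.comp (measurable_const.sub measurable_fst)).enorm.aemeasurable.mul
      (aemeasurable_aconv_uncurry hk hH t).prod_swap
  simp only [aconv, aduh]
  rw [← lintegral_lintegral_swap (μ := volume) (ν := volume.restrict (Ioo s t)) hm]
  refine lintegral_congr fun y => ?_
  rw [lintegral_const_mul' _ _ (by simp)]

/-- Fubini's theorem for the composition of a convolution with a Duhamel integral. -/
theorem conv_duh {K : Rn n → ℝ} (hK : Measurable K) (hk : Measurable (Function.uncurry k))
    {h : ℝ} (hsemi : ∀ τ ∈ Ioo s t, ∀ x, ∫ y, K (x - y) * k (t - τ) y = k (h + t - τ) x)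
    (hF : AEStronglyMeasurable (Function.uncurry F) (slab n s t)) {x : Rn n}
    (h1 : ∀ᵐ y, aduh k (fun τ y => ‖F τ y‖ₑ) s t y ≠ ∞)
    (h2 : aconv K (aduh k (fun τ y => ‖F τ y‖ₑ) s t) x ≠ ∞) :
    conv K (duh k F s t) x = ∫ τ in Ioo s t, conv (k (h + t - τ)) (F τ) x := by
  set Φ : Rn n × (ℝ × Rn n) → 𝕜 :=
    fun w => K (x - w.1) • (k (t - w.2.1) (w.1 - w.2.2) • F w.2.1 w.2.2) with hΦ
  have hm : AEStronglyMeasurable Φ (volume.prod (slab n s t)) := by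
    refine AEStronglyMeasurable.smul (hK.comp (measurable_const.sub
      measurable_fst)).aestronglyMeasurable (AEStronglyMeasurable.smul ?_ ?_)
    · exact (hk.comp ((measurable_const.sub measurable_snd.fst).prodMk
        (measurable_fst.sub measurable_snd.snd))).aestronglyMeasurable
    · exact hF.comp_quasiMeasurePreserving Measure.quasiMeasurePreserving_snd
  have hint : Integrable Φ (volume.prod (slab n s t)) := by
    refine ⟨hm, ?_⟩
    rw [HasFiniteIntegral, lintegral_prod _ hm.enorm]
    refine lt_of_eq_of_lt ?_ h2.lt_top
    refine lintegral_congr fun y => ?_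
    simp only [hΦ, enorm_smul]
    rw [lintegral_const_mul' _ _ (by simp)]
    congr 1
    rw [aduh, ← lintegral_duh_integrand hk hF]
    simp only [enorm_smul]
  have e1 : conv K (duh k F s t) x = ∫ y, ∫ z, Φ (y, z) ∂(slab n s t) := by
    refine integral_congr_ae ?_
    filter_upwards [h1] with y hy
    simp only [hΦ]
    rw [integral_smul, duh_eq_integral hk hF hy]
  -- Integrating the intermediate point first, the two kernels merge by the semigroup identity,
  -- after a translation by z.2.
  have e2 : ∀ᵐ z ∂(slab n s t), ∫ y, Φ (y, z) = k (h + t - z.1) (x - z.2) • F z.1 z.2 := by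
    rw [slab_eq]
    filter_upwards [ae_restrict_mem (measurableSet_Ioo.prod MeasurableSet.univ)] with z hz
    simp only [hΦ, smul_smul]
    rw [integral_smul_const, ← hsemi z.1 hz.1 (x - z.2),
      ← integral_add_right_eq_self (fun y => K (x - y) * k (t - z.1) (y - z.2)) z.2]
    congr 1
    refine integral_congr_ae (Eventually.of_forall fun y => ?_)
    simp only [add_sub_cancel_right]
    congr 2
    abel
  have hint2 : Integrable (fun z : ℝ × Rn n => k (h + t - z.1) (x - z.2) • F z.1 z.2)
      (slab n s t) := hint.integral_prod_right.congr e2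
  rw [e1, integral_integral_swap (f := fun y z => Φ (y, z)) hint, integral_congr_ae e2]
  rw [slab] at hint2 ⊢
  rw [integral_prod _ hint2]
  rfl

theorem conv_conv {K k k' : Rn n → ℝ} (hK : Measurable K) (hk : Measurable k)
    (hsemi : ∀ x, ∫ y, K (x - y) * k y = k' x) {g : Rn n → 𝕜} (hg : AEStronglyMeasurable g)
    {x : Rn n} (h2 : aconv K (aconv k (fun y => ‖g y‖ₑ)) x ≠ ∞) :
    conv K (conv k g) x = conv k' g x := by
  set Φ : Rn n × Rn n → 𝕜 := fun w => K (x - w.1) • (k (w.1 - w.2) • g w.2) with hΦ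
  have hm : AEStronglyMeasurable Φ (volume.prod volume) := by
    refine AEStronglyMeasurable.smul (hK.comp (measurable_const.sub
      measurable_fst)).aestronglyMeasurable (AEStronglyMeasurable.smul ?_ ?_)
    · exact (hk.comp (measurable_fst.sub measurable_snd)).aestronglyMeasurable
    · exact hg.comp_quasiMeasurePreserving Measure.quasiMeasurePreserving_snd
  have hint : Integrable Φ (volume.prod volume) := by
    refine ⟨hm, ?_⟩
    rw [HasFiniteIntegral, lintegral_prod _ hm.enorm]
    refine lt_of_eq_of_lt ?_ h2.lt_top
    refine lintegral_congr fun y => ?_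
    simp only [hΦ, enorm_smul]
    rw [lintegral_const_mul' _ _ (by simp)]
    rfl
  have e1 : conv K (conv k g) x = ∫ y, ∫ z, Φ (y, z) := by
    refine integral_congr_ae (Eventually.of_forall fun y => ?_)
    simp only [hΦ]
    rw [integral_smul]
    rfl
  rw [e1, integral_integral_swap (f := fun y z => Φ (y, z)) hint]
  refine integral_congr_ae (Eventually.of_forall fun z => ?_)
  simp only [hΦ, smul_smul]
  rw [integral_smul_const, ← hsemi (x - z),
    ← integral_add_right_eq_self (fun y => K (x - y) * k (y - z)) z]
  congr 1
  refine integral_congr_ae (Eventually.of_forall fun y => ?_)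
  simp only [add_sub_cancel_right]
  congr 2
  abel

theorem integrable_conv_integrand {k : Rn n → ℝ} (hk : Measurable k) {g : Rn n → 𝕜}
    (hg : AEStronglyMeasurable g) {x : Rn n} (h : aconv k (fun y => ‖g y‖ₑ) x ≠ ∞) :
    Integrable (fun y => k (x - y) • g y) := by
  refine ⟨AEStronglyMeasurable.smul (hk.comp (measurable_const.sub
    measurable_id)).aestronglyMeasurable hg, ?_⟩
  rw [HasFiniteIntegral]
  simp only [enorm_smul]
  exact h.lt_top

theorem aconv_mono {k : Rn n → ℝ} {g g' : Rn n → ℝ≥0∞} (h : ∀ᵐ y, g y ≤ g' y) (x : Rn n) :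
    aconv k g x ≤ aconv k g' x := by
  refine lintegral_mono_ae ?_
  filter_upwards [h] with y hy
  gcongr

theorem aconv_add {k : Rn n → ℝ} (hk : Measurable k) {g g' : Rn n → ℝ≥0∞}
    (hg : AEMeasurable g) (x : Rn n) :
    aconv k (fun y => g y + g' y) x = aconv k g x + aconv k g' x := by
  simp only [aconv, mul_add]
  exact lintegral_add_left' ((hk.comp (measurable_const.sub
    measurable_id)).enorm.aemeasurable.mul hg) _

theorem conv_add {k : Rn n → ℝ} (hk : Measurable k) {g g' : Rn n → 𝕜}
    (hg : AEStronglyMeasurable g) (hg' : AEStronglyMeasurable g') {x : Rn n}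
    (h : aconv k (fun y => ‖g y‖ₑ) x ≠ ∞) (h' : aconv k (fun y => ‖g' y‖ₑ) x ≠ ∞) :
    conv k (fun y => g y + g' y) x = conv k g x + conv k g' x := by
  simp only [conv, smul_add]
  exact integral_add (integrable_conv_integrand hk hg h) (integrable_conv_integrand hk hg' h')

theorem conv_sub {k : Rn n → ℝ} (hk : Measurable k) {g g' : Rn n → 𝕜}
    (hg : AEStronglyMeasurable g) (hg' : AEStronglyMeasurable g') {x : Rn n}
    (h : aconv k (fun y => ‖g y‖ₑ) x ≠ ∞) (h' : aconv k (fun y => ‖g' y‖ₑ) x ≠ ∞) :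
    conv k (fun y => g y - g' y) x = conv k g x - conv k g' x := by
  simp only [conv, smul_sub]
  exact integral_sub (integrable_conv_integrand hk hg h) (integrable_conv_integrand hk hg' h')

theorem aestronglyMeasurable_conv {k : Rn n → ℝ} (hk : Measurable k) {g : Rn n → 𝕜}
    (hg : AEStronglyMeasurable g) : AEStronglyMeasurable (conv k g) := by
  have hm : AEStronglyMeasurable (fun z : Rn n × Rn n => k (z.1 - z.2) • g z.2)
      (volume.prod volume) :=
    AEStronglyMeasurable.smul (hk.comp (measurable_fst.sub measurable_snd)).aestronglyMeasurable
      (hg.comp_quasiMeasurePreserving Measure.quasiMeasurePreserving_snd)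
  exact hm.integral_prod_right'

theorem aestronglyMeasurable_duh (hk : Measurable (Function.uncurry k))
    (hF : AEStronglyMeasurable (Function.uncurry F) (slab n s t)) :
    AEStronglyMeasurable (duh k F s t) := by
  obtain ⟨F', hF', he⟩ := hF
  have hF'' : StronglyMeasurable (Function.uncurry fun τ y => F' (τ, y)) := hF'
  have h1 : ∀ᵐ τ ∂(volume.restrict (Ioo s t)), F τ =ᵐ[volume] fun y => F' (τ, y) :=
    Measure.ae_ae_of_ae_prod he
  have e : duh k F s t = duh k (fun τ y => F' (τ, y)) s t := funext fun x => duh_congr h1 x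
  rw [e]
  have hm : StronglyMeasurable (fun w : (Rn n × ℝ) × Rn n =>
      k (t - w.1.2) (w.1.1 - w.2) • F' (w.1.2, w.2)) := by
    refine StronglyMeasurable.smul (Measurable.stronglyMeasurable ?_) ?_
    · exact hk.comp ((measurable_const.sub measurable_fst.snd).prodMk
        (measurable_fst.fst.sub measurable_snd))
    · exact hF'.comp_measurable (by fun_prop)
  exact (hm.integral_prod_right'.integral_prod_right' (ν := volume.restrict (Ioo s t))
    ).aestronglyMeasurable

theorem stronglyMeasurable_duh_uncurry (hk : Measurable (Function.uncurry k))
    (hF : StronglyMeasurable (Function.uncurry F)) (s : ℝ) :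
    StronglyMeasurable (Function.uncurry fun t x => duh k F s t x) := by
  have hm : StronglyMeasurable (fun w : ((ℝ × Rn n) × ℝ) × Rn n =>
      k (w.1.1.1 - w.1.2) (w.1.1.2 - w.2) • F w.1.2 w.2) := by
    refine StronglyMeasurable.smul (Measurable.stronglyMeasurable ?_) ?_
    · exact hk.comp ((measurable_fst.fst.fst.sub measurable_fst.snd).prodMk
        (measurable_fst.fst.snd.sub measurable_snd))
    · exact hF.comp_measurable (g := fun w : ((ℝ × Rn n) × ℝ) × Rn n => (w.1.2, w.2))
        (by fun_prop)
  -- The domain of integration moves with t. Written as an indicator in (t, x, τ), it allows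
  -- measurability of integrals depending on parameters to apply.
  have hS : MeasurableSet {w : (ℝ × Rn n) × ℝ | w.2 ∈ Ioo s w.1.1} :=
    (measurableSet_lt measurable_const measurable_snd).inter
      (measurableSet_lt measurable_snd measurable_fst.fst)
  have h1 := (hm.integral_prod_right' (ν := volume)).indicator hS
  have h2 := h1.integral_prod_right' (ν := volume)
  have e : (Function.uncurry fun t x => duh k F s t x) = fun z : ℝ × Rn n => ∫ τ,
      {w : (ℝ × Rn n) × ℝ | w.2 ∈ Ioo s w.1.1}.indicator
        (fun w => ∫ y, k (w.1.1 - w.2) (w.1.2 - y) • F w.2 y) (z, τ) := by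
    funext ⟨t, x⟩
    simp only [Function.uncurry, duh]
    rw [← integral_indicator measurableSet_Ioo]
    rfl
  rw [e]
  exact h2

end DuhamelIntegral
end FracDissip

namespace FracDissip

/-! ### Local Lipschitz bounds for the power nonlinearity. -/

section Power

variable {𝕜 : Type*} [RCLike 𝕜]

theorem norm_power (ε : ℤˣ) {b : ℝ} (hb : 0 < b) (z : 𝕜) : ‖power ε b z‖ = ‖z‖ ^ (b + 1) := by
  have h : |((ε : ℤ) : ℝ)| = 1 := by
    rcases Int.units_eq_one_or ε with rfl | rfl <;> simp
  rw [power, norm_smul, norm_mul, Real.norm_eq_abs, h, one_mul, Real.norm_of_nonneg (by positivity)]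
  rw [Real.rpow_add_of_nonneg (norm_nonneg z) hb.le zero_le_one, Real.rpow_one]

theorem enorm_power (ε : ℤˣ) {b : ℝ} (hb : 0 < b) (z : 𝕜) :
    ‖power ε b z‖ₑ = ‖z‖ₑ ^ (b + 1) := by
  rw [← ofReal_norm, norm_power ε hb, ← ofReal_norm,
    ENNReal.ofReal_rpow_of_nonneg (norm_nonneg z) (by linarith)]

/-- Young's inequality for x^b · y with exponents (b+1)/b and b+1. It replaces the mean value
theorem and works for every b > 0, including b < 1. -/
theorem mul_rpow_sub_rpow_le {b x y : ℝ} (hb : 0 < b) (hx : 0 ≤ x) (hy : 0 ≤ y) :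
    y * (x ^ b - y ^ b) ≤ b * x ^ b * (x - y) := by
  have hb1 : 0 < b + 1 := by linarith
  have hc : ((b + 1) / b).HolderConjugate (b + 1) := by
    rw [Real.holderConjugate_iff]
    constructor
    · rw [lt_div_iff₀ hb]; linarith
    · field_simp
  have h := Real.young_inequality_of_nonneg (Real.rpow_nonneg hx b) hy hc
  rw [← Real.rpow_mul hx, mul_div_cancel₀ _ hb.ne', Real.rpow_add_of_nonneg hx hb.le zero_le_one,
    Real.rpow_add_of_nonneg hy hb.le zero_le_one, Real.rpow_one, Real.rpow_one] at h
  have h2 : x ^ b * y * (b + 1) ≤ b * (x ^ b * x) + y ^ b * y := by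
    calc x ^ b * y * (b + 1) ≤ (x ^ b * x / ((b + 1) / b) + y ^ b * y / (b + 1)) * (b + 1) := by
          gcongr
      _ = _ := by field_simp
  linarith

/-- For ‖w‖ ≤ ‖z‖ split |z|^b z - |w|^b w as |z|^b (z - w) + (|z|^b - |w|^b) w; the second term is
controlled by the scalar inequality, and the factor |w| removes any singularity of the power at
zero. -/
theorem norm_power_sub_le (ε : ℤˣ) {b : ℝ} (hb : 0 < b) {R : ℝ} {z w : 𝕜} (hz : ‖z‖ ≤ R)
    (hw : ‖w‖ ≤ R) : ‖power ε b z - power ε b w‖ ≤ (b + 1) * R ^ b * ‖z - w‖ := by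
  wlog h : ‖w‖ ≤ ‖z‖ generalizing z w
  · rw [norm_sub_rev, norm_sub_rev z]
    exact this hw hz (le_of_not_ge h)
  have hε : |((ε : ℤ) : ℝ)| = 1 := by
    rcases Int.units_eq_one_or ε with rfl | rfl <;> simp
  have e : power ε b z - power ε b w
      = ((ε : ℤ) : ℝ) • (‖z‖ ^ b • (z - w) + (‖z‖ ^ b - ‖w‖ ^ b) • w) := by
    simp only [power, smul_add, smul_sub, sub_smul, mul_smul]
    abel
  have hmono : ‖w‖ ^ b ≤ ‖z‖ ^ b := Real.rpow_le_rpow (norm_nonneg _) h hb.le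
  have h1 := mul_rpow_sub_rpow_le hb (norm_nonneg z) (norm_nonneg w)
  rw [e, norm_smul, Real.norm_eq_abs, hε, one_mul]
  calc _ ≤ ‖‖z‖ ^ b • (z - w)‖ + ‖(‖z‖ ^ b - ‖w‖ ^ b) • w‖ := norm_add_le _ _
    _ = ‖z‖ ^ b * ‖z - w‖ + ‖w‖ * (‖z‖ ^ b - ‖w‖ ^ b) := by
        rw [norm_smul, norm_smul, Real.norm_of_nonneg (by positivity),
          Real.norm_of_nonneg (by linarith), mul_comm ‖w‖]
    _ ≤ ‖z‖ ^ b * ‖z - w‖ + b * ‖z‖ ^ b * (‖z‖ - ‖w‖) := by gcongr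
    _ ≤ ‖z‖ ^ b * ‖z - w‖ + b * ‖z‖ ^ b * ‖z - w‖ := by
        gcongr
        exact norm_sub_norm_le z w
    _ = (b + 1) * ‖z‖ ^ b * ‖z - w‖ := by ring
    _ ≤ _ := by gcongr

theorem enorm_power_sub_le (ε : ℤˣ) {b : ℝ} (hb : 0 < b) {R : ℝ} {z w : 𝕜}
    (hz : ‖z‖ₑ ≤ ENNReal.ofReal R) (hw : ‖w‖ₑ ≤ ENNReal.ofReal R) (hR : 0 ≤ R) :
    ‖power ε b z - power ε b w‖ₑ ≤ ENNReal.ofReal ((b + 1) * R ^ b) * ‖z - w‖ₑ := by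
  rw [← ofReal_norm, ENNReal.ofReal_le_ofReal_iff hR] at hz hw
  rw [← ofReal_norm, ← ofReal_norm (z - w), ← ENNReal.ofReal_mul (by positivity)]
  exact ENNReal.ofReal_le_ofReal (norm_power_sub_le ε hb hz hw)

theorem measurable_power (ε : ℤˣ) (b : ℝ) : Measurable (power (𝕜 := 𝕜) ε b) := by
  unfold power
  exact (measurable_const.mul (measurable_norm.pow_const b)).smul measurable_id

theorem AEStronglyMeasurable.power {X : Type*} [MeasurableSpace X] {μ : Measure X} {f : X → 𝕜}
    (hf : AEStronglyMeasurable f μ) (ε : ℤˣ) (b : ℝ) :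
    AEStronglyMeasurable (fun x => FracDissip.power ε b (f x)) μ :=
  ((measurable_power ε b).comp_aemeasurable hf.aemeasurable).aestronglyMeasurable

end Power

/-! ### Strong continuity of the semigroup at time zero. -/

section ApproximateIdentity

variable {n : ℕ} {𝕜 : Type*} [RCLike 𝕜]

/-- Continuity of translations in `Lʳ`. -/
theorem tendsto_eLpNorm_translate {r : ℝ} (hr : 1 ≤ r) {φ : Rn n → 𝕜}
    (hφ : MemLp φ (ENNReal.ofReal r) volume) :
    Tendsto (fun y => eLpNorm (fun x => φ (x - y) - φ x) (ENNReal.ofReal r) volume)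
      (𝓝 (0 : Rn n)) (𝓝 0) := by
  have : Fact (1 ≤ ENNReal.ofReal r) := ⟨by simpa using hr⟩
  have : Fact (ENNReal.ofReal r ≠ ∞) := ⟨ENNReal.ofReal_ne_top⟩
  set f := hφ.toLp φ with hf
  have hc : Tendsto (fun y : Rn n => DomAddAct.mk (-y) +ᵥ f) (𝓝 0)
      (𝓝 (DomAddAct.mk (-(0 : Rn n)) +ᵥ f)) := by
    have h1 : Continuous fun y : Rn n => DomAddAct.mk (-y) +ᵥ f := by
      have h2 : Continuous fun y : Rn n => (DomAddAct.mk (-y) : (Rn n)ᵈᵃᵃ) :=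
        DomAddAct.continuous_mk.comp continuous_neg
      exact h2.vadd continuous_const
    exact h1.tendsto 0
  rw [tendsto_iff_edist_tendsto_0] at hc
  refine hc.congr fun y => ?_
  rw [neg_zero, hf, DomAddAct.mk_vadd_toLp, DomAddAct.mk_vadd_toLp, Lp.edist_toLp_toLp]
  refine eLpNorm_congr_ae (Eventually.of_forall fun x => ?_)
  simp [sub_eq_add_neg, add_comm]

/-- The kernel has mass one, so the difference is an average of φ(·-y) - φ against K_h. Jensen and
the substitution y = h^a z leave the fixed density |K_1| against the modulus of continuity at h^a z,
which tends to 0 pointwise and is bounded; dominated convergence concludes. -/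
theorem tendsto_eLpNorm_semigroup (hn : 1 ≤ n) {α : ℝ} (hα : 1 < 2 * α) {r : ℝ} (hr : 1 ≤ r)
    {φ : Rn n → 𝕜} (hφ : MemLp φ (ENNReal.ofReal r) volume) :
    Tendsto (fun h => eLpNorm (fun x => conv (kernel α h) φ x - φ x) (ENNReal.ofReal r) volume)
      (𝓝[>] 0) (𝓝 0) := by
  wlog hm : StronglyMeasurable φ generalizing φ
  · obtain ⟨ψ, hψ, he⟩ := hφ.1
    refine (this ((memLp_congr_ae he).1 hφ) hψ).congr fun h => ?_
    refine eLpNorm_congr_ae ?_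
    filter_upwards [he] with x hx
    rw [conv_congr he, hx]
  have hr0 : 0 < r := by linarith
  have hα0 : 0 < α := by linarith
  set a := 1 / (2 * α) with ha
  have ha0 : 0 < a := by positivity
  obtain ⟨C, hC⟩ := kerBound_jet (n := n) hn hα (k := 0) (by norm_num)
    (fun (_ : Unit) (_ : Fin 0) => (0 : Rn n))
  have hK := hC (max C 1) (le_max_left _ _)
  simp_rw [jet_zero, Nat.cast_zero, zero_mul] at hK
  set C' := max C 1 with hC'
  have hC'0 : 0 < C' := lt_of_lt_of_le one_pos (le_max_right _ _)
  have hmφ : Measurable φ := hm.measurable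
  set N : Rn n → ℝ≥0∞ := fun y => ∫⁻ x, ‖φ (x - y) - φ x‖ₑ ^ r with hN
  have hNm : Measurable N := by
    refine Measurable.lintegral_prod_right' (f := fun z : Rn n × Rn n =>
      ‖φ (z.2 - z.1) - φ z.2‖ₑ ^ r) ?_
    exact ((hmφ.comp (measurable_snd.sub measurable_fst)).sub
      (hmφ.comp measurable_snd)).enorm.pow_const r
  have hNe : ∀ y, N y = eLpNorm (fun x => φ (x - y) - φ x) (ENNReal.ofReal r) volume ^ r := by
    intro y
    rw [eLpNorm_ofReal_eq hr0, ← ENNReal.rpow_mul, one_div_mul_cancel hr0.ne', ENNReal.rpow_one]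
  have hN0 : Tendsto N (𝓝 0) (𝓝 0) := by
    rw [funext hNe]
    have := ((ENNReal.continuous_rpow_const (y := r)).tendsto 0).comp
      (tendsto_eLpNorm_translate hr hφ)
    rw [ENNReal.zero_rpow_of_pos hr0] at this
    exact this
  set Q := (2 * eLpNorm φ (ENNReal.ofReal r) volume) ^ r with hQ
  have hQt : Q ≠ ∞ := ENNReal.rpow_ne_top_of_nonneg hr0.le (ENNReal.mul_ne_top (by simp) hφ.2.ne)
  have hNQ : ∀ y, N y ≤ Q := by
    intro y
    rw [hNe, hQ]
    gcongr
    refine (eLpNorm_sub_le (hmφ.comp (measurable_id.sub_const y)).aestronglyMeasurable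
      hφ.1 (by simpa using hr)).trans_eq ?_
    rw [two_mul]
    congr 1
    exact eLpNorm_comp_measurePreserving hφ.1 (measurePreserving_sub_right volume y)
  have hKm : ∀ h, Measurable (kernel (n := n) α h) := hK.meas_slice
  -- the bound by the modulus of continuity
  have key : ∀ h : ℝ, 0 < h →
      eLpNorm (fun x => conv (kernel α h) φ x - φ x) (ENNReal.ofReal r) volume ≤
      (ENNReal.ofReal C' ^ (r - 1) * ∫⁻ y, ‖kernel (n := n) α 1 y‖ₑ * N (h ^ a • y)) ^ (1 / r) := by
    intro h hh
    have hone : ∫⁻ y, ‖kernel (n := n) α h y‖ₑ ≤ ENNReal.ofReal C' := by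
      simpa using hK.one h hh
    have hpt : ∀ x, ‖conv (kernel α h) φ x - φ x‖ₑ ^ r ≤
        ENNReal.ofReal C' ^ (r - 1) * ∫⁻ y, ‖kernel α h y‖ₑ * ‖φ (x - y) - φ x‖ₑ ^ r := by
      intro x
      have hfin : aconv (kernel α h) (fun y => ‖φ y‖ₑ) x ≠ ∞ := by
        refine ne_top_of_le_ne_top ?_ (hK.aconv_le_Lm hC'0.le hmφ.enorm.aemeasurable hr hh x)
        rw [eLpNorm_enorm]
        exact ENNReal.mul_ne_top ENNReal.ofReal_ne_top hφ.2.ne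
      have hi : Integrable (fun y => kernel α h y • φ (x - y)) := by
        have := (integrable_conv_integrand (hKm h) hφ.1 hfin).comp_sub_left x
        simpa using this
      have hi2 : Integrable (fun y => kernel α h y • φ x) :=
        (integrable_kernel hn hα hh).smul_const _
      have e : conv (kernel α h) φ x - φ x = ∫ y, kernel α h y • (φ (x - y) - φ x) := by
        simp only [smul_sub]
        rw [integral_sub hi hi2, integral_smul_const, integral_kernel hn hα hh, one_smul]
        congr 1
        rw [conv, ← integral_sub_left_eq_self (fun y => kernel α h (x - y) • φ y) volume x]
        simp
      rw [e]
      calc _ ≤ (∫⁻ y, ‖kernel α h y‖ₑ * ‖φ (x - y) - φ x‖ₑ) ^ r := by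
            gcongr
            refine (enorm_integral_le_lintegral_enorm _).trans_eq ?_
            simp only [enorm_smul]
        _ ≤ _ := lintegral_mul_rpow_le (hKm h).enorm.aemeasurable (by fun_prop) hr
        _ ≤ _ := by gcongr
    rw [eLpNorm_ofReal_eq hr0]
    gcongr
    calc ∫⁻ x, ‖conv (kernel α h) φ x - φ x‖ₑ ^ r
        ≤ ∫⁻ x, ENNReal.ofReal C' ^ (r - 1) * ∫⁻ y, ‖kernel α h y‖ₑ * ‖φ (x - y) - φ x‖ₑ ^ r :=
          lintegral_mono hpt
      _ = ENNReal.ofReal C' ^ (r - 1) * ∫⁻ x, ∫⁻ y, ‖kernel α h y‖ₑ * ‖φ (x - y) - φ x‖ₑ ^ r :=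
          lintegral_const_mul' _ _ (ENNReal.rpow_ne_top_of_nonneg (by linarith)
            ENNReal.ofReal_ne_top)
      _ = ENNReal.ofReal C' ^ (r - 1) * ∫⁻ y, ∫⁻ x, ‖kernel α h y‖ₑ * ‖φ (x - y) - φ x‖ₑ ^ r := by
          rw [lintegral_lintegral_swap]
          exact (((hKm h).comp measurable_snd).enorm.mul
            (((hmφ.comp (measurable_fst.sub measurable_snd)).sub
              (hmφ.comp measurable_fst)).enorm.pow_const r)).aemeasurable
      _ = ENNReal.ofReal C' ^ (r - 1) * ∫⁻ y, ‖kernel α h y‖ₑ * N y := by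
          congr 1
          refine lintegral_congr fun y => ?_
          rw [lintegral_const_mul' _ _ (by simp)]
      _ = _ := by
          congr 1
          have hha : 0 < h ^ a := by positivity
          have e3 : ∀ y : Rn n, ‖kernel (n := n) α h y‖ₑ * N y =
              ENNReal.ofReal (h ^ (-(n * a))) * (fun z : Rn n =>
                ‖kernel (n := n) α 1 z‖ₑ * N (h ^ a • z)) (h ^ (-a) • y) := by
            intro y
            simp only [smul_smul]
            rw [← Real.rpow_add hh, add_neg_cancel, Real.rpow_zero, one_smul,
              kernel_scale hα0 hh y, enorm_mul, Real.enorm_of_nonneg (by positivity), mul_assoc]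
          simp_rw [e3]
          rw [lintegral_const_mul' _ _ (by simp), lintegral_comp_smul_scale (fun z : Rn n =>
                ‖kernel (n := n) α 1 z‖ₑ * N (h ^ a • z)) (by positivity),
            ← mul_assoc, ← ENNReal.ofReal_mul (by positivity), ← Real.rpow_mul hh.le,
            ← Real.rpow_add hh]
          simp [mul_comm]
  have hlim : Tendsto (fun h : ℝ => ∫⁻ y, ‖kernel (n := n) α 1 y‖ₑ * N (h ^ a • y)) (𝓝[>] 0)
      (𝓝 (∫⁻ _ : Rn n, 0)) := by
    refine tendsto_lintegral_filter_of_dominated_convergence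
      (fun y => ‖kernel (n := n) α 1 y‖ₑ * Q) ?_ ?_ ?_ ?_
    · exact Eventually.of_forall fun h => (hKm 1).enorm.mul (hNm.comp (by fun_prop))
    · exact Eventually.of_forall fun h => Eventually.of_forall fun y => by gcongr; exact hNQ _
    · rw [lintegral_mul_const' _ _ hQt]
      refine ENNReal.mul_ne_top (ne_top_of_le_ne_top ENNReal.ofReal_ne_top (hK.one 1 one_pos)) hQt
    · refine Eventually.of_forall fun y => ?_
      have h1 : Tendsto (fun h : ℝ => h ^ a • y) (𝓝[>] 0) (𝓝 0) := by
        have h2 : Tendsto (fun h : ℝ => h ^ a) (𝓝 0) (𝓝 0) := by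
          have := (Real.continuousAt_rpow_const 0 a (Or.inr ha0.le)).tendsto
          rwa [Real.zero_rpow ha0.ne'] at this
        simpa using (h2.mono_left nhdsWithin_le_nhds).smul_const y
      have h3 := ENNReal.Tendsto.const_mul (a := ‖kernel (n := n) α 1 y‖ₑ) (hN0.comp h1)
        (Or.inr (by simp))
      simpa using h3
  rw [lintegral_zero] at hlim
  refine tendsto_of_tendsto_of_tendsto_of_le_of_le' tendsto_const_nhds (h := fun h : ℝ =>
    (ENNReal.ofReal C' ^ (r - 1) * ∫⁻ y, ‖kernel (n := n) α 1 y‖ₑ * N (h ^ a • y)) ^ (1 / r)) ?_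
    (Eventually.of_forall fun _ => zero_le) (eventually_mem_nhdsWithin.mono key)
  have h4 := ENNReal.Tendsto.const_mul (a := ENNReal.ofReal C' ^ (r - 1)) hlim
    (Or.inr (ENNReal.rpow_ne_top_of_nonneg (by linarith) ENNReal.ofReal_ne_top))
  have h5 := ((ENNReal.continuous_rpow_const (y := 1 / r)).tendsto _).comp h4
  rw [mul_zero, ENNReal.zero_rpow_of_pos (by positivity)] at h5
  exact h5

end ApproximateIdentity
end FracDissip

/-! ### The abstract integral equation and its weighted norm. -/

namespace FracDissip

/-- The data of an integral equation
`u(t) = k₀(t) * φ + ∑ⱼ ∫₀ᵗ kⱼ(t-τ) * fⱼ(u(τ)) dτ`, `fⱼ(z) = εⱼ |z|^{bⱼ} z`, with self-similar kernel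
bounds under which all the nonlinear terms are subcritical in `Lʳ`. -/
structure MildSystem (n : ℕ) (𝕜 : Type*) [RCLike 𝕜] where
  a : ℝ
  C : ℝ
  r : ℝ
  γ : Fin 2 → ℝ
  b : Fin 2 → ℝ
  ε : Fin 2 → ℤˣ
  k : Fin 2 → ℝ → Rn n → ℝ
  one_le_n : 1 ≤ n
  a_pos : 0 < a
  C_pos : 0 < C
  one_lt_r : 1 < r
  γ_zero : γ 0 = 0
  γ_nonneg : ∀ j, 0 ≤ γ j
  b_pos : ∀ j, 0 < b j
  b_lt : b 1 < b 0
  subcritical : ∀ j, 0 < 1 - γ j - n * a / r * b j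
  ker : ∀ j, KerBound a (γ j) C (k j)
  semi : ∀ j, ∀ s t : ℝ, 0 < s → 0 < t → ∀ x, ∫ y, k 0 s (x - y) * k j t y = k j (s + t) x
  approx : ∀ φ : Rn n → 𝕜, MemLp φ (ENNReal.ofReal r) volume →
    Tendsto (fun h => eLpNorm (fun x => conv (k 0 h) φ x - φ x) (ENNReal.ofReal r) volume)
      (𝓝[>] 0) (𝓝 0)

theorem exists_kerBound_pair {n : ℕ} (hn : 1 ≤ n) {α : ℝ} (hα : 1 < 2 * α) (D : DiffOp n) :
    ∃ C : ℝ, 0 < C ∧ ∀ j : Fin 2, KerBound (1 / (2 * α)) (![0, D.order / (2 * α)] j) C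
      ((![kernel α, fun s => D.apply (kernel α s)] : Fin 2 → ℝ → Rn n → ℝ) j) := by
  obtain ⟨k, ι, _, m, -, hk2, hk, hD⟩ := D.exists_jet
  obtain ⟨C₁, h₁⟩ := kerBound_jet (n := n) hn hα (k := 0) (by norm_num)
    (fun (_ : Unit) (_ : Fin 0) => (0 : Rn n))
  obtain ⟨C₂, h₂⟩ := kerBound_jet hn hα hk2 m
  have e₁ := h₁ (max (max C₁ C₂) 1) ((le_max_left _ _).trans (le_max_left _ _))
  have e₂ := h₂ (max (max C₁ C₂) 1) ((le_max_right _ _).trans (le_max_left _ _))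
  refine ⟨max (max C₁ C₂) 1, lt_of_lt_of_le one_pos (le_max_right _ _), fun j => ?_⟩
  fin_cases j
  · simp_rw [jet_zero, Nat.cast_zero, zero_mul] at e₁
    exact e₁
  · have : (fun s => D.apply (kernel α s)) = fun s => jet k m (kernel α s) := by
      funext s x; exact hD _ x
    simp only [Fin.mk_one, Matrix.cons_val_one, Matrix.cons_val_fin_one, this]
    rwa [hk, mul_one_div] at e₂

/-- The system of the Cauchy problem `u_t + (-Δ)^α u = f₁(u) + D f₂(u)`. -/
def MildSystem.ofData {n : ℕ} (𝕜 : Type*) [RCLike 𝕜] (hn : 1 ≤ n) {α : ℝ} (hα : 1 < 2 * α)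
    (D : DiffOp n) (ε₁ ε₂ : ℤˣ) {b₁ b₂ : ℝ} (hb₂ : 0 < b₂) (hb : b₂ < b₁) {r : ℝ} (hr : 1 < r)
    (h₁ : n * (1 / (2 * α)) / r * b₁ < 1)
    (h₂ : n * (1 / (2 * α)) / r * b₂ < 1 - D.order / (2 * α)) : MildSystem n 𝕜 where
  a := 1 / (2 * α)
  C := (exists_kerBound_pair hn hα D).choose
  r := r
  γ := ![0, D.order / (2 * α)]
  b := ![b₁, b₂]
  ε := ![ε₁, ε₂]
  k := ![kernel α, fun s => D.apply (kernel α s)]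
  one_le_n := hn
  a_pos := by have : 0 < α := by linarith
              positivity
  C_pos := (exists_kerBound_pair hn hα D).choose_spec.1
  one_lt_r := hr
  γ_zero := rfl
  γ_nonneg := by
    have : 0 < 2 * α := by linarith
    have : 0 ≤ D.order := by cases D <;> norm_num [DiffOp.order]
    intro j
    fin_cases j
    · simp
    · simp only [Fin.mk_one, Matrix.cons_val_one, Matrix.cons_val_fin_one]
      positivity
  b_pos := by intro j; fin_cases j; exacts [hb₂.trans hb, hb₂]
  b_lt := hb
  subcritical := by
    intro j
    fin_cases j
    · simpa using h₁
    · simpa using h₂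
  ker := (exists_kerBound_pair hn hα D).choose_spec.2
  semi := by
    intro j s t hs ht x
    obtain ⟨k, ι, _, m, -, hk2, -, hD⟩ := D.exists_jet
    fin_cases j
    · have := kernel_conv_jet_kernel hn hα hs ht (k := 0) (by norm_num)
        (fun (_ : Unit) (_ : Fin 0) => (0 : Rn n)) x
      simp_rw [jet_zero] at this
      exact this
    · have := kernel_conv_jet_kernel hn hα hs ht hk2 m x
      simp_rw [← hD] at this
      exact this
  approx := fun _ hφ => tendsto_eLpNorm_semigroup hn hα hr.le hφ

namespace MildSystem

variable {n : ℕ} {𝕜 : Type*} [RCLike 𝕜] (P : MildSystem n 𝕜)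

/-- The decay exponent of `‖k₀(t) * φ‖_∞` for `φ ∈ Lʳ`. -/
def σ : ℝ := n * P.a / P.r

/-- If |u| ≤ R t^{-σ}, the Lipschitz constant of the j-th nonlinearity at time t is of order t^{-θ
j}. -/
def θ (j : Fin 2) : ℝ := P.σ * P.b j

/-- The power of the elapsed time gained by the j-th Duhamel term; its positivity is subcriticality.
-/
def ω (j : Fin 2) : ℝ := 1 - P.γ j - P.θ j

/-- The exponent of the Lebesgue space. -/
abbrev R : ℝ≥0∞ := ENNReal.ofReal P.r

def f (j : Fin 2) (z : 𝕜) : 𝕜 := power (P.ε j) (P.b j) z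

/-- The nonlinear terms along `u`. -/
def src (j : Fin 2) (u : ℝ → Rn n → 𝕜) (τ : ℝ) (y : Rn n) : 𝕜 := P.f j (u τ y)

/-- The sum of the Duhamel integrals. -/
def N (u : ℝ → Rn n → 𝕜) (t : ℝ) (x : Rn n) : 𝕜 := ∑ j, duh (P.k j) (P.src j u) 0 t x

/-- The constant of the Duhamel estimates. -/
def D (j : Fin 2) : ℝ := P.C * betaC (P.γ j) (P.θ j) * 2 ^ P.σ

theorem r_pos : 0 < P.r := by linarith [P.one_lt_r]

theorem σ_pos : 0 < P.σ := by
  have := P.one_le_n; have := P.a_pos; have := P.r_pos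
  have : (0 : ℝ) < n := by exact_mod_cast P.one_le_n
  unfold σ; positivity

theorem θ_pos (j : Fin 2) : 0 < P.θ j := mul_pos P.σ_pos (P.b_pos j)

theorem ω_pos (j : Fin 2) : 0 < P.ω j := P.subcritical j

theorem γ_lt_one (j : Fin 2) : P.γ j < 1 := by
  have := P.θ_pos j; have := P.ω_pos j; unfold ω at this; linarith

theorem θ_lt_one (j : Fin 2) : P.θ j < 1 := by
  have := P.γ_nonneg j; have := P.ω_pos j; unfold ω at this; linarith

theorem D_pos (j : Fin 2) : 0 < P.D j := by
  have := P.C_pos; have := betaC_pos (P.γ_lt_one j) (P.θ_lt_one j)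
  unfold D; positivity

theorem meas_k (j : Fin 2) : Measurable (Function.uncurry (P.k j)) := (P.ker j).meas

theorem one_le_R : 1 ≤ P.R := by
  rw [R, ENNReal.one_le_ofReal]; exact P.one_lt_r.le

theorem aestronglyMeasurable_src (j : Fin 2) {u : ℝ → Rn n → 𝕜} {s t : ℝ}
    (hu : AEStronglyMeasurable (Function.uncurry u) (slab n s t)) :
    AEStronglyMeasurable (Function.uncurry (P.src j u)) (slab n s t) :=
  AEStronglyMeasurable.power hu _ _

theorem enorm_src (j : Fin 2) (u : ℝ → Rn n → 𝕜) (τ : ℝ) (y : Rn n) :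
    ‖P.src j u τ y‖ₑ = ‖u τ y‖ₑ ^ (P.b j + 1) := enorm_power _ (P.b_pos j) _

/-- The Duhamel estimates. -/
theorem eLpNorm_aduh_le (j : Fin 2) {H : ℝ → Rn n → ℝ≥0∞} {s t : ℝ} (hst : s ≤ t)
    (hH : AEMeasurable (Function.uncurry H) (slab n s t)) {B : ℝ} (hB : 0 < B)
    (hb : ∀ᵐ τ ∂(volume.restrict (Ioo s t)),
      eLpNorm (H τ) P.R volume ≤ ENNReal.ofReal (B * (τ - s) ^ (-P.θ j))) :
    eLpNorm (aduh (P.k j) H s t) P.R volume ≤ ENNReal.ofReal (P.D j * B * (t - s) ^ P.ω j) := by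
  refine (FracDissip.eLpNorm_aduh_le (P.ker j) P.C_pos (P.γ_nonneg j) (P.γ_lt_one j)
    (P.θ_pos j).le (P.θ_lt_one j) P.one_lt_r.le hst hH hB hb).trans (ENNReal.ofReal_le_ofReal ?_)
  have h1 : 0 < P.C * betaC (P.γ j) (P.θ j) :=
    mul_pos P.C_pos (betaC_pos (P.γ_lt_one j) (P.θ_lt_one j))
  have h2 : 1 ≤ (2 : ℝ) ^ P.σ := Real.one_le_rpow (by norm_num) P.σ_pos.le
  have h3 : 0 ≤ (t - s) ^ P.ω j := Real.rpow_nonneg (by linarith) _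
  unfold D
  change _ * _ * B * (t - s) ^ P.ω j ≤ _
  have h4 := le_mul_of_one_le_right h1.le h2
  gcongr

theorem aduh_le (j : Fin 2) {H : ℝ → Rn n → ℝ≥0∞} {s t : ℝ} (hst : s < t)
    (hH : AEMeasurable (Function.uncurry H) (slab n s t)) {B : ℝ} (hB : 0 < B)
    (hb : ∀ᵐ τ ∂(volume.restrict (Ioo s t)),
      eLpNorm (H τ) P.R volume ≤ ENNReal.ofReal (B * (τ - s) ^ (-P.θ j)))
    (hb' : ∀ᵐ τ ∂(volume.restrict (Ioo s t)),
      ∀ᵐ y, H τ y ≤ ENNReal.ofReal (B * (τ - s) ^ (-(P.θ j + P.σ)))) (x : Rn n) :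
    aduh (P.k j) H s t x ≤ ENNReal.ofReal (P.D j * B * (t - s) ^ P.ω j * (t - s) ^ (-P.σ)) := by
  refine (FracDissip.aduh_le (P.ker j) P.C_pos P.a_pos.le (P.γ_nonneg j) (P.γ_lt_one j)
    (P.θ_pos j).le (P.θ_lt_one j) P.one_lt_r.le hst hH hB hb hb' x).trans_eq ?_
  congr 1
  change P.C * betaC (P.γ j) (P.θ j) * 2 ^ P.σ * B * (t - s) ^ (P.ω j - P.σ) = _
  rw [mul_assoc _ (_ ^ _) (_ ^ _), ← Real.rpow_add (by linarith)]
  rfl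

/-- `w` is bounded by `B` in the norm `sup_t (‖w(t)‖_r + t^σ ‖w(t)‖_∞)`. -/
def YBound (B T : ℝ) (w : ℝ → Rn n → 𝕜) : Prop :=
  ∀ t ∈ Ioo 0 T, eLpNorm (w t) P.R volume ≤ ENNReal.ofReal B ∧
    ∀ᵐ x, ‖w t x‖ₑ ≤ ENNReal.ofReal (B * t ^ (-P.σ))

variable {P}

theorem YBound.mono {B B' T T' : ℝ} {w : ℝ → Rn n → 𝕜} (h : P.YBound B T w) (hB : B ≤ B')
    (hT : T' ≤ T) : P.YBound B' T' w := by
  intro t ht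
  obtain ⟨h1, h2⟩ := h t ⟨ht.1, ht.2.trans_le hT⟩
  refine ⟨h1.trans (ENNReal.ofReal_le_ofReal hB), ?_⟩
  filter_upwards [h2] with x hx
  refine hx.trans (ENNReal.ofReal_le_ofReal ?_)
  have := Real.rpow_nonneg ht.1.le (-P.σ)
  gcongr

theorem YBound.add {B B' T : ℝ} {v w : ℝ → Rn n → 𝕜} (h : P.YBound B T v) (h' : P.YBound B' T w)
    (hv : ∀ t ∈ Ioo 0 T, AEStronglyMeasurable (v t)) (hw : ∀ t ∈ Ioo 0 T, AEStronglyMeasurable (w t))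
    (hB : 0 ≤ B) (hB' : 0 ≤ B') :
    P.YBound (B + B') T fun t x => v t x + w t x := by
  intro t ht
  obtain ⟨h1, h2⟩ := h t ht
  obtain ⟨h1', h2'⟩ := h' t ht
  constructor
  · refine (eLpNorm_add_le (hv t ht) (hw t ht) P.one_le_R).trans ?_
    rw [ENNReal.ofReal_add hB hB']
    gcongr
  · filter_upwards [h2, h2'] with x hx hx'
    have := Real.rpow_nonneg ht.1.le (-P.σ)
    refine (enorm_add_le _ _).trans ?_
    rw [add_mul, ENNReal.ofReal_add (by positivity) (by positivity)]
    gcongr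

theorem YBound.neg {B T : ℝ} {v : ℝ → Rn n → 𝕜} (h : P.YBound B T v) :
    P.YBound B T fun t x => -v t x := by
  intro t ht
  obtain ⟨h1, h2⟩ := h t ht
  refine ⟨?_, by simpa using h2⟩
  change eLpNorm (-(v t)) _ _ ≤ _
  rwa [eLpNorm_neg]

theorem YBound.sub {B B' T : ℝ} {v w : ℝ → Rn n → 𝕜} (h : P.YBound B T v) (h' : P.YBound B' T w)
    (hv : ∀ t ∈ Ioo 0 T, AEStronglyMeasurable (v t)) (hw : ∀ t ∈ Ioo 0 T, AEStronglyMeasurable (w t))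
    (hB : 0 ≤ B) (hB' : 0 ≤ B') :
    P.YBound (B + B') T fun t x => v t x - w t x := by
  simpa only [sub_eq_add_neg] using h.add h'.neg hv (fun t ht => (hw t ht).neg) hB hB'

/-- The nonlinearity is locally Lipschitz. -/
theorem enorm_f_sub_le (j : Fin 2) {A : ℝ} (hA : 0 ≤ A) {z w : 𝕜} (hz : ‖z‖ₑ ≤ ENNReal.ofReal A)
    (hw : ‖w‖ₑ ≤ ENNReal.ofReal A) :
    ‖P.f j z - P.f j w‖ₑ ≤ ENNReal.ofReal ((P.b j + 1) * A ^ P.b j) * ‖z - w‖ₑ :=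
  enorm_power_sub_le _ (P.b_pos j) hz hw hA

/-- The pointwise bounds R t^{-σ} of u and v enter only through the Lipschitz constant, and the
difference keeps its own bound B. Hence B appears linearly, as a contraction requires. -/
theorem YBound.src_sub (j : Fin 2) {B R T : ℝ} (hR : 0 ≤ R) {u v : ℝ → Rn n → 𝕜}
    (hu : P.YBound R T u) (hv : P.YBound R T v) (h : P.YBound B T fun t x => u t x - v t x) {t : ℝ}
    (ht : t ∈ Ioo 0 T) :
    eLpNorm (fun x => ‖P.src j u t x - P.src j v t x‖ₑ) P.R volume
        ≤ ENNReal.ofReal ((P.b j + 1) * R ^ P.b j * B * t ^ (-P.θ j)) ∧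
      ∀ᵐ x, ‖P.src j u t x - P.src j v t x‖ₑ
        ≤ ENNReal.ofReal ((P.b j + 1) * R ^ P.b j * B * t ^ (-(P.θ j + P.σ))) := by
  have ht0 := ht.1
  have hb := P.b_pos j
  have hpt : ∀ᵐ x, ‖P.src j u t x - P.src j v t x‖ₑ ≤
      ENNReal.ofReal ((P.b j + 1) * R ^ P.b j * t ^ (-P.θ j)) * ‖u t x - v t x‖ₑ := by
    filter_upwards [(hu t ht).2, (hv t ht).2] with x hx hx'
    refine (enorm_f_sub_le j (by positivity) hx hx').trans_eq ?_
    rw [Real.mul_rpow hR (by positivity), ← Real.rpow_mul ht0.le, neg_mul, ← θ, mul_assoc]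
  constructor
  · rw [eLpNorm_enorm]
    refine (eLpNorm_le_nnreal_smul_eLpNorm_of_ae_le_mul' (f := fun x => P.src j u t x - P.src j v t x)
      (g := fun x => u t x - v t x) (c := Real.toNNReal ((P.b j + 1) * R ^ P.b j * t ^ (-P.θ j)))
      hpt P.R).trans ?_
    calc _ ≤ ENNReal.ofReal ((P.b j + 1) * R ^ P.b j * t ^ (-P.θ j)) * ENNReal.ofReal B := by
          rw [ENNReal.smul_def, smul_eq_mul]
          exact mul_le_mul' le_rfl (h t ht).1
      _ = _ := by
          rw [← ENNReal.ofReal_mul (by positivity)]; congr 1; ring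
  · filter_upwards [hpt, (h t ht).2] with x hx hx'
    refine hx.trans ?_
    calc _ ≤ ENNReal.ofReal ((P.b j + 1) * R ^ P.b j * t ^ (-P.θ j)) *
          ENNReal.ofReal (B * t ^ (-P.σ)) := by gcongr
      _ = _ := by
          rw [← ENNReal.ofReal_mul (by positivity), neg_add, Real.rpow_add ht0]; congr 1; ring

theorem src_zero (j : Fin 2) (t : ℝ) (x : Rn n) : P.src j (fun _ _ => (0 : 𝕜)) t x = 0 := by
  simp [src, f, power]

theorem yBound_zero (R T : ℝ) : P.YBound R T fun _ _ => (0 : 𝕜) := by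
  intro t ht
  refine ⟨by simp, Eventually.of_forall fun x => by simp⟩

theorem YBound.src_le (j : Fin 2) {R T : ℝ} (hR : 0 ≤ R) {u : ℝ → Rn n → 𝕜}
    (hu : P.YBound R T u) {t : ℝ} (ht : t ∈ Ioo 0 T) :
    eLpNorm (fun x => ‖P.src j u t x‖ₑ) P.R volume
        ≤ ENNReal.ofReal ((P.b j + 1) * R ^ P.b j * R * t ^ (-P.θ j)) ∧
      ∀ᵐ x, ‖P.src j u t x‖ₑ
        ≤ ENNReal.ofReal ((P.b j + 1) * R ^ P.b j * R * t ^ (-(P.θ j + P.σ))) := by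
  simpa only [src_zero, sub_zero] using
    hu.src_sub j hR (yBound_zero R T) (by simpa using hu) ht

end MildSystem
end FracDissip

/-! ### Local existence by Picard iteration. -/

namespace FracDissip
namespace MildSystem

variable {n : ℕ} {𝕜 : Type*} [RCLike 𝕜] {P : MildSystem n 𝕜}

/-- Fatou's lemma for the Lʳ part, pointwise passage to the limit for the supremum; so limits of
iterates need only converge almost everywhere at each time. -/
theorem YBound.lim {B T : ℝ} {w : ℕ → ℝ → Rn n → 𝕜} {w' : ℝ → Rn n → 𝕜}
    (h : ∀ m, P.YBound B T (w m)) (hm : ∀ m, ∀ t ∈ Ioo 0 T, AEStronglyMeasurable (w m t))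
    (hl : ∀ t ∈ Ioo 0 T, ∀ᵐ x, Tendsto (fun m => w m t x) atTop (𝓝 (w' t x))) :
    P.YBound B T w' := by
  intro t ht
  constructor
  · refine (Lp.eLpNorm_lim_le_liminf_eLpNorm (fun m => hm m t ht) (w' t) (hl t ht)).trans ?_
    refine liminf_le_of_le (by isBoundedDefault) fun b hb => ?_
    obtain ⟨m, hm⟩ := hb.exists
    exact hm.trans (h m t ht).1
  · filter_upwards [hl t ht, ae_all_iff.2 fun m => (h m t ht).2] with x hx hx'
    exact le_of_tendsto hx.enorm (Eventually.of_forall hx')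

theorem measurable_slab_mono {u : ℝ → Rn n → 𝕜} {s t s' t' : ℝ}
    (hu : AEStronglyMeasurable (Function.uncurry u) (slab n s t)) (hs : s ≤ s') (ht : t' ≤ t) :
    AEStronglyMeasurable (Function.uncurry u) (slab n s' t') :=
  hu.mono_measure (slab_mono (Ioo_subset_Ioo hs ht))

/-- The Duhamel integrals of a bounded function. -/
theorem YBound.aduh_src (j : Fin 2) {R T : ℝ} (hR : 0 < R) {u : ℝ → Rn n → 𝕜}
    (hu : P.YBound R T u) (hm : AEStronglyMeasurable (Function.uncurry u) (slab n 0 T)) {s t : ℝ}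
    (hs : 0 ≤ s) (hst : s < t) (ht : t ≤ T) :
    eLpNorm (aduh (P.k j) (fun τ y => ‖P.src j u τ y‖ₑ) s t) P.R volume
        ≤ ENNReal.ofReal (P.D j * ((P.b j + 1) * R ^ P.b j * R) * (t - s) ^ P.ω j) ∧
      ∀ x, aduh (P.k j) (fun τ y => ‖P.src j u τ y‖ₑ) s t x ≤ ENNReal.ofReal
        (P.D j * ((P.b j + 1) * R ^ P.b j * R) * (t - s) ^ P.ω j * (t - s) ^ (-P.σ)) := by
  have hb := P.b_pos j
  have hB : 0 < (P.b j + 1) * R ^ P.b j * R := by positivity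
  have hms := (P.aestronglyMeasurable_src j (measurable_slab_mono hm hs ht)).enorm
  -- The weight of the source is singular at time zero. For s ≥ 0 it is at most the same power of τ
  -- - s, so one estimate serves every starting time.
  have h1 : ∀ᵐ τ ∂(volume.restrict (Ioo s t)), eLpNorm (fun y => ‖P.src j u τ y‖ₑ) P.R volume ≤
      ENNReal.ofReal ((P.b j + 1) * R ^ P.b j * R * (τ - s) ^ (-P.θ j)) := by
    filter_upwards [ae_Ioo_mem s t] with τ hτ
    refine (hu.src_le j hR.le ⟨hs.trans_lt hτ.1, hτ.2.trans_le ht⟩).1.trans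
      (ENNReal.ofReal_le_ofReal ?_)
    have := P.θ_pos j
    exact mul_le_mul_of_nonneg_left (Real.rpow_le_rpow_of_nonpos (by linarith [hτ.1])
      (by linarith) (by linarith)) hB.le
  have h2 : ∀ᵐ τ ∂(volume.restrict (Ioo s t)), ∀ᵐ y, ‖P.src j u τ y‖ₑ ≤
      ENNReal.ofReal ((P.b j + 1) * R ^ P.b j * R * (τ - s) ^ (-(P.θ j + P.σ))) := by
    filter_upwards [ae_Ioo_mem s t] with τ hτ
    filter_upwards [(hu.src_le j hR.le ⟨hs.trans_lt hτ.1, hτ.2.trans_le ht⟩).2] with y hy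
    refine hy.trans (ENNReal.ofReal_le_ofReal ?_)
    have := P.θ_pos j
    have := P.σ_pos
    exact mul_le_mul_of_nonneg_left (Real.rpow_le_rpow_of_nonpos (by linarith [hτ.1])
      (by linarith) (by linarith)) hB.le
  exact ⟨P.eLpNorm_aduh_le j (H := fun τ y => ‖P.src j u τ y‖ₑ) hst.le hms hB h1,
    P.aduh_le j (H := fun τ y => ‖P.src j u τ y‖ₑ) hst hms hB h1 h2⟩

theorem YBound.aduh_src_ne_top (j : Fin 2) {R T : ℝ} (hR : 0 < R) {u : ℝ → Rn n → 𝕜}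
    (hu : P.YBound R T u) (hm : AEStronglyMeasurable (Function.uncurry u) (slab n 0 T)) {s t : ℝ}
    (hs : 0 ≤ s) (hst : s < t) (ht : t ≤ T) (x : Rn n) :
    aduh (P.k j) (fun τ y => ‖P.src j u τ y‖ₑ) s t x ≠ ∞ :=
  ne_top_of_le_ne_top ENNReal.ofReal_ne_top ((hu.aduh_src j hR hm hs hst ht).2 x)

variable (P) in
/-- The contraction factor of the integral operator on a ball of radius `R`. -/
def q (R T : ℝ) : ℝ := ∑ j, P.D j * ((P.b j + 1) * R ^ P.b j) * T ^ P.ω j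

theorem q_nonneg {R T : ℝ} (hR : 0 ≤ R) (hT : 0 ≤ T) : 0 ≤ P.q R T := by
  refine Finset.sum_nonneg fun j _ => ?_
  have := P.D_pos j; have := P.b_pos j
  positivity

/-- The contraction estimate: add the two Duhamel bounds for the difference of the sources and use
t^ω ≤ T^ω. With v = 0 it also bounds the nonlinear term itself. -/
theorem YBound.N_sub {B R T : ℝ} (hR : 0 < R) (hB : 0 < B) {u v : ℝ → Rn n → 𝕜}
    (hmu : AEStronglyMeasurable (Function.uncurry u) (slab n 0 T))
    (hmv : AEStronglyMeasurable (Function.uncurry v) (slab n 0 T))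
    (hu : P.YBound R T u) (hv : P.YBound R T v) (h : P.YBound B T fun t x => u t x - v t x) :
    P.YBound (P.q R T * B) T fun t x => P.N u t x - P.N v t x := by
  intro t ht
  set H : Fin 2 → ℝ → Rn n → ℝ≥0∞ := fun j τ y => ‖P.src j u τ y - P.src j v τ y‖ₑ with hH
  have hmu' := measurable_slab_mono hmu le_rfl ht.2.le
  have hmv' := measurable_slab_mono hmv le_rfl ht.2.le
  have hHm : ∀ j, AEMeasurable (Function.uncurry (H j)) (slab n 0 t) := fun j =>
    ((P.aestronglyMeasurable_src j hmu').sub (P.aestronglyMeasurable_src j hmv')).enorm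
  have hpt : ∀ x, ‖P.N u t x - P.N v t x‖ₑ ≤ ∑ j, aduh (P.k j) (H j) 0 t x := by
    intro x
    rw [N, N, ← Finset.sum_sub_distrib]
    refine (enorm_sum_le _ _).trans (Finset.sum_le_sum fun j _ => ?_)
    exact enorm_duh_sub_le (P.meas_k j) (P.aestronglyMeasurable_src j hmu')
      (P.aestronglyMeasurable_src j hmv') (hu.aduh_src_ne_top j hR hmu le_rfl ht.1 ht.2.le x)
      (hv.aduh_src_ne_top j hR hmv le_rfl ht.1 ht.2.le x)
  have hB' : ∀ j, 0 < (P.b j + 1) * R ^ P.b j * B := fun j => by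
    have := P.b_pos j; positivity
  have h1 : ∀ j, ∀ᵐ τ ∂(volume.restrict (Ioo 0 t)), eLpNorm (H j τ) P.R volume ≤
      ENNReal.ofReal ((P.b j + 1) * R ^ P.b j * B * (τ - 0) ^ (-P.θ j)) := by
    intro j
    filter_upwards [ae_Ioo_mem 0 t] with τ hτ
    rw [sub_zero]
    exact (hu.src_sub j hR.le hv h ⟨hτ.1, hτ.2.trans ht.2⟩).1
  have h2 : ∀ j, ∀ᵐ τ ∂(volume.restrict (Ioo 0 t)), ∀ᵐ y, H j τ y ≤
      ENNReal.ofReal ((P.b j + 1) * R ^ P.b j * B * (τ - 0) ^ (-(P.θ j + P.σ))) := by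
    intro j
    filter_upwards [ae_Ioo_mem 0 t] with τ hτ
    rw [sub_zero]
    exact (hu.src_sub j hR.le hv h ⟨hτ.1, hτ.2.trans ht.2⟩).2
  have hT : 0 < T := ht.1.trans ht.2
  have hterm : ∀ j, P.D j * ((P.b j + 1) * R ^ P.b j * B) * (t - 0) ^ P.ω j ≤
      P.D j * ((P.b j + 1) * R ^ P.b j) * T ^ P.ω j * B := by
    intro j
    rw [sub_zero]
    have h3 : t ^ P.ω j ≤ T ^ P.ω j := Real.rpow_le_rpow ht.1.le ht.2.le (P.ω_pos j).le
    have := P.D_pos j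
    have := P.b_pos j
    calc _ ≤ P.D j * ((P.b j + 1) * R ^ P.b j * B) * T ^ P.ω j := by gcongr
      _ = _ := by ring
  have hterm0 : ∀ j ∈ (Finset.univ : Finset (Fin 2)),
      0 ≤ P.D j * ((P.b j + 1) * R ^ P.b j) * T ^ P.ω j * B := by
    intro j _
    have := P.D_pos j
    have := P.b_pos j
    positivity
  constructor
  · calc _ ≤ eLpNorm (∑ j, aduh (P.k j) (H j) 0 t) P.R volume := by
          refine eLpNorm_mono_enorm fun x => ?_
          rw [Finset.sum_apply, enorm_eq_self]
          exact hpt x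
      _ ≤ ∑ j, eLpNorm (aduh (P.k j) (H j) 0 t) P.R volume :=
          eLpNorm_sum_le (fun j _ => (aemeasurable_aduh (P.meas_k j) (hHm j)).aestronglyMeasurable)
            P.one_le_R
      _ ≤ ∑ j, ENNReal.ofReal (P.D j * ((P.b j + 1) * R ^ P.b j) * T ^ P.ω j * B) := by
          gcongr with j
          exact (P.eLpNorm_aduh_le j ht.1.le (hHm j) (hB' j) (h1 j)).trans
            (ENNReal.ofReal_le_ofReal (hterm j))
      _ = _ := by rw [← ENNReal.ofReal_sum_of_nonneg hterm0, q, Finset.sum_mul]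
  · refine Eventually.of_forall fun x => (hpt x).trans ?_
    have hts : 0 ≤ t ^ (-P.σ) := Real.rpow_nonneg ht.1.le _
    calc _ ≤ ∑ j, ENNReal.ofReal (P.D j * ((P.b j + 1) * R ^ P.b j) * T ^ P.ω j * B *
          t ^ (-P.σ)) := by
          gcongr with j
          refine (P.aduh_le j ht.1 (hHm j) (hB' j) (h1 j) (h2 j) x).trans
            (ENNReal.ofReal_le_ofReal ?_)
          rw [sub_zero t]
          have := hterm j
          rw [sub_zero t] at this
          gcongr
      _ = _ := by
          rw [← ENNReal.ofReal_sum_of_nonneg fun j hj => mul_nonneg (hterm0 j hj) hts, q,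
            Finset.sum_mul, Finset.sum_mul]

theorem N_zero (t : ℝ) (x : Rn n) : P.N (fun _ _ => (0 : 𝕜)) t x = 0 := by
  have : ∀ j, P.src j (fun _ _ => (0 : 𝕜)) = fun _ _ => 0 := fun j => by
    funext t x; exact src_zero j t x
  simp [N, this, duh, conv]

theorem N_congr {u v : ℝ → Rn n → 𝕜} {t : ℝ} (h : ∀ τ ∈ Ioo 0 t, u τ =ᵐ[volume] v τ) (x : Rn n) :
    P.N u t x = P.N v t x := by
  refine Finset.sum_congr rfl fun j _ => duh_congr ?_ x
  filter_upwards [ae_Ioo_mem 0 t] with τ hτ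
  filter_upwards [h τ hτ] with y hy
  simp [src, hy]

variable (P) in
/-- The linear evolution. -/
def lin (φ : Rn n → 𝕜) (t : ℝ) (x : Rn n) : 𝕜 := conv (P.k 0 t) φ x

theorem meas_slice (j : Fin 2) (t : ℝ) : Measurable (P.k j t) := (P.ker j).meas_slice t

theorem eLpNorm_aconv_le (g : Rn n → ℝ≥0∞) (hg : AEMeasurable g) {t : ℝ} (ht : 0 < t) :
    eLpNorm (aconv (P.k 0 t) g) P.R volume ≤ ENNReal.ofReal P.C * eLpNorm g P.R volume := by
  have := (P.ker 0).eLpNorm_aconv_le hg P.one_lt_r.le ht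
  rwa [P.γ_zero, neg_zero, Real.rpow_zero, mul_one] at this

theorem aconv_le (g : Rn n → ℝ≥0∞) (hg : AEMeasurable g) {t : ℝ} (ht : 0 < t) (x : Rn n) :
    aconv (P.k 0 t) g x ≤ ENNReal.ofReal (P.C * t ^ (-P.σ)) * eLpNorm g P.R volume := by
  have := (P.ker 0).aconv_le_Lm P.C_pos.le hg P.one_lt_r.le ht x
  rwa [P.γ_zero, zero_add] at this

theorem yBound_lin {M : ℝ} {φ : Rn n → 𝕜} (hφ : AEStronglyMeasurable φ)
    (hM : eLpNorm φ P.R volume ≤ ENNReal.ofReal M) (T : ℝ) : P.YBound (P.C * M) T (P.lin φ) := by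
  have hC := P.C_pos
  intro t ht
  have hts : 0 ≤ t ^ (-P.σ) := Real.rpow_nonneg ht.1.le _
  constructor
  · calc _ ≤ eLpNorm (aconv (P.k 0 t) fun y => ‖φ y‖ₑ) P.R volume :=
          eLpNorm_mono_enorm fun x => by rw [enorm_eq_self]; exact enorm_conv_le _ _ _
      _ ≤ ENNReal.ofReal P.C * eLpNorm φ P.R volume := by
          have := eLpNorm_aconv_le (P := P) _ hφ.enorm ht.1
          rwa [eLpNorm_enorm] at this
      _ ≤ _ := by rw [ENNReal.ofReal_mul hC.le]; gcongr
  · refine Eventually.of_forall fun x => (enorm_conv_le _ _ _).trans ?_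
    refine (aconv_le _ hφ.enorm ht.1 x).trans ?_
    rw [eLpNorm_enorm, mul_right_comm, ENNReal.ofReal_mul (mul_nonneg hC.le hts)]
    gcongr

variable (P) in
/-- Solutions on `[0, T)` that are bounded in the norm of `YBound`. -/
structure BSol (R T : ℝ) (φ : Rn n → 𝕜) (u : ℝ → Rn n → 𝕜) : Prop where
  pos : 0 < R
  meas : AEStronglyMeasurable (Function.uncurry u) (slab n 0 T)
  init : u 0 =ᵐ[volume] φ
  mem : MemLp φ P.R volume
  bound : P.YBound R T u
  eq : ∀ t ∈ Ioo 0 T, ∀ᵐ x, u t x = P.lin φ t x + P.N u t x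

theorem lin_congr {φ ψ : Rn n → 𝕜} (h : φ =ᵐ[volume] ψ) (t : ℝ) (x : Rn n) :
    P.lin φ t x = P.lin ψ t x := conv_congr h x

theorem stronglyMeasurable_lin {φ : Rn n → 𝕜} (hφ : StronglyMeasurable φ) :
    StronglyMeasurable (Function.uncurry (P.lin φ)) := by
  have : StronglyMeasurable (fun w : (ℝ × Rn n) × Rn n => P.k 0 w.1.1 (w.1.2 - w.2) • φ w.2) := by
    refine StronglyMeasurable.smul (Measurable.stronglyMeasurable ?_)
      (hφ.comp_measurable measurable_snd)
    exact (P.meas_k 0).comp (measurable_fst.fst.prodMk (measurable_fst.snd.sub measurable_snd))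
  exact this.integral_prod_right'

theorem stronglyMeasurable_N {u : ℝ → Rn n → 𝕜} (hu : StronglyMeasurable (Function.uncurry u)) :
    StronglyMeasurable (Function.uncurry (P.N u)) := by
  have h : ∀ j, StronglyMeasurable (Function.uncurry (P.src j u)) := fun j =>
    ((measurable_power (P.ε j) (P.b j)).comp hu.measurable).stronglyMeasurable
  have e : Function.uncurry (P.N u) = fun z => ∑ j, Function.uncurry
      (fun t x => duh (P.k j) (P.src j u) 0 t x) z := rfl
  rw [e]
  exact Finset.stronglyMeasurable_fun_sum _ fun j _ => stronglyMeasurable_duh_uncurry (P.meas_k j) (h j) 0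

variable (P) in
/-- The Picard iterates. -/
def picard (φ : Rn n → 𝕜) : ℕ → ℝ → Rn n → 𝕜
  | 0 => fun _ _ => 0
  | m + 1 => fun t x => P.lin φ t x + P.N (picard φ m) t x

theorem stronglyMeasurable_picard {φ : Rn n → 𝕜} (hφ : StronglyMeasurable φ) (m : ℕ) :
    StronglyMeasurable (Function.uncurry (P.picard φ m)) := by
  induction m with
  | zero => exact stronglyMeasurable_const
  | succ m ih => exact (stronglyMeasurable_lin hφ).add (stronglyMeasurable_N ih)

theorem stronglyMeasurable_slice {u : ℝ → Rn n → 𝕜} (hu : StronglyMeasurable (Function.uncurry u))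
    (t : ℝ) : StronglyMeasurable (u t) := hu.comp_measurable measurable_prodMk_left

/-- With R = 2CM the linear part takes R/2 of the ball and, for q ≤ 1/4, the nonlinear part at most
R/4, so the iterates stay in the ball. Consecutive differences shrink by at least a factor 1/2. -/
theorem picard_bound {φ : Rn n → 𝕜} (hφ : StronglyMeasurable φ) {M T : ℝ} (hM : 0 < M)
    (hφM : eLpNorm φ P.R volume ≤ ENNReal.ofReal M) (hT : 0 < T)
    (hq : P.q (2 * P.C * M) T ≤ 1 / 4) (m : ℕ) :
    P.YBound (2 * P.C * M) T (P.picard φ m) ∧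
      P.YBound (2 * P.C * M * (1 / 2) ^ m) T
        fun t x => P.picard φ (m + 1) t x - P.picard φ m t x := by
  have hC := P.C_pos
  set R := 2 * P.C * M with hR
  have hR0 : 0 < R := by positivity
  have hmeas : ∀ m t, AEStronglyMeasurable (P.picard φ m t) := fun m t =>
    (stronglyMeasurable_slice (stronglyMeasurable_picard hφ m) t).aestronglyMeasurable
  have hmeas' : ∀ m, AEStronglyMeasurable (Function.uncurry (P.picard φ m)) (slab n 0 T) := fun m =>
    (stronglyMeasurable_picard hφ m).aestronglyMeasurable
  have hlin := yBound_lin (P := P) hφ.aestronglyMeasurable hφM T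
  have hq0 : 0 ≤ P.q R T := q_nonneg hR0.le hT.le
  induction m with
  | zero =>
    refine ⟨yBound_zero R T, ?_⟩
    have : (fun t x => P.picard φ (0 + 1) t x - P.picard φ 0 t x) = P.lin φ := by
      funext t x; simp [picard, N_zero]
    rw [this]
    exact hlin.mono (by rw [hR]; nlinarith) le_rfl
  | succ m ih =>
    have hb : P.YBound R T (P.picard φ (m + 1)) := by
      have h1 : P.YBound (P.q R T * R) T fun t x => P.N (P.picard φ m) t x - P.N (fun _ _ => 0) t x :=
        YBound.N_sub hR0 hR0 (hmeas' m) (stronglyMeasurable_const.aestronglyMeasurable) ih.1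
          (yBound_zero R T) (by simpa using ih.1)
      simp only [N_zero, sub_zero] at h1
      have h2 := hlin.add h1 (fun t _ => (stronglyMeasurable_slice
        (stronglyMeasurable_lin hφ) t).aestronglyMeasurable) (fun t _ => (stronglyMeasurable_slice
        (stronglyMeasurable_N (stronglyMeasurable_picard hφ m)) t).aestronglyMeasurable)
        (by positivity) (by positivity)
      refine h2.mono ?_ le_rfl
      have : P.q R T * R ≤ 1 / 4 * R := by gcongr
      have : P.C * M = R / 2 := by rw [hR]; ring
      linarith
    refine ⟨hb, ?_⟩
    have h1 := YBound.N_sub hR0 (by positivity) (hmeas' (m + 1)) (hmeas' m) hb ih.1 ih.2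
    have e : (fun t x => P.picard φ (m + 1 + 1) t x - P.picard φ (m + 1) t x) =
        fun t x => P.N (P.picard φ (m + 1)) t x - P.N (P.picard φ m) t x := by
      funext t x; simp [picard]
    rw [e]
    refine h1.mono ?_ le_rfl
    calc _ ≤ 1 / 4 * (R * (1 / 2) ^ m) := by gcongr
      _ ≤ R * (1 / 2) ^ (m + 1) := by
        rw [pow_succ]; nlinarith [pow_pos (show (0 : ℝ) < 1 / 2 by norm_num) m]

/-- Local existence by iteration. -/
theorem exists_bSol {φ : Rn n → 𝕜} (hφ : MemLp φ P.R volume) {M T : ℝ} (hM : 0 < M)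
    (hφM : eLpNorm φ P.R volume ≤ ENNReal.ofReal M) (hT : 0 < T)
    (hq : P.q (2 * P.C * M) T ≤ 1 / 4) : ∃ u, P.BSol (2 * P.C * M) T φ u := by
  wlog hm : StronglyMeasurable φ generalizing φ
  · obtain ⟨ψ, hψ, he⟩ := hφ.1
    obtain ⟨u, hu⟩ := this ((memLp_congr_ae he).1 hφ) (by rwa [← eLpNorm_congr_ae he]) hψ
    refine ⟨u, hu.pos, hu.meas, hu.init.trans he.symm, hφ, hu.bound, fun t ht => ?_⟩
    filter_upwards [hu.eq t ht] with x hx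
    rw [hx, lin_congr he]
  have hC := P.C_pos
  set R := 2 * P.C * M with hR
  have hR0 : 0 < R := by positivity
  have hB := picard_bound hm hM hφM hT hq
  set U := P.picard φ with hU
  have hmeas := stronglyMeasurable_picard (P := P) hm
  have hmeas' : ∀ m t, AEStronglyMeasurable (U m t) := fun m t =>
    (stronglyMeasurable_slice (hmeas m) t).aestronglyMeasurable
  -- Taking the limit pointwise, with a default value where it does not exist, keeps joint
  -- measurability. Time zero is set by hand, because the iterates are controlled only for t > 0.
  set u : ℝ → Rn n → 𝕜 := fun t x => if t ≤ 0 then φ x else limUnder atTop fun m => U m t x with hu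
  have hum : StronglyMeasurable (Function.uncurry u) := by
    refine StronglyMeasurable.ite (measurableSet_le measurable_fst measurable_const)
      (hm.comp_measurable measurable_snd) ?_
    exact StronglyMeasurable.limUnder (f := fun m (z : ℝ × Rn n) => U m z.1 z.2) hmeas
  have hlim : ∀ t ∈ Ioo 0 T, ∀ᵐ x, Tendsto (fun m => U m t x) atTop (𝓝 (u t x)) := by
    intro t ht
    filter_upwards [ae_all_iff.2 fun m => ((hB m).2 t ht).2] with x hx
    have hts : 0 ≤ t ^ (-P.σ) := Real.rpow_nonneg ht.1.le _
    have hc : CauchySeq fun m => U m t x := by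
      refine cauchySeq_of_le_geometric (1 / 2) (R * t ^ (-P.σ)) (by norm_num) fun m => ?_
      have h1 := hx m
      rw [← ofReal_norm, ENNReal.ofReal_le_ofReal_iff (by positivity)] at h1
      rw [dist_comm, dist_eq_norm]
      refine h1.trans_eq (by ring)
    simp only [hu, if_neg (not_le.2 ht.1)]
    exact hc.tendsto_limUnder
  have hub : P.YBound R T u := YBound.lim (fun m => (hB m).1) (fun m t _ => hmeas' m t) hlim
  -- The exact partial geometric sum is carried, so that the induction on i closes without loss.
  have hdiff : ∀ m i, P.YBound (2 * R * (1 / 2) ^ m * (1 - (1 / 2) ^ i)) T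
      fun t x => U (m + i) t x - U m t x := by
    intro m i
    induction i with
    | zero => simpa using yBound_zero (P := P) 0 T
    | succ i ih =>
      have h1 := (hB (m + i)).2.add ih (fun t _ => (hmeas' _ t).sub (hmeas' _ t))
        (fun t _ => (hmeas' _ t).sub (hmeas' _ t)) (by positivity)
        (mul_nonneg (by positivity) (sub_nonneg.2 (pow_le_one₀ (by norm_num) (by norm_num))))
      simp only [sub_add_sub_cancel] at h1
      refine h1.mono (le_of_eq ?_) le_rfl
      rw [pow_add, pow_succ]; ring
  have hdl : ∀ m, P.YBound (2 * R * (1 / 2) ^ m) T fun t x => u t x - U m t x := by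
    intro m
    refine YBound.lim (w := fun i t x => U (m + i) t x - U m t x) (fun i => (hdiff m i).mono ?_ le_rfl)
      (fun i t _ => (hmeas' _ t).sub (hmeas' _ t)) fun t ht => ?_
    · have : (0 : ℝ) < (1 / 2) ^ i := by positivity
      have : 0 < 2 * R * (1 / 2) ^ m := by positivity
      nlinarith
    · filter_upwards [hlim t ht] with x hx
      refine Tendsto.sub_const ?_ _
      simp_rw [add_comm m]
      exact (tendsto_add_atTop_iff_nat (f := fun i => U i t x) m).2 hx
  refine ⟨u, hR0, hum.aestronglyMeasurable, ?_, hφ, hub, fun t ht => ?_⟩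
  · exact Eventually.of_forall fun x => by simp [hu]
  -- The contraction estimate also gives pointwise convergence of the nonlinear terms, so the
  -- recursion passes to the limit.
  · have hN : ∀ m, P.YBound (P.q R T * (2 * R * (1 / 2) ^ m)) T
        fun t x => P.N u t x - P.N (U m) t x := fun m =>
      YBound.N_sub hR0 (by positivity) hum.aestronglyMeasurable (hmeas m).aestronglyMeasurable hub
        (hB m).1 (hdl m)
    filter_upwards [hlim t ht, ae_all_iff.2 fun m => ((hN m) t ht).2] with x hx hx'
    have hts : 0 ≤ t ^ (-P.σ) := Real.rpow_nonneg ht.1.le _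
    have hq0 : 0 ≤ P.q R T := q_nonneg hR0.le hT.le
    have h1 : Tendsto (fun m => P.N (U m) t x) atTop (𝓝 (P.N u t x)) := by
      rw [tendsto_iff_norm_sub_tendsto_zero]
      refine squeeze_zero (fun _ => norm_nonneg _) (g := fun m : ℕ =>
        P.q R T * (2 * R * (1 / 2) ^ m) * t ^ (-P.σ)) (fun m => ?_) ?_
      · have h1 := hx' m
        rw [← ofReal_norm, ENNReal.ofReal_le_ofReal_iff (by positivity)] at h1
        rwa [norm_sub_rev]
      · have := (tendsto_pow_atTop_nhds_zero_of_lt_one (r := (1 / 2 : ℝ)) (by norm_num)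
          (by norm_num)).const_mul (P.q R T * (2 * R) * t ^ (-P.σ))
        rw [mul_zero] at this
        refine this.congr fun m => by ring
    have h2 : Tendsto (fun m => U (m + 1) t x) atTop (𝓝 (P.lin φ t x + P.N u t x)) :=
      h1.const_add _
    exact tendsto_nhds_unique ((tendsto_add_atTop_iff_nat 1).2 hx) h2

end MildSystem
end FracDissip

/-! ### Restarting, uniqueness and gluing of bounded solutions. -/

namespace FracDissip

section Shift

variable {n : ℕ} {𝕜 : Type*} [RCLike 𝕜]

theorem measurePreserving_slab_shift (s a b : ℝ) :
    MeasurePreserving (fun z : ℝ × Rn n => (s + z.1, z.2)) (slab n a b) (slab n (s + a) (s + b)) := by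
  have h := (measurePreserving_add_left volume s).restrict_preimage
    (measurableSet_Ioo (a := s + a) (b := s + b))
  have e : (fun x => s + x) ⁻¹' Ioo (s + a) (s + b) = Ioo a b := by ext x; simp
  rw [e] at h
  exact h.prod (MeasurePreserving.id volume)

theorem aestronglyMeasurable_shift {u : ℝ → Rn n → 𝕜} {s a b : ℝ}
    (hu : AEStronglyMeasurable (Function.uncurry u) (slab n (s + a) (s + b))) :
    AEStronglyMeasurable (Function.uncurry fun τ => u (s + τ)) (slab n a b) :=
  hu.comp_measurePreserving (measurePreserving_slab_shift s a b)

theorem duh_shift (k : ℝ → Rn n → ℝ) (F : ℝ → Rn n → 𝕜) (s t : ℝ) (x : Rn n) :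
    duh k (fun τ => F (s + τ)) 0 t x = duh k F s (s + t) x := by
  have e : (fun x => s + x) ⁻¹' Ioo s (s + t) = Ioo 0 t := by ext x; simp
  have h := (measurePreserving_add_left volume s).setIntegral_preimage_emb
    (measurableEmbedding_addLeft s) (fun τ => conv (k (s + t - τ)) (F τ) x) (Ioo s (s + t))
  simp only [e, add_sub_add_left_eq_sub] at h
  exact h

end Shift

namespace MildSystem

variable {n : ℕ} {𝕜 : Type*} [RCLike 𝕜] {P : MildSystem n 𝕜}

theorem aconv_ne_top {g : Rn n → ℝ≥0∞} (hg : AEMeasurable g) (hgt : eLpNorm g P.R volume ≠ ∞)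
    {t : ℝ} (ht : 0 < t) (x : Rn n) : aconv (P.k 0 t) g x ≠ ∞ :=
  ne_top_of_le_ne_top (ENNReal.mul_ne_top ENNReal.ofReal_ne_top hgt) (aconv_le g hg ht x)

/-- The integral equation can be restarted at a later time. -/
theorem restart {φ : Rn n → 𝕜} (hφ : MemLp φ P.R volume) {u : ℝ → Rn n → 𝕜} {s t : ℝ} (hs : 0 < s)
    (hst : s < t) (hm : AEStronglyMeasurable (Function.uncurry u) (slab n 0 t))
    (heq : ∀ᵐ x, u s x = P.lin φ s x + P.N u s x)
    (hfs : ∀ j, ∀ᵐ y, aduh (P.k j) (fun τ y => ‖P.src j u τ y‖ₑ) 0 s y ≠ ∞) {x : Rn n}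
    (hfc : ∀ j, aconv (P.k 0 (t - s)) (aduh (P.k j) (fun τ y => ‖P.src j u τ y‖ₑ) 0 s) x ≠ ∞)
    (hft : ∀ j, aduh (P.k j) (fun τ y => ‖P.src j u τ y‖ₑ) 0 t x ≠ ∞) :
    P.lin φ t x + P.N u t x = P.lin (u s) (t - s) x + ∑ j, duh (P.k j) (P.src j u) s t x := by
  have hts : 0 < t - s := by linarith
  have hms := measurable_slab_mono hm le_rfl hst.le
  have hK := meas_slice (P := P) 0 (t - s)
  have hmsrc := fun j => P.aestronglyMeasurable_src j hm
  have hmsrcs := fun j => P.aestronglyMeasurable_src j hms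
  -- Apply the kernel at time t - s to the equation at time s. By the semigroup identity the linear
  -- part becomes the linear part at t, and each Duhamel term becomes its own portion over (0, s) at
  -- time t.
  have h1 : P.lin (u s) (t - s) x = conv (P.k 0 (t - s)) (fun y => P.lin φ s y +
      (duh (P.k 0) (P.src 0 u) 0 s y + duh (P.k 1) (P.src 1 u) 0 s y)) x := by
    refine conv_congr ?_ x
    filter_upwards [heq] with y hy
    rw [hy, N, Fin.sum_univ_two]
  have hmd := fun j => aestronglyMeasurable_duh (P.meas_k j) (hmsrcs j)
  have hfd : ∀ j, aconv (P.k 0 (t - s)) (fun y => ‖duh (P.k j) (P.src j u) 0 s y‖ₑ) x ≠ ∞ := fun j =>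
    ne_top_of_le_ne_top (hfc j) (aconv_mono (Eventually.of_forall fun y => enorm_duh_le _ _ _ _ y) x)
  have hml : AEStronglyMeasurable (P.lin φ s) :=
    aestronglyMeasurable_conv (meas_slice 0 s) hφ.1
  have hfl0 : aconv (P.k 0 (t - s)) (aconv (P.k 0 s) fun y => ‖φ y‖ₑ) x ≠ ∞ := by
    refine aconv_ne_top (aemeasurable_aconv (meas_slice 0 s) hφ.1.enorm) ?_ hts x
    refine ne_top_of_le_ne_top (ENNReal.mul_ne_top ENNReal.ofReal_ne_top ?_)
      (eLpNorm_aconv_le _ hφ.1.enorm hs)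
    rw [eLpNorm_enorm]; exact hφ.2.ne
  have hfl : aconv (P.k 0 (t - s)) (fun y => ‖P.lin φ s y‖ₑ) x ≠ ∞ :=
    ne_top_of_le_ne_top hfl0 (aconv_mono (Eventually.of_forall fun y => enorm_conv_le _ _ y) x)
  have hfd2 : aconv (P.k 0 (t - s)) (fun y => ‖duh (P.k 0) (P.src 0 u) 0 s y +
      duh (P.k 1) (P.src 1 u) 0 s y‖ₑ) x ≠ ∞ := by
    refine ne_top_of_le_ne_top (ENNReal.add_ne_top.2 ⟨hfd 0, hfd 1⟩) ?_
    rw [← aconv_add hK (hmd 0).enorm]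
    exact aconv_mono (Eventually.of_forall fun y => enorm_add_le _ _) x
  have hlin : conv (P.k 0 (t - s)) (P.lin φ s) x = P.lin φ t x := by
    refine conv_conv hK (meas_slice 0 s) (fun y => ?_) hφ.1 hfl0
    rw [P.semi 0 _ _ hts hs, sub_add_cancel]
  have hduh : ∀ j, conv (P.k 0 (t - s)) (duh (P.k j) (P.src j u) 0 s) x
      = ∫ τ in Ioo 0 s, conv (P.k j (t - τ)) (P.src j u τ) x := by
    intro j
    have := conv_duh (h := t - s) hK (P.meas_k j) (fun τ hτ y => by
      rw [P.semi j _ _ hts (by linarith [hτ.2])]; congr 1; ring) (hmsrcs j) (hfs j) (hfc j)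
    simpa only [sub_add_cancel] using this
  rw [h1, conv_add (g' := fun y => duh (P.k 0) (P.src 0 u) 0 s y + duh (P.k 1) (P.src 1 u) 0 s y)
      hK hml ((hmd 0).add (hmd 1)) hfl hfd2, conv_add hK (hmd 0) (hmd 1) (hfd 0) (hfd 1),
    hlin, hduh, hduh, N, Fin.sum_univ_two, Fin.sum_univ_two,
    duh_split (P.meas_k 0) hs.le hst.le (hmsrc 0) (hft 0),
    duh_split (P.meas_k 1) hs.le hst.le (hmsrc 1) (hft 1)]
  ring

/-- For bounded functions all the finiteness conditions of the restart formula hold at every point,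
so the identity does as well. -/
theorem YBound.restart {R T : ℝ} (hR : 0 < R) {φ : Rn n → 𝕜} (hφ : MemLp φ P.R volume)
    {u : ℝ → Rn n → 𝕜} (hu : P.YBound R T u)
    (hm : AEStronglyMeasurable (Function.uncurry u) (slab n 0 T)) {s t : ℝ} (hs : 0 < s)
    (hst : s < t) (ht : t ≤ T) (heq : ∀ᵐ x, u s x = P.lin φ s x + P.N u s x) (x : Rn n) :
    P.lin φ t x + P.N u t x = P.lin (u s) (t - s) x + ∑ j, duh (P.k j) (P.src j u) s t x := by
  have hms := measurable_slab_mono hm le_rfl (hst.le.trans ht)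
  refine MildSystem.restart hφ hs hst (measurable_slab_mono hm le_rfl ht) heq
    (fun j => Eventually.of_forall fun y =>
      hu.aduh_src_ne_top j hR hm le_rfl hs (hst.le.trans ht) y) (fun j => ?_)
    (fun j => hu.aduh_src_ne_top j hR hm le_rfl (hs.trans hst) ht x)
  refine aconv_ne_top (aemeasurable_aduh (F := fun τ y => ‖P.src j u τ y‖ₑ) (P.meas_k j)
    (P.aestronglyMeasurable_src j hms).enorm) (ne_top_of_le_ne_top ENNReal.ofReal_ne_top
      (hu.aduh_src j hR hm le_rfl hs (hst.le.trans ht)).1) (by linarith) x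

variable {R T : ℝ} {φ : Rn n → 𝕜} {u v : ℝ → Rn n → 𝕜}

theorem aestronglyMeasurable_N {t : ℝ}
    (hm : AEStronglyMeasurable (Function.uncurry u) (slab n 0 t)) : AEStronglyMeasurable (P.N u t) := by
  have e : P.N u t = ∑ j, duh (P.k j) (P.src j u) 0 t := by
    funext x; simp [N]
  rw [e]
  exact Finset.aestronglyMeasurable_sum _ fun j _ =>
    aestronglyMeasurable_duh (P.meas_k j) (P.aestronglyMeasurable_src j hm)

theorem BSol.aestronglyMeasurable (hu : P.BSol R T φ u) {t : ℝ} (ht : t ∈ Ico 0 T) :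
    AEStronglyMeasurable (u t) := by
  rcases ht.1.eq_or_lt with rfl | h0
  · exact hu.mem.1.congr hu.init.symm
  · refine ((aestronglyMeasurable_conv (meas_slice (P := P) 0 t) hu.mem.1).add
      (aestronglyMeasurable_N (P := P) (measurable_slab_mono hu.meas le_rfl ht.2.le))).congr ?_
    filter_upwards [hu.eq t ⟨h0, ht.2⟩] with x hx using hx.symm

theorem BSol.memLp (hu : P.BSol R T φ u) {t : ℝ} (ht : t ∈ Ico 0 T) : MemLp (u t) P.R volume := by
  rcases ht.1.eq_or_lt with rfl | h0
  · exact (memLp_congr_ae hu.init).2 hu.mem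
  · exact ⟨hu.aestronglyMeasurable ht, (hu.bound t ⟨h0, ht.2⟩).1.trans_lt ENNReal.ofReal_lt_top⟩

theorem BSol.mono (hu : P.BSol R T φ u) {R' T' : ℝ} (hR : R ≤ R') (hT : T' ≤ T) :
    P.BSol R' T' φ u :=
  ⟨hu.pos.trans_le hR, measurable_slab_mono hu.meas le_rfl hT, hu.init, hu.mem, hu.bound.mono hR hT,
    fun t ht => hu.eq t ⟨ht.1, ht.2.trans_le hT⟩⟩

theorem BSol.congr_init (hu : P.BSol R T φ u) {ψ : Rn n → 𝕜} (h : φ =ᵐ[volume] ψ) :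
    P.BSol R T ψ u :=
  ⟨hu.pos, hu.meas, hu.init.trans h, (memLp_congr_ae h).1 hu.mem, hu.bound, fun t ht => by
    filter_upwards [hu.eq t ht] with x hx
    rw [hx, lin_congr h]⟩

theorem BSol.eq_restart (hu : P.BSol R T φ u) {s t : ℝ} (hs : 0 ≤ s) (hst : s < t) (ht : t < T) :
    ∀ᵐ x, u t x = P.lin (u s) (t - s) x + ∑ j, duh (P.k j) (P.src j u) s t x := by
  rcases hs.eq_or_lt with rfl | h0
  · filter_upwards [hu.eq t ⟨hst, ht⟩] with x hx
    rw [hx, sub_zero, lin_congr hu.init]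
    rfl
  · filter_upwards [hu.eq t ⟨h0.trans hst, ht⟩] with x hx
    rw [hx]
    exact hu.bound.restart hu.pos hu.mem hu.meas h0 hst ht.le (hu.eq s ⟨h0, hst.trans ht⟩) x

theorem N_shift (u : ℝ → Rn n → 𝕜) (s t : ℝ) (x : Rn n) :
    P.N (fun τ => u (s + τ)) t x = ∑ j, duh (P.k j) (P.src j u) s (s + t) x :=
  Finset.sum_congr rfl fun j _ => duh_shift (P.k j) (P.src j u) s t x

/-- The radius does not grow, since (s + t)^{-σ} ≤ t^{-σ}. -/
theorem BSol.shift (hu : P.BSol R T φ u) {s : ℝ} (hs : s ∈ Ico 0 T) :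
    P.BSol R (T - s) (u s) (fun τ => u (s + τ)) := by
  have hσ := P.σ_pos
  refine ⟨hu.pos, ?_, by simp, hu.memLp hs, fun t ht => ?_, fun t ht => ?_⟩
  · refine aestronglyMeasurable_shift ?_
    rw [add_zero, add_sub_cancel]
    exact measurable_slab_mono hu.meas hs.1 le_rfl
  · obtain ⟨h1, h2⟩ := hu.bound (s + t) ⟨by linarith [hs.1, ht.1], by linarith [ht.2]⟩
    refine ⟨h1, ?_⟩
    filter_upwards [h2] with x hx
    refine hx.trans (ENNReal.ofReal_le_ofReal (mul_le_mul_of_nonneg_left ?_ hu.pos.le))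
    exact Real.rpow_le_rpow_of_nonpos ht.1 (by linarith [hs.1]) (by linarith)
  · filter_upwards [hu.eq_restart hs.1 (show s < s + t by linarith [ht.1]) (by linarith [ht.2])]
      with x hx
    rw [hx, N_shift, add_sub_cancel_left]

theorem exists_q_le (P : MildSystem n 𝕜) (R : ℝ) {c : ℝ} (hc : 0 < c) : ∃ T, 0 < T ∧ P.q R T ≤ c := by
  have h : Tendsto (fun T => P.q R T) (𝓝 0) (𝓝 (P.q R 0)) := by
    refine tendsto_finsetSum _ fun j _ => ?_
    exact ((Real.continuousAt_rpow_const 0 (P.ω j) (Or.inr (P.ω_pos j).le)).tendsto).const_mul _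
  have h0 : P.q R 0 = 0 := by
    simp [q, Real.zero_rpow (P.ω_pos _).ne']
  rw [h0] at h
  have h2 := (h.mono_left (nhdsWithin_le_nhds (s := Ioi (0 : ℝ)))).eventually (gt_mem_nhds hc)
  obtain ⟨T, hT, hT0⟩ := (h2.and (self_mem_nhdsWithin (s := Ioi (0 : ℝ)))).exists
  exact ⟨T, hT0, hT.le⟩

theorem YBound.congr {B T : ℝ} {v w : ℝ → Rn n → 𝕜} (h : P.YBound B T v)
    (he : ∀ t ∈ Ioo 0 T, v t =ᵐ[volume] w t) : P.YBound B T w := by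
  intro t ht
  refine ⟨(eLpNorm_congr_ae (he t ht)).symm.trans_le (h t ht).1, ?_⟩
  filter_upwards [(h t ht).2, he t ht] with x hx hx'
  rwa [← hx']

theorem q_mono {R T T' : ℝ} (hR : 0 ≤ R) (hT : 0 ≤ T) (h : T ≤ T') : P.q R T ≤ P.q R T' := by
  refine Finset.sum_le_sum fun j _ => ?_
  have := P.D_pos j
  have := P.b_pos j
  exact mul_le_mul_of_nonneg_left (Real.rpow_le_rpow hT h (P.ω_pos j).le) (by positivity)

/-- Iterating the contraction estimate on the difference improves its bound from 2R to 2R/4^m for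
every m. -/
theorem BSol.unique_of_small (hu : P.BSol R T φ u) (hv : P.BSol R T φ v) (hq : P.q R T ≤ 1 / 4)
    {t : ℝ} (ht : t ∈ Ioo 0 T) : u t =ᵐ[volume] v t := by
  have hR := hu.pos
  have hT : 0 < T := ht.1.trans ht.2
  have hmu : ∀ t ∈ Ioo 0 T, AEStronglyMeasurable (u t) := fun t ht =>
    hu.aestronglyMeasurable (Ioo_subset_Ico_self ht)
  have hmv : ∀ t ∈ Ioo 0 T, AEStronglyMeasurable (v t) := fun t ht =>
    hv.aestronglyMeasurable (Ioo_subset_Ico_self ht)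
  have h : ∀ m : ℕ, P.YBound (2 * R * (1 / 4) ^ m) T fun t x => u t x - v t x := by
    intro m
    induction m with
    | zero => exact (hu.bound.sub hv.bound hmu hmv hR.le hR.le).mono (by linarith) le_rfl
    | succ m ih =>
      refine (YBound.mono (YBound.N_sub hR (by positivity) hu.meas hv.meas hu.bound hv.bound ih)
        ?_ le_rfl).congr fun t ht => ?_
      · rw [pow_succ]
        have : (0 : ℝ) < 2 * R * (1 / 4) ^ m := by positivity
        nlinarith
      · filter_upwards [hu.eq t ht, hv.eq t ht] with x hx hx'
        rw [hx, hx', add_sub_add_left_eq_sub]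
  have hlim : Tendsto (fun m : ℕ => ENNReal.ofReal (2 * R * (1 / 4) ^ m)) atTop (𝓝 0) := by
    rw [← ENNReal.ofReal_zero]
    refine ENNReal.tendsto_ofReal ?_
    simpa using (tendsto_pow_atTop_nhds_zero_of_lt_one (r := (1 / 4 : ℝ)) (by norm_num)
      (by norm_num)).const_mul (2 * R)
  have h0 : eLpNorm (fun x => u t x - v t x) P.R volume = 0 :=
    le_antisymm (ge_of_tendsto' hlim fun m => (h m t ht).1) zero_le
  rw [eLpNorm_eq_zero_iff (f := fun x => u t x - v t x) ((hmu t ht).sub (hmv t ht)) (by simpa using P.r_pos)] at h0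
  filter_upwards [h0] with x hx
  exact sub_eq_zero.1 hx

theorem BSol.unique {R' : ℝ} (hu : P.BSol R T φ u) (hv : P.BSol R' T φ v) {t : ℝ}
    (ht : t ∈ Ico 0 T) : u t =ᵐ[volume] v t := by
  wlog hRR : R = R' generalizing R R'
  · exact this (hu.mono (le_max_left R R') le_rfl) (hv.mono (le_max_right R R') le_rfl) rfl
  subst hRR
  obtain ⟨ℓ, hℓ, hq⟩ := P.exists_q_le R (c := 1 / 4) (by norm_num)
  -- Advance by ℓ/2: that time lies strictly inside the interval of local uniqueness, and the
  -- translates there are bounded solutions with a common datum and the same R. Hence the induction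
  -- is over all data and solutions at once.
  have key : ∀ m : ℕ, ∀ (T : ℝ) (φ : Rn n → 𝕜) (u v : ℝ → Rn n → 𝕜), P.BSol R T φ u →
      P.BSol R T φ v → ∀ t ∈ Ioo 0 T, t < m * (ℓ / 2) → u t =ᵐ[volume] v t := by
    intro m
    induction m with
    | zero => intro T φ u v hu hv t ht h; simp at h; linarith [ht.1]
    | succ m ih =>
      intro T φ u v hu hv t ht h
      have hT : 0 < T := ht.1.trans ht.2
      have hloc : ∀ t ∈ Ioo 0 T, t < ℓ → u t =ᵐ[volume] v t := by
        intro t ht h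
        have hmin : 0 < min T ℓ := lt_min hT hℓ
        exact (hu.mono le_rfl (min_le_left T ℓ)).unique_of_small
          (hv.mono le_rfl (min_le_left T ℓ))
          ((q_mono hu.pos.le hmin.le (min_le_right _ _)).trans hq) ⟨ht.1, lt_min ht.2 h⟩
      rcases lt_or_ge t ℓ with h' | h'
      · exact hloc t ht h'
      · have hs : ℓ / 2 ∈ Ioo 0 T := ⟨by positivity, by linarith [ht.2]⟩
        have e := hloc (ℓ / 2) hs (by linarith)
        have h1 := hu.shift (Ioo_subset_Ico_self hs)
        have h2 := (hv.shift (Ioo_subset_Ico_self hs)).congr_init e.symm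
        have := ih _ _ _ _ h1 h2 (t - ℓ / 2) ⟨by linarith, by linarith [ht.2]⟩
          (by push_cast at h; linarith)
        simpa using this
  rcases ht.1.eq_or_lt with rfl | h0
  · exact hu.init.trans hv.init.symm
  · obtain ⟨m, hm⟩ := exists_nat_gt (t / (ℓ / 2))
    rw [div_lt_iff₀ (by positivity)] at hm
    exact key m T φ u v hu hv t ⟨h0, ht.2⟩ hm

/-- Gluing of a solution with a solution that starts from a later value. -/
theorem BSol.glue {R' L s : ℝ} {w : ℝ → Rn n → 𝕜} (hu : P.BSol R T φ u) (hs : s ∈ Ioo 0 T)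
    (hw : P.BSol R' L (u s) w) (hL : 0 < L) :
    ∃ R'' v, P.BSol R'' (s + L) φ v ∧ ∀ t ∈ Ico 0 (s + L), t < T → v t =ᵐ[volume] u t := by
  have hσ := P.σ_pos
  have hR := hu.pos
  have hR' := hw.pos
  -- The switch to w takes place strictly after s, because the bound of w(t - s) is singular at t =
  -- s; on the overlap both functions agree by uniqueness.
  obtain ⟨s', hs1, hs2⟩ : ∃ s', s < s' ∧ s' < min T (s + L) :=
    exists_between (lt_min hs.2 (by linarith))
  have hs'T : s' < T := hs2.trans_le (min_le_left _ _)
  have hs'L : s' < s + L := hs2.trans_le (min_le_right _ _)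
  have hs0 := hs.1
  have hover : ∀ t, s ≤ t → t < T → t < s + L → w (t - s) =ᵐ[volume] u t := by
    intro t h1 h2 h3
    have hmin : 0 < min (T - s) L := lt_min (by linarith) hL
    have e := (hw.mono le_rfl (min_le_right (T - s) L)).unique
      ((hu.shift (Ioo_subset_Ico_self hs)).mono le_rfl (min_le_left (T - s) L))
      (t := t - s) ⟨by linarith, lt_min (by linarith) (by linarith)⟩
    simpa using e
  set v : ℝ → Rn n → 𝕜 := fun t x => if t < s' then u t x else w (t - s) x with hv
  have hv1 : ∀ t < s', v t = u t := fun t ht => by funext x; simp [hv, ht]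
  have hv2 : ∀ t, s' ≤ t → v t = w (t - s) := fun t ht => by funext x; simp [hv, not_lt.2 ht]
  have hvu : ∀ t, t < T → t < s + L → v t =ᵐ[volume] u t := by
    intro t h2 h3
    rcases lt_or_ge t s' with h | h
    · rw [hv1 t h]
    · rw [hv2 t h]; exact hover t (by linarith) h2 h3
  have hvw : ∀ t, s ≤ t → t < s + L → v t =ᵐ[volume] w (t - s) := by
    intro t h2 h3
    rcases lt_or_ge t s' with h | h
    · rw [hv1 t h]; exact (hover t h2 (by linarith) h3).symm
    · rw [hv2 t h]
  have hm : AEStronglyMeasurable (Function.uncurry v) (slab n 0 (s + L)) := by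
    have hS : MeasurableSet {z : ℝ × Rn n | z.1 < s'} :=
      measurableSet_lt measurable_fst measurable_const
    have h1 : AEStronglyMeasurable (Function.uncurry u)
        ((slab n 0 (s + L)).restrict {z | z.1 < s'}) := by
      refine hu.meas.mono_measure ?_
      rw [slab_eq, slab_eq, Measure.restrict_restrict hS]
      have hsub : {z : ℝ × Rn n | z.1 < s'} ∩ Ioo 0 (s + L) ×ˢ univ ⊆ Ioo 0 T ×ˢ univ :=
        fun z hz => ⟨⟨hz.2.1.1, lt_trans hz.1 hs'T⟩, trivial⟩
      exact Measure.restrict_mono hsub le_rfl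
    have h2 : AEStronglyMeasurable (fun z : ℝ × Rn n => w (z.1 - s) z.2)
        ((slab n 0 (s + L)).restrict {z | z.1 < s'}ᶜ) := by
      have h3 := aestronglyMeasurable_shift (u := w) (s := -s) (a := s) (b := s + L)
        (by simpa using hw.meas)
      have h4 : AEStronglyMeasurable (fun z : ℝ × Rn n => w (z.1 - s) z.2) (slab n s (s + L)) := by
        refine h3.congr (Eventually.of_forall fun z => ?_)
        simp [Function.uncurry, sub_eq_neg_add]
      refine h4.mono_measure ?_
      rw [slab_eq, slab_eq, Measure.restrict_restrict hS.compl]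
      have hsub : {z : ℝ × Rn n | z.1 < s'}ᶜ ∩ Ioo 0 (s + L) ×ˢ univ ⊆ Ioo s (s + L) ×ˢ univ :=
        fun z hz => ⟨⟨hs1.trans_le (not_lt.1 hz.1), hz.2.1.2⟩, trivial⟩
      exact Measure.restrict_mono hsub le_rfl
    classical
    have h5 := AEStronglyMeasurable.piecewise hS h1 h2
    refine h5.congr (Eventually.of_forall fun z => ?_)
    by_cases h : z.1 < s' <;> simp [Set.piecewise, h, hv, Function.uncurry]
  -- Chosen so that t - s ≥ c t for all t in [s', s + L), which turns the weight (t-s)^{-σ} into a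
  -- multiple of t^{-σ}.
  set c : ℝ := (s' - s) / (s + L) with hc
  have hc0 : 0 < c := div_pos (by linarith) (by linarith)
  set R'' := R + R' + R' * c ^ (-P.σ) with hR''
  have hRc : 0 < R' * c ^ (-P.σ) := by positivity
  have hb : P.YBound R'' (s + L) v := by
    intro t ht
    have ht0 := ht.1
    rcases lt_or_ge t s' with h | h
    · rw [hv1 t h]
      exact hu.bound.mono (show R ≤ R'' by linarith) le_rfl t ⟨ht.1, by linarith⟩
    · rw [hv2 t h]
      obtain ⟨h1, h2⟩ := hw.bound (t - s) ⟨by linarith, by linarith [ht.2]⟩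
      refine ⟨h1.trans (ENNReal.ofReal_le_ofReal (by linarith)), ?_⟩
      filter_upwards [h2] with x hx
      refine hx.trans (ENNReal.ofReal_le_ofReal ?_)
      have h3 : c * t ≤ t - s := by
        have : t / (s + L) ≤ 1 := by rw [div_le_one (by linarith)]; exact ht.2.le
        calc c * t = (s' - s) * (t / (s + L)) := by rw [hc]; ring
          _ ≤ (s' - s) * 1 := by gcongr
          _ ≤ t - s := by linarith
      calc R' * (t - s) ^ (-P.σ) ≤ R' * (c * t) ^ (-P.σ) := by
            refine mul_le_mul_of_nonneg_left ?_ hR'.le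
            exact Real.rpow_le_rpow_of_nonpos (by positivity) h3 (by linarith)
        _ = R' * c ^ (-P.σ) * t ^ (-P.σ) := by rw [Real.mul_rpow hc0.le ht0.le]; ring
        _ ≤ R'' * t ^ (-P.σ) := by gcongr; linarith
  have hR''0 : 0 < R'' := by linarith
  have heq1 : ∀ t ∈ Ioo 0 (s + L), t < s' → ∀ᵐ x, v t x = P.lin φ t x + P.N v t x := by
    intro t ht h
    filter_upwards [hu.eq t ⟨ht.1, h.trans hs'T⟩] with x hx
    rw [hv1 t h, hx, N_congr (u := v) (v := u) fun τ hτ => ?_]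
    rw [hv1 τ (hτ.2.trans h)]
  refine ⟨R'', v, ⟨hR''0, hm, ?_, hu.mem, hb, fun t ht => ?_⟩, fun t ht h => hvu t h ht.2⟩
  · rw [hv1 0 (hs0.trans hs1)]; exact hu.init
  · rcases lt_or_ge t s' with h | h
    · exact heq1 t ht h
    · have hst : s < t := hs1.trans_le h
      -- Beyond s' the restart formula for v at time s reduces its equation to that of w, the
      -- shifted source of v being that of w almost everywhere.
      filter_upwards [hw.eq (t - s) ⟨by linarith, by linarith [ht.2]⟩] with x hx
      rw [hb.restart hR''0 hu.mem hm hs0 hst ht.2.le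
        (heq1 s ⟨hs0, by linarith⟩ hs1) x, hv2 t h, hx, hv1 s hs1]
      congr 1
      have e := N_shift (P := P) v s (t - s) x
      rw [add_sub_cancel] at e
      rw [← e]
      refine (N_congr (u := fun τ => v (s + τ)) (v := w) (fun τ hτ => ?_) x).symm
      have := hvw (s + τ) (by linarith [hτ.1]) (by linarith [hτ.2, ht.2])
      simpa using this

/-! ### Continuity in time with values in Lʳ. -/

variable (P) in
/-- The modulus of continuity of a solution along the linear evolution. -/
def modulus (R h : ℝ) : ℝ := ∑ j, P.D j * ((P.b j + 1) * R ^ P.b j * R) * h ^ P.ω j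

theorem tendsto_modulus (R : ℝ) : Tendsto (P.modulus R) (𝓝 0) (𝓝 0) := by
  have h : Tendsto (P.modulus R) (𝓝 0) (𝓝 (P.modulus R 0)) := by
    refine tendsto_finsetSum _ fun j _ => ?_
    exact ((Real.continuousAt_rpow_const 0 (P.ω j) (Or.inr (P.ω_pos j).le)).tendsto).const_mul _
  rwa [show P.modulus R 0 = 0 by simp [modulus, Real.zero_rpow (P.ω_pos _).ne']] at h

/-- After a restart at s the remainder is a Duhamel integral over (s, t), and the bound depends on R
and t - s only. -/
theorem BSol.eLpNorm_sub_lin_le (hu : P.BSol R T φ u) {s t : ℝ} (hs : 0 ≤ s) (hst : s < t)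
    (ht : t < T) : eLpNorm (fun x => u t x - P.lin (u s) (t - s) x) P.R volume
      ≤ ENNReal.ofReal (P.modulus R (t - s)) := by
  have hR := hu.pos
  have hms := measurable_slab_mono hu.meas hs ht.le
  calc _ ≤ eLpNorm (∑ j, aduh (P.k j) (fun τ y => ‖P.src j u τ y‖ₑ) s t) P.R volume := by
        refine eLpNorm_mono_enorm_ae ?_
        filter_upwards [hu.eq_restart hs hst ht] with x hx
        rw [hx, add_sub_cancel_left, Finset.sum_apply, enorm_eq_self]
        exact (enorm_sum_le _ _).trans (Finset.sum_le_sum fun j _ => enorm_duh_le _ _ _ _ _)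
    _ ≤ ∑ j, eLpNorm (aduh (P.k j) (fun τ y => ‖P.src j u τ y‖ₑ) s t) P.R volume :=
        eLpNorm_sum_le (fun j _ => (aemeasurable_aduh (F := fun τ y => ‖P.src j u τ y‖ₑ) (P.meas_k j)
          (P.aestronglyMeasurable_src j hms).enorm).aestronglyMeasurable) P.one_le_R
    _ ≤ ∑ j, ENNReal.ofReal (P.D j * ((P.b j + 1) * R ^ P.b j * R) * (t - s) ^ P.ω j) := by
        gcongr with j
        exact (hu.bound.aduh_src j hR hu.meas hs hst ht.le).1
    _ = _ := by
        rw [← ENNReal.ofReal_sum_of_nonneg]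
        · rfl
        · intro j _
          have := P.D_pos j; have := P.b_pos j
          have : 0 < t - s := by linarith
          positivity

theorem eLpNorm_lin_le {ψ : Rn n → 𝕜} (hψ : AEStronglyMeasurable ψ) {t : ℝ} (ht : 0 < t) :
    eLpNorm (P.lin ψ t) P.R volume ≤ ENNReal.ofReal P.C * eLpNorm ψ P.R volume := by
  refine (eLpNorm_mono_enorm fun x => ?_).trans
    ((eLpNorm_aconv_le (P := P) (fun y => ‖ψ y‖ₑ) hψ.enorm ht).trans_eq (by rw [eLpNorm_enorm]))
  rw [enorm_eq_self]
  exact enorm_conv_le _ _ _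

theorem lin_lin {ψ : Rn n → 𝕜} (hψ : MemLp ψ P.R volume) {s t : ℝ} (hs : 0 < s) (ht : 0 < t)
    (x : Rn n) : P.lin (P.lin ψ s) t x = P.lin ψ (t + s) x := by
  refine conv_conv (meas_slice 0 t) (meas_slice 0 s) (fun y => P.semi 0 _ _ ht hs y) hψ.1 ?_
  refine aconv_ne_top (aemeasurable_aconv (meas_slice 0 s) hψ.1.enorm) ?_ ht x
  refine ne_top_of_le_ne_top (ENNReal.mul_ne_top ENNReal.ofReal_ne_top ?_)
    (eLpNorm_aconv_le _ hψ.1.enorm hs)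
  rw [eLpNorm_enorm]; exact hψ.2.ne

theorem lin_sub {ψ ψ' : Rn n → 𝕜} (hψ : MemLp ψ P.R volume) (hψ' : MemLp ψ' P.R volume) {t : ℝ}
    (ht : 0 < t) (x : Rn n) : P.lin (fun y => ψ y - ψ' y) t x = P.lin ψ t x - P.lin ψ' t x :=
  conv_sub (meas_slice 0 t) hψ.1 hψ'.1
    (aconv_ne_top hψ.1.enorm (by rw [eLpNorm_enorm]; exact hψ.2.ne) ht x)
    (aconv_ne_top hψ'.1.enorm (by rw [eLpNorm_enorm]; exact hψ'.2.ne) ht x)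

theorem memLp_lin {ψ : Rn n → 𝕜} (hψ : MemLp ψ P.R volume) {t : ℝ} (ht : 0 < t) :
    MemLp (P.lin ψ t) P.R volume :=
  ⟨aestronglyMeasurable_conv (meas_slice 0 t) hψ.1,
    (eLpNorm_lin_le hψ.1 ht).trans_lt (ENNReal.mul_lt_top ENNReal.ofReal_lt_top hψ.2)⟩

/-- Compare u(s) with the linear evolution of u(t): the nonlinear remainder vanishes with s - t, and
the linear evolution tends to u(t) because the semigroup approximates the identity. -/
theorem BSol.tendsto_right (hu : P.BSol R T φ u) {t : ℝ} (ht : t ∈ Ico 0 T) :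
    Tendsto (fun s => eLpNorm (u s - u t) P.R volume) (𝓝[Ioo t T] t) (𝓝 0) := by
  have hsub : Tendsto (fun s => s - t) (𝓝[Ioo t T] t) (𝓝[>] 0) := by
    refine tendsto_nhdsWithin_iff.2 ⟨?_, ?_⟩
    · have : Tendsto (fun s => s - t) (𝓝 t) (𝓝 (t - t)) := tendsto_id.sub_const t
      rw [sub_self] at this
      exact this.mono_left nhdsWithin_le_nhds
    · filter_upwards [self_mem_nhdsWithin] with s hs
      exact sub_pos.2 hs.1
  have h1 := (P.approx (u t) (hu.memLp ht)).comp hsub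
  have h2 := ENNReal.tendsto_ofReal ((tendsto_modulus (P := P) R).comp
    (hsub.mono_right nhdsWithin_le_nhds))
  rw [ENNReal.ofReal_zero] at h2
  have h3 := h2.add h1
  rw [add_zero] at h3
  refine tendsto_of_tendsto_of_tendsto_of_le_of_le' tendsto_const_nhds h3
    (Eventually.of_forall fun _ => zero_le) ?_
  filter_upwards [self_mem_nhdsWithin] with s hs
  have hml := memLp_lin (P := P) (hu.memLp ht) (sub_pos.2 hs.1)
  have e : u s - u t = (fun x => u s x - P.lin (u t) (s - t) x) +
      fun x => P.lin (u t) (s - t) x - u t x := by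
    funext x; simp
  rw [e]
  refine (eLpNorm_add_le ((hu.aestronglyMeasurable ⟨ht.1.trans hs.1.le, hs.2⟩).sub hml.1)
    (hml.1.sub (hu.aestronglyMeasurable ht)) P.one_le_R).trans ?_
  exact add_le_add (hu.eLpNorm_sub_lin_le ht.1 hs.1 hs.2) le_rfl

/-- Starting at s is useless, since the approximation of the identity is not uniform in the datum.
Fix s₀ < t with t - s₀ small instead and compare both u(s) and u(t) with the linear evolution of
u(s₀). The linear difference is S(s-s₀) applied to (S(t-s) - 1)u(s₀), where the datum is fixed. -/
theorem BSol.tendsto_left (hu : P.BSol R T φ u) {t : ℝ} (ht : t ∈ Ioo 0 T) :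
    Tendsto (fun s => eLpNorm (u s - u t) P.R volume) (𝓝[Ioo 0 t] t) (𝓝 0) := by
  rw [ENNReal.tendsto_nhds_zero]
  intro ε hε
  have hε3 : 0 < ε / 3 := ENNReal.div_pos hε.ne' (by simp)
  have hmod := ENNReal.tendsto_ofReal (tendsto_modulus (P := P) R)
  rw [ENNReal.ofReal_zero] at hmod
  obtain ⟨δ, hδ, hδm⟩ := Metric.eventually_nhds_iff.1 (ENNReal.tendsto_nhds_zero.1 hmod (ε / 3) hε3)
  set s₀ := max (t / 2) (t - δ / 2) with hs₀
  have hs₀0 : 0 < s₀ := lt_max_of_lt_left (by linarith [ht.1])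
  have hs₀t : s₀ < t := max_lt (by linarith [ht.1]) (by linarith)
  have hs₀δ : t - s₀ < δ := by have := le_max_right (t / 2) (t - δ / 2); linarith
  have hms₀ := hu.memLp (t := s₀) ⟨hs₀0.le, hs₀t.trans ht.2⟩
  have hsub : Tendsto (fun s => t - s) (𝓝[Ioo 0 t] t) (𝓝[>] 0) := by
    refine tendsto_nhdsWithin_iff.2 ⟨?_, ?_⟩
    · have : Tendsto (fun s => t - s) (𝓝 t) (𝓝 (t - t)) := tendsto_const_nhds.sub tendsto_id
      rw [sub_self] at this
      exact this.mono_left nhdsWithin_le_nhds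
    · filter_upwards [self_mem_nhdsWithin] with s hs
      exact sub_pos.2 hs.2
  have h1 := ENNReal.Tendsto.const_mul (a := ENNReal.ofReal P.C)
    ((P.approx (u s₀) hms₀).comp hsub) (Or.inr ENNReal.ofReal_ne_top)
  rw [mul_zero] at h1
  filter_upwards [self_mem_nhdsWithin, ENNReal.tendsto_nhds_zero.1 h1 (ε / 3) hε3,
    mem_nhdsWithin_of_mem_nhds (Ioi_mem_nhds hs₀t)] with s hs h2 hs₀s
  have hs₀s : s₀ < s := hs₀s
  have hmt := memLp_lin (P := P) hms₀ (sub_pos.2 hs₀t)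
  have hms := memLp_lin (P := P) hms₀ (sub_pos.2 hs₀s)
  have hus := hu.aestronglyMeasurable (t := s) ⟨hs.1.le, hs.2.trans ht.2⟩
  have hut := hu.aestronglyMeasurable (t := t) ⟨ht.1.le, ht.2⟩
  have e : u s - u t = ((fun x => u s x - P.lin (u s₀) (s - s₀) x) -
      fun x => u t x - P.lin (u s₀) (t - s₀) x) -
      fun x => P.lin (u s₀) (t - s₀) x - P.lin (u s₀) (s - s₀) x := by
    funext x
    simp only [Pi.sub_apply]
    ring
  have hmod' : ∀ τ, s₀ < τ → τ ≤ t → eLpNorm (fun x => u τ x - P.lin (u s₀) (τ - s₀) x) P.R volume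
      ≤ ε / 3 := fun τ h h' => (hu.eLpNorm_sub_lin_le hs₀0.le h (h'.trans_lt ht.2)).trans
    (hδm (by rw [Real.dist_eq, sub_zero, abs_of_pos (by linarith)]; linarith))
  have h3 : eLpNorm (fun x => P.lin (u s₀) (t - s₀) x - P.lin (u s₀) (s - s₀) x) P.R volume
      ≤ ε / 3 := by
    have hml := memLp_lin (P := P) hms₀ (sub_pos.2 hs.2)
    have e2 : (fun x => P.lin (u s₀) (t - s₀) x - P.lin (u s₀) (s - s₀) x) =
        P.lin (fun y => P.lin (u s₀) (t - s) y - u s₀ y) (s - s₀) := by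
      funext x
      rw [lin_sub hml hms₀ (sub_pos.2 hs₀s), lin_lin hms₀ (sub_pos.2 hs.2) (sub_pos.2 hs₀s)]
      congr 2; ring
    rw [e2]
    exact (eLpNorm_lin_le (hml.1.sub hms₀.1) (sub_pos.2 hs₀s)).trans h2
  rw [e]
  calc _ ≤ _ := eLpNorm_sub_le ((hus.sub hms.1).sub (hut.sub hmt.1)) (hmt.1.sub hms.1) P.one_le_R
    _ ≤ (ε / 3 + ε / 3) + ε / 3 := by
        refine add_le_add ((eLpNorm_sub_le (hus.sub hms.1) (hut.sub hmt.1) P.one_le_R).trans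
          (add_le_add (hmod' s hs₀s hs.2.le) (hmod' t hs₀t le_rfl))) h3
    _ = ε := ENNReal.add_thirds ε

theorem BSol.continuous (hu : P.BSol R T φ u) {t : ℝ} (ht : t ∈ Ico 0 T) :
    Tendsto (fun s => eLpNorm (u s - u t) P.R volume) (𝓝[Ico 0 T] t) (𝓝 0) := by
  have hself : Tendsto (fun s => eLpNorm (u s - u t) P.R volume) (𝓝[{t}] t) (𝓝 0) := by
    rw [nhdsWithin_singleton, tendsto_pure_left]
    intro s hs
    simpa using mem_of_mem_nhds hs
  rcases ht.1.eq_or_lt with rfl | h0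
  · have e : Ico 0 T = {0} ∪ Ioo 0 T := by
      rw [singleton_union, Ioo_insert_left ht.2]
    rw [e, nhdsWithin_union]
    exact hself.sup (hu.tendsto_right ht)
  · have e : Ico 0 T ⊆ {0} ∪ Ioo 0 t ∪ ({t} ∪ Ioo t T) := by
      intro s hs
      rcases hs.1.eq_or_lt with rfl | h1
      · simp
      · rcases lt_trichotomy s t with h | h | h
        · exact Or.inl (Or.inr ⟨h1, h⟩)
        · exact Or.inr (Or.inl h)
        · exact Or.inr (Or.inr ⟨h, hs.2⟩)
    refine Tendsto.mono_left ?_ (nhdsWithin_mono t e)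
    rw [nhdsWithin_union, nhdsWithin_union, nhdsWithin_union]
    refine Tendsto.sup (Tendsto.sup ?_ (hu.tendsto_left ⟨h0, ht.2⟩))
      (hself.sup (hu.tendsto_right ht))
    rw [show 𝓝[{(0 : ℝ)}] t = ⊥ from ?_]
    · exact tendsto_bot
    · rw [← notMem_closure_iff_nhdsWithin_eq_bot]
      simpa using h0.ne'

end MildSystem
end FracDissip

/-! ### Membership in L^q L^p. -/

namespace FracDissip

section Interpolation

variable {n : ℕ}

/-- Pointwise h^p ≤ S^{p-ρ} h^ρ. -/
theorem eLpNorm_le_interpolation {X : Type*} [MeasurableSpace X] {μ : Measure X} {h : X → ℝ≥0∞}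
    {ρ p : ℝ} (hρ : 0 < ρ) (hp : ρ ≤ p) {S : ℝ≥0∞} (hS : S ≠ ∞) (hh : ∀ᵐ x ∂μ, h x ≤ S) :
    eLpNorm h (ENNReal.ofReal p) μ ≤ S ^ (1 - ρ / p) * eLpNorm h (ENNReal.ofReal ρ) μ ^ (ρ / p) := by
  have hp0 : 0 < p := hρ.trans_le hp
  rw [eLpNorm_ofReal_le_iff hp0, ENNReal.mul_rpow_of_nonneg _ _ hp0.le, ← ENNReal.rpow_mul,
    ← ENNReal.rpow_mul, eLpNorm_ofReal_eq hρ, ← ENNReal.rpow_mul, div_mul_cancel₀ _ hp0.ne',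
    one_div_mul_cancel hρ.ne', ENNReal.rpow_one, sub_mul, one_mul, div_mul_cancel₀ _ hp0.ne',
    ← lintegral_const_mul' _ _ (ENNReal.rpow_ne_top_of_nonneg (by linarith) hS)]
  refine lintegral_mono_ae ?_
  filter_upwards [hh] with x hx
  rw [enorm_eq_self]
  calc h x ^ p = h x ^ (p - ρ) * h x ^ ρ := by
        rw [← ENNReal.rpow_add_of_nonneg _ _ (by linarith) hρ.le, sub_add_cancel]
    _ ≤ _ := by gcongr

/-- The `L^ρ → L^p` smoothing estimate. -/
theorem KerBound.eLpNorm_aconv_le_smoothing {a C : ℝ} {k : ℝ → Rn n → ℝ} (hk : KerBound a 0 C k)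
    (hC : 0 ≤ C) {ρ p : ℝ} (hρ : 1 ≤ ρ) (hp : ρ ≤ p) {g : Rn n → ℝ≥0∞} (hg : AEMeasurable g)
    (hgt : eLpNorm g (ENNReal.ofReal ρ) volume ≠ ∞) {t : ℝ} (ht : 0 < t) :
    eLpNorm (aconv (k t) g) (ENNReal.ofReal p) volume
      ≤ ENNReal.ofReal (C * t ^ (-(n * a * (1 / ρ - 1 / p)))) * eLpNorm g (ENNReal.ofReal ρ) volume := by
  have hρ0 : 0 < ρ := by linarith
  have hp0 : 0 < p := hρ0.trans_le hp
  have h1 := fun x => hk.aconv_le_Lm hC hg hρ ht x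
  have h2 := hk.eLpNorm_aconv_le hg hρ ht
  rw [neg_zero, Real.rpow_zero, mul_one] at h2
  set A := eLpNorm g (ENNReal.ofReal ρ) volume with hA
  have hle : 0 ≤ 1 - ρ / p := by rw [sub_nonneg, div_le_one hp0]; exact hp
  refine (eLpNorm_le_interpolation hρ0 hp (ENNReal.mul_ne_top ENNReal.ofReal_ne_top hgt)
    (Eventually.of_forall h1)).trans ?_
  calc _ ≤ (ENNReal.ofReal (C * t ^ (-(0 + n * a / ρ))) * A) ^ (1 - ρ / p) *
        (ENNReal.ofReal C * A) ^ (ρ / p) := by gcongr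
    _ = (ENNReal.ofReal ((C * t ^ (-(0 + n * a / ρ))) ^ (1 - ρ / p)) * ENNReal.ofReal (C ^ (ρ / p)))
        * (A ^ (1 - ρ / p) * A ^ (ρ / p)) := by
        rw [ENNReal.mul_rpow_of_nonneg _ _ hle, ENNReal.mul_rpow_of_nonneg _ _ (by positivity),
          ENNReal.ofReal_rpow_of_nonneg (by positivity) hle,
          ENNReal.ofReal_rpow_of_nonneg hC (by positivity)]
        ring
    _ = _ := by
        rw [← ENNReal.rpow_add_of_nonneg _ _ hle (by positivity), sub_add_cancel, ENNReal.rpow_one,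
          ← ENNReal.ofReal_mul (by positivity), Real.mul_rpow hC (by positivity), ← Real.rpow_mul ht.le,
          mul_right_comm, ← Real.rpow_add_of_nonneg hC hle (by positivity), sub_add_cancel,
          Real.rpow_one]
        congr 4
        field_simp
        ring

theorem lintegral_rpow_Ioi {η c : ℝ} (hη : 0 < η) (hc : 0 < c) :
    ∫⁻ t in Ioi c, ENNReal.ofReal (t ^ (-1 - η)) = ENNReal.ofReal (c ^ (-η) / η) := by
  rw [← ofReal_integral_eq_lintegral_ofReal (integrableOn_Ioi_rpow_of_lt (by linarith) hc),
    integral_Ioi_rpow_of_lt (by linarith) hc]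
  · congr 1
    rw [show -1 - η + 1 = -η by ring, neg_div_neg_eq]
  · refine (ae_restrict_iff' measurableSet_Ioi).2 (Eventually.of_forall fun t ht => ?_)
    exact Real.rpow_nonneg (hc.trans ht).le _

/-- The cut restricts t to at most G^{-1/σ}, where the time integral converges at zero because ρ > r
and equals a multiple of G^{r-ρ}. -/
theorem lintegral_low_cut {σ ρ r G : ℝ} (hσ : 0 < σ) (hr : 0 < r) (hρ : r < ρ) (hG : 0 ≤ G) :
    ∫⁻ t in Ioi (0 : ℝ), ENNReal.ofReal (t ^ (-1 + σ * (ρ - r))) *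
      (if G ≤ t ^ (-σ) then ENNReal.ofReal (G ^ ρ) else 0)
      ≤ ENNReal.ofReal (1 / (σ * (ρ - r))) * ENNReal.ofReal (G ^ r) := by
  have hη : 0 < σ * (ρ - r) := mul_pos hσ (by linarith)
  rcases hG.eq_or_lt with rfl | hG0
  · simp [Real.zero_rpow (hr.trans hρ).ne']
  set c := G ^ (-(1 / σ)) with hc
  have hc0 : 0 < c := by positivity
  have hiff : ∀ t : ℝ, 0 < t → G ≤ t ^ (-σ) → t ≤ c := by
    intro t ht h
    have h1 := Real.rpow_le_rpow_of_nonpos hG0 h (show -(1 / σ) ≤ 0 by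
      rw [neg_nonpos]; positivity)
    rwa [← Real.rpow_mul ht.le, neg_mul_neg, mul_one_div_cancel hσ.ne', Real.rpow_one] at h1
  calc _ ≤ ∫⁻ t in Ioi (0 : ℝ), (Ioc 0 c).indicator (fun t =>
        ENNReal.ofReal (t ^ (-1 + σ * (ρ - r))) * ENNReal.ofReal (G ^ ρ)) t := by
        refine setLIntegral_mono' measurableSet_Ioi fun t ht => ?_
        split_ifs with h
        · rw [indicator_of_mem (show t ∈ Ioc 0 c from ⟨ht, hiff t ht h⟩)]
        · simp
    _ ≤ ∫⁻ t in Ioc 0 c, ENNReal.ofReal (t ^ (-1 + σ * (ρ - r))) * ENNReal.ofReal (G ^ ρ) := by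
        rw [← lintegral_indicator measurableSet_Ioc]
        exact lintegral_mono' Measure.restrict_le_self le_rfl
    _ = ENNReal.ofReal (c ^ (σ * (ρ - r)) / (σ * (ρ - r))) * ENNReal.ofReal (G ^ ρ) := by
        rw [lintegral_mul_const' _ _ ENNReal.ofReal_ne_top, setLIntegral_congr Ioo_ae_eq_Ioc.symm]
        have := lintegral_rpow_left (θ := 1 - σ * (ρ - r)) (by linarith) hc0.le
        simp only [sub_zero, neg_sub, sub_sub_cancel] at this
        rw [← this]
        congr 3
        ext t
        ring_nf
    _ = _ := by
        rw [← ENNReal.ofReal_mul (by positivity), ← ENNReal.ofReal_mul (by positivity)]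
        congr 1
        rw [hc, ← Real.rpow_mul hG, show -(1 / σ) * (σ * (ρ - r)) = r - ρ by field_simp; ring]
        have : G ^ (r - ρ) * G ^ ρ = G ^ r := by rw [← Real.rpow_add hG0, sub_add_cancel]
        rw [← this]; ring

/-- The mirror image: for ρ < r the time integral converges at infinity, and the cut keeps only t >
G^{-1/σ}. -/
theorem lintegral_high_cut {σ ρ r G : ℝ} (hσ : 0 < σ) (hρ0 : 0 < ρ) (hρ : ρ < r) (hG : 0 ≤ G) :
    ∫⁻ t in Ioi (0 : ℝ), ENNReal.ofReal (t ^ (-1 + σ * (ρ - r))) *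
      (if t ^ (-σ) < G then ENNReal.ofReal (G ^ ρ) else 0)
      ≤ ENNReal.ofReal (1 / (σ * (r - ρ))) * ENNReal.ofReal (G ^ r) := by
  have hη : 0 < σ * (r - ρ) := mul_pos hσ (by linarith)
  rcases hG.eq_or_lt with rfl | hG0
  · simp [Real.zero_rpow hρ0.ne']
  set c := G ^ (-(1 / σ)) with hc
  have hc0 : 0 < c := by positivity
  have hiff : ∀ t : ℝ, 0 < t → t ^ (-σ) < G → c < t := by
    intro t ht h
    have h1 := Real.rpow_lt_rpow_of_neg (by positivity) h (show -(1 / σ) < 0 by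
      rw [neg_neg_iff_pos]; positivity)
    rwa [← Real.rpow_mul ht.le, neg_mul_neg, mul_one_div_cancel hσ.ne', Real.rpow_one] at h1
  calc _ ≤ ∫⁻ t in Ioi (0 : ℝ), (Ioi c).indicator (fun t =>
        ENNReal.ofReal (t ^ (-1 - σ * (r - ρ))) * ENNReal.ofReal (G ^ ρ)) t := by
        refine setLIntegral_mono' measurableSet_Ioi fun t ht => ?_
        split_ifs with h
        · rw [indicator_of_mem (show t ∈ Ioi c from hiff t ht h)]
          refine le_of_eq ?_
          congr 3; ring
        · simp
    _ ≤ ∫⁻ t in Ioi c, ENNReal.ofReal (t ^ (-1 - σ * (r - ρ))) * ENNReal.ofReal (G ^ ρ) := by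
        rw [← lintegral_indicator (s := Ioi c) measurableSet_Ioi]
        exact lintegral_mono' Measure.restrict_le_self le_rfl
    _ = ENNReal.ofReal (c ^ (-(σ * (r - ρ))) / (σ * (r - ρ))) * ENNReal.ofReal (G ^ ρ) := by
        rw [lintegral_mul_const' _ _ ENNReal.ofReal_ne_top, lintegral_rpow_Ioi hη hc0]
    _ = _ := by
        rw [← ENNReal.ofReal_mul (by positivity), ← ENNReal.ofReal_mul (by positivity)]
        congr 1
        rw [hc, ← Real.rpow_mul hG, show -(1 / σ) * (-(σ * (r - ρ))) = r - ρ by field_simp]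
        have : G ^ (r - ρ) * G ^ ρ = G ^ r := by rw [← Real.rpow_add hG0, sub_add_cancel]
        rw [← this]; ring

end Interpolation

namespace MildSystem

variable {n : ℕ} {𝕜 : Type*} [RCLike 𝕜] {P : MildSystem n 𝕜}

theorem ker_zero (P : MildSystem n 𝕜) : KerBound P.a 0 P.C (P.k 0) := P.γ_zero ▸ P.ker 0

theorem na_eq (P : MildSystem n 𝕜) : n * P.a = P.σ * P.r := by
  have := P.r_pos
  unfold σ; field_simp

/-- A time-dependent truncation of the data in the proof of the space-time estimate. -/
theorem lintegral_lin_cut_lt_top {p κ ρ c : ℝ} (hρ : 1 ≤ ρ) (hp : ρ ≤ p) (hκ0 : 0 < κ)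
    (hκρ : κ * ρ ≤ 1) (hκ : κ = P.σ * (1 - P.r / p)) {G : Rn n → ℝ} (hG : Measurable G)
    (hG0 : ∀ x, 0 ≤ G x) (hGi : ∫⁻ x, ENNReal.ofReal (G x ^ P.r) ≠ ∞) {S : Set (ℝ × Rn n)}
    (hS : MeasurableSet S)
    (h1 : ∀ t x, 0 < t → (t, x) ∈ S → G x ^ ρ ≤ t ^ (-(P.σ * (ρ - P.r))) * G x ^ P.r)
    (h2 : ∀ x, ∫⁻ t in Ioi (0 : ℝ), ENNReal.ofReal (t ^ (-1 + P.σ * (ρ - P.r))) *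
      (S.indicator (fun z => ENNReal.ofReal (G z.2 ^ ρ)) (t, x))
      ≤ ENNReal.ofReal c * ENNReal.ofReal (G x ^ P.r)) (T : ℝ) :
    ∫⁻ t in Ioo 0 T, eLpNorm (aconv (P.k 0 t) fun x =>
      S.indicator (fun z => ENNReal.ofReal (G z.2)) (t, x)) (ENNReal.ofReal p) volume ^ (1 / κ) < ∞ := by
  have hρ0 : 0 < ρ := by linarith
  have hp0 : 0 < p := hρ0.trans_le hp
  have hC := P.C_pos
  set cut : ℝ → Rn n → ℝ≥0∞ := fun t x => S.indicator (fun z => ENNReal.ofReal (G z.2)) (t, x)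
    with hcut
  set A : ℝ × Rn n → ℝ≥0∞ := S.indicator (fun z => ENNReal.ofReal (G z.2 ^ ρ)) with hA
  have hAm : Measurable A := by
    refine Measurable.indicator ?_ hS
    exact ((hG.comp measurable_snd).pow_const ρ).ennreal_ofReal
  have hcutm : ∀ t, Measurable (cut t) := fun t => by
    have : Measurable (S.indicator fun z : ℝ × Rn n => ENNReal.ofReal (G z.2)) :=
      ((hG.comp measurable_snd).ennreal_ofReal).indicator hS
    exact this.comp measurable_prodMk_left
  have hcutA : ∀ t x, cut t x ^ ρ = A (t, x) := by
    intro t x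
    simp only [hcut, hA]
    by_cases h : (t, x) ∈ S
    · rw [indicator_of_mem h, indicator_of_mem h, ENNReal.ofReal_rpow_of_nonneg (hG0 x) hρ0.le]
    · rw [indicator_of_notMem h, indicator_of_notMem h, ENNReal.zero_rpow_of_pos hρ0]
  set N := ∫⁻ x, ENNReal.ofReal (G x ^ P.r) with hN
  set I : ℝ → ℝ≥0∞ := fun t => ∫⁻ x, A (t, x) with hI
  have hIm : Measurable I := hAm.lintegral_prod_right'
  have hIN : ∀ t, 0 < t → I t ≤ ENNReal.ofReal (t ^ (-(P.σ * (ρ - P.r)))) * N := by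
    intro t ht
    rw [hN, ← lintegral_const_mul' _ _ ENNReal.ofReal_ne_top]
    refine lintegral_mono fun x => ?_
    by_cases h : (t, x) ∈ S
    · simp only [hA]
      rw [indicator_of_mem h, ← ENNReal.ofReal_mul (by positivity)]
      exact ENNReal.ofReal_le_ofReal (h1 t x ht h)
    · simp only [hA]
      rw [indicator_of_notMem h]
      exact zero_le
  have hnorm : ∀ t, eLpNorm (cut t) (ENNReal.ofReal ρ) volume = I t ^ (1 / ρ) := by
    intro t
    rw [eLpNorm_ofReal_eq hρ0]
    simp only [enorm_eq_self, hcutA, hI]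
  have hle : 0 ≤ 1 / (κ * ρ) - 1 := by
    rw [sub_nonneg, one_le_div (by positivity)]; exact hκρ
  have hpt : ∀ t ∈ Ioo 0 T, eLpNorm (aconv (P.k 0 t) (cut t)) (ENNReal.ofReal p) volume ^ (1 / κ) ≤
      (ENNReal.ofReal (P.C ^ (1 / κ)) * N ^ (1 / (κ * ρ) - 1)) *
        (ENNReal.ofReal (t ^ (-1 + P.σ * (ρ - P.r))) * I t) := by
    intro t ht
    have ht0 := ht.1
    have hIt : I t ≠ ∞ := ne_top_of_le_ne_top (ENNReal.mul_ne_top ENNReal.ofReal_ne_top hGi)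
      (hIN t ht0)
    have h3 := P.ker_zero.eLpNorm_aconv_le_smoothing hC.le hρ hp (hcutm t).aemeasurable
      (by rw [hnorm]; exact ENNReal.rpow_ne_top_of_nonneg (by positivity) hIt) ht0
    rw [hnorm] at h3
    -- Since κρ ≤ 1 the total power of I is at least one. One factor is kept for the integration in
    -- time; the surplus is bounded uniformly through the cut.
    have h4 : I t ^ (1 / ρ * (1 / κ)) ≤
        ENNReal.ofReal (t ^ (-(P.σ * (ρ - P.r)) * (1 / (κ * ρ) - 1))) * N ^ (1 / (κ * ρ) - 1) * I t := by
      calc I t ^ (1 / ρ * (1 / κ)) = I t ^ (1 / (κ * ρ) - 1) * I t := by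
            conv_rhs => rw [← ENNReal.rpow_one (I t), ← ENNReal.rpow_mul, one_mul]
            rw [← ENNReal.rpow_add_of_nonneg _ _ hle zero_le_one]
            congr 1; field_simp; ring
        _ ≤ (ENNReal.ofReal (t ^ (-(P.σ * (ρ - P.r)))) * N) ^ (1 / (κ * ρ) - 1) * I t := by
            gcongr; exact hIN t ht0
        _ = _ := by
            rw [ENNReal.mul_rpow_of_nonneg _ _ hle,
              ENNReal.ofReal_rpow_of_nonneg (by positivity) hle, ← Real.rpow_mul ht0.le]
    calc _ ≤ (ENNReal.ofReal (P.C * t ^ (-(n * P.a * (1 / ρ - 1 / p)))) * I t ^ (1 / ρ)) ^ (1 / κ) := by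
          gcongr
      _ = ENNReal.ofReal (P.C ^ (1 / κ) * t ^ (-(n * P.a * (1 / ρ - 1 / p)) * (1 / κ))) *
          I t ^ (1 / ρ * (1 / κ)) := by
          rw [ENNReal.mul_rpow_of_nonneg _ _ (by positivity), ← ENNReal.rpow_mul,
            ENNReal.ofReal_rpow_of_nonneg (by positivity) (by positivity),
            Real.mul_rpow hC.le (by positivity), ← Real.rpow_mul ht0.le]
      _ ≤ ENNReal.ofReal (P.C ^ (1 / κ) * t ^ (-(n * P.a * (1 / ρ - 1 / p)) * (1 / κ))) *
          (ENNReal.ofReal (t ^ (-(P.σ * (ρ - P.r)) * (1 / (κ * ρ) - 1))) * N ^ (1 / (κ * ρ) - 1) *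
            I t) := by gcongr
      _ = ENNReal.ofReal (P.C ^ (1 / κ)) * N ^ (1 / (κ * ρ) - 1) *
          ((ENNReal.ofReal (t ^ (-(n * P.a * (1 / ρ - 1 / p)) * (1 / κ))) *
          ENNReal.ofReal (t ^ (-(P.σ * (ρ - P.r)) * (1 / (κ * ρ) - 1)))) * I t) := by
          rw [ENNReal.ofReal_mul (by positivity)]; ring
      _ = _ := by
          rw [← ENNReal.ofReal_mul (by positivity), ← Real.rpow_add ht0]
          congr 4
          -- The relation κ = σ(1 - r/p) makes the smoothing exponent and the one from the surplus
          -- add up to -1 + σ(ρ - r), the scale-invariant weight.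
          rw [P.na_eq]
          have e : P.σ * P.r / p = P.σ - κ := by rw [hκ]; ring
          have e1 : P.σ * P.r * (1 / ρ - 1 / p) = P.σ * P.r / ρ - (P.σ - κ) := by rw [← e]; ring
          rw [e1]
          field_simp
          ring
  refine (setLIntegral_mono' measurableSet_Ioo hpt).trans_lt ?_
  have hct : ENNReal.ofReal (P.C ^ (1 / κ)) * N ^ (1 / (κ * ρ) - 1) ≠ ∞ :=
    ENNReal.mul_ne_top ENNReal.ofReal_ne_top (ENNReal.rpow_ne_top_of_nonneg hle hGi)
  rw [lintegral_const_mul' _ _ hct]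
  refine ENNReal.mul_lt_top hct.lt_top ?_
  have hwm : Measurable fun t : ℝ => ENNReal.ofReal (t ^ (-1 + P.σ * (ρ - P.r))) :=
    (measurable_id.pow_const _).ennreal_ofReal
  calc ∫⁻ t in Ioo 0 T, ENNReal.ofReal (t ^ (-1 + P.σ * (ρ - P.r))) * I t
      ≤ ∫⁻ t in Ioi (0 : ℝ), ENNReal.ofReal (t ^ (-1 + P.σ * (ρ - P.r))) * I t :=
        lintegral_mono_set Ioo_subset_Ioi_self
    _ = ∫⁻ t in Ioi (0 : ℝ), ∫⁻ x, ENNReal.ofReal (t ^ (-1 + P.σ * (ρ - P.r))) * A (t, x) := by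
        refine lintegral_congr fun t => ?_
        rw [lintegral_const_mul' _ _ ENNReal.ofReal_ne_top]
    _ = ∫⁻ x, ∫⁻ t in Ioi (0 : ℝ), ENNReal.ofReal (t ^ (-1 + P.σ * (ρ - P.r))) * A (t, x) := by
        rw [lintegral_lintegral_swap]
        exact ((hwm.comp measurable_fst).mul hAm).aemeasurable
    _ ≤ ∫⁻ x, ENNReal.ofReal c * ENNReal.ofReal (G x ^ P.r) := lintegral_mono h2
    _ = ENNReal.ofReal c * N := lintegral_const_mul' _ _ ENNReal.ofReal_ne_top
    _ < ∞ := ENNReal.mul_lt_top ENNReal.ofReal_lt_top hGi.lt_top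

/-- The linear evolution of `φ ∈ Lʳ` belongs to `L^q L^p`. -/
theorem lintegral_lin_lt_top {p κ : ℝ} (hκ0 : 0 < κ) (hp : P.r < p) (hκr : κ * P.r < 1)
    (hκ : κ = P.σ * (1 - P.r / p)) {φ : Rn n → 𝕜} (hφ : MemLp φ P.R volume) (T : ℝ) :
    ∫⁻ t in Ioo 0 T, eLpNorm (P.lin φ t) (ENNReal.ofReal p) volume ^ (1 / κ) < ∞ := by
  wlog hm : StronglyMeasurable φ generalizing φ
  · obtain ⟨ψ, hψ, he⟩ := hφ.1
    have h := this ((memLp_congr_ae he).1 hφ) hψ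
    have e : P.lin φ = P.lin ψ := by funext t x; exact lin_congr he t x
    rwa [e]
  have hr := P.one_lt_r
  have hr0 := P.r_pos
  have hσ := P.σ_pos
  have hp1 : 1 ≤ p := by linarith
  have hκ1 : κ ≤ 1 := by nlinarith
  set G : Rn n → ℝ := fun x => ‖φ x‖ with hGdef
  have hG : Measurable G := hm.measurable.norm
  have hG0 : ∀ x, 0 ≤ G x := fun x => norm_nonneg _
  have hGi : ∫⁻ x, ENNReal.ofReal (G x ^ P.r) ≠ ∞ := by
    have h := hφ.2
    rw [eLpNorm_ofReal_eq hr0, ENNReal.rpow_lt_top_iff_of_pos (by positivity)] at h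
    refine ne_of_eq_of_ne (lintegral_congr fun x => ?_) h.ne
    rw [← ofReal_norm, ENNReal.ofReal_rpow_of_nonneg (norm_nonneg _) hr0.le]
  have hτ : Measurable fun z : ℝ × Rn n => z.1 ^ (-P.σ) := measurable_fst.pow_const _
  set lo : Set (ℝ × Rn n) := {z | G z.2 ≤ z.1 ^ (-P.σ)} with hlo
  set hi : Set (ℝ × Rn n) := {z | z.1 ^ (-P.σ) < G z.2} with hhi
  have hlom : MeasurableSet lo := measurableSet_le (hG.comp measurable_snd) hτ
  have hhim : MeasurableSet hi := measurableSet_lt hτ (hG.comp measurable_snd)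
  have hcut : ∀ (ρ t : ℝ) (x : Rn n), lo.indicator (fun z => ENNReal.ofReal (G z.2 ^ ρ)) (t, x) =
      if G x ≤ t ^ (-P.σ) then ENNReal.ofReal (G x ^ ρ) else 0 := by
    intro ρ t x
    by_cases h : G x ≤ t ^ (-P.σ) <;> simp [hlo, indicator, h]
  have hcut' : ∀ (ρ t : ℝ) (x : Rn n), hi.indicator (fun z => ENNReal.ofReal (G z.2 ^ ρ)) (t, x) =
      if t ^ (-P.σ) < G x then ENNReal.ofReal (G x ^ ρ) else 0 := by
    intro ρ t x
    by_cases h : t ^ (-P.σ) < G x <;> simp [hhi, indicator, h]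
  -- Values below t^{-σ} are measured in an exponent ρ > r, values above it in exponent 1 < r. Room
  -- for ρ with κρ ≤ 1 exists because κr < 1.
  obtain ⟨ρ, hρr, hρp, hρκ⟩ : ∃ ρ, P.r < ρ ∧ ρ ≤ p ∧ κ * ρ ≤ 1 := by
    refine ⟨min p (1 / κ), lt_min hp ?_, min_le_left _ _, ?_⟩
    · rw [lt_div_iff₀ hκ0]; linarith
    · calc κ * min p (1 / κ) ≤ κ * (1 / κ) := by gcongr; exact min_le_right _ _
        _ = 1 := mul_one_div_cancel hκ0.ne'
  have hlow := lintegral_lin_cut_lt_top (P := P) (S := lo) (c := 1 / (P.σ * (ρ - P.r)))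
    (by linarith) hρp hκ0 hρκ hκ hG hG0 hGi hlom (fun t x ht h => by
      have h : G x ≤ t ^ (-P.σ) := h
      rcases (hG0 x).eq_or_lt with h0 | h0
      · rw [← h0, Real.zero_rpow (by linarith), Real.zero_rpow hr0.ne', mul_zero]
      · calc G x ^ ρ = G x ^ (ρ - P.r) * G x ^ P.r := by rw [← Real.rpow_add h0, sub_add_cancel]
          _ ≤ (t ^ (-P.σ)) ^ (ρ - P.r) * G x ^ P.r := by gcongr
          _ = _ := by rw [← Real.rpow_mul ht.le, neg_mul])
    (fun x => by simp_rw [hcut]; exact lintegral_low_cut hσ hr0 hρr (hG0 x)) T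
  have hhigh := lintegral_lin_cut_lt_top (P := P) (S := hi) (ρ := 1) (c := 1 / (P.σ * (P.r - 1)))
    le_rfl hp1 hκ0 (by linarith) hκ hG hG0 hGi hhim (fun t x ht h => by
      have h : t ^ (-P.σ) < G x := h
      have h0 : 0 < G x := lt_trans (by positivity) h
      calc G x ^ (1 : ℝ) = G x ^ (1 - P.r) * G x ^ P.r := by rw [← Real.rpow_add h0, sub_add_cancel]
        _ ≤ (t ^ (-P.σ)) ^ (1 - P.r) * G x ^ P.r := by
            refine mul_le_mul_of_nonneg_right ?_ (Real.rpow_nonneg h0.le _)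
            exact Real.rpow_le_rpow_of_nonpos (Real.rpow_pos_of_pos ht _) h.le (by linarith)
        _ = _ := by rw [← Real.rpow_mul ht.le, neg_mul])
    (fun x => by simp_rw [hcut']; exact lintegral_high_cut hσ one_pos hr (hG0 x)) T
  set clo : ℝ → Rn n → ℝ≥0∞ := fun t x => lo.indicator (fun z => ENNReal.ofReal (G z.2)) (t, x)
    with hclo
  set chi : ℝ → Rn n → ℝ≥0∞ := fun t x => hi.indicator (fun z => ENNReal.ofReal (G z.2)) (t, x)
    with hchi
  have hclom : Measurable fun z : ℝ × Rn n => clo z.1 z.2 :=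
    ((hG.comp measurable_snd).ennreal_ofReal).indicator hlom
  have hchim : Measurable fun z : ℝ × Rn n => chi z.1 z.2 :=
    ((hG.comp measurable_snd).ennreal_ofReal).indicator hhim
  have hsum : ∀ t x, ‖φ x‖ₑ = clo t x + chi t x := by
    intro t x
    simp only [hclo, hchi, hlo, hhi, indicator, mem_ofPred_eq]
    rw [← ofReal_norm]
    rcases le_or_gt (G x) (t ^ (-P.σ)) with h | h
    · rw [if_pos h, if_neg (not_lt.2 h), add_zero]
    · rw [if_neg (not_le.2 h), if_pos h, zero_add]
  have hpt : ∀ t, eLpNorm (P.lin φ t) (ENNReal.ofReal p) volume ^ (1 / κ) ≤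
      2 ^ (1 / κ - 1) * (eLpNorm (aconv (P.k 0 t) (clo t)) (ENNReal.ofReal p) volume ^ (1 / κ) +
        eLpNorm (aconv (P.k 0 t) (chi t)) (ENNReal.ofReal p) volume ^ (1 / κ)) := by
    intro t
    have hlt : Measurable (clo t) := hclom.comp measurable_prodMk_left
    have hht : Measurable (chi t) := hchim.comp measurable_prodMk_left
    have h1 : eLpNorm (P.lin φ t) (ENNReal.ofReal p) volume ≤
        eLpNorm (aconv (P.k 0 t) (clo t)) (ENNReal.ofReal p) volume +
        eLpNorm (aconv (P.k 0 t) (chi t)) (ENNReal.ofReal p) volume := by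
      refine (eLpNorm_mono_enorm (g := aconv (P.k 0 t) (clo t) + aconv (P.k 0 t) (chi t))
        fun x => ?_).trans (eLpNorm_add_le
          (aemeasurable_aconv (meas_slice 0 t) hlt.aemeasurable).aestronglyMeasurable
          (aemeasurable_aconv (meas_slice 0 t) hht.aemeasurable).aestronglyMeasurable
          (by simpa using hp1))
      rw [enorm_eq_self, Pi.add_apply, ← aconv_add (meas_slice 0 t) hlt.aemeasurable]
      refine (enorm_conv_le _ _ _).trans_eq ?_
      simp_rw [hsum t]
    calc _ ≤ _ := ENNReal.rpow_le_rpow h1 (by positivity)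
      _ ≤ _ := ENNReal.rpow_add_le_mul_rpow_add_rpow _ _ (by rw [one_le_div hκ0]; exact hκ1)
  refine (lintegral_mono hpt).trans_lt ?_
  have h2 : (2 : ℝ≥0∞) ^ (1 / κ - 1) ≠ ∞ :=
    ENNReal.rpow_ne_top_of_nonneg (by rw [sub_nonneg, one_le_div hκ0]; exact hκ1) (by simp)
  rw [lintegral_const_mul' _ _ h2, lintegral_add_left']
  · exact ENNReal.mul_lt_top h2.lt_top (ENNReal.add_lt_top.2 ⟨hlow, hhigh⟩)
  · have hJ : AEMeasurable (Function.uncurry fun t x => aconv (P.k 0 t) (clo t) x)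
        ((volume.restrict (Ioo 0 T)).prod volume) := by
      have : Measurable fun w : (ℝ × Rn n) × Rn n => ‖P.k 0 w.1.1 (w.1.2 - w.2)‖ₑ * clo w.1.1 w.2 := by
        refine ((P.meas_k 0).comp (measurable_fst.fst.prodMk
          (measurable_fst.snd.sub measurable_snd))).enorm.mul ?_
        exact hclom.comp (measurable_fst.fst.prodMk measurable_snd)
      exact (this.lintegral_prod_right').aemeasurable
    have := (hJ.pow_const p).lintegral_prod_right'
    refine AEMeasurable.congr ((this.pow_const (1 / p)).pow_const (1 / κ)) ?_
    refine Eventually.of_forall fun t => ?_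
    dsimp only
    rw [eLpNorm_ofReal_eq (by linarith)]
    rfl

/-- Bounded solutions belong to `L^q L^p` for admissible exponents. -/
theorem BSol.mixedNorm_lt_top {R T : ℝ} {φ : Rn n → 𝕜} {u : ℝ → Rn n → 𝕜} (hu : P.BSol R T φ u)
    {q : ℝ≥0∞} {p : ℝ} (hp : P.r ≤ p) (hlt : n * P.a * (1 / P.r - 1 / p) * P.r < 1)
    (hq : q⁻¹ = ENNReal.ofReal (n * P.a * (1 / P.r - 1 / p))) :
    mixedNorm q (ENNReal.ofReal p) T u < ∞ := by
  have hr0 := P.r_pos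
  have hp0 : 0 < p := hr0.trans_le hp
  have hσ := P.σ_pos
  set κ := n * P.a * (1 / P.r - 1 / p) with hκdef
  have hκ : κ = P.σ * (1 - P.r / p) := by rw [hκdef, P.na_eq]; field_simp
  -- For p = r the exponent q is infinite and the uniform Lʳ bound is enough.
  rcases hp.eq_or_lt with rfl | hp'
  · have hκ0 : κ = 0 := by rw [hκ, div_self hr0.ne']; ring
    rw [hκ0, ENNReal.ofReal_zero, ENNReal.inv_eq_zero] at hq
    rw [mixedNorm, hq, eLpNorm_exponent_top]
    refine lt_of_le_of_lt (eLpNormEssSup_le_of_ae_enorm_bound (C := ENNReal.ofReal R) ?_)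
      ENNReal.ofReal_lt_top
    filter_upwards [ae_Ioo_mem 0 T] with t ht
    exact (hu.bound t ht).1
  have hκ0 : 0 < κ := by
    rw [hκ]
    refine mul_pos hσ ?_
    rw [sub_pos, div_lt_one hp0]; exact hp'
  have hκ1 : κ ≤ 1 := by nlinarith [P.one_lt_r]
  have hq' : q = ENNReal.ofReal (1 / κ) := by
    rw [one_div, ENNReal.ofReal_inv_of_pos hκ0, ← hq, inv_inv]
  have hR := hu.pos
  set A : Fin 2 → ℝ := fun j => P.D j * ((P.b j + 1) * R ^ P.b j * R) with hA
  have hA0 : ∀ j, 0 < A j := fun j => by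
    have := P.D_pos j; have := P.b_pos j
    simp only [hA]; positivity
  -- the Duhamel terms
  have hN : ∀ t ∈ Ioo 0 T, ∀ j, eLpNorm (aduh (P.k j) (fun τ y => ‖P.src j u τ y‖ₑ) 0 t)
      (ENNReal.ofReal p) volume ≤ ENNReal.ofReal (A j * t ^ (P.ω j - κ)) := by
    intro t ht j
    have ht0 := ht.1
    obtain ⟨h1, h2⟩ := hu.bound.aduh_src j hR hu.meas le_rfl ht.1 ht.2.le
    have hle : 0 ≤ 1 - P.r / p := by rw [sub_nonneg, div_le_one hp0]; exact hp
    have hAj := hA0 j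
    refine (eLpNorm_le_interpolation hr0 hp ENNReal.ofReal_ne_top
      (Eventually.of_forall h2)).trans ?_
    calc _ ≤ ENNReal.ofReal (A j * (t - 0) ^ P.ω j * (t - 0) ^ (-P.σ)) ^ (1 - P.r / p) *
          ENNReal.ofReal (A j * (t - 0) ^ P.ω j) ^ (P.r / p) := by gcongr
      _ = _ := by
          rw [sub_zero, ENNReal.ofReal_rpow_of_nonneg (by positivity) hle,
            ENNReal.ofReal_rpow_of_nonneg (by positivity) (by positivity),
            ← ENNReal.ofReal_mul (by positivity), Real.mul_rpow (by positivity) (by positivity),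
            mul_right_comm, ← Real.rpow_add (by positivity), sub_add_cancel, Real.rpow_one,
            ← Real.rpow_mul ht0.le, neg_mul, ← hκ, mul_assoc, ← Real.rpow_add ht0, ← sub_eq_add_neg]
  have hsum : ∀ t ∈ Ioo 0 T, eLpNorm (u t) (ENNReal.ofReal p) volume ≤
      eLpNorm (P.lin φ t) (ENNReal.ofReal p) volume +
        ENNReal.ofReal (∑ j, A j * t ^ (P.ω j - κ)) := by
    intro t ht
    have hp1 : (1 : ℝ≥0∞) ≤ ENNReal.ofReal p := by
      rw [ENNReal.one_le_ofReal]; linarith [P.one_lt_r]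
    have hmt := measurable_slab_mono hu.meas le_rfl ht.2.le
    have hmN := aestronglyMeasurable_N (P := P) hmt
    rw [eLpNorm_congr_ae (hu.eq t ht)]
    refine (eLpNorm_add_le (f := P.lin φ t)
      (aestronglyMeasurable_conv (meas_slice 0 t) hu.mem.1) hmN hp1).trans (add_le_add le_rfl ?_)
    rw [ENNReal.ofReal_sum_of_nonneg fun j _ => by
      have := hA0 j; have := ht.1; positivity]
    calc _ ≤ eLpNorm (∑ j, aduh (P.k j) (fun τ y => ‖P.src j u τ y‖ₑ) 0 t)
          (ENNReal.ofReal p) volume := by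
          refine eLpNorm_mono_enorm fun x => ?_
          rw [Finset.sum_apply, enorm_eq_self]
          exact (enorm_sum_le _ _).trans (Finset.sum_le_sum fun j _ => enorm_duh_le _ _ _ _ _)
      _ ≤ _ := eLpNorm_sum_le (fun j _ => (aemeasurable_aduh (F := fun τ y => ‖P.src j u τ y‖ₑ)
          (P.meas_k j) (P.aestronglyMeasurable_src j hmt).enorm).aestronglyMeasurable) hp1
      _ ≤ _ := by gcongr with j; exact hN t ht j
  rw [mixedNorm, hq', eLpNorm_ofReal_eq (by positivity)]
  refine ENNReal.rpow_lt_top_of_nonneg (by positivity) (ne_of_lt ?_)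
  have hlin := lintegral_lin_lt_top hκ0 hp' hlt hκ hu.mem T
  have h2 : (2 : ℝ≥0∞) ^ (1 / κ - 1) ≠ ∞ :=
    ENNReal.rpow_ne_top_of_nonneg (by rw [sub_nonneg, one_le_div hκ0]; exact hκ1) (by simp)
  -- Raised to the power 1/κ, the bound t^{ω-κ} becomes t^{ω/κ-1}, integrable at zero as ω > 0.
  have hint : ∀ j, ∫⁻ t in Ioo 0 T, ENNReal.ofReal (A j * t ^ (P.ω j - κ)) ^ (1 / κ) < ∞ := by
    intro j
    have hω := P.ω_pos j
    have hAj := hA0 j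
    rcases le_or_gt T 0 with hT | hT
    · simp [Ioo_eq_empty (not_lt.2 hT)]
    have e : ∀ t ∈ Ioo 0 T, ENNReal.ofReal (A j * t ^ (P.ω j - κ)) ^ (1 / κ) =
        ENNReal.ofReal (A j ^ (1 / κ)) * ENNReal.ofReal ((t - 0) ^ (-(1 - P.ω j / κ))) := by
      intro t ht
      have ht0 := ht.1
      rw [ENNReal.ofReal_rpow_of_nonneg (by positivity) (by positivity),
        Real.mul_rpow hAj.le (by positivity), ← Real.rpow_mul ht0.le,
        ENNReal.ofReal_mul (by positivity), sub_zero]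
      congr 3
      field_simp
      ring
    rw [setLIntegral_congr_fun measurableSet_Ioo e, lintegral_const_mul' _ _ ENNReal.ofReal_ne_top,
      lintegral_rpow_left (by have := div_pos hω hκ0; linarith) hT.le]
    exact ENNReal.mul_lt_top ENNReal.ofReal_lt_top ENNReal.ofReal_lt_top
  have hq1 : 1 ≤ 1 / κ := by rw [one_le_div hκ0]; exact hκ1
  calc ∫⁻ t in Ioo 0 T, ‖eLpNorm (u t) (ENNReal.ofReal p) volume‖ₑ ^ (1 / κ)
      ≤ ∫⁻ t in Ioo 0 T, (2 ^ (1 / κ - 1) * eLpNorm (P.lin φ t) (ENNReal.ofReal p) volume ^ (1 / κ) +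
        2 ^ (1 / κ - 1) * (2 ^ (1 / κ - 1) *
          (ENNReal.ofReal (A 0 * t ^ (P.ω 0 - κ)) ^ (1 / κ) +
            ENNReal.ofReal (A 1 * t ^ (P.ω 1 - κ)) ^ (1 / κ)))) := by
        refine setLIntegral_mono' measurableSet_Ioo fun t ht => ?_
        rw [enorm_eq_self]
        have ht0 := ht.1
        calc _ ≤ _ := ENNReal.rpow_le_rpow (hsum t ht) (by positivity)
          _ ≤ _ := ENNReal.rpow_add_le_mul_rpow_add_rpow _ _ hq1
          _ ≤ _ := by
            rw [mul_add]
            gcongr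
            rw [Fin.sum_univ_two, ENNReal.ofReal_add (by have := hA0 0; positivity)
              (by have := hA0 1; positivity)]
            exact ENNReal.rpow_add_le_mul_rpow_add_rpow _ _ hq1
    _ < ∞ := by
        rw [lintegral_add_right' _ (by fun_prop), lintegral_const_mul' _ _ h2,
          lintegral_const_mul' _ _ h2, lintegral_const_mul' _ _ h2,
          lintegral_add_right' _ (by fun_prop)]
        exact ENNReal.add_lt_top.2 ⟨ENNReal.mul_lt_top h2.lt_top hlin, ENNReal.mul_lt_top h2.lt_top
          (ENNReal.mul_lt_top h2.lt_top (ENNReal.add_lt_top.2 ⟨hint 0, hint 1⟩))⟩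

end MildSystem
end FracDissip

/-! ### The excess argument: pointwise bounds without a priori boundedness. -/

namespace FracDissip
namespace MildSystem

variable {n : ℕ} {𝕜 : Type*} [RCLike 𝕜] {P : MildSystem n 𝕜}

variable (P) in
/-- The part of `t^{σ b₀} V^{b₀+1}` where `V ≥ A t^{-σ}`. -/
def excess (A : ℝ) (V : ℝ → Rn n → ℝ) (t : ℝ) (x : Rn n) : ℝ≥0∞ :=
  {z : ℝ × Rn n | A * z.1 ^ (-P.σ) ≤ V z.1 z.2}.indicator
    (fun z => ENNReal.ofReal (z.1 ^ P.θ 0 * V z.1 z.2 ^ (P.b 0 + 1))) (t, x)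

theorem measurable_excess (A : ℝ) {V : ℝ → Rn n → ℝ} (hV : Measurable (Function.uncurry V)) :
    Measurable (Function.uncurry (P.excess A V)) := by
  have h : Measurable fun z : ℝ × Rn n => V z.1 z.2 := hV
  refine Measurable.indicator ?_ ?_
  · exact ((measurable_fst.pow_const _).mul (h.pow_const _)).ennreal_ofReal
  · exact measurableSet_le ((measurable_fst.pow_const _).const_mul A) h

theorem b_le (P : MildSystem n 𝕜) (j : Fin 2) : P.b j ≤ P.b 0 := by
  fin_cases j
  · exact le_rfl
  · exact P.b_lt.le

/-- Large values are controlled by the excess, small ones by their size. -/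
theorem rpow_le_add_excess (j : Fin 2) {A Y : ℝ} (hA : 0 < A) (hY : A ≤ Y) {V : ℝ → Rn n → ℝ}
    (hV : ∀ t x, 0 ≤ V t x) {τ : ℝ} (hτ : 0 < τ) (y : Rn n) :
    ENNReal.ofReal (V τ y ^ (P.b j + 1)) ≤ ENNReal.ofReal ((Y * τ ^ (-P.σ)) ^ (P.b j + 1)) +
      ENNReal.ofReal (Y ^ (P.b j - P.b 0) * τ ^ (-P.θ j)) * P.excess A V τ y := by
  have hY0 : 0 < Y := hA.trans_le hY
  have hbj := P.b_pos j
  have hb0 := P.b_pos 0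
  rcases le_or_gt (V τ y) (Y * τ ^ (-P.σ)) with h | h
  · refine le_add_right (ENNReal.ofReal_le_ofReal ?_)
    exact Real.rpow_le_rpow (hV τ y) h (by linarith)
  · refine le_add_left ?_
    have hv : 0 < V τ y := lt_trans (by positivity) h
    have hmem : (τ, y) ∈ {z : ℝ × Rn n | A * z.1 ^ (-P.σ) ≤ V z.1 z.2} := by
      refine le_trans ?_ h.le
      dsimp only
      gcongr
    rw [excess, indicator_of_mem hmem, ← ENNReal.ofReal_mul (by positivity)]
    refine ENNReal.ofReal_le_ofReal ?_
    -- Above the height Yτ^{-σ} the power b_j + 1 is exchanged for the largest power b₀ + 1. The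
    -- exponent b_j - b₀ is nonpositive, so V may be replaced by that height.
    have e : (Y * τ ^ (-P.σ)) ^ (P.b j - P.b 0) = Y ^ (P.b j - P.b 0) * (τ ^ (-P.θ j) * τ ^ P.θ 0) := by
      rw [Real.mul_rpow hY0.le (by positivity), ← Real.rpow_mul hτ.le, ← Real.rpow_add hτ]
      congr 2
      unfold θ; ring
    calc V τ y ^ (P.b j + 1) = V τ y ^ (P.b j - P.b 0) * V τ y ^ (P.b 0 + 1) := by
          rw [← Real.rpow_add hv]; congr 1; ring
      _ ≤ (Y * τ ^ (-P.σ)) ^ (P.b j - P.b 0) * V τ y ^ (P.b 0 + 1) := by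
          refine mul_le_mul_of_nonneg_right ?_ (by positivity)
          exact Real.rpow_le_rpow_of_nonpos (by positivity) h.le (by linarith [P.b_le j])
      _ = _ := by rw [e]; ring

theorem lintegral_kernel_le (j : Fin 2) {L s t : ℝ} (hL : 0 ≤ L) (hst : s ≤ t) (x : Rn n) :
    aduh (P.k j) (fun _ _ => ENNReal.ofReal L) s t x
      ≤ ENNReal.ofReal (P.C * L * ((t - s) ^ (1 - P.γ j) / (1 - P.γ j))) := by
  have hC := P.C_pos
  calc _ ≤ ∫⁻ τ in Ioo s t, ENNReal.ofReal (P.C * L) * ENNReal.ofReal ((t - τ) ^ (-P.γ j)) := by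
        refine setLIntegral_mono' measurableSet_Ioo fun τ hτ => ?_
        refine ((P.ker j).aconv_le_sup ENNReal.ofReal_ne_top (Eventually.of_forall fun _ => le_rfl)
          (sub_pos.2 hτ.2) x).trans_eq ?_
        have : 0 ≤ (t - τ) ^ (-P.γ j) := Real.rpow_nonneg (sub_pos.2 hτ.2).le _
        rw [← ENNReal.ofReal_mul (by positivity), ← ENNReal.ofReal_mul (by positivity)]
        congr 1; ring
    _ = _ := by
        rw [lintegral_const_mul' _ _ ENNReal.ofReal_ne_top, lintegral_rpow_right (P.γ_lt_one j) hst,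
          ← ENNReal.ofReal_mul (by positivity)]

/-- The contribution of the moderate values to the Duhamel integral is small. -/
theorem moderate_le (j : Fin 2) {K A T Y t κ : ℝ} (hK : 0 < K) (hA : 0 < A) (hAY : A ≤ Y)
    (ht : 0 < t) (htT : t ≤ T) (hκ : 0 < κ) (hκY : Y * κ ^ P.σ ≤ K)
    (hlow : P.C * 2 ^ (P.σ * (P.b j + 1)) / (1 - P.γ j) * K ^ ((1 - P.γ j) / P.σ) *
      A ^ (-(P.ω j / P.σ)) * T ^ P.ω j ≤ 1 / 8) :
    P.C * (Y * (t / 2) ^ (-P.σ)) ^ (P.b j + 1) * ((κ * t) ^ (1 - P.γ j) / (1 - P.γ j))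
      ≤ Y * t ^ (-P.σ) / 8 := by
  have hσ := P.σ_pos
  have hC := P.C_pos
  have hω := P.ω_pos j
  have hγ : 0 < 1 - P.γ j := sub_pos.2 (P.γ_lt_one j)
  have hY : 0 < Y := hA.trans_le hAY
  -- The constraint on Yκ^σ converts κ^{1-γ} into a negative power of Y. In total Y occurs to the
  -- power 1 - ω/σ, and the surplus Y^{-ω/σ} ≤ A^{-ω/σ} is what large A makes small.
  have h1 : κ ^ (1 - P.γ j) ≤ K ^ ((1 - P.γ j) / P.σ) * Y ^ (-((1 - P.γ j) / P.σ)) := by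
    have h2 : κ ^ P.σ ≤ K / Y := by rw [le_div_iff₀ hY]; linarith
    calc κ ^ (1 - P.γ j) = (κ ^ P.σ) ^ ((1 - P.γ j) / P.σ) := by
          rw [← Real.rpow_mul hκ.le, mul_div_cancel₀ _ hσ.ne']
      _ ≤ (K / Y) ^ ((1 - P.γ j) / P.σ) := by gcongr
      _ = _ := by rw [Real.div_rpow hK.le hY.le, Real.rpow_neg hY.le, div_eq_mul_inv]
  have e1 : (Y * (t / 2) ^ (-P.σ)) ^ (P.b j + 1) =
      Y ^ (P.b j + 1) * (t ^ (-(P.σ * (P.b j + 1))) * 2 ^ (P.σ * (P.b j + 1))) := by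
    rw [Real.mul_rpow hY.le (by positivity), ← Real.rpow_mul (by positivity), neg_mul,
      Real.div_rpow ht.le zero_le_two, Real.rpow_neg zero_le_two, div_inv_eq_mul]
  have e2 : Y ^ (P.b j + 1) * Y ^ (-((1 - P.γ j) / P.σ)) = Y * Y ^ (-(P.ω j / P.σ)) := by
    have h3 : Y * Y ^ (-(P.ω j / P.σ)) = Y ^ (1 + -(P.ω j / P.σ)) := by
      rw [Real.rpow_add hY, Real.rpow_one]
    rw [h3, ← Real.rpow_add hY]
    congr 1
    unfold ω θ
    field_simp
    ring
  have e3 : t ^ (-(P.σ * (P.b j + 1))) * t ^ (1 - P.γ j) = t ^ (-P.σ) * t ^ P.ω j := by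
    rw [← Real.rpow_add ht, ← Real.rpow_add ht]
    congr 1
    unfold ω θ
    ring
  have h4 : Y ^ (-(P.ω j / P.σ)) ≤ A ^ (-(P.ω j / P.σ)) :=
    Real.rpow_le_rpow_of_nonpos hA hAY (by rw [neg_nonpos]; positivity)
  have h5 : t ^ P.ω j ≤ T ^ P.ω j := by gcongr
  calc _ = P.C * 2 ^ (P.σ * (P.b j + 1)) / (1 - P.γ j) * κ ^ (1 - P.γ j) * Y ^ (P.b j + 1) *
        (t ^ (-(P.σ * (P.b j + 1))) * t ^ (1 - P.γ j)) := by
        rw [e1, Real.mul_rpow hκ.le ht.le]; ring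
    _ ≤ P.C * 2 ^ (P.σ * (P.b j + 1)) / (1 - P.γ j) *
        (K ^ ((1 - P.γ j) / P.σ) * Y ^ (-((1 - P.γ j) / P.σ))) * Y ^ (P.b j + 1) *
        (t ^ (-(P.σ * (P.b j + 1))) * t ^ (1 - P.γ j)) := by gcongr
    _ = P.C * 2 ^ (P.σ * (P.b j + 1)) / (1 - P.γ j) * K ^ ((1 - P.γ j) / P.σ) *
        (Y ^ (P.b j + 1) * Y ^ (-((1 - P.γ j) / P.σ))) *
        (t ^ (-(P.σ * (P.b j + 1))) * t ^ (1 - P.γ j)) := by ring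
    _ = (Y * t ^ (-P.σ)) * (P.C * 2 ^ (P.σ * (P.b j + 1)) / (1 - P.γ j) *
        K ^ ((1 - P.γ j) / P.σ) * Y ^ (-(P.ω j / P.σ)) * t ^ P.ω j) := by rw [e2, e3]; ring
    _ ≤ (Y * t ^ (-P.σ)) * (P.C * 2 ^ (P.σ * (P.b j + 1)) / (1 - P.γ j) *
        K ^ ((1 - P.γ j) / P.σ) * A ^ (-(P.ω j / P.σ)) * T ^ P.ω j) := by gcongr
    _ ≤ (Y * t ^ (-P.σ)) * (1 / 8) := by gcongr
    _ = _ := by ring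

/-- At a point with V = Y t^{-σ}, Y ≥ A, the inequality is used for one dyadic window of relative
length κ = 2^{-m}, adapted to Y: long enough that the linear term is at most V/4, short enough that
moderate values contribute at most V/8 per nonlinearity. What remains, at least V/2, must come from
the excess inside the window, whose length is at most T(K/A)^{1/σ} with K = 4CM·2^σ. This makes the
memory short for large A. -/
theorem excess_le {A M T : ℝ} (hM : 0 < M) (hA : 4 * P.C * M * 2 ^ P.σ ≤ A)
    (hlow : ∀ j, P.C * 2 ^ (P.σ * (P.b j + 1)) / (1 - P.γ j) *
      (4 * P.C * M * 2 ^ P.σ) ^ ((1 - P.γ j) / P.σ) * A ^ (-(P.ω j / P.σ)) * T ^ P.ω j ≤ 1 / 8)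
    {V : ℝ → Rn n → ℝ} (hV : ∀ t x, 0 ≤ V t x) {t : ℝ} (ht : t ∈ Ioo 0 T) {x : Rn n}
    (hineq : ∀ m : ℕ, 1 ≤ m → ENNReal.ofReal (V t x) ≤
      ENNReal.ofReal (P.C * M * ((1 / 2) ^ m * t) ^ (-P.σ)) +
      ∑ j, aduh (P.k j) (fun τ y => ENNReal.ofReal (V τ y ^ (P.b j + 1))) (t - (1 / 2) ^ m * t) t x) :
    P.excess A V t x ≤ ∑ j, ENNReal.ofReal (2 * (4 * P.C * M * 2 ^ P.σ) ^ P.b j * 2 ^ P.θ j) *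
      ∫⁻ τ in Ioo (max 0 (t - T * (4 * P.C * M * 2 ^ P.σ / A) ^ (1 / P.σ))) t,
        ENNReal.ofReal ((t - τ) ^ (-P.θ j)) * aconv (P.k j (t - τ)) (P.excess A V τ) x := by
  have hσ := P.σ_pos
  have hC := P.C_pos
  have ht0 := ht.1
  set K := 4 * P.C * M * 2 ^ P.σ with hKdef
  have h2σ : 1 < (2 : ℝ) ^ P.σ := Real.one_lt_rpow (by norm_num) hσ
  have hK : 0 < K := by positivity
  have hA0 : 0 < A := hK.trans_le hA
  by_cases hmem : (t, x) ∈ {z : ℝ × Rn n | A * z.1 ^ (-P.σ) ≤ V z.1 z.2}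
  swap
  · rw [excess, indicator_of_notMem hmem]; exact zero_le
  have hge : A * t ^ (-P.σ) ≤ V t x := hmem
  set Y := V t x * t ^ P.σ with hYdef
  have htt : t ^ (-P.σ) * t ^ P.σ = 1 := by rw [← Real.rpow_add ht0]; simp
  have hYA : A ≤ Y := by
    calc A = A * t ^ (-P.σ) * t ^ P.σ := by rw [mul_assoc, htt, mul_one]
      _ ≤ Y := mul_le_mul_of_nonneg_right hge (by positivity)
  have hY : 0 < Y := hA0.trans_le hYA
  have hVY : V t x = Y * t ^ (-P.σ) := by
    rw [hYdef, mul_assoc, mul_comm (t ^ P.σ), htt, mul_one]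
  have hCM : 0 < 4 * P.C * M := by positivity
  -- The largest m for which the linear term stays below V/4. Maximality gives Yκ^σ ≤ K with K =
  -- 4CM·2^σ, and A ≥ K forces m ≥ 1, so that the window stays in [t/2, t].
  obtain ⟨m, hm1, hm2⟩ := exists_nat_pow_near (x := Y / (4 * P.C * M)) (y := (2 : ℝ) ^ P.σ)
    (by rw [one_le_div hCM]; refine le_trans ?_ (hA.trans hYA); exact le_mul_of_one_le_right hCM.le h2σ.le)
    h2σ
  have hm : 1 ≤ m := by
    by_contra h
    have h0 : m = 0 := by omega
    subst h0
    rw [zero_add, pow_one, div_lt_iff₀ hCM] at hm2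
    have : K ≤ Y := hA.trans hYA
    rw [hKdef] at this
    linarith
  set κ : ℝ := (1 / 2) ^ m with hκdef
  have hκ0 : 0 < κ := by positivity
  have hκ1 : κ ≤ 1 / 2 := by
    calc κ ≤ (1 / 2) ^ 1 := pow_le_pow_of_le_one (by norm_num) (by norm_num) hm
      _ = 1 / 2 := pow_one _
  have hκσ : κ ^ P.σ * ((2 : ℝ) ^ P.σ) ^ m = 1 := by
    rw [hκdef, ← Real.rpow_natCast, ← Real.rpow_natCast, ← Real.rpow_mul (by norm_num), mul_comm (m : ℝ),
      Real.rpow_mul (by norm_num), ← Real.mul_rpow (by positivity) (by positivity),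
      ← Real.mul_rpow (by positivity) (by positivity)]
    norm_num
  have hκneg : κ ^ (-P.σ) = ((2 : ℝ) ^ P.σ) ^ m := by
    rw [Real.rpow_neg hκ0.le]
    exact inv_eq_of_mul_eq_one_right hκσ
  have hκY : Y * κ ^ P.σ ≤ K := by
    rw [div_lt_iff₀ hCM, pow_succ] at hm2
    calc Y * κ ^ P.σ ≤ (((2 : ℝ) ^ P.σ) ^ m * 2 ^ P.σ * (4 * P.C * M)) * κ ^ P.σ := by gcongr
      _ = K * (κ ^ P.σ * ((2 : ℝ) ^ P.σ) ^ m) := by rw [hKdef]; ring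
      _ = K := by rw [hκσ, mul_one]
  have hκA : κ ≤ (K / A) ^ (1 / P.σ) := by
    have h1 : κ ^ P.σ ≤ K / A := by
      rw [le_div_iff₀ hA0]
      calc κ ^ P.σ * A ≤ κ ^ P.σ * Y := by gcongr
        _ ≤ K := by linarith
    calc κ = (κ ^ P.σ) ^ (1 / P.σ) := by
          rw [← Real.rpow_mul hκ0.le, mul_one_div_cancel hσ.ne', Real.rpow_one]
      _ ≤ _ := by gcongr
  set s := t - κ * t with hs
  have hts : t - s = κ * t := by rw [hs]; ring
  have hsh : t / 2 ≤ s := by rw [hs]; nlinarith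
  have hs0 : 0 < s := by linarith
  have hst : s < t := by rw [hs]; linarith [mul_pos hκ0 ht0]
  have hsub : Ioo s t ⊆ Ioo (max 0 (t - T * (K / A) ^ (1 / P.σ))) t := by
    refine Ioo_subset_Ioo_left (max_le hs0.le ?_)
    have : κ * t ≤ (K / A) ^ (1 / P.σ) * T := mul_le_mul hκA ht.2.le ht0.le (by positivity)
    rw [hs]; linarith
  set H : Fin 2 → ℝ≥0∞ := fun j => ∫⁻ τ in Ioo s t,
    ENNReal.ofReal (Y ^ (P.b j - P.b 0) * τ ^ (-P.θ j)) * aconv (P.k j (t - τ)) (P.excess A V τ) x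
    with hH
  have hterm : ∀ j, aduh (P.k j) (fun τ y => ENNReal.ofReal (V τ y ^ (P.b j + 1))) s t x ≤
      ENNReal.ofReal (Y * t ^ (-P.σ) / 8) + H j := by
    intro j
    have hbj := P.b_pos j
    have h1 : aduh (P.k j) (fun τ y => ENNReal.ofReal (V τ y ^ (P.b j + 1))) s t x ≤
        aduh (P.k j) (fun τ y => ENNReal.ofReal ((Y * (t / 2) ^ (-P.σ)) ^ (P.b j + 1)) +
          ENNReal.ofReal (Y ^ (P.b j - P.b 0) * τ ^ (-P.θ j)) * P.excess A V τ y) s t x := by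
      refine aduh_mono ?_ x
      filter_upwards [ae_Ioo_mem s t] with τ hτ
      refine Eventually.of_forall fun y => (rpow_le_add_excess j hA0 hYA hV (hs0.trans hτ.1) y).trans ?_
      refine add_le_add (ENNReal.ofReal_le_ofReal ?_) le_rfl
      refine Real.rpow_le_rpow (by have := hs0.trans hτ.1; positivity)
        (mul_le_mul_of_nonneg_left ?_ hY.le) (by linarith)
      exact Real.rpow_le_rpow_of_nonpos (by linarith) (by linarith [hτ.1]) (by linarith)
    refine h1.trans ?_
    have h2 : aduh (P.k j) (fun τ y => ENNReal.ofReal ((Y * (t / 2) ^ (-P.σ)) ^ (P.b j + 1)) +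
          ENNReal.ofReal (Y ^ (P.b j - P.b 0) * τ ^ (-P.θ j)) * P.excess A V τ y) s t x =
        aduh (P.k j) (fun _ _ => ENNReal.ofReal ((Y * (t / 2) ^ (-P.σ)) ^ (P.b j + 1))) s t x + H j := by
      simp only [aduh, hH]
      have e : ∀ τ, aconv (P.k j (t - τ)) (fun y =>
          ENNReal.ofReal ((Y * (t / 2) ^ (-P.σ)) ^ (P.b j + 1)) +
          ENNReal.ofReal (Y ^ (P.b j - P.b 0) * τ ^ (-P.θ j)) * P.excess A V τ y) x =
          aconv (P.k j (t - τ)) (fun _ => ENNReal.ofReal ((Y * (t / 2) ^ (-P.σ)) ^ (P.b j + 1))) x +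
          ENNReal.ofReal (Y ^ (P.b j - P.b 0) * τ ^ (-P.θ j)) *
            aconv (P.k j (t - τ)) (P.excess A V τ) x := by
        intro τ
        rw [aconv_add (meas_slice j _) aemeasurable_const]
        congr 1
        simp only [aconv]
        rw [← lintegral_const_mul' _ _ ENNReal.ofReal_ne_top]
        refine lintegral_congr fun y => ?_
        ring
      simp_rw [e]
      rw [lintegral_add_left]
      have : Measurable fun z : ℝ × Rn n => ‖P.k j (t - z.1) (x - z.2)‖ₑ *
          ENNReal.ofReal ((Y * (t / 2) ^ (-P.σ)) ^ (P.b j + 1)) :=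
        ((P.meas_k j).comp ((measurable_const.sub measurable_fst).prodMk
          (measurable_const.sub measurable_snd))).enorm.mul_const _
      exact this.lintegral_prod_right'
    rw [h2]
    refine add_le_add ((lintegral_kernel_le j (by positivity) hst.le x).trans
      (ENNReal.ofReal_le_ofReal ?_)) le_rfl
    rw [hts]
    exact moderate_le j hK hA0 hYA ht0 ht.2.le hκ0 hκY (hlow j)
  -- The finite amount V/4 + V/8 + V/8 is cancelled from both sides.
  have hmain : ENNReal.ofReal (V t x / 2) ≤ H 0 + H 1 := by
    have h1 := hineq m hm
    rw [Fin.sum_univ_two] at h1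
    have h3 : P.C * M * (κ * t) ^ (-P.σ) ≤ V t x / 4 := by
      rw [le_div_iff₀ hCM] at hm1
      rw [Real.mul_rpow hκ0.le ht0.le, hκneg, hVY]
      have : 0 < t ^ (-P.σ) := by positivity
      nlinarith
    have hV0 := hV t x
    have h2 : ENNReal.ofReal (V t x / 2) + ENNReal.ofReal (V t x / 2) ≤
        ENNReal.ofReal (V t x / 2) + (H 0 + H 1) := by
      calc _ = ENNReal.ofReal (V t x) := by
            rw [← ENNReal.ofReal_add (by linarith) (by linarith), add_halves]
        _ ≤ _ := h1
        _ ≤ ENNReal.ofReal (V t x / 4) + ((ENNReal.ofReal (V t x / 8) + H 0) +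
            (ENNReal.ofReal (V t x / 8) + H 1)) := by
            have t0 := hterm 0
            have t1 := hterm 1
            rw [← hVY] at t0 t1
            exact add_le_add (ENNReal.ofReal_le_ofReal h3) (add_le_add t0 t1)
        _ = (ENNReal.ofReal (V t x / 4) + (ENNReal.ofReal (V t x / 8) + ENNReal.ofReal (V t x / 8)))
            + (H 0 + H 1) := by ring
        _ = _ := by
            rw [← ENNReal.ofReal_add (by linarith) (by linarith),
              ← ENNReal.ofReal_add (by linarith) (by linarith)]
            congr 2; ring
    exact ENNReal.le_of_add_le_add_left ENNReal.ofReal_ne_top h2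
  -- Since t^{θ 0} V^{b 0} = Y^{b 0}, multiplying the estimate of V/2 by 2Y^{b 0} turns its
  -- left-hand side into the excess.
  have hex : P.excess A V t x = ENNReal.ofReal (2 * Y ^ P.b 0) * ENNReal.ofReal (V t x / 2) := by
    rw [excess, indicator_of_mem hmem, ← ENNReal.ofReal_mul (by positivity)]
    congr 1
    dsimp only
    have hV0 := hV t x
    have hb0 := P.b_pos 0
    rw [Real.rpow_add_of_nonneg hV0 hb0.le zero_le_one, Real.rpow_one]
    have : t ^ P.θ 0 * V t x ^ P.b 0 = Y ^ P.b 0 := by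
      rw [hYdef, Real.mul_rpow hV0 (by positivity), ← Real.rpow_mul ht0.le, mul_comm]
      rfl
    rw [← mul_assoc, this]; ring
  rw [hex]
  refine (mul_le_mul' le_rfl hmain).trans ?_
  rw [mul_add, Fin.sum_univ_two]
  have hfin : ∀ j, ENNReal.ofReal (2 * Y ^ P.b 0) * H j ≤
      ENNReal.ofReal (2 * K ^ P.b j * 2 ^ P.θ j) *
      ∫⁻ τ in Ioo (max 0 (t - T * (K / A) ^ (1 / P.σ))) t,
        ENNReal.ofReal ((t - τ) ^ (-P.θ j)) * aconv (P.k j (t - τ)) (P.excess A V τ) x := by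
    intro j
    have hbj := P.b_pos j
    have hθ := P.θ_pos j
    rw [hH, ← lintegral_const_mul' _ _ ENNReal.ofReal_ne_top,
      ← lintegral_const_mul' _ _ ENNReal.ofReal_ne_top]
    refine (setLIntegral_mono' measurableSet_Ioo fun τ hτ => ?_).trans (lintegral_mono_set hsub)
    have hτ0 : 0 < τ := hs0.trans hτ.1
    have htτ : 0 < t - τ := sub_pos.2 hτ.2
    rw [← mul_assoc, ← mul_assoc, ← ENNReal.ofReal_mul (by positivity),
      ← ENNReal.ofReal_mul (by positivity)]
    refine mul_le_mul' (ENNReal.ofReal_le_ofReal ?_) le_rfl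
    have e1 : Y ^ P.b 0 * Y ^ (P.b j - P.b 0) = Y ^ P.b j := by
      rw [← Real.rpow_add hY]; congr 1; ring
    -- By the choice of κ, Y is at most Kκ^{-σ}; and κt, the length of the window, is at least t -
    -- τ. Thus the unknown height Y becomes the singular but integrable weight (t - τ)^{-θ j}.
    have h1 : Y ^ P.b j ≤ K ^ P.b j * κ ^ (-P.θ j) := by
      have h2 : Y ≤ K * κ ^ (-P.σ) := by
        rw [Real.rpow_neg hκ0.le, ← div_eq_mul_inv, le_div_iff₀ (by positivity)]; exact hκY
      calc Y ^ P.b j ≤ (K * κ ^ (-P.σ)) ^ P.b j := by gcongr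
        _ = _ := by
          rw [Real.mul_rpow hK.le (by positivity), ← Real.rpow_mul hκ0.le, neg_mul]; rfl
    have h2 : τ ^ (-P.θ j) ≤ (t / 2) ^ (-P.θ j) :=
      Real.rpow_le_rpow_of_nonpos (by positivity) (by linarith [hτ.1]) (by linarith)
    have h3 : (κ * t) ^ (-P.θ j) ≤ (t - τ) ^ (-P.θ j) :=
      Real.rpow_le_rpow_of_nonpos htτ (by rw [← hts]; linarith [hτ.1]) (by linarith)
    calc 2 * Y ^ P.b 0 * (Y ^ (P.b j - P.b 0) * τ ^ (-P.θ j))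
        = 2 * (Y ^ P.b 0 * Y ^ (P.b j - P.b 0)) * τ ^ (-P.θ j) := by ring
      _ = 2 * Y ^ P.b j * τ ^ (-P.θ j) := by rw [e1]
      _ ≤ 2 * (K ^ P.b j * κ ^ (-P.θ j)) * (t / 2) ^ (-P.θ j) := by gcongr
      _ = 2 * K ^ P.b j * 2 ^ P.θ j * (κ * t) ^ (-P.θ j) := by
          rw [Real.div_rpow ht0.le zero_le_two, Real.rpow_neg zero_le_two, div_inv_eq_mul,
            Real.mul_rpow hκ0.le ht0.le]
          ring
      _ ≤ _ := by gcongr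
  exact add_le_add (hfin 0) (hfin 1)

theorem measurable_short_memory (j : Fin 2) {E : ℝ → Rn n → ℝ≥0∞}
    (hE : Measurable (Function.uncurry E)) (ℓ : ℝ) :
    Measurable fun z : ℝ × Rn n => ∫⁻ τ in Ioo (max 0 (z.1 - ℓ)) z.1,
      ENNReal.ofReal ((z.1 - τ) ^ (-P.θ j)) * aconv (P.k j (z.1 - τ)) (E τ) z.2 := by
  simp_rw [← lintegral_indicator measurableSet_Ioo]
  have h1 : Measurable fun w : ((ℝ × Rn n) × ℝ) × Rn n =>
      ‖P.k j (w.1.1.1 - w.1.2) (w.1.1.2 - w.2)‖ₑ * E w.1.2 w.2 := by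
    refine Measurable.mul ((P.meas_k j).comp (Measurable.prodMk ?_ ?_)).enorm
      (hE.comp (Measurable.prodMk ?_ ?_)) <;> fun_prop
  have h2 : Measurable fun w : (ℝ × Rn n) × ℝ => ENNReal.ofReal ((w.1.1 - w.2) ^ (-P.θ j)) *
      aconv (P.k j (w.1.1 - w.2)) (E w.2) w.1.2 :=
    Measurable.mul (by fun_prop) h1.lintegral_prod_right'
  have h3 : MeasurableSet {w : (ℝ × Rn n) × ℝ | w.2 ∈ Ioo (max 0 (w.1.1 - ℓ)) w.1.1} :=
    (measurableSet_lt (measurable_const.max (measurable_fst.fst.sub_const ℓ)) measurable_snd).inter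
      (measurableSet_lt measurable_snd measurable_fst.fst)
  exact (h2.indicator h3).lintegral_prod_right'

/-- Integrating in x replaces the kernel by its L¹ norm; then Tonelli in time leaves the integral of
s^{-(γ+θ)} over (0, ℓ), which is ℓ^ω/ω. -/
theorem lintegral_short_memory_le (j : Fin 2) {E : ℝ → Rn n → ℝ≥0∞}
    (hE : Measurable (Function.uncurry E)) {ℓ : ℝ} (hℓ : 0 ≤ ℓ) (T : ℝ) :
    ∫⁻ t in Ioo 0 T, ∫⁻ x, ∫⁻ τ in Ioo (max 0 (t - ℓ)) t,
      ENNReal.ofReal ((t - τ) ^ (-P.θ j)) * aconv (P.k j (t - τ)) (E τ) x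
      ≤ ENNReal.ofReal (P.C * (ℓ ^ P.ω j / P.ω j)) * ∫⁻ t in Ioo 0 T, ∫⁻ x, E t x := by
  have hC := P.C_pos
  have hω := P.ω_pos j
  set e : ℝ → ℝ≥0∞ := fun τ => ∫⁻ x, E τ x with he
  have hem : Measurable e := hE.lintegral_prod_right'
  have hEτ : ∀ τ, Measurable (E τ) := fun τ => hE.comp measurable_prodMk_left
  set S : Set (ℝ × ℝ) := {z | z.2 < z.1 ∧ z.1 < z.2 + ℓ} with hS
  have hSm : MeasurableSet S := (measurableSet_lt measurable_snd measurable_fst).inter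
    (measurableSet_lt measurable_fst (measurable_snd.add_const ℓ))
  set Φ : ℝ × ℝ → ℝ≥0∞ := S.indicator fun z =>
    ENNReal.ofReal (P.C * (z.1 - z.2) ^ (-(P.γ j + P.θ j))) * e z.2 with hΦ
  have hΦm : Measurable Φ := by
    refine Measurable.indicator ?_ hSm
    exact ((((measurable_fst.sub measurable_snd).pow_const _).const_mul _).ennreal_ofReal).mul
      (hem.comp measurable_snd)
  have h1 : ∀ t ∈ Ioo 0 T, ∫⁻ x, ∫⁻ τ in Ioo (max 0 (t - ℓ)) t,
      ENNReal.ofReal ((t - τ) ^ (-P.θ j)) * aconv (P.k j (t - τ)) (E τ) x ≤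
      ∫⁻ τ in Ioo 0 T, Φ (t, τ) := by
    intro t ht
    have hm : AEMeasurable (Function.uncurry fun τ x => aconv (P.k j (t - τ)) (E τ) x)
        ((volume.restrict (Ioo (max 0 (t - ℓ)) t)).prod volume) :=
      aemeasurable_aconv_uncurry (s := max 0 (t - ℓ)) (t := t) (P.meas_k j) hE.aemeasurable t
    have hw : Measurable fun τ : ℝ => ENNReal.ofReal ((t - τ) ^ (-P.θ j)) := by fun_prop
    rw [← lintegral_lintegral_swap (f := fun τ x => ENNReal.ofReal ((t - τ) ^ (-P.θ j)) *
      aconv (P.k j (t - τ)) (E τ) x) ((hw.comp measurable_fst).aemeasurable.mul hm)]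
    have h2 : ∀ τ ∈ Ioo (max 0 (t - ℓ)) t, ∫⁻ x, ENNReal.ofReal ((t - τ) ^ (-P.θ j)) *
        aconv (P.k j (t - τ)) (E τ) x ≤ Φ (t, τ) := by
      intro τ hτ
      have htτ : 0 < t - τ := sub_pos.2 hτ.2
      have hmem : (t, τ) ∈ S := ⟨hτ.2, by
        have := (le_max_right _ _).trans_lt hτ.1
        change t < τ + ℓ
        linarith⟩
      rw [lintegral_const_mul' _ _ ENNReal.ofReal_ne_top,
        lintegral_aconv (meas_slice j _) (hEτ τ).aemeasurable]
      simp only [hΦ]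
      rw [indicator_of_mem hmem, ← mul_assoc]
      refine mul_le_mul' ?_ le_rfl
      calc _ ≤ ENNReal.ofReal ((t - τ) ^ (-P.θ j)) * ENNReal.ofReal (P.C * (t - τ) ^ (-P.γ j)) := by
            gcongr
            exact (P.ker j).one _ htτ
        _ = _ := by
            rw [← ENNReal.ofReal_mul (by positivity)]
            congr 1
            rw [neg_add, Real.rpow_add htτ]; ring
    refine (setLIntegral_mono' measurableSet_Ioo h2).trans (lintegral_mono_set ?_)
    exact Ioo_subset_Ioo (le_max_left _ _) ht.2.le
  refine (setLIntegral_mono' measurableSet_Ioo h1).trans ?_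
  rw [lintegral_lintegral_swap (f := fun t τ => Φ (t, τ)) hΦm.aemeasurable,
    ← lintegral_const_mul' _ _ ENNReal.ofReal_ne_top]
  refine lintegral_mono fun τ => ?_
  have e1 : ∀ t, Φ (t, τ) = (Ioo τ (τ + ℓ)).indicator (fun t => ENNReal.ofReal P.C *
      ENNReal.ofReal ((t - τ) ^ (-(P.γ j + P.θ j)))) t * e τ := by
    intro t
    simp only [hΦ, hS, indicator, mem_ofPred_eq, mem_Ioo]
    split_ifs
    · rw [ENNReal.ofReal_mul hC.le]
    · rw [zero_mul]
  simp_rw [e1]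
  rw [lintegral_mul_const]
  · refine mul_le_mul' ?_ le_rfl
    refine (lintegral_mono' Measure.restrict_le_self le_rfl).trans ?_
    rw [lintegral_indicator measurableSet_Ioo, lintegral_const_mul' _ _ ENNReal.ofReal_ne_top,
      lintegral_rpow_left (by have := P.ω_pos j; unfold ω at this; linarith) (by linarith),
      ← ENNReal.ofReal_mul hC.le]
    refine le_of_eq ?_
    congr 1
    rw [add_sub_cancel_left, show 1 - (P.γ j + P.θ j) = P.ω j by unfold ω; ring]
  · refine Measurable.indicator ?_ measurableSet_Ioo
    fun_prop

/-- If the values of `V` are, up to a decaying term, generated by a short memory, then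
`V ≤ A t^{-σ}`. -/
theorem exists_pointwise_bound {M T : ℝ} (hM : 0 < M) (hT : 0 < T) {V : ℝ → Rn n → ℝ}
    (hV : ∀ t x, 0 ≤ V t x) (hVm : Measurable (Function.uncurry V))
    (hineq : ∀ᵐ t ∂(volume.restrict (Ioo 0 T)), ∀ m : ℕ, 1 ≤ m → ∀ᵐ x, ENNReal.ofReal (V t x) ≤
      ENNReal.ofReal (P.C * M * ((1 / 2) ^ m * t) ^ (-P.σ)) +
      ∑ j, aduh (P.k j) (fun τ y => ENNReal.ofReal (V τ y ^ (P.b j + 1))) (t - (1 / 2) ^ m * t) t x)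
    (hfin : ∀ A, 0 < A → ∫⁻ t in Ioo 0 T, ∫⁻ x, P.excess A V t x ≠ ∞) :
    ∃ A, 0 < A ∧ ∀ᵐ t ∂(volume.restrict (Ioo 0 T)), ∀ᵐ x, V t x ≤ A * t ^ (-P.σ) := by
  have hσ := P.σ_pos
  have hC := P.C_pos
  set K := 4 * P.C * M * 2 ^ P.σ with hKdef
  have hK : 0 < K := by positivity
  set c : Fin 2 → ℝ := fun j => 2 * K ^ P.b j * 2 ^ P.θ j with hc
  have hc0 : ∀ j, 0 < c j := fun j => by simp only [hc]; positivity
  -- Two requirements fix A: the moderate values contribute at most one eighth, and, next, the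
  -- short-memory operator has norm at most 1/4 for each j. Both hold eventually, as A enters with
  -- negative powers.
  have hl1 : ∀ j, ∀ᶠ A : ℝ in atTop, P.C * 2 ^ (P.σ * (P.b j + 1)) / (1 - P.γ j) *
      K ^ ((1 - P.γ j) / P.σ) * A ^ (-(P.ω j / P.σ)) * T ^ P.ω j ≤ 1 / 8 := by
    intro j
    have h := ((tendsto_rpow_neg_atTop (div_pos (P.ω_pos j) hσ)).const_mul
      (P.C * 2 ^ (P.σ * (P.b j + 1)) / (1 - P.γ j) * K ^ ((1 - P.γ j) / P.σ))).mul_const (T ^ P.ω j)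
    rw [mul_zero, zero_mul] at h
    exact h.eventually_le_const (by norm_num)
  have hl2 : ∀ j, ∀ᶠ A : ℝ in atTop,
      c j * (P.C * ((T * (K / A) ^ (1 / P.σ)) ^ P.ω j / P.ω j)) ≤ 1 / 4 := by
    intro j
    have h0 : Tendsto (fun A : ℝ => K / A) atTop (𝓝 0) := tendsto_const_nhds.div_atTop tendsto_id
    have h1 : Tendsto (fun A : ℝ => (K / A) ^ (1 / P.σ)) atTop (𝓝 0) := by
      have := h0.rpow_const (p := 1 / P.σ) (Or.inr (by positivity))
      rwa [Real.zero_rpow (by positivity)] at this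
    have h2 : Tendsto (fun A : ℝ => (T * (K / A) ^ (1 / P.σ)) ^ P.ω j) atTop (𝓝 0) := by
      have := (h1.const_mul T).rpow_const (p := P.ω j) (Or.inr (P.ω_pos j).le)
      rwa [mul_zero, Real.zero_rpow (P.ω_pos j).ne'] at this
    have h3 := ((h2.div_const (P.ω j)).const_mul P.C).const_mul (c j)
    rw [zero_div, mul_zero, mul_zero] at h3
    exact h3.eventually_le_const (by norm_num)
  obtain ⟨A, hA⟩ := ((eventually_ge_atTop K).and ((hl1 0).and ((hl1 1).and
    ((hl2 0).and (hl2 1))))).exists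
  obtain ⟨hAK, h10, h11, h20, h21⟩ := hA
  have hA0 : 0 < A := hK.trans_le hAK
  set ℓ := T * (K / A) ^ (1 / P.σ) with hℓ
  have hℓ0 : 0 ≤ ℓ := by positivity
  set E := P.excess A V with hE
  have hEm : Measurable (Function.uncurry E) := measurable_excess A hVm
  set J := ∫⁻ t in Ioo 0 T, ∫⁻ x, E t x with hJ
  have hpt : ∀ᵐ t ∂(volume.restrict (Ioo 0 T)), ∀ᵐ x, E t x ≤ ∑ j, ENNReal.ofReal (c j) *
      ∫⁻ τ in Ioo (max 0 (t - ℓ)) t,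
        ENNReal.ofReal ((t - τ) ^ (-P.θ j)) * aconv (P.k j (t - τ)) (E τ) x := by
    filter_upwards [hineq, ae_Ioo_mem 0 T] with t ht htT
    have ht' : ∀ᵐ x, ∀ m : ℕ, 1 ≤ m → ENNReal.ofReal (V t x) ≤
      ENNReal.ofReal (P.C * M * ((1 / 2) ^ m * t) ^ (-P.σ)) +
      ∑ j, aduh (P.k j) (fun τ y => ENNReal.ofReal (V τ y ^ (P.b j + 1))) (t - (1 / 2) ^ m * t) t x := by
      rw [ae_all_iff]
      intro m
      by_cases hm : 1 ≤ m
      · filter_upwards [ht m hm] with x hx _ using hx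
      · exact Eventually.of_forall fun x h => absurd h hm
    filter_upwards [ht'] with x hx
    refine excess_le hM hAK (fun j => ?_) hV htT hx
    fin_cases j
    · exact h10
    · exact h11
  -- Integrate the excess inequality over the whole slab. Finiteness of J, supplied by `hfin`, then
  -- forces J = 0.
  have hhalf : J ≤ ENNReal.ofReal (1 / 2) * J := by
    have hterm : ∀ j, ENNReal.ofReal (c j) * ∫⁻ t in Ioo 0 T, ∫⁻ x,
        ∫⁻ τ in Ioo (max 0 (t - ℓ)) t,
        ENNReal.ofReal ((t - τ) ^ (-P.θ j)) * aconv (P.k j (t - τ)) (E τ) x ≤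
        ENNReal.ofReal (c j * (P.C * (ℓ ^ P.ω j / P.ω j))) * J := by
      intro j
      rw [ENNReal.ofReal_mul (hc0 j).le, mul_assoc]
      gcongr
      exact lintegral_short_memory_le j hEm hℓ0 T
    have hsum : J ≤ ENNReal.ofReal (c 0) * (∫⁻ t in Ioo 0 T, ∫⁻ x,
        ∫⁻ τ in Ioo (max 0 (t - ℓ)) t,
          ENNReal.ofReal ((t - τ) ^ (-P.θ 0)) * aconv (P.k 0 (t - τ)) (E τ) x) +
        ENNReal.ofReal (c 1) * ∫⁻ t in Ioo 0 T, ∫⁻ x,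
        ∫⁻ τ in Ioo (max 0 (t - ℓ)) t,
          ENNReal.ofReal ((t - τ) ^ (-P.θ 1)) * aconv (P.k 1 (t - τ)) (E τ) x := by
      have hm := fun j => measurable_short_memory (P := P) j hEm ℓ
      have hpt' : J ≤ ∫⁻ t in Ioo 0 T, ∫⁻ x, (ENNReal.ofReal (c 0) *
          (∫⁻ τ in Ioo (max 0 (t - ℓ)) t,
            ENNReal.ofReal ((t - τ) ^ (-P.θ 0)) * aconv (P.k 0 (t - τ)) (E τ) x) +
          ENNReal.ofReal (c 1) * ∫⁻ τ in Ioo (max 0 (t - ℓ)) t,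
            ENNReal.ofReal ((t - τ) ^ (-P.θ 1)) * aconv (P.k 1 (t - τ)) (E τ) x) := by
        refine lintegral_mono_ae ?_
        filter_upwards [hpt] with t ht
        refine lintegral_mono_ae ?_
        filter_upwards [ht] with x hx
        rwa [Fin.sum_univ_two] at hx
      refine hpt'.trans (le_of_eq ?_)
      simp_rw [← lintegral_const_mul' _ _ ENNReal.ofReal_ne_top]
      rw [← lintegral_add_left]
      · refine lintegral_congr fun t => ?_
        rw [lintegral_add_left]
        simp_rw [lintegral_const_mul' _ _ (ENNReal.ofReal_ne_top (r := c 0))]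
        exact ((hm 0).comp measurable_prodMk_left).const_mul _
      · simp_rw [lintegral_const_mul' _ _ (ENNReal.ofReal_ne_top (r := c 0))]
        exact (hm 0).lintegral_prod_right'.const_mul _
    calc J ≤ _ := hsum
      _ ≤ ENNReal.ofReal (1 / 4) * J + ENNReal.ofReal (1 / 4) * J :=
          add_le_add ((hterm 0).trans (by gcongr)) ((hterm 1).trans (by gcongr))
      _ = _ := by
          rw [← add_mul, ← ENNReal.ofReal_add (by norm_num) (by norm_num)]; norm_num
  have hJ0 : J = 0 := by
    have hJt : J ≠ ∞ := hfin A hA0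
    by_contra h
    have h1 : ENNReal.ofReal (1 / 2) * J < 1 * J :=
      ENNReal.mul_lt_mul_left h hJt (by rw [ENNReal.ofReal_lt_one]; norm_num)
    rw [one_mul] at h1
    exact absurd hhalf (not_le.2 h1)
  refine ⟨A, hA0, ?_⟩
  -- The excess vanishes almost everywhere, whereas it is positive wherever V exceeds A t^{-σ}.
  rw [hJ, lintegral_eq_zero_iff (f := fun t => ∫⁻ x, E t x) hEm.lintegral_prod_right'] at hJ0
  filter_upwards [hJ0, ae_Ioo_mem 0 T] with t ht htT
  rw [Pi.zero_apply, lintegral_eq_zero_iff (f := fun x => E t x) (hEm.comp measurable_prodMk_left)] at ht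
  filter_upwards [ht] with x hx
  by_contra h
  push Not at h
  have hmem : (t, x) ∈ {z : ℝ × Rn n | A * z.1 ^ (-P.σ) ≤ V z.1 z.2} := h.le
  have hx' : E t x = 0 := hx
  rw [hE, excess, indicator_of_mem hmem, ENNReal.ofReal_eq_zero] at hx'
  have ht0 := htT.1
  have hv : 0 < V t x := lt_trans (by positivity) h
  have : 0 < t ^ P.θ 0 * V t x ^ (P.b 0 + 1) := by positivity
  exact absurd hx' (not_le.2 this)

end MildSystem
end FracDissip

/-! ### Arbitrary mild solutions are bounded solutions. -/

namespace FracDissip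

section Lebesgue

variable {n : ℕ}

theorem exists_ofReal_of_ne_top {m : ℝ≥0∞} (hm : 1 ≤ m) (h : m ≠ ∞) :
    ∃ p : ℝ, 1 ≤ p ∧ m = ENNReal.ofReal p := by
  refine ⟨m.toReal, ?_, (ENNReal.ofReal_toReal h).symm⟩
  rw [← ENNReal.toReal_one]
  exact ENNReal.toReal_mono h hm

/-- The Lebesgue norms of the slices of a measurable function are measurable. -/
theorem measurable_eLpNorm_slice {H : ℝ → Rn n → ℝ≥0∞} (hH : Measurable (Function.uncurry H))
    {m : ℝ≥0∞} (hm : 1 ≤ m) : Measurable fun τ => eLpNorm (H τ) m volume := by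
  rcases eq_or_ne m ∞ with rfl | h
  · refine measurable_of_Ioi fun c => ?_
    -- The essential supremum exceeds c exactly when the superlevel set has positive measure, and
    -- measures of slices are measurable.
    have e : (fun τ => eLpNorm (H τ) ∞ volume) ⁻¹' Ioi c =
        (fun τ => volume {y | c < H τ y}) ⁻¹' {0}ᶜ := by
      ext τ
      simp only [mem_preimage, mem_Ioi, mem_compl_iff, mem_singleton_iff]
      rw [← not_le, not_iff_not, eLpNorm_exponent_top]
      constructor
      · intro h
        have := (ae_le_eLpNormEssSup (f := H τ) (μ := volume)).mono fun y hy => hy.trans h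
        simpa only [ae_iff, enorm_eq_self, not_le] using this
      · intro h
        refine eLpNormEssSup_le_of_ae_enorm_bound ?_
        simpa only [ae_iff, enorm_eq_self, not_le] using h
    rw [e]
    have hS : MeasurableSet {z : ℝ × Rn n | c < Function.uncurry H z} :=
      measurableSet_lt measurable_const hH
    exact measurable_measure_prodMk_left hS (measurableSet_singleton 0).compl
  · obtain ⟨p, hp, rfl⟩ := exists_ofReal_of_ne_top hm h
    simp_rw [eLpNorm_ofReal_eq (show 0 < p by linarith), enorm_eq_self]
    exact ((hH.pow_const p).lintegral_prod_right').pow_const _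

theorem aemeasurable_eLpNorm_slice {H : ℝ → Rn n → ℝ≥0∞} {s t : ℝ}
    (hH : AEMeasurable (Function.uncurry H) (slab n s t)) {m : ℝ≥0∞} (hm : 1 ≤ m) :
    AEMeasurable (fun τ => eLpNorm (H τ) m volume) (volume.restrict (Ioo s t)) := by
  obtain ⟨G, hG, he⟩ := hH
  refine ⟨fun τ => eLpNorm (fun y => G (τ, y)) m volume,
    measurable_eLpNorm_slice (H := fun τ y => G (τ, y)) hG hm, ?_⟩
  filter_upwards [Measure.ae_ae_of_ae_prod he] with τ hτ
  exact eLpNorm_congr_ae hτ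

variable {a γ C : ℝ} {k : ℝ → Rn n → ℝ}

/-- The exponent m comes from the definition of a mild solution, where it is arbitrary; the infinite
case needs its own argument. -/
theorem KerBound.exists_aconv_le (hk : KerBound a γ C k) (hC : 0 < C) {m : ℝ≥0∞} (hm : 1 ≤ m)
    {s : ℝ} (hs : 0 < s) : ∃ c : ℝ≥0∞, c ≠ ∞ ∧ ∀ g : Rn n → ℝ≥0∞, AEMeasurable g → ∀ x,
      aconv (k s) g x ≤ c * eLpNorm g m volume := by
  rcases eq_or_ne m ∞ with rfl | h
  · refine ⟨ENNReal.ofReal (C * s ^ (-γ)), ENNReal.ofReal_ne_top, fun g _ x => ?_⟩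
    have hpos : ENNReal.ofReal (C * s ^ (-γ)) ≠ 0 := (ENNReal.ofReal_pos.2 (by positivity)).ne'
    by_cases ht : eLpNorm g ∞ volume = ∞
    · rw [ht, ENNReal.mul_top hpos]; exact le_top
    · refine hk.aconv_le_sup ht ?_ hs x
      rw [eLpNorm_exponent_top]
      exact ae_le_eLpNormEssSup (f := g)
  · obtain ⟨p, hp, rfl⟩ := exists_ofReal_of_ne_top hm h
    exact ⟨_, ENNReal.ofReal_ne_top, fun g hg x => hk.aconv_le_Lm hC.le hg hp hs x⟩

theorem KerBound.eLpNorm_aconv_le_of_one_le (hk : KerBound a γ C k) (hC : 0 < C) {m : ℝ≥0∞}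
    (hm : 1 ≤ m) {s : ℝ} (hs : 0 < s) {g : Rn n → ℝ≥0∞} (hg : AEMeasurable g) :
    eLpNorm (aconv (k s) g) m volume ≤ ENNReal.ofReal (C * s ^ (-γ)) * eLpNorm g m volume := by
  rcases eq_or_ne m ∞ with rfl | h
  · have hpos : ENNReal.ofReal (C * s ^ (-γ)) ≠ 0 := (ENNReal.ofReal_pos.2 (by positivity)).ne'
    by_cases ht : eLpNorm g ∞ volume = ∞
    · rw [ht, ENNReal.mul_top hpos]; exact le_top
    · rw [eLpNorm_exponent_top (f := aconv (k s) g)]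
      refine eLpNormEssSup_le_of_ae_enorm_bound (Eventually.of_forall fun x => ?_)
      refine hk.aconv_le_sup ht ?_ hs x
      rw [eLpNorm_exponent_top]
      exact ae_le_eLpNormEssSup (f := g)
  · obtain ⟨p, hp, rfl⟩ := exists_ofReal_of_ne_top hm h
    exact hk.eLpNorm_aconv_le hg hp hs

/-- An Abel integral of an integrable function is finite almost everywhere. -/
theorem ae_abel_lt_top {γ T : ℝ} (hγ : γ < 1) {G : ℝ → ℝ≥0∞}
    (hG : AEMeasurable G (volume.restrict (Ioo 0 T))) (hi : ∫⁻ τ in Ioo 0 T, G τ ≠ ∞) :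
    ∀ᵐ s ∂(volume.restrict (Ioo 0 T)),
      ∫⁻ τ in Ioo 0 s, ENNReal.ofReal ((s - τ) ^ (-γ)) * G τ < ∞ := by
  set Φ : ℝ × ℝ → ℝ≥0∞ := {z : ℝ × ℝ | z.2 < z.1}.indicator fun z =>
    ENNReal.ofReal ((z.1 - z.2) ^ (-γ)) * G z.2 with hΦ
  have hΦm : AEMeasurable Φ ((volume.restrict (Ioo 0 T)).prod (volume.restrict (Ioo 0 T))) := by
    refine AEMeasurable.indicator ?_ (measurableSet_lt measurable_snd measurable_fst)
    exact AEMeasurable.mul (by fun_prop)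
      (hG.comp_quasiMeasurePreserving Measure.quasiMeasurePreserving_snd)
  have hfin : ∫⁻ s in Ioo 0 T, ∫⁻ τ in Ioo 0 T, Φ (s, τ) ≠ ∞ := by
    rw [lintegral_lintegral_swap (f := fun s τ => Φ (s, τ)) hΦm]
    refine ne_top_of_le_ne_top (ENNReal.mul_ne_top
      (ENNReal.ofReal_ne_top (r := T ^ (1 - γ) / (1 - γ))) hi) ?_
    rw [← lintegral_const_mul' _ _ ENNReal.ofReal_ne_top]
    refine setLIntegral_mono' measurableSet_Ioo fun τ hτ => ?_
    have e : ∀ s ∈ Ioo 0 T, Φ (s, τ) = (Ioo τ T).indicator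
        (fun s => ENNReal.ofReal ((s - τ) ^ (-γ))) s * G τ := by
      intro s hs
      simp only [hΦ, indicator, mem_ofPred_eq, mem_Ioo, hs.2, and_true]
      split_ifs <;> simp
    rw [setLIntegral_congr_fun measurableSet_Ioo e, lintegral_mul_const]
    · refine mul_le_mul' ?_ le_rfl
      refine (lintegral_mono' Measure.restrict_le_self le_rfl).trans ?_
      rw [lintegral_indicator measurableSet_Ioo, lintegral_rpow_left hγ hτ.2.le]
      refine ENNReal.ofReal_le_ofReal ?_
      have h1 : 0 < 1 - γ := by linarith
      have h2 : 0 < T - τ := by linarith [hτ.2]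
      gcongr
      linarith [hτ.1]
    · exact Measurable.indicator (by fun_prop) measurableSet_Ioo
  have := ae_lt_top' hΦm.lintegral_prod_right' hfin
  filter_upwards [this, ae_Ioo_mem 0 T] with s hs hsT
  refine lt_of_le_of_lt ?_ hs
  refine le_trans ?_ (lintegral_mono_set (Ioo_subset_Ioo_right hsT.2.le))
  refine setLIntegral_mono' measurableSet_Ioo fun τ hτ => ?_
  have hmem : (s, τ) ∈ {z : ℝ × ℝ | z.2 < z.1} := hτ.2
  simp only [hΦ]
  rw [indicator_of_mem hmem]

/-- If the source is integrable in time with values in a Lebesgue space, then at almost every time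
its Duhamel integral can be smoothed. -/
theorem ae_aconv_aduh_ne_top {γ' C' : ℝ} {K : ℝ → Rn n → ℝ} (hK : KerBound a γ' C' K) (hC' : 0 < C')
    (hk : KerBound a γ C k) (hC : 0 < C) (hγ : γ < 1) {H : ℝ → Rn n → ℝ≥0∞} {T : ℝ}
    (hH : AEMeasurable (Function.uncurry H) (slab n 0 T)) {m : ℝ≥0∞} (hm : 1 ≤ m)
    (hi : ∫⁻ τ in Ioo 0 T, eLpNorm (H τ) m volume ≠ ∞) :
    ∀ᵐ s ∂(volume.restrict (Ioo 0 T)), ∀ h, 0 < h → ∀ x,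
      aconv (K h) (aduh k H 0 s) x ≠ ∞ := by
  filter_upwards [ae_abel_lt_top hγ (aemeasurable_eLpNorm_slice hH hm) hi, ae_Ioo_mem 0 T]
    with s hs hsT h hh x
  have hHs : AEMeasurable (Function.uncurry H) (slab n 0 s) :=
    hH.mono_measure (slab_mono (Ioo_subset_Ioo_right hsT.2.le))
  rw [lintegral_aconv_comm (hK.meas_slice h) hk.meas hHs]
  obtain ⟨c, hc, hcb⟩ := hK.exists_aconv_le hC' hm hh
  refine ne_top_of_le_ne_top (ENNReal.mul_ne_top (ENNReal.mul_ne_top hc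
    (ENNReal.ofReal_ne_top (r := C))) hs.ne) ?_
  rw [← lintegral_const_mul' _ _ (ENNReal.mul_ne_top hc ENNReal.ofReal_ne_top)]
  refine lintegral_mono_ae ?_
  filter_upwards [ae_aemeasurable_slice hHs, ae_Ioo_mem 0 s] with τ hτm hτ
  have hτs : 0 < s - τ := sub_pos.2 hτ.2
  calc _ ≤ c * eLpNorm (aconv (k (s - τ)) (H τ)) m volume :=
        hcb _ (aemeasurable_aconv (hk.meas_slice _) hτm) x
    _ ≤ c * (ENNReal.ofReal (C * (s - τ) ^ (-γ)) * eLpNorm (H τ) m volume) := by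
        gcongr
        exact hk.eLpNorm_aconv_le_of_one_le hC hm hτs hτm
    _ = _ := by rw [ENNReal.ofReal_mul hC.le]; ring

/-- Dilations preserve null sets. Only almost every time is suitable for a restart, and this places
the times (1 - 2^{-m})t in the good set for almost every t. -/
theorem ae_mul_of_ae_Ioo {T : ℝ} {p : ℝ → Prop} (h : ∀ᵐ s ∂(volume.restrict (Ioo 0 T)), p s)
    {c : ℝ} (hc : 0 < c) (hc1 : c ≤ 1) : ∀ᵐ t ∂(volume.restrict (Ioo 0 T)), p (c * t) := by
  rw [ae_restrict_iff' measurableSet_Ioo] at h ⊢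
  have h1 : ∀ᵐ t : ℝ, c * t ∈ Ioo 0 T → p (c * t) := by
    rw [ae_iff] at h ⊢
    have := Real.volume_preimage_mul_left hc.ne' {s | ¬(s ∈ Ioo 0 T → p s)}
    rw [h, mul_zero] at this
    exact this
  filter_upwards [h1] with t ht htT
  exact ht ⟨mul_pos hc htT.1, by nlinarith [htT.1, htT.2]⟩

end Lebesgue

namespace MildSystem

variable {n : ℕ} {𝕜 : Type*} [RCLike 𝕜]

/-- Mild solutions without the pointwise bound. -/
structure Sol (P : MildSystem n 𝕜) (T : ℝ) (φ : Rn n → 𝕜) (u : ℝ → Rn n → 𝕜) : Prop where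
  meas : AEStronglyMeasurable (Function.uncurry u) (slab n 0 T)
  memLp : ∀ t ∈ Ico 0 T, MemLp (u t) P.R volume
  cont : ∀ t ∈ Ico 0 T, Tendsto (fun s => eLpNorm (u s - u t) P.R volume) (𝓝[Ico 0 T] t) (𝓝 0)
  int_src : ∀ j, ∀ t ∈ Ioo 0 T, ∃ m : ℝ≥0∞, 1 ≤ m ∧ mixedNorm 1 m t (P.src j u) < ∞
  fin : ∀ j, ∀ t ∈ Ioo 0 T, ∀ᵐ x, aduh (P.k j) (fun τ y => ‖P.src j u τ y‖ₑ) 0 t x ≠ ∞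
  init : u 0 =ᵐ[volume] φ
  eq : ∀ t ∈ Ioo 0 T, ∀ᵐ x, u t x = P.lin φ t x + P.N u t x

variable {P : MildSystem n 𝕜} {T T' : ℝ} {φ : Rn n → 𝕜} {u : ℝ → Rn n → 𝕜}

theorem mixedNorm_one_src (j : Fin 2) (m : ℝ≥0∞) (t : ℝ) (u : ℝ → Rn n → 𝕜) :
    mixedNorm 1 m t (P.src j u) =
      ∫⁻ τ in Ioo 0 t, eLpNorm (fun y => ‖P.src j u τ y‖ₑ) m volume := by
  rw [mixedNorm, eLpNorm_one_eq_lintegral_enorm]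
  simp_rw [enorm_eq_self, eLpNorm_enorm]

/-- Continuity gives local boundedness of the norm, and compactness of [0, T'] makes it uniform. -/
theorem Sol.exists_norm_le (hu : P.Sol T φ u) (hT' : T' < T) :
    ∃ M, 0 < M ∧ ∀ t ∈ Icc 0 T', eLpNorm (u t) P.R volume ≤ ENNReal.ofReal M := by
  refine isCompact_Icc.induction_on (p := fun S => ∃ M, 0 < M ∧ ∀ t ∈ S,
    eLpNorm (u t) P.R volume ≤ ENNReal.ofReal M) ⟨1, one_pos, by simp⟩ ?_ ?_ ?_
  · rintro S S' h ⟨M, hM, hb⟩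
    exact ⟨M, hM, fun t ht => hb t (h ht)⟩
  · rintro S S' ⟨M, hM, hb⟩ ⟨M', hM', hb'⟩
    refine ⟨max M M', lt_max_of_lt_left hM, ?_⟩
    rintro t (ht | ht)
    · exact (hb t ht).trans (ENNReal.ofReal_le_ofReal (le_max_left _ _))
    · exact (hb' t ht).trans (ENNReal.ofReal_le_ofReal (le_max_right _ _))
  · intro t ht
    have hsub : Icc 0 T' ⊆ Ico 0 T := fun s hs => ⟨hs.1, hs.2.trans_lt hT'⟩
    have hmt := hu.memLp t (hsub ht)
    have h1 := ((hu.cont t (hsub ht)).mono_left (nhdsWithin_mono t hsub)).eventually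
      (gt_mem_nhds (one_pos : (0 : ℝ≥0∞) < 1))
    refine ⟨{s | s ∈ Icc 0 T' ∧ eLpNorm (u s - u t) P.R volume < 1},
      (eventually_mem_nhdsWithin.and h1), 1 + (eLpNorm (u t) P.R volume).toReal, by positivity, ?_⟩
    rintro s ⟨hs, hs1⟩
    have hms := hu.memLp s (hsub hs)
    calc eLpNorm (u s) P.R volume = eLpNorm ((u s - u t) + u t) P.R volume := by simp
      _ ≤ eLpNorm (u s - u t) P.R volume + eLpNorm (u t) P.R volume :=
          eLpNorm_add_le (hms.1.sub hmt.1) hmt.1 P.one_le_R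
      _ ≤ 1 + eLpNorm (u t) P.R volume := by gcongr
      _ = _ := by
          rw [ENNReal.ofReal_add zero_le_one ENNReal.toReal_nonneg, ENNReal.ofReal_one,
            ENNReal.ofReal_toReal hmt.2.ne]

/-- At almost every time a solution can be restarted from dyadic fractions of that time. -/
theorem Sol.ae_restart (hu : P.Sol T φ u) (hφ : MemLp φ P.R volume) {M : ℝ}
    (hT0 : 0 < T') (hT' : T' < T)
    (hM : ∀ t ∈ Icc 0 T', eLpNorm (u t) P.R volume ≤ ENNReal.ofReal M) :
    ∀ᵐ t ∂(volume.restrict (Ioo 0 T')), ∀ m : ℕ, 1 ≤ m → ∀ᵐ x, ‖u t x‖ₑ ≤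
      ENNReal.ofReal (P.C * M * ((1 / 2) ^ m * t) ^ (-P.σ)) +
      ∑ j, aduh (P.k j) (fun τ y => ‖P.src j u τ y‖ₑ) (t - (1 / 2) ^ m * t) t x := by
  have hC := P.C_pos
  have hmeas := measurable_slab_mono hu.meas le_rfl hT'.le
  have hgood : ∀ᵐ s ∂(volume.restrict (Ioo 0 T')), ∀ j, ∀ h, 0 < h → ∀ x,
      aconv (P.k 0 h) (aduh (P.k j) (fun τ y => ‖P.src j u τ y‖ₑ) 0 s) x ≠ ∞ := by
    rw [ae_all_iff]
    intro j
    obtain ⟨m, hm, hi⟩ := hu.int_src j T' ⟨hT0, hT'⟩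
    rw [mixedNorm_one_src] at hi
    exact ae_aconv_aduh_ne_top (P.ker 0) hC (P.ker j) hC (P.γ_lt_one j)
      (H := fun τ y => ‖P.src j u τ y‖ₑ) (P.aestronglyMeasurable_src j hmeas).enorm hm hi.ne
  -- Restricting restarts to dyadic fractions makes the exceptional sets countable in number.
  have hgood' : ∀ᵐ t ∂(volume.restrict (Ioo 0 T')), ∀ m : ℕ, 1 ≤ m → ∀ j, ∀ h, 0 < h → ∀ x,
      aconv (P.k 0 h) (aduh (P.k j) (fun τ y => ‖P.src j u τ y‖ₑ) 0 ((1 - (1 / 2) ^ m) * t)) x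
        ≠ ∞ := by
    rw [ae_all_iff]
    intro m
    by_cases hm : 1 ≤ m
    · have h1 : ((1 : ℝ) / 2) ^ m ≤ (1 / 2) ^ 1 :=
        pow_le_pow_of_le_one (by norm_num) (by norm_num) hm
      have h2 : (0 : ℝ) < (1 / 2) ^ m := by positivity
      filter_upwards [ae_mul_of_ae_Ioo hgood (c := 1 - (1 / 2) ^ m) (by linarith) (by linarith)]
        with t ht _ using ht
    · exact Eventually.of_forall fun t h => absurd h hm
  filter_upwards [hgood', ae_Ioo_mem 0 T'] with t ht htT m hm
  have h1 : ((1 : ℝ) / 2) ^ m ≤ (1 / 2) ^ 1 :=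
    pow_le_pow_of_le_one (by norm_num) (by norm_num) hm
  have h2 : (0 : ℝ) < (1 / 2) ^ m := by positivity
  have ht0 := htT.1
  set s := t - (1 / 2) ^ m * t with hs
  have hs0 : 0 < s := by rw [hs]; nlinarith
  have hst : s < t := by rw [hs]; nlinarith
  have hts : t - s = (1 / 2) ^ m * t := by rw [hs]; ring
  have hg := ht m hm
  rw [show (1 - (1 / 2) ^ m) * t = s by rw [hs]; ring] at hg
  have hsT : s ∈ Ioo 0 T := ⟨hs0, by linarith [htT.2]⟩
  have htT2 : t ∈ Ioo 0 T := ⟨ht0, by linarith [htT.2]⟩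
  have hms := hu.memLp s (Ioo_subset_Ico_self hsT)
  filter_upwards [hu.eq t htT2, ae_all_iff.2 fun j => hu.fin j t htT2] with x hx hxf
  rw [hx, restart hφ hs0 hst (measurable_slab_mono hu.meas le_rfl htT2.2.le) (hu.eq s hsT)
    (fun j => hu.fin j s hsT) (fun j => hg j _ (by linarith) x) hxf]
  refine (enorm_add_le _ _).trans (add_le_add ?_ ?_)
  · refine (enorm_conv_le _ _ _).trans ((aconv_le _ hms.1.enorm (by linarith) x).trans ?_)
    rw [eLpNorm_enorm, hts]
    have h3 : 0 ≤ P.C * ((1 / 2) ^ m * t) ^ (-P.σ) := by positivity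
    calc _ ≤ ENNReal.ofReal (P.C * ((1 / 2) ^ m * t) ^ (-P.σ)) * ENNReal.ofReal M := by
          gcongr
          exact hM s ⟨hs0.le, by linarith [htT.2]⟩
      _ = _ := by rw [← ENNReal.ofReal_mul h3]; congr 1; ring
  · exact (enorm_sum_le _ _).trans (Finset.sum_le_sum fun j _ => enorm_duh_le _ _ _ _ _)

/-- Chebyshev's and Hölder's inequalities on the set of large values. -/
theorem lintegral_excess_le {A B M : ℝ} (hA : 0 < A) (hM : 0 < M) {V : ℝ → Rn n → ℝ}
    (hV : ∀ t x, 0 ≤ V t x) (hVm : Measurable (Function.uncurry V)) {m : ℝ≥0∞} (hm : 1 ≤ m)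
    {t : ℝ} (ht : t ∈ Ioo 0 B) (hn : eLpNorm (V t) P.R volume ≤ ENNReal.ofReal M) :
    ∫⁻ x, P.excess A V t x ≤ ENNReal.ofReal (B ^ P.θ 0) *
      (eLpNorm (fun x => ENNReal.ofReal (V t x ^ (P.b 0 + 1))) m volume *
      ENNReal.ofReal ((M * B ^ P.σ / A) ^ P.r) ^ (1 - 1 / m.toReal)) := by
  have ht0 := ht.1
  have hB : 0 < B := ht0.trans ht.2
  have hr := P.r_pos
  have hσ := P.σ_pos
  have hVt : Measurable (V t) := hVm.comp measurable_prodMk_left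
  set S : Set (Rn n) := {x | A * t ^ (-P.σ) ≤ V t x} with hS
  have hSm : MeasurableSet S := measurableSet_le measurable_const hVt
  set F : Rn n → ℝ≥0∞ := fun x => ENNReal.ofReal (V t x ^ (P.b 0 + 1)) with hF
  have hFm : Measurable F := (hVt.pow_const _).ennreal_ofReal
  -- Chebyshev's inequality in Lʳ, with t^σ replaced by B^σ to be uniform in time.
  have hvol : volume S ≤ ENNReal.ofReal ((M * B ^ P.σ / A) ^ P.r) := by
    have hc : 0 < A * t ^ (-P.σ) := by positivity
    have h1 := meas_ge_le_mul_pow_eLpNorm_enorm (p := P.R) volume (by simpa using hr)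
      ENNReal.ofReal_ne_top (f := V t) hVt.aestronglyMeasurable
      (ε := ENNReal.ofReal (A * t ^ (-P.σ))) (ENNReal.ofReal_pos.2 hc).ne'
      (fun h => absurd h ENNReal.ofReal_ne_top)
    have e : {x | ENNReal.ofReal (A * t ^ (-P.σ)) ≤ ‖V t x‖ₑ} = S := by
      ext x
      simp only [mem_ofPred_eq, hS]
      rw [Real.enorm_of_nonneg (hV t x), ENNReal.ofReal_le_ofReal_iff (hV t x)]
    rw [e, ENNReal.toReal_ofReal hr.le] at h1
    refine h1.trans ?_
    calc _ ≤ (ENNReal.ofReal (A * t ^ (-P.σ)))⁻¹ ^ P.r * ENNReal.ofReal M ^ P.r := by gcongr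
      _ = ENNReal.ofReal ((M * t ^ P.σ / A) ^ P.r) := by
          rw [← ENNReal.mul_rpow_of_nonneg _ _ hr.le, ← ENNReal.ofReal_inv_of_pos hc,
            ← ENNReal.ofReal_mul (by positivity), ENNReal.ofReal_rpow_of_nonneg (by positivity) hr.le]
          congr 2
          rw [Real.rpow_neg ht0.le]
          field_simp
      _ ≤ _ := by
          refine ENNReal.ofReal_le_ofReal ?_
          have := ht.2.le
          gcongr
  have h1 : ∫⁻ x, P.excess A V t x ≤ ∫⁻ x in S, ENNReal.ofReal (B ^ P.θ 0) * F x := by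
    rw [← lintegral_indicator hSm]
    refine lintegral_mono fun x => ?_
    by_cases hx : x ∈ S
    · have hmem : (t, x) ∈ {z : ℝ × Rn n | A * z.1 ^ (-P.σ) ≤ V z.1 z.2} := hx
      rw [indicator_of_mem hx, excess, indicator_of_mem hmem, ← ENNReal.ofReal_mul (by positivity)]
      refine ENNReal.ofReal_le_ofReal ?_
      have := hV t x
      have := ht.2.le
      have := P.θ_pos 0
      dsimp only
      gcongr
    · have hmem : (t, x) ∉ {z : ℝ × Rn n | A * z.1 ^ (-P.σ) ≤ V z.1 z.2} := hx
      rw [excess, indicator_of_notMem hmem]; exact zero_le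
  refine h1.trans ?_
  rw [lintegral_const_mul' _ _ ENNReal.ofReal_ne_top]
  refine mul_le_mul' le_rfl ?_
  -- On a set of finite measure the L^m norm controls the L¹ norm, for whichever m the source
  -- provides.
  have h2 := eLpNorm_le_eLpNorm_mul_rpow_measure_univ (μ := volume.restrict S) (f := F) hm
    hFm.aestronglyMeasurable
  rw [eLpNorm_one_eq_lintegral_enorm] at h2
  simp only [enorm_eq_self, ENNReal.toReal_one, Measure.restrict_apply_univ, div_one] at h2
  refine h2.trans (mul_le_mul' (eLpNorm_restrict_le _ _ _ _) ?_)
  refine ENNReal.rpow_le_rpow hvol ?_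
  rcases eq_or_ne m ∞ with rfl | h
  · simp
  · obtain ⟨p, hp, rfl⟩ := exists_ofReal_of_ne_top hm h
    rw [ENNReal.toReal_ofReal (by linarith), sub_nonneg, div_le_one (by linarith)]
    exact hp

/-- Bounds that hold at almost every time hold at every time. -/
theorem Sol.bound_of_ae (hu : P.Sol T φ u) (hT' : T' ≤ T) {A : ℝ}
    (h : ∀ᵐ t ∂(volume.restrict (Ioo 0 T')), ∀ᵐ x, ‖u t x‖ₑ ≤ ENNReal.ofReal (A * t ^ (-P.σ)))
    {t : ℝ} (ht : t ∈ Ioo 0 T') : ∀ᵐ x, ‖u t x‖ₑ ≤ ENNReal.ofReal (A * t ^ (-P.σ)) := by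
  rw [ae_restrict_iff' measurableSet_Ioo] at h
  -- Good times are dense. Along a sequence of them u converges in Lʳ, hence almost everywhere along
  -- a subsequence, and the bound is continuous in time.
  obtain ⟨τ, hτ, hlim⟩ := mem_closure_iff_seq_limit.1
    ((Measure.dense_of_ae h).open_subset_closure_inter isOpen_Ioo ht)
  have hsub : Ioo 0 T' ⊆ Ico 0 T := fun s hs => ⟨hs.1.le, hs.2.trans_le hT'⟩
  have hlim' : Tendsto τ atTop (𝓝[Ico 0 T] t) :=
    tendsto_nhdsWithin_iff.2 ⟨hlim, Eventually.of_forall fun i => hsub (hτ i).1⟩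
  obtain ⟨ns, hns, hae⟩ := (tendstoInMeasure_of_tendsto_eLpNorm (p := P.R)
    (by simpa using P.r_pos) (fun i => (hu.memLp _ (hsub (hτ i).1)).1) (hu.memLp t (hsub ht)).1
    ((hu.cont t (hsub ht)).comp hlim')).exists_seq_tendsto_ae
  filter_upwards [hae, ae_all_iff.2 fun i => (hτ i).2 (hτ i).1] with x hx hxb
  refine le_of_tendsto_of_tendsto' hx.enorm ?_ fun i => hxb (ns i)
  refine ENNReal.tendsto_ofReal (Tendsto.const_mul A ?_)
  exact ((Real.continuousAt_rpow_const t (-P.σ) (Or.inl ht.1.ne')).tendsto.comp hlim).comp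
    hns.tendsto_atTop

/-- Every mild solution satisfies the pointwise bound. -/
theorem Sol.exists_bSol (hu : P.Sol T φ u) (hφ : MemLp φ P.R volume) (hT0 : 0 < T') (hT' : T' < T) :
    ∃ R, P.BSol R T' φ u := by
  obtain ⟨M, hM, hMb⟩ := hu.exists_norm_le hT'
  have hmeas := measurable_slab_mono hu.meas le_rfl hT'.le
  -- The excess argument needs a jointly measurable function, so it is run for a representative that
  -- agrees with u on almost every slice.
  obtain ⟨u', hu'm, hu'⟩ := hmeas
  have hae : ∀ᵐ τ ∂(volume.restrict (Ioo 0 T')), ∀ᵐ y, u τ y = u' (τ, y) :=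
    Measure.ae_ae_of_ae_prod hu'
  set V : ℝ → Rn n → ℝ := fun t x => ‖u' (t, x)‖ with hVdef
  have hV : ∀ t x, 0 ≤ V t x := fun t x => norm_nonneg _
  have hVm : Measurable (Function.uncurry V) := hu'm.measurable.norm
  have hVe : ∀ t x, ENNReal.ofReal (V t x) = ‖u' (t, x)‖ₑ := fun t x => ofReal_norm _
  have hVp : ∀ j t x, ENNReal.ofReal (V t x ^ (P.b j + 1)) = ‖u' (t, x)‖ₑ ^ (P.b j + 1) := by
    intro j t x
    have := P.b_pos j
    rw [← ENNReal.ofReal_rpow_of_nonneg (hV t x) (by linarith), hVe]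
  have hineq : ∀ᵐ t ∂(volume.restrict (Ioo 0 T')), ∀ m : ℕ, 1 ≤ m → ∀ᵐ x, ENNReal.ofReal (V t x) ≤
      ENNReal.ofReal (P.C * M * ((1 / 2) ^ m * t) ^ (-P.σ)) + ∑ j, aduh (P.k j)
        (fun τ y => ENNReal.ofReal (V τ y ^ (P.b j + 1))) (t - (1 / 2) ^ m * t) t x := by
    filter_upwards [hu.ae_restart hφ hT0 hT' hMb, hae, ae_Ioo_mem 0 T'] with t ht hut htT m hm
    have h1 : ((1 : ℝ) / 2) ^ m ≤ 1 := pow_le_one₀ (by norm_num) (by norm_num)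
    have ht0 := htT.1
    filter_upwards [ht m hm, hut] with x hx hxu
    rw [hVe, ← hxu]
    refine hx.trans_eq ?_
    congr 1
    refine Finset.sum_congr rfl fun j _ => aduh_congr ?_ x
    have hsub : Ioo (t - (1 / 2) ^ m * t) t ⊆ Ioo 0 T' :=
      Ioo_subset_Ioo (by nlinarith) htT.2.le
    filter_upwards [ae_restrict_of_ae_restrict_of_subset hsub hae] with τ hτ
    filter_upwards [hτ] with y hy
    rw [hVp, ← hy, enorm_src]
  -- The excess is governed by the source with index 0, the larger power, which is integrable in
  -- time with values in L^m.
  have hfin : ∀ A, 0 < A → ∫⁻ t in Ioo 0 T', ∫⁻ x, P.excess A V t x ≠ ∞ := by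
    intro A hA
    obtain ⟨m, hm, hi⟩ := hu.int_src 0 T' ⟨hT0, hT'⟩
    rw [mixedNorm_one_src] at hi
    set K := ENNReal.ofReal (T' ^ P.θ 0) *
      ENNReal.ofReal ((M * T' ^ P.σ / A) ^ P.r) ^ (1 - 1 / m.toReal) with hK
    have hKt : K ≠ ∞ := by
      refine ENNReal.mul_ne_top ENNReal.ofReal_ne_top (ENNReal.rpow_ne_top_of_ne_zero ?_
        ENNReal.ofReal_ne_top)
      exact (ENNReal.ofReal_pos.2 (by positivity)).ne'
    refine ne_top_of_le_ne_top (ENNReal.mul_ne_top hKt hi.ne) ?_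
    rw [← lintegral_const_mul' _ _ hKt]
    refine lintegral_mono_ae ?_
    filter_upwards [hae, ae_Ioo_mem 0 T'] with t hut htT
    refine (lintegral_excess_le (B := T') hA hM hV hVm hm htT ?_).trans_eq ?_
    · refine le_trans (le_of_eq ?_) (hMb t ⟨htT.1.le, htT.2.le⟩)
      rw [← eLpNorm_norm (u t)]
      refine eLpNorm_congr_ae ?_
      filter_upwards [hut] with x hx
      rw [hx]
    · rw [show eLpNorm (fun x => ENNReal.ofReal (V t x ^ (P.b 0 + 1))) m volume =
        eLpNorm (fun y => ‖P.src 0 u t y‖ₑ) m volume from ?_]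
      · rw [hK]; ring
      · refine eLpNorm_congr_ae ?_
        filter_upwards [hut] with x hx
        rw [hVp, ← hx, enorm_src]
  obtain ⟨A, hA, hb⟩ := exists_pointwise_bound hM hT0 hV hVm hineq hfin
  have hb' : ∀ᵐ t ∂(volume.restrict (Ioo 0 T')), ∀ᵐ x,
      ‖u t x‖ₑ ≤ ENNReal.ofReal (A * t ^ (-P.σ)) := by
    filter_upwards [hb, hae] with t ht hut
    filter_upwards [ht, hut] with x hx hxu
    rw [hxu, ← hVe]
    exact ENNReal.ofReal_le_ofReal hx
  refine ⟨max M A, lt_max_of_lt_left hM, measurable_slab_mono hu.meas le_rfl hT'.le, hu.init, hφ,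
    fun t ht => ⟨?_, ?_⟩, fun t ht => hu.eq t ⟨ht.1, ht.2.trans hT'⟩⟩
  · exact (hMb t (Ioo_subset_Icc_self ht)).trans (ENNReal.ofReal_le_ofReal (le_max_left _ _))
  · filter_upwards [hu.bound_of_ae hT'.le hb' ht] with x hx
    refine hx.trans (ENNReal.ofReal_le_ofReal ?_)
    have := Real.rpow_nonneg ht.1.le (-P.σ)
    gcongr
    exact le_max_right _ _

end MildSystem
end FracDissip

/-! ### Maximal solutions and the blow-up rate. -/

namespace FracDissip

/-- Slicewise equality yields joint equality only for measurable sets, so the comparison is made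
between strongly measurable representatives. -/
theorem ae_slab_of_forall_ae {n : ℕ} {𝕜 : Type*} [RCLike 𝕜] {u v : ℝ → Rn n → 𝕜} {s t : ℝ}
    (hu : AEStronglyMeasurable (Function.uncurry u) (slab n s t))
    (hv : AEStronglyMeasurable (Function.uncurry v) (slab n s t))
    (h : ∀ τ ∈ Ioo s t, u τ =ᵐ[volume] v τ) :
    Function.uncurry u =ᵐ[slab n s t] Function.uncurry v := by
  obtain ⟨u', hu', hue⟩ := hu
  obtain ⟨v', hv', hve⟩ := hv
  have h1 : ∀ᵐ z ∂(slab n s t), u' z = v' z := by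
    rw [slab, Measure.ae_prod_iff_ae_ae (hu'.measurableSet_eq_fun hv')]
    filter_upwards [Measure.ae_ae_of_ae_prod hue, Measure.ae_ae_of_ae_prod hve, ae_Ioo_mem s t]
      with τ hτ hτ' hτm
    filter_upwards [hτ, hτ', h τ hτm] with y h1 h2 h3
    rw [← h1, ← h2]
    exact h3
  filter_upwards [hue, hve, h1] with z h1 h2 h3
  rw [h1, h2, h3]

namespace MildSystem

variable {n : ℕ} {𝕜 : Type*} [RCLike 𝕜] {P : MildSystem n 𝕜}

theorem BSol.congr {R T : ℝ} {φ : Rn n → 𝕜} {u v : ℝ → Rn n → 𝕜} (hu : P.BSol R T φ u) (hT : 0 < T)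
    (hv : AEStronglyMeasurable (Function.uncurry v) (slab n 0 T))
    (h : ∀ t ∈ Ico 0 T, u t =ᵐ[volume] v t) : P.BSol R T φ v := by
  have h' : ∀ t ∈ Ioo 0 T, u t =ᵐ[volume] v t := fun t ht => h t (Ioo_subset_Ico_self ht)
  refine ⟨hu.pos, hv, (h 0 ⟨le_rfl, hT⟩).symm.trans hu.init, hu.mem, hu.bound.congr h',
    fun t ht => ?_⟩
  filter_upwards [hu.eq t ht, h' t ht] with x hx hx'
  rw [← hx', hx, N_congr fun τ hτ => h' τ ⟨hτ.1, hτ.2.trans ht.2⟩]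

/-- Bounded solutions on an exhausting sequence of intervals fit together. -/
theorem exists_bSol_of_seq {φ : Rn n → 𝕜} {τ : ℕ → ℝ} {R : ℕ → ℝ} {w : ℕ → ℝ → Rn n → 𝕜}
    (hw : ∀ k, P.BSol (R k) (τ k) φ (w k)) :
    ∃ u : ℝ → Rn n → 𝕜, ∀ k, ∀ T, 0 < T → T ≤ τ k → P.BSol (R k) T φ u := by
  classical
  -- At each time take the first member of the sequence still alive. Joint measurability survives
  -- because u agrees almost everywhere on the slab with any single member, the exceptional sets
  -- being countably many.
  set u : ℝ → Rn n → 𝕜 := fun t =>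
    if h : ∃ k, t < τ k then w (Nat.find h) t else 0 with hu
  have hut : ∀ t, (∃ k, t < τ k) → ∃ j, t < τ j ∧ u t = w j t := by
    intro t h
    exact ⟨Nat.find h, Nat.find_spec h, by rw [hu]; exact dif_pos h⟩
  refine ⟨u, fun k T hT hTk => ((hw k).mono le_rfl hTk).congr hT ?_ fun t ht => ?_⟩
  · have h1 : ∀ j, ∀ᵐ z ∂(slab n 0 T), z.1 < τ j → w k z.1 z.2 = w j z.1 z.2 := by
      intro j
      have h2 : Function.uncurry (w k) =ᵐ[slab n 0 (min T (τ j))] Function.uncurry (w j) := by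
        refine ae_slab_of_forall_ae (measurable_slab_mono (hw k).meas le_rfl
          ((min_le_left _ _).trans hTk)) (measurable_slab_mono (hw j).meas le_rfl
          (min_le_right _ _)) fun t ht => ?_
        exact ((hw k).mono le_rfl ((min_le_left _ _).trans hTk)).unique
          ((hw j).mono le_rfl (min_le_right _ _)) (Ioo_subset_Ico_self ht)
      rw [slab_eq] at h2 ⊢
      rw [Filter.EventuallyEq, ae_restrict_iff' (measurableSet_Ioo.prod MeasurableSet.univ)] at h2
      rw [ae_restrict_iff' (measurableSet_Ioo.prod MeasurableSet.univ)]
      filter_upwards [h2] with z hz hzT hzj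
      exact hz ⟨⟨hzT.1.1, lt_min hzT.1.2 hzj⟩, trivial⟩
    refine (measurable_slab_mono (hw k).meas le_rfl hTk).congr ?_
    have h3 : ∀ᵐ z ∂(slab n 0 T), z.1 < τ k := by
      rw [slab_eq, ae_restrict_iff' (measurableSet_Ioo.prod MeasurableSet.univ)]
      exact Eventually.of_forall fun z hz => hz.1.2.trans_le hTk
    filter_upwards [ae_all_iff.2 h1, h3] with z hz hzk
    obtain ⟨j, hj, he⟩ := hut z.1 ⟨k, hzk⟩
    change w k z.1 z.2 = u z.1 z.2
    rw [he]
    exact hz j hj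
  · have htk : t < τ k := ht.2.trans_le hTk
    obtain ⟨j, hj, he⟩ := hut t ⟨k, htk⟩
    rw [he]
    have hmin := lt_min htk hj
    exact ((hw k).mono le_rfl (min_le_left (τ k) (τ j))).unique
      ((hw j).mono le_rfl (min_le_right _ _)) ⟨ht.1, hmin⟩

/-- A norm bound of the order `L^{-e}` gives an existence time of the order `L`. -/
theorem exists_q_rpow_le (P : MildSystem n 𝕜) {e : ℝ} (he : ∀ j, e * P.b j ≤ P.ω j)
    (T₀ : ℝ) : ∃ C, 0 < C ∧ ∀ L, 0 < L → L ≤ T₀ → P.q (2 * P.C * (C * L ^ (-e))) L ≤ 1 / 4 := by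
  have hC := P.C_pos
  -- With a radius proportional to c L^{-e}, each term of q carries L to the power ω - e b ≥ 0, so L
  -- may be replaced by T₀; the remaining function of c is continuous and vanishes at 0.
  set F : ℝ → ℝ := fun c => ∑ j, P.D j * ((P.b j + 1) * (2 * P.C * c) ^ P.b j) *
    T₀ ^ (P.ω j - e * P.b j) with hF
  have h : Tendsto F (𝓝 0) (𝓝 (F 0)) := by
    refine tendsto_finsetSum _ fun j _ => ?_
    have h1 : Tendsto (fun c : ℝ => 2 * P.C * c) (𝓝 0) (𝓝 (2 * P.C * 0)) :=
      tendsto_id.const_mul _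
    exact (((h1.rpow_const (Or.inr (P.b_pos j).le)).const_mul _).const_mul _).mul_const _
  have h0 : F 0 = 0 := by simp [hF, Real.zero_rpow (P.b_pos _).ne']
  rw [h0] at h
  have h2 := (h.mono_left (nhdsWithin_le_nhds (s := Ioi (0 : ℝ)))).eventually
    (gt_mem_nhds (show (0 : ℝ) < 1 / 4 by norm_num))
  obtain ⟨C, hCF, hC0⟩ := (h2.and (self_mem_nhdsWithin (s := Ioi (0 : ℝ)))).exists
  have hC0 : 0 < C := hC0
  refine ⟨C, hC0, fun L hL hLT => le_trans (Finset.sum_le_sum fun j _ => ?_) hCF.le⟩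
  have hD := P.D_pos j
  have hb := P.b_pos j
  have e1 : (2 * P.C * (C * L ^ (-e))) ^ P.b j * L ^ P.ω j =
      (2 * P.C * C) ^ P.b j * L ^ (P.ω j - e * P.b j) := by
    rw [← mul_assoc, Real.mul_rpow (by positivity) (by positivity), ← Real.rpow_mul hL.le, mul_assoc,
      ← Real.rpow_add hL]
    congr 2; ring
  have e2 : L ^ (P.ω j - e * P.b j) ≤ T₀ ^ (P.ω j - e * P.b j) :=
    Real.rpow_le_rpow hL.le hLT (sub_nonneg.2 (he j))
  calc _ = P.D j * (P.b j + 1) * ((2 * P.C * (C * L ^ (-e))) ^ P.b j * L ^ P.ω j) := by ring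
    _ = P.D j * (P.b j + 1) * ((2 * P.C * C) ^ P.b j * L ^ (P.ω j - e * P.b j)) := by rw [e1]
    _ ≤ P.D j * (P.b j + 1) * ((2 * P.C * C) ^ P.b j * T₀ ^ (P.ω j - e * P.b j)) := by gcongr
    _ = _ := by ring

variable (P) in
/-- The solutions of the Cauchy problem are the solutions of the system. -/
structure Represents (α : ℝ) (D : DiffOp n) (ε₁ ε₂ : ℤˣ) (b₁ b₂ : ℝ) (q : ℝ≥0∞) (p : ℝ) : Prop where
  sol : ∀ φ T u, IsSol (𝕜 := 𝕜) α D ε₁ ε₂ b₁ b₂ q p P.r φ T u → P.Sol T φ u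
  isSol : ∀ φ R T u, P.BSol R T φ u → IsSol α D ε₁ ε₂ b₁ b₂ q p P.r φ T u

namespace Represents

variable {α : ℝ} {D : DiffOp n} {ε₁ ε₂ : ℤˣ} {b₁ b₂ : ℝ} {q : ℝ≥0∞} {p : ℝ} {φ : Rn n → 𝕜}
  {T T' : ℝ} {Tₘ Tₘ' : ℝ≥0∞} {u v : ℝ → Rn n → 𝕜}

/-- On a slightly shorter interval both solutions are bounded solutions, for which uniqueness is
known. -/
theorem unique (h : P.Represents α D ε₁ ε₂ b₁ b₂ q p) (hφ : MemLp φ P.R volume)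
    (hu : IsSol α D ε₁ ε₂ b₁ b₂ q p P.r φ T u) (hv : IsSol α D ε₁ ε₂ b₁ b₂ q p P.r φ T' v) {t : ℝ}
    (ht0 : 0 ≤ t) (ht : t < T) (ht' : t < T') : u t =ᵐ[volume] v t := by
  obtain ⟨s, hts, hs⟩ := exists_between (lt_min ht ht')
  have hs0 : 0 < s := ht0.trans_lt hts
  obtain ⟨R, hR⟩ := (h.sol _ _ _ hu).exists_bSol hφ hs0 (hs.trans_le (min_le_left _ _))
  obtain ⟨R', hR'⟩ := (h.sol _ _ _ hv).exists_bSol hφ hs0 (hs.trans_le (min_le_right _ _))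
  exact hR.unique hR' ⟨ht0, hts⟩

theorem uniqueSol (h : P.Represents α D ε₁ ε₂ b₁ b₂ q p) (hφ : MemLp φ P.R volume) {M : ℝ}
    (hM : 0 < M) (hφM : eLpNorm φ P.R volume ≤ ENNReal.ofReal M) (hT : 0 < T)
    (hq : P.q (2 * P.C * M) T ≤ 1 / 4) : UniqueSol α D ε₁ ε₂ b₁ b₂ q p P.r φ T := by
  obtain ⟨u, hu⟩ := MildSystem.exists_bSol hφ hM hφM hT hq
  exact ⟨⟨u, h.isSol _ _ _ _ hu⟩, fun u v hu hv t ht => h.unique hφ hu hv ht.1 ht.2 ht.2⟩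

/-- The existence time depends only on the norm of the datum. -/
theorem exists_time (h : P.Represents α D ε₁ ε₂ b₁ b₂ q p) (M : ℝ) : ∃ T : ℝ, 0 < T ∧
    ∀ φ : Rn n → 𝕜, MemLp φ P.R volume → eLpNorm φ P.R volume ≤ ENNReal.ofReal M →
      UniqueSol α D ε₁ ε₂ b₁ b₂ q p P.r φ T := by
  obtain ⟨T, hT, hq⟩ := P.exists_q_le (2 * P.C * max M 1) (c := 1 / 4) (by norm_num)
  exact ⟨T, hT, fun φ hφ hφM => h.uniqueSol hφ (lt_max_of_lt_right one_pos)
    (hφM.trans (ENNReal.ofReal_le_ofReal (le_max_left _ _))) hT hq⟩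

theorem exists_uniqueSol (h : P.Represents α D ε₁ ε₂ b₁ b₂ q p) (hφ : MemLp φ P.R volume) :
    ∃ T : ℝ, 0 < T ∧ UniqueSol α D ε₁ ε₂ b₁ b₂ q p P.r φ T := by
  obtain ⟨T, hT, hu⟩ := h.exists_time (eLpNorm φ P.R volume).toReal
  exact ⟨T, hT, hu φ hφ (by rw [ENNReal.ofReal_toReal hφ.2.ne])⟩

/-- No solution lives longer than a maximal one. -/
theorem le_of_isMaximal (h : P.Represents α D ε₁ ε₂ b₁ b₂ q p) (hφ : MemLp φ P.R volume)
    (hu : IsMaximal α D ε₁ ε₂ b₁ b₂ q p P.r φ Tₘ u)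
    (hv : IsSol α D ε₁ ε₂ b₁ b₂ q p P.r φ T v) : ENNReal.ofReal T ≤ Tₘ := by
  by_contra hlt
  push Not at hlt
  -- By uniqueness any longer solution coincides with u before the maximal time, hence would be an
  -- extension.
  refine hu.not_extends T hlt ⟨v, hv, fun t ht0 ht => ?_⟩
  obtain ⟨s, hs0, hts, hs⟩ := ENNReal.lt_iff_exists_real_btwn.1 ht
  have hts' : t < s := ((ENNReal.ofReal_lt_ofReal_iff_of_nonneg ht0).1 hts)
  exact h.unique hφ hv (hu.isSol s (ht0.trans_lt hts') hs) ht0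
    ((ENNReal.ofReal_lt_ofReal_iff_of_nonneg ht0).1 (ht.trans hlt)) hts'

theorem isMaximal_le (h : P.Represents α D ε₁ ε₂ b₁ b₂ q p) (hφ : MemLp φ P.R volume)
    (hu : IsMaximal α D ε₁ ε₂ b₁ b₂ q p P.r φ Tₘ u)
    (hv : IsMaximal α D ε₁ ε₂ b₁ b₂ q p P.r φ Tₘ' v) : Tₘ' ≤ Tₘ := by
  by_contra hlt
  push Not at hlt
  obtain ⟨s, hs0, hs, hs'⟩ := ENNReal.lt_iff_exists_real_btwn.1 hlt
  have hspos : 0 < s := ENNReal.ofReal_pos.1 (zero_le.trans_lt hs)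
  exact absurd (h.le_of_isMaximal hφ hu (hv.isSol s hspos hs')) (not_le.2 hs)

/-- The maximal time is the supremum of all existence times. Bounded solutions on intervals
exhausting it fit together, and a solution beyond it would contradict the supremum. -/
theorem exists_isMaximal (h : P.Represents α D ε₁ ε₂ b₁ b₂ q p) (hφ : MemLp φ P.R volume) :
    ∃ (Tₘ : ℝ≥0∞) (u : ℝ → Rn n → 𝕜), IsMaximal α D ε₁ ε₂ b₁ b₂ q p P.r φ Tₘ u ∧
      ∀ (Tₘ' : ℝ≥0∞) (v : ℝ → Rn n → 𝕜), IsMaximal α D ε₁ ε₂ b₁ b₂ q p P.r φ Tₘ' v →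
        Tₘ' = Tₘ ∧ ∀ t : ℝ, 0 ≤ t → ENNReal.ofReal t < Tₘ → v t =ᵐ[volume] u t := by
  set E : Set ℝ := {T | 0 < T ∧ ∃ u, IsSol α D ε₁ ε₂ b₁ b₂ q p P.r φ T u} with hE
  set Tₘ : ℝ≥0∞ := ⨆ T ∈ E, ENNReal.ofReal T with hTₘ
  have hle : ∀ T ∈ E, ENNReal.ofReal T ≤ Tₘ := fun T hT => le_iSup₂_of_le T hT le_rfl
  have hpos : 0 < Tₘ := by
    obtain ⟨T, hT, ⟨u, hu⟩, -⟩ := h.exists_uniqueSol hφ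
    exact (ENNReal.ofReal_pos.2 hT).trans_le (hle T ⟨hT, u, hu⟩)
  have hex : ∀ T, 0 < T → ENNReal.ofReal T < Tₘ → ∃ R w, P.BSol R T φ w := by
    intro T hT hlt
    simp only [hTₘ, lt_iSup_iff] at hlt
    obtain ⟨T', ⟨hT', w, hw⟩, hTT'⟩ := hlt
    obtain ⟨R, hR⟩ := (h.sol _ _ _ hw).exists_bSol hφ hT
      ((ENNReal.ofReal_lt_ofReal_iff hT').1 hTT')
    exact ⟨R, w, hR⟩
  obtain ⟨s, -, hs, hslim⟩ := exists_seq_strictMono_tendsto' hpos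
  have hsr : ∀ k, ENNReal.ofReal (s k).toReal = s k := fun k =>
    ENNReal.ofReal_toReal ((hs k).2.trans_le le_top).ne
  have hex' : ∀ k, ∃ R w, P.BSol R (s k).toReal φ w := fun k =>
    hex _ (ENNReal.toReal_pos (hs k).1.ne' ((hs k).2.trans_le le_top).ne) (by
      rw [hsr]; exact (hs k).2)
  choose R w hw using hex'
  obtain ⟨u, hu⟩ := exists_bSol_of_seq hw
  have hmax : IsMaximal α D ε₁ ε₂ b₁ b₂ q p P.r φ Tₘ u := by
    refine ⟨hpos, fun T hT hlt => ?_, fun T hlt => ?_⟩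
    · obtain ⟨k, hk⟩ := (hslim.eventually (lt_mem_nhds hlt)).exists
      refine h.isSol _ _ _ _ (hu k T hT ?_)
      rw [← hsr k] at hk
      exact ((ENNReal.ofReal_lt_ofReal_iff_of_nonneg hT.le).1 hk).le
    · rintro ⟨v, hv, -⟩
      exact absurd (hle T ⟨ENNReal.ofReal_pos.1 (hpos.trans hlt), v, hv⟩) (not_le.2 hlt)
  refine ⟨Tₘ, u, hmax, fun Tₘ' v hv => ?_⟩
  have he : Tₘ' = Tₘ := le_antisymm (h.isMaximal_le hφ hmax hv) (h.isMaximal_le hφ hv hmax)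
  subst he
  refine ⟨rfl, fun t ht0 ht => ?_⟩
  obtain ⟨s, hs0, hts, hs⟩ := ENNReal.lt_iff_exists_real_btwn.1 ht
  have hts' : t < s := ((ENNReal.ofReal_lt_ofReal_iff_of_nonneg ht0).1 hts)
  exact h.unique hφ (hv.isSol s (ht0.trans_lt hts') hs) (hmax.isSol s (ht0.trans_lt hts') hs)
    ht0 hts' hts'

/-- If the norm at s were below the rate, the solution started at u(s) would live for twice the
remaining time; glued to u, it would outlive the maximal solution. The doubling costs the factor
2^{-e}. -/
theorem exists_blowup_rate (h : P.Represents α D ε₁ ε₂ b₁ b₂ q p) {e : ℝ}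
    (he : ∀ j, e * P.b j ≤ P.ω j) (T₀ : ℝ) : ∃ C : ℝ, 0 < C ∧
      ∀ φ : Rn n → 𝕜, MemLp φ P.R volume → ∀ (Tₘ : ℝ) (u : ℝ → Rn n → 𝕜), Tₘ ≤ T₀ →
        IsMaximal α D ε₁ ε₂ b₁ b₂ q p P.r φ (ENNReal.ofReal Tₘ) u →
        ∀ s ∈ Ico 0 Tₘ, ENNReal.ofReal (C / (Tₘ - s) ^ e) ≤ eLpNorm (u s) P.R volume := by
  obtain ⟨C, hC, hq⟩ := P.exists_q_rpow_le he (2 * max T₀ 1)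
  refine ⟨C * 2 ^ (-e), by positivity, fun φ hφ Tₘ u hTₘ hu s hs => ?_⟩
  by_contra hlt
  push Not at hlt
  set L := 2 * (Tₘ - s) with hLdef
  have hs0 := hs.1
  have hts : 0 < Tₘ - s := sub_pos.2 hs.2
  have hL : 0 < L := by positivity
  have hLT : L ≤ 2 * max T₀ 1 := by
    have := le_max_left T₀ 1
    linarith
  have hCL : C * 2 ^ (-e) / (Tₘ - s) ^ e = C * L ^ (-e) := by
    rw [hLdef, Real.mul_rpow zero_le_two hts.le, Real.rpow_neg hts.le, ← mul_assoc,
      div_eq_mul_inv]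
  rw [hCL] at hlt
  obtain ⟨T, hsT, hT⟩ := exists_between hs.2
  have hT0 : 0 < T := hs0.trans_lt hsT
  have huT := h.sol _ _ _ (hu.isSol T hT0 ((ENNReal.ofReal_lt_ofReal_iff (by linarith)).2 hT))
  obtain ⟨w, hw⟩ := MildSystem.exists_bSol (huT.memLp s ⟨hs0, hsT⟩) (by positivity) hlt.le hL
    (hq L hL hLT)
  have hlong : ∃ R v, P.BSol R (s + L) φ v := by
    rcases hs0.eq_or_lt with rfl | hs1
    · rw [zero_add]
      exact ⟨_, w, hw.congr_init huT.init⟩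
    -- Gluing needs a bounded solution on an interval reaching beyond s, which is available on every
    -- [0, T') with T' < T.
    · obtain ⟨T', hsT', hT'⟩ := exists_between hsT
      obtain ⟨R, hR⟩ := huT.exists_bSol hφ (hs1.trans hsT') hT'
      obtain ⟨R'', v, hv, -⟩ := hR.glue ⟨hs1, hsT'⟩ hw hL
      exact ⟨R'', v, hv⟩
  obtain ⟨R, v, hv⟩ := hlong
  have h1 := h.le_of_isMaximal hφ hu (h.isSol _ _ _ _ hv)
  rw [ENNReal.ofReal_le_ofReal_iff (by linarith)] at h1
  linarith

/-- The rate with T₀ equal to the maximal time tends to infinity, because e > 0. -/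
theorem tendsto_blowup (h : P.Represents α D ε₁ ε₂ b₁ b₂ q p) {e : ℝ} (he0 : 0 < e)
    (he : ∀ j, e * P.b j ≤ P.ω j) (hφ : MemLp φ P.R volume) {Tₘ : ℝ}
    (hu : IsMaximal α D ε₁ ε₂ b₁ b₂ q p P.r φ (ENNReal.ofReal Tₘ) u) :
    Tendsto (fun t => eLpNorm (u t) P.R volume) (𝓝[<] Tₘ) (𝓝 ∞) := by
  obtain ⟨C, hC, hrate⟩ := h.exists_blowup_rate he Tₘ
  have hTₘ : 0 < Tₘ := ENNReal.ofReal_pos.1 hu.pos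
  have h1 : Tendsto (fun t => Tₘ - t) (𝓝[<] Tₘ) (𝓝[>] 0) := by
    refine tendsto_nhdsWithin_iff.2 ⟨?_, ?_⟩
    · have : Tendsto (fun t => Tₘ - t) (𝓝 Tₘ) (𝓝 (Tₘ - Tₘ)) := tendsto_const_nhds.sub tendsto_id
      rw [sub_self] at this
      exact this.mono_left nhdsWithin_le_nhds
    · filter_upwards [self_mem_nhdsWithin] with t ht
      exact sub_pos.2 (mem_Iio.1 ht)
  have h2 := ENNReal.tendsto_ofReal_atTop.comp
    (((tendsto_rpow_neg_nhdsGT_zero (neg_lt_zero.2 he0)).comp h1).const_mul_atTop hC)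
  refine tendsto_nhds_top_mono h2 ?_
  filter_upwards [self_mem_nhdsWithin, mem_nhdsWithin_of_mem_nhds (Ioi_mem_nhds hTₘ)] with t ht ht0
  have ht : t < Tₘ := ht
  have ht0 : 0 < t := ht0
  refine le_trans (le_of_eq ?_) (hrate φ hφ Tₘ u le_rfl hu t ⟨ht0.le, ht⟩)
  simp only [Function.comp_apply]
  rw [Real.rpow_neg (sub_pos.2 ht).le, ← div_eq_mul_inv]

end Represents

/-! ### Translation between the Cauchy problem and the abstract system. -/

variable {hn : 1 ≤ n} {α : ℝ} {hα : 1 < 2 * α} {D : DiffOp n} {ε₁ ε₂ : ℤˣ} {b₁ b₂ : ℝ} {hb₂ : 0 < b₂}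
  {hb : b₂ < b₁} {r : ℝ} {hr : 1 < r} {h₁ : n * (1 / (2 * α)) / r * b₁ < 1}
  {h₂ : n * (1 / (2 * α)) / r * b₂ < 1 - D.order / (2 * α)}

theorem sol_of_isSol {q : ℝ≥0∞} {p T : ℝ} {φ : Rn n → 𝕜} {u : ℝ → Rn n → 𝕜}
    (hu : IsSol α D ε₁ ε₂ b₁ b₂ q p r φ T u) :
    (ofData 𝕜 hn hα D ε₁ ε₂ hb₂ hb hr h₁ h₂).Sol T φ u := by
  set P := ofData 𝕜 hn hα D ε₁ ε₂ hb₂ hb hr h₁ h₂ with hP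
  obtain ⟨hX, hm⟩ := hu
  have hmeas : AEStronglyMeasurable (Function.uncurry u) (slab n 0 T) := by
    rw [slab_eq]
    exact hX.measurable.mono_measure (Measure.restrict_mono
      (Set.prod_mono Ioo_subset_Ico_self le_rfl) le_rfl)
  refine ⟨hmeas, hX.memLp, hX.continuous, fun j => ?_, fun j t ht => ?_, hm.initial, fun t ht => ?_⟩
  · fin_cases j
    · exact hm.source₁
    · exact hm.source₂
  · have hmt := P.aestronglyMeasurable_src j (measurable_slab_mono hmeas le_rfl ht.2.le)
    have key : ∀ᵐ x, Integrable (fun z : ℝ × Rn n => P.k j (t - z.1) (x - z.2) • P.src j u z.1 z.2)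
        (slab n 0 t) := by
      rw [slab_eq]
      fin_cases j
      · exact hm.integrable₁ t ht
      · exact hm.integrable₂ t ht
    filter_upwards [key] with x hx
    exact (aduh_ne_top_iff (P.meas_k j) hmt).2 hx
  · filter_upwards [hm.equation t ht] with x hx
    rw [hx, N, Fin.sum_univ_two, add_assoc]
    rfl

theorem isSol_of_bSol {q : ℝ≥0∞} {p R T : ℝ} {φ : Rn n → 𝕜} {u : ℝ → Rn n → 𝕜}
    (hadm : Admissible n α q p r)
    (hu : (ofData 𝕜 hn hα D ε₁ ε₂ hb₂ hb hr h₁ h₂).BSol R T φ u) :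
    IsSol α D ε₁ ε₂ b₁ b₂ q p r φ T u := by
  set P := ofData 𝕜 hn hα D ε₁ ε₂ hb₂ hb hr h₁ h₂ with hP
  obtain ⟨-, hrp, hpn, hq⟩ := hadm
  have hr0 : 0 < r := by linarith
  have hp0 : 0 < p := by linarith
  have hn0 : (0 : ℝ) < n := by exact_mod_cast hn
  have hα0 : 0 < α := by linarith
  have hsrc : ∀ j, ∀ t ∈ Ioo 0 T, ∃ m : ℝ≥0∞, 1 ≤ m ∧ mixedNorm 1 m t (P.src j u) < ∞ := by
    intro j t ht
    refine ⟨P.R, P.one_le_R, ?_⟩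
    rw [mixedNorm_one_src]
    have hR := hu.pos
    have hb := P.b_pos j
    calc _ ≤ ∫⁻ τ in Ioo 0 t, ENNReal.ofReal ((P.b j + 1) * R ^ P.b j * R) *
          ENNReal.ofReal ((τ - 0) ^ (-P.θ j)) := by
          refine setLIntegral_mono' measurableSet_Ioo fun τ hτ => ?_
          rw [← ENNReal.ofReal_mul (by positivity), sub_zero]
          exact (hu.bound.src_le j hR.le ⟨hτ.1, hτ.2.trans ht.2⟩).1
      _ < ∞ := by
          rw [lintegral_const_mul' _ _ ENNReal.ofReal_ne_top,
            lintegral_rpow_left (P.θ_lt_one j) ht.1.le]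
          exact ENNReal.mul_lt_top ENNReal.ofReal_lt_top ENNReal.ofReal_lt_top
  have hint : ∀ j, ∀ t ∈ Ioo 0 T, ∀ᵐ x : Rn n, Integrable
      (fun z : ℝ × Rn n => P.k j (t - z.1) (x - z.2) • P.src j u z.1 z.2)
      (volume.restrict (Ioo 0 t ×ˢ univ)) := by
    intro j t ht
    have hmt := P.aestronglyMeasurable_src j (measurable_slab_mono hu.meas le_rfl ht.2.le)
    refine Eventually.of_forall fun x => ?_
    rw [← slab_eq]
    exact (aduh_ne_top_iff (P.meas_k j) hmt).1
      (hu.bound.aduh_src_ne_top j hu.pos hu.meas le_rfl ht.1 ht.2.le x)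
  refine ⟨⟨?_, fun t ht => hu.memLp ht, fun t ht => hu.continuous ht, ?_⟩,
    ⟨hsrc 0, hsrc 1, hint 0, hint 1, hu.init, fun t ht => ?_⟩⟩
  -- Adding the time slice at 0 changes only a null set.
  · have e : volume.restrict (Ico 0 T ×ˢ univ) = slab n 0 T := by
      rw [slab, Measure.restrict_congr_set Ioo_ae_eq_Ico, Measure.restrict_prod_eq_prod_univ,
        Measure.volume_eq_prod]
    rw [e]
    exact hu.meas
  · have e : (n : ℝ) * P.a * (1 / P.r - 1 / p) = n / (2 * α) * (1 / r - 1 / p) := by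
      change (n : ℝ) * (1 / (2 * α)) * (1 / r - 1 / p) = _
      ring
    refine hu.mixedNorm_lt_top hrp ?_ (by rw [e]; exact hq)
    rw [e]
    change (n : ℝ) / (2 * α) * (1 / r - 1 / p) * r < 1
    -- In this form the condition is n(p - r) < 2αp: the upper bound on p if n > 2α, and automatic
    -- otherwise.
    have e2 : (n : ℝ) / (2 * α) * (1 / r - 1 / p) * r = n * (p - r) / (2 * α * p) := by
      field_simp
    rw [e2, div_lt_one (by positivity)]
    rcases lt_or_ge (2 * α) n with hlt | hge
    · have := hpn hlt
      rw [lt_div_iff₀ (by linarith)] at this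
      nlinarith
    · nlinarith [mul_pos hn0 hr0, mul_le_mul_of_nonneg_right hge hp0.le]
  · filter_upwards [hu.eq t ht] with x hx
    rw [hx, N, Fin.sum_univ_two, ← add_assoc]
    rfl

end MildSystem
end FracDissip

end

/-! ### The theorem: verification of the exponents. -/

theorem theorem5p3 {n : ℕ} {𝕜 : Type*} [RCLike 𝕜] (α : ℝ) (D : FracDissip.DiffOp n)
    (hα : D.order < 2 * α) (ε₁ ε₂ : ℤˣ) (b₁ b₂ : ℝ) (hb₂ : 0 < b₂) (hb : b₂ < b₁)
    (q : ℝ≥0∞) (p r : ℝ) (hrd : 1 < n * b₁ / (2 * α - D.order))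
    (hr : n * b₁ / (2 * α - D.order) ≤ r) (hadm : FracDissip.Admissible n α q p r) :
    -- local existence and uniqueness: the time depends on the norm if `r > r_d`
    (n * b₁ / (2 * α - D.order) < r → ∀ M : ℝ, ∃ T : ℝ, 0 < T ∧
      ∀ φ : FracDissip.Rn n → 𝕜, MemLp φ (ENNReal.ofReal r) volume →
        eLpNorm φ (ENNReal.ofReal r) volume ≤ ENNReal.ofReal M →
        FracDissip.UniqueSol α D ε₁ ε₂ b₁ b₂ q p r φ T) ∧
    -- and on the datum itself if `r = r_d`
    (r = n * b₁ / (2 * α - D.order) →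
      ∀ φ : FracDissip.Rn n → 𝕜, MemLp φ (ENNReal.ofReal r) volume →
        ∃ T : ℝ, 0 < T ∧ FracDissip.UniqueSol α D ε₁ ε₂ b₁ b₂ q p r φ T) ∧
    -- maximal solutions and blow-up if `r > r_d`
    (n * b₁ / (2 * α - D.order) < r →
      (∀ φ : FracDissip.Rn n → 𝕜, MemLp φ (ENNReal.ofReal r) volume →
        ∃ (Tₘ : ℝ≥0∞) (u : ℝ → FracDissip.Rn n → 𝕜),
          FracDissip.IsMaximal α D ε₁ ε₂ b₁ b₂ q p r φ Tₘ u ∧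
          ∀ (Tₘ' : ℝ≥0∞) (v : ℝ → FracDissip.Rn n → 𝕜),
            FracDissip.IsMaximal α D ε₁ ε₂ b₁ b₂ q p r φ Tₘ' v →
            Tₘ' = Tₘ ∧ ∀ t : ℝ, 0 ≤ t → ENNReal.ofReal t < Tₘ → v t =ᵐ[volume] u t) ∧
      (∀ T₀ : ℝ, ∃ C : ℝ, 0 < C ∧
        ∀ φ : FracDissip.Rn n → 𝕜, MemLp φ (ENNReal.ofReal r) volume →
        ∀ (Tₘ : ℝ) (u : ℝ → FracDissip.Rn n → 𝕜), Tₘ ≤ T₀ →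
          FracDissip.IsMaximal α D ε₁ ε₂ b₁ b₂ q p r φ (ENNReal.ofReal Tₘ) u →
          ∀ s ∈ Ico 0 Tₘ,
            ENNReal.ofReal (C / (Tₘ - s) ^ (1 / b₁ - D.order / (2 * b₁ * α) - n / (2 * r * α)))
              ≤ eLpNorm (u s) (ENNReal.ofReal r) volume) ∧
      (∀ φ : FracDissip.Rn n → 𝕜, MemLp φ (ENNReal.ofReal r) volume →
        ∀ (Tₘ : ℝ) (u : ℝ → FracDissip.Rn n → 𝕜),
          FracDissip.IsMaximal α D ε₁ ε₂ b₁ b₂ q p r φ (ENNReal.ofReal Tₘ) u →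
          Tendsto (fun t => eLpNorm (u t) (ENNReal.ofReal r) volume) (𝓝[<] Tₘ) (𝓝 ∞))) := by
  have hd : 1 ≤ D.order := by cases D <;> norm_num [FracDissip.DiffOp.order]
  have hα1 : 1 < 2 * α := by linarith
  have hα0 : 0 < α := by linarith
  have hden : 0 < 2 * α - D.order := by linarith
  have hb₁ : 0 < b₁ := hb₂.trans hb
  -- In dimension zero r_d would be 0, contrary to r_d > 1.
  have hn : 1 ≤ n := by
    rcases Nat.eq_zero_or_pos n with rfl | h
    · norm_num at hrd
    · exact h
  have hn0 : (0 : ℝ) < n := by exact_mod_cast hn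
  have hr1 : 1 < r := hadm.1
  have hr0 : 0 < r := by linarith
  have hnb : n * b₁ ≤ r * (2 * α - D.order) := (div_le_iff₀ hden).1 hr
  -- Strict even for r = r_d, because the order of the operator is positive; in `h₂` strictness
  -- comes from b₂ < b₁.
  have h₁ : n * (1 / (2 * α)) / r * b₁ < 1 := by
    have e : n * (1 / (2 * α)) / r * b₁ = n * b₁ / (2 * α * r) := by field_simp
    rw [e, div_lt_one (by positivity)]
    nlinarith
  have h₂ : n * (1 / (2 * α)) / r * b₂ < 1 - D.order / (2 * α) := by
    have e : n * (1 / (2 * α)) / r * b₂ = n * b₂ / r / (2 * α) := by field_simp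
    rw [e, one_sub_div (by positivity)]
    gcongr
    rw [div_lt_iff₀ hr0]
    nlinarith [mul_lt_mul_of_pos_left hb hn0]
  set P := FracDissip.MildSystem.ofData 𝕜 hn hα1 D ε₁ ε₂ hb₂ hb hr1 h₁ h₂ with hP
  have h : P.Represents α D ε₁ ε₂ b₁ b₂ q p :=
    ⟨fun φ T u hu => FracDissip.MildSystem.sol_of_isSol hu,
      fun φ R T u hu => FracDissip.MildSystem.isSol_of_bSol hadm hu⟩
  set e := 1 / b₁ - D.order / (2 * b₁ * α) - n / (2 * r * α) with he
  have heb : e * b₁ = 1 - D.order / (2 * α) - n * (1 / (2 * α)) / r * b₁ := by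
    rw [he]; field_simp
  -- The exponent e balances b₁ against the smoothing loss of the differentiated term. Thus e b₁
  -- falls short of ω 0 by d/(2α), and e b₂ ≤ ω 1 because b₂/b₁ ≤ 1.
  have hej : ∀ j, e * P.b j ≤ P.ω j := by
    intro j
    fin_cases j
    · change e * b₁ ≤ 1 - 0 - n * (1 / (2 * α)) / r * b₁
      rw [heb]
      have : 0 ≤ D.order / (2 * α) := by positivity
      linarith
    · change e * b₂ ≤ 1 - D.order / (2 * α) - n * (1 / (2 * α)) / r * b₂
      have h3 : 0 < 1 - D.order / (2 * α) := by
        rw [one_sub_div (by positivity)]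
        exact div_pos hden (by positivity)
      have e1 : e = (1 - D.order / (2 * α)) / b₁ - n * (1 / (2 * α)) / r := by
        rw [he]; field_simp
      rw [e1, sub_mul]
      have : (1 - D.order / (2 * α)) / b₁ * b₂ ≤ 1 - D.order / (2 * α) := by
        rw [div_mul_eq_mul_div, div_le_iff₀ hb₁]
        exact mul_le_mul_of_nonneg_left hb.le h3.le
      linarith
  refine ⟨fun _ M => h.exists_time M, fun _ φ hφ => h.exists_uniqueSol hφ, fun hlt =>
    ⟨fun φ hφ => h.exists_isMaximal hφ, fun T₀ => h.exists_blowup_rate hej T₀,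
      fun φ hφ Tₘ u hu => h.tendsto_blowup ?_ hej hφ hu⟩⟩
  have hnb' : n * b₁ < r * (2 * α - D.order) := (div_lt_iff₀ hden).1 hlt
  -- Positivity of e is exactly r > r_d; it is needed only for the divergence of the norm, not for
  -- the rate.
  have e2 : e * b₁ = (r * (2 * α - D.order) - n * b₁) / (2 * α * r) := by
    rw [heb]; field_simp
  refine pos_of_mul_pos_left (b := b₁) ?_ hb₁.le
  rw [e2]
  exact div_pos (by linarith) (by positivity)
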